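/- **Definitions.** A *closed orientable surface* may be disconnected. A *compact orientable singular 3-manifold with singular points in a finite set* $S$ is a compact (finite, orientable) complex $X$ such that $X\setminus S$ is a 3-manifold, possibly with boundary, and every $s\in S$ has a neighbourhood homeomorphic to a cone, with apex $s$, on a connected closed orientable surface, the link of $s$. Let $P=\langle x_1,\dots,x_n\mid r_1,\dots,r_k\rangle$ be a finite ordered presentation whose relators are non-empty (not necessarily reduced) words in the letters $x_i^{\pm1}$. Let $d_i$ be the number of occurrences of $x_i^{\pm1}$ in $r_1r_2\cdots r_k$, numbered from left to right. *The surface $\Omega_P$.* For each $i$ take two rectangles, $D_i^{+}$ in an upper row and its mirror image $D_i^{-}$ in a lower row. On the edge facing the other row each carries $d_i$ disjoint legs (segments), numbered $1,\dots,d_i$ from left to right, one for each occurrence. Whenever $x_i^{\epsilon}$ ($p$-th occurrence of $x_i$) is followed, cyclically, by $x_j^{\epsilon'}$ ($q$-th occurrence of $x_j$) in a relator, attach an untwisted ribbon joining leg $p$ of $D_i^{\epsilon}$ to leg $q$ of $D_j^{-\epsilon'}$, all ribbons being disjoint. The surface $\Omega_P$ is obtained from this orientable ribbon surface by filling in each boundary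 component with a disc. *The space $X_P$.* Take the cone on $\Omega_P$ with apex $\omega$. For each $i$ attach a 3-dimensional 1-handle (rectangle)$\,\times[0,1]$, identifying its two ends with $D_i^{-}$ and $D_i^{+}$. For each relator attach a 3-dimensional 2-handle (disc)$\,\times[0,1]$ along the annulus formed by the strips that run over the 1-handles along the legs of its letters and by the ribbons joining its consecutive letters. **Theorem.** (1) For every such $P$: $\Omega_P$ is a closed orientable surface; some neighbourhood of $\omega$ in $X_P$ is a cone on $\Omega_P$ with apex $\omega$; there is an embedding of the standard presentation 2-complex $K_P$ in $X_P$, taking the vertex to $\omega$, onto whose image $X_P$ strongly deformation retracts; $X_P$ is path connected and $\pi_1(X_P,\omega)$ is isomorphic to the group presented by $P$; and if $\Omega_P$ is connected, then $X_P$ is a compact orientable singular 3-manifold with no singular point other than (possibly) $\omega$. (2) Every finitely presentable group $G$ has such a presentation $P$ with $\Omega_P$ connected. Hence $X_P$ is a path connected compact orientable singular 3-manifold with at most one singular point, $\omega$, and $\pi_1(X_P,\omega)\cong G$. -/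

import Mathlib

open scoped unitInterval Topology

noncomputable section

namespace SingularManifold

/-! ### Cones -/

section Cone

variable (Y : Type*) [TopologicalSpace Y]

/-- The relation on `{apex} ⊔ Y × [0,1]` that collapses `Y × {1}` to the apex. -/
inductive ConeRel : Unit ⊕ (Y × I) → Unit ⊕ (Y × I) → Prop
  | top (y : Y) : ConeRel (Sum.inr (y, 1)) (Sum.inl ())

/-- The (closed) cone on a space; the cone on the empty space is a point. -/
def Cone : Type _ := Quot (ConeRel Y)

instance : TopologicalSpace (Cone Y) := inferInstanceAs (TopologicalSpace (Quot (ConeRel Y)))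

/-- The apex of the cone. -/
def Cone.apex : Cone Y := Quot.mk _ (Sum.inl ())

variable {Y}

/-- The inclusion of `Y` as the base of its cone. -/
def Cone.base (y : Y) : Cone Y := Quot.mk _ (Sum.inr (y, 0))

end Cone

/-! ### Surfaces and singular 3-manifolds -/

/-- `X` is (homeomorphic to) a finite simplicial complex whose `n`-simplices can be oriented
coherently. An orientation of the `n`-simplices assigns a sign to every ordering
`v 0, …, v n` of the vertices of an `n`-simplex, alternating under permutations. It is coherent if
any two distinct `n`-simplices with a common facet induce opposite orientations on this facet. -/
def OrientablyTriangulable (n : ℕ) (X : Type*) [TopologicalSpace X] : Prop :=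
  ∃ (N : ℕ) (K : Geometry.SimplicialComplex ℝ (EuclideanSpace ℝ (Fin N))),
    K.faces.Finite ∧ Nonempty (K.space ≃ₜ X) ∧
    ∃ o : (Fin (n + 1) → EuclideanSpace ℝ (Fin N)) → ℤˣ,
      (∀ (v) (hv : Function.Injective v), Finset.univ.map ⟨v, hv⟩ ∈ K.faces →
        ∀ π : Equiv.Perm (Fin (n + 1)), o (v ∘ π) = Equiv.Perm.sign π * o v) ∧
      (∀ (v w) (hv : Function.Injective v) (hw : Function.Injective w),
        Finset.univ.map ⟨v, hv⟩ ∈ K.faces → Finset.univ.map ⟨w, hw⟩ ∈ K.faces →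
        v 0 ≠ w 0 → (∀ i : Fin n, v i.succ = w i.succ) → o w = - o v)

/-- A closed orientable surface, possibly disconnected: a compact Hausdorff (and second countable,
being triangulable) space locally homeomorphic to the plane, and orientable. -/
structure IsClosedOrientableSurface (L : Type*) [TopologicalSpace L] : Prop where
  compact : CompactSpace L
  hausdorff : T2Space L
  locallyPlane : Nonempty (ChartedSpace (EuclideanSpace ℝ (Fin 2)) L)
  orientable : OrientablyTriangulable 2 L

/-- The point `s` of `X` has link `L`: some neighbourhood of `s` in `X` is homeomorphic to
the cone on `L`, the point `s` corresponding to the apex. -/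
def HasLink (X : Type*) [TopologicalSpace X] (s : X) (L : Type*) [TopologicalSpace L] : Prop :=
  ∃ f : Cone L → X, Topology.IsEmbedding f ∧ f (Cone.apex L) = s ∧ Set.range f ∈ 𝓝 s

/-- `X` is a compact orientable singular 3-manifold all of whose singular points are in `S`:
a finite complex which is a 3-manifold (possibly with boundary) away from the finite set `S`, and
in which the link of each point of `S` is a connected closed orientable surface. -/
structure IsCompactOrientableSingularThreeManifold
    (X : Type) [TopologicalSpace X] (S : Set X) : Prop where
  compact : CompactSpace X
  hausdorff : T2Space X
  finite : S.Finite
  manifold : Nonempty (ChartedSpace (EuclideanHalfSpace 3) ↥Sᶜ)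
  link : ∀ s ∈ S, ∃ (L : Type) (_ : TopologicalSpace L),
    IsClosedOrientableSurface L ∧ ConnectedSpace L ∧ HasLink X s L
  orientable : OrientablyTriangulable 3 X

/-- `A` is a strong deformation retract of `X`: the identity of `X` is homotopic, through maps
fixing `A` pointwise, to a map with values in `A`. -/
def IsStrongDeformationRetract {X : Type*} [TopologicalSpace X] (A : Set X) : Prop :=
  ∃ r : C(X, X), (∀ x, r x ∈ A) ∧ (ContinuousMap.id X).HomotopicRel r A

/-! ### Finite presentations -/

/-- A finite ordered presentation: `n` generators and `k` relators, which are nonempty words in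
the letters `(i, true) = xᵢ` and `(i, false) = xᵢ⁻¹` (not necessarily reduced). -/
structure FinPresentation where
  n : ℕ
  k : ℕ
  rel : Fin k → List (Fin n × Bool)
  rel_ne_nil : ∀ j, rel j ≠ []

namespace FinPresentation

variable (P : FinPresentation)

/-- The group given by the presentation. -/
abbrev Grp : Type := PresentedGroup (Set.range fun j => FreeGroup.mk (P.rel j))

/-- The occurrences of letters in the relators: the pair `(j, m)` is the letter in position `m`
of the `j`-th relator. -/
abbrev Occ : Type := Σ j : Fin P.k, Fin (P.rel j).length

variable {P}

/-- The generator occurring. -/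
def gen (o : P.Occ) : Fin P.n := ((P.rel o.1).get o.2).1

/-- The sign (`true` for `+1`) of the exponent with which it occurs. -/
def sgn (o : P.Occ) : Bool := ((P.rel o.1).get o.2).2

/-- The cyclically next letter of the same relator. -/
def next (o : P.Occ) : P.Occ :=
  ⟨o.1, ⟨(o.2.1 + 1) % (P.rel o.1).length, Nat.mod_lt _ (Nat.zero_lt_of_lt o.2.2)⟩⟩

/-- `o'` precedes `o` in the concatenated word `r₁ r₂ ⋯ r_k`. -/
def Precedes (o' o : P.Occ) : Prop := o'.1 < o.1 ∨ (o'.1 = o.1 ∧ o'.2.1 < o.2.1)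

open Classical in
/-- The number of occurrences of the same generator before `o`; so `o` is occurrence number
`index o` of this generator, counting from `0`. -/
def index (o : P.Occ) : ℕ := (Finset.univ.filter fun o' => gen o' = gen o ∧ Precedes o' o).card

open Classical in
/-- The total number of occurrences of the generator `i`, with either sign, in all relators. -/
def deg (i : Fin P.n) : ℕ := (Finset.univ.filter fun o : P.Occ => gen o = i).card

theorem index_lt (o : P.Occ) : index o < deg (gen o) := by
  classical
  apply Finset.card_lt_card
  rw [Finset.ssubset_iff_of_subset]
  · refine ⟨o, by simp, fun h => ?_⟩
    rcases (Finset.mem_filter.1 h).2.2 with h | h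
    · exact lt_irrefl _ h
    · exact lt_irrefl _ h.2
  · intro o' h
    simp only [Finset.mem_filter, Finset.mem_univ, true_and] at h ⊢
    exact h.1

/-! ### The ribbon surface -/

/-- The rectangular disc of the generator `i`. Its lower edge carries, from left to right, the
places where legs are attached: leg number `p` is the segment `[2p+1, 2p+2] × {0}`. -/
abbrev Rect (i : Fin P.n) : Type := Set.Icc ((0, 0) : ℝ × ℝ) (2 * (deg i : ℝ) + 1, 1)

/-- The leg of the occurrence `o`, parametrised by `u ∈ [0,1]`, from left to right if the letter
is positive and from right to left if it is negative. -/
def leg (o : P.Occ) (u : I) : Rect (gen o) :=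
  ⟨(2 * (index o : ℝ) + 1 + (if sgn o then (u : ℝ) else 1 - u), 0), by
    have h : (index o : ℝ) + 1 ≤ deg (gen o) := by exact_mod_cast index_lt o
    have h0 : (0 : ℝ) ≤ index o := Nat.cast_nonneg _
    have h1 := u.2.1
    have h2 := u.2.2
    constructor <;> constructor <;> simp <;> split_ifs <;> linarith⟩

variable (P)

/-- The pieces of the ribbon surface: for each generator `i` two rectangular discs
`(i, true)`, `(i, false)`, in the upper and in the lower row; and for each occurrence `o` a ribbon
`[0,1] × [0,1]` with points `(o, u, t)`, where `u` is the coordinate across the ribbon and `t` the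
one along it. The lower row is thought of as a mirror image of the upper row, so that discs of
the same row have the same orientation, and those of different rows opposite orientations, with
respect to the coordinates in `Rect i`. -/
abbrev RibbonPieces : Type := (Σ i : Fin P.n, Rect i × Bool) ⊕ (P.Occ × I × I)

/-- The ribbon of `o` runs from the leg of `o` on the disc `(gen o, sgn o)` to the leg of the next
letter `o'` on the disc `(gen o', -sgn o')`. It is attached without twisting: it preserves the
left-to-right direction if it joins the two rows, and reverses it if it joins discs of one row. -/
inductive RibbonRel : P.RibbonPieces → P.RibbonPieces → Prop
  | start (o : P.Occ) (u : I) :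
      RibbonRel (Sum.inr (o, u, 0)) (Sum.inl ⟨gen o, leg o u, sgn o⟩)
  | finish (o : P.Occ) (u : I) :
      RibbonRel (Sum.inr (o, u, 1)) (Sum.inl ⟨gen (next o), leg (next o) u, !sgn (next o)⟩)

/-- The ribbon surface with boundary: discs with ribbons attached. -/
def Ribbon : Type := Quot P.RibbonRel

instance : TopologicalSpace P.Ribbon := inferInstanceAs (TopologicalSpace (Quot P.RibbonRel))

variable {P}

/-- A point of the disc `(i, b)`. -/
def Ribbon.disc (i : Fin P.n) (b : Bool) (x : Rect i) : P.Ribbon := Quot.mk _ (Sum.inl ⟨i, x, b⟩)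

/-- A point of the ribbon of `o`. -/
def Ribbon.strip (o : P.Occ) (u t : I) : P.Ribbon := Quot.mk _ (Sum.inr (o, u, t))

variable (P)

/-- The boundary of the ribbon surface: the edges of the rectangles, except for the interiors of
the legs, and the two long sides of every ribbon. -/
def Ribbon.boundary : Set P.Ribbon :=
  {z | (∃ (i : Fin P.n) (b : Bool) (x : Rect i), z = Ribbon.disc i b x ∧
          (x.1.1 = 0 ∨ x.1.1 = 2 * (deg i : ℝ) + 1 ∨ x.1.2 = 1 ∨
            (x.1.2 = 0 ∧ ∀ p : ℕ, p < deg i → ¬ (2 * (p : ℝ) + 1 < x.1.1 ∧ x.1.1 < 2 * p + 2)))) ∨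
       (∃ (o : P.Occ) (u t : I), z = Ribbon.strip o u t ∧ (u = 0 ∨ u = 1))}

/-- Each boundary component (a circle) is filled in by a disc, namely by the cone on it: a collar
`∂ × [0,1]` is attached along `∂ × {0}`, and its other end is collapsed to one
point for each connected component of the boundary. -/
inductive CapRel : P.Ribbon ⊕ (Ribbon.boundary P × I) → P.Ribbon ⊕ (Ribbon.boundary P × I) → Prop
  | glue (z : Ribbon.boundary P) : CapRel (Sum.inr (z, 0)) (Sum.inl z)
  | collapse (z z' : Ribbon.boundary P) (h : connectedComponent z = connectedComponent z') :
      CapRel (Sum.inr (z, 1)) (Sum.inr (z', 1))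

/-- The closed ribbon surface `Ω_P`. -/
def Omega : Type := Quot P.CapRel

instance : TopologicalSpace P.Omega := inferInstanceAs (TopologicalSpace (Quot P.CapRel))

variable {P}

/-- The inclusion of the ribbon surface into the closed ribbon surface. -/
def Ribbon.toOmega (z : P.Ribbon) : P.Omega := Quot.mk _ (Sum.inl z)

variable (P)

/-! ### The singular 3-manifold of a presentation -/

/-- The closed unit disc. -/
abbrev Disc : Type := Metric.closedBall (0 : ℂ) 1

/-- The pieces of the space: the cone on the closed ribbon surface; for each generator
a 3-dimensional 1-handle (rectangle) `× [0,1]`; and for each relator a 3-dimensional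
2-handle (disc) `× [0,1]`. -/
abbrev Pieces : Type := Cone P.Omega ⊕ (Σ i : Fin P.n, Rect i × I) ⊕ (Fin P.k × Disc × I)

/-- The attachments. The 1-handle of `i` is attached at its two ends to the two discs of `i`.
The 2-handle of the `j`-th relator is attached along `∂(disc) × [0,1]`, its `[0,1]` coordinate
being the coordinate `u` across legs and ribbons: the boundary circle of the disc is cut
into `2l` arcs, `l` the length of the relator, two for each letter. The first
runs over the 1-handle of the letter along the leg, from the end `(i, -ε)` to the end `(i, ε)`
for a letter `xᵢ^ε`; the second runs along the ribbon to the next letter. -/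
inductive AttachRel : P.Pieces → P.Pieces → Prop
  | handleTop (i : Fin P.n) (x : Rect i) :
      AttachRel (Sum.inr (Sum.inl ⟨i, x, 1⟩))
        (Sum.inl (Cone.base (Ribbon.disc i true x).toOmega))
  | handleBot (i : Fin P.n) (x : Rect i) :
      AttachRel (Sum.inr (Sum.inl ⟨i, x, 0⟩))
        (Sum.inl (Cone.base (Ribbon.disc i false x).toOmega))
  | overHandle (o : P.Occ) (u t : I) (z : Disc)
      (hz : (z : ℂ) = Complex.exp
        (2 * Real.pi * Complex.I * (((o.2.1 + (t : ℝ) / 2) / (P.rel o.1).length : ℝ) : ℂ))) :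
      AttachRel (Sum.inr (Sum.inr (o.1, z, u)))
        (Sum.inr (Sum.inl ⟨gen o, leg o u, if sgn o then t else σ t⟩))
  | alongRibbon (o : P.Occ) (u t : I) (z : Disc)
      (hz : (z : ℂ) = Complex.exp
        (2 * Real.pi * Complex.I * (((o.2.1 + (1 + (t : ℝ)) / 2) / (P.rel o.1).length : ℝ) : ℂ))) :
      AttachRel (Sum.inr (Sum.inr (o.1, z, u)))
        (Sum.inl (Cone.base (Ribbon.strip o u t).toOmega))

/-- The space `X_P` built from the presentation. -/
def X : Type := Quot P.AttachRel

instance : TopologicalSpace P.X := inferInstanceAs (TopologicalSpace (Quot P.AttachRel))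

/-- The cone point `ω`. -/
def omega : P.X := Quot.mk _ (Sum.inl (Cone.apex P.Omega))

/-! ### The presentation complex -/

/-- The presentation complex has one vertex, one 1-cell for each generator, and one 2-cell
for each relator, whose boundary circle is cut into as many arcs as the relator has letters;
the arc of a letter `xᵢ^ε` runs along the 1-cell of `xᵢ` in the direction given by `ε`. -/
inductive CellRel :
    Unit ⊕ (Fin P.n × I) ⊕ (Fin P.k × Disc) → Unit ⊕ (Fin P.n × I) ⊕ (Fin P.k × Disc) → Prop
  | source (i : Fin P.n) : CellRel (Sum.inr (Sum.inl (i, 0))) (Sum.inl ())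
  | target (i : Fin P.n) : CellRel (Sum.inr (Sum.inl (i, 1))) (Sum.inl ())
  | letter (o : P.Occ) (t : I) (z : Disc)
      (hz : (z : ℂ) = Complex.exp
        (2 * Real.pi * Complex.I * (((o.2.1 + (t : ℝ)) / (P.rel o.1).length : ℝ) : ℂ))) :
      CellRel (Sum.inr (Sum.inr (o.1, z)))
        (Sum.inr (Sum.inl (gen o, if sgn o then t else σ t)))

/-- The standard presentation 2-complex `K_P`. -/
def K : Type := Quot P.CellRel

instance : TopologicalSpace P.K := inferInstanceAs (TopologicalSpace (Quot P.CellRel))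

/-- The vertex of the presentation complex. -/
def vertex : P.K := Quot.mk _ (Sum.inl ())

end FinPresentation

end SingularManifold

end

noncomputable section

namespace SingularManifold

open Function Topology

/-! ### Order complexes of finite posets -/

section OrderComplex

open scoped Classical

variable {Q A B C : Type*}

/-- The support of `t` is a chain. -/
def ChainSupp [LE Q] (t : Q → ℝ) : Prop := ∀ p q, t p ≠ 0 → t q ≠ 0 → p ≤ q ∨ q ≤ p

/-- The order complex of a finite poset, in barycentric coordinates. -/
def ocSet (Q : Type*) [Fintype Q] [LE Q] : Set (Q → ℝ) :=
  {t | (∀ p, 0 ≤ t p) ∧ ∑ p, t p = 1 ∧ ChainSupp t}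

/-- The order complex of a finite poset as a space. -/
abbrev OC (Q : Type*) [Fintype Q] [LE Q] : Type _ := ↥(ocSet Q)

instance [Fintype Q] [LE Q] : CoeFun (OC Q) (fun _ => Q → ℝ) := ⟨Subtype.val⟩

theorem isClosed_chainSupp [LE Q] : IsClosed {t : Q → ℝ | ChainSupp t} := by
  have : {t : Q → ℝ | ChainSupp t} = ⋂ p, ⋂ q, {t | (p ≤ q ∨ q ≤ p) ∨ t p * t q = 0} := by
    ext t
    simp only [ChainSupp, Set.mem_ofPred_eq, Set.mem_iInter, mul_eq_zero]
    refine forall₂_congr fun p q => ?_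
    tauto
  rw [this]
  refine isClosed_iInter fun p => isClosed_iInter fun q => ?_
  by_cases h : p ≤ q ∨ q ≤ p
  · simp [h]
  · simp only [h, false_or]; exact isClosed_eq (by fun_prop) continuous_const

section Basic

variable [Fintype Q] [LE Q]

theorem OC.nonneg (t : OC Q) (p : Q) : 0 ≤ t p := t.2.1 p
theorem OC.sum_eq (t : OC Q) : ∑ p, t p = 1 := t.2.2.1
theorem OC.chain (t : OC Q) : ChainSupp t.1 := t.2.2.2
theorem OC.le_one (t : OC Q) (p : Q) : t p ≤ 1 := by
  rw [← t.sum_eq]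
  exact Finset.single_le_sum (f := t.1) (fun q _ => t.nonneg q) (Finset.mem_univ p)

theorem OC.exists_ne (t : OC Q) : ∃ p, t p ≠ 0 := by
  by_contra! h
  have := t.sum_eq
  simp [h] at this

theorem isCompact_ocSet : IsCompact (ocSet Q) := by
  refine IsCompact.of_isClosed_subset (isCompact_univ_pi fun _ : Q => isCompact_Icc (a := (0 : ℝ)) (b := 1))
    ?_ fun t ht p _ => ⟨ht.1 p, OC.le_one ⟨t, ht⟩ p⟩
  refine IsClosed.inter ?_ (IsClosed.inter ?_ isClosed_chainSupp)
  · have : {t : Q → ℝ | ∀ p, 0 ≤ t p} = ⋂ p, {t | 0 ≤ t p} := by ext; simp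
    change IsClosed {t : Q → ℝ | ∀ p, 0 ≤ t p}
    rw [this]
    exact isClosed_iInter fun p => isClosed_le continuous_const (continuous_apply p)
  · exact isClosed_eq (by fun_prop) continuous_const

instance : CompactSpace (OC Q) := isCompact_iff_compactSpace.1 isCompact_ocSet

theorem OC.continuous_coord (p : Q) : Continuous fun t : OC Q => t p :=
  (continuous_apply p).comp continuous_subtype_val

theorem OC.continuous_of_coord {Y : Type*} [TopologicalSpace Y] {f : Y → OC Q}
    (h : ∀ p, Continuous fun y => f y p) : Continuous f :=
  Continuous.subtype_mk (f := fun y => (f y).1) (continuous_pi h) _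

end Basic

/-- Push-forward of a mass distribution. -/
def push [Fintype A] (e : A → B) (t : A → ℝ) : B → ℝ := fun b => ∑ a, if e a = b then t a else 0

section push

variable [Fintype A]

theorem push_nonneg {e : A → B} {t : A → ℝ} (h : ∀ a, 0 ≤ t a) (b : B) : 0 ≤ push e t b :=
  Finset.sum_nonneg fun a _ => by split_ifs <;> simp [h]

theorem sum_push [Fintype B] (e : A → B) (t : A → ℝ) : ∑ b, push e t b = ∑ a, t a := by
  simp only [push]
  rw [Finset.sum_comm]
  simp

theorem exists_of_push_ne {e : A → B} {t : A → ℝ} {b : B} (h : push e t b ≠ 0) :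
    ∃ a, e a = b ∧ t a ≠ 0 := by
  by_contra! H
  refine h (Finset.sum_eq_zero fun a _ => ?_)
  split_ifs with hb
  · exact H a hb
  · rfl

theorem push_apply {e : A → B} (he : Injective e) (t : A → ℝ) (a : A) :
    push e t (e a) = t a := by
  simp only [push, he.eq_iff]
  simp

theorem push_eq_zero {e : A → B} {t : A → ℝ} {b : B} (h : ∀ a, e a = b → t a = 0) :
    push e t b = 0 := by
  by_contra H
  obtain ⟨a, ha, h'⟩ := exists_of_push_ne H
  exact h' (h a ha)

theorem push_push [Fintype B] (e : A → B) (f : B → C) (t : A → ℝ) :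
    push f (push e t) = push (f ∘ e) t := by
  ext c
  simp only [push, Function.comp]
  calc _ = ∑ b, ∑ a, if f b = c then if e a = b then t a else 0 else 0 := by
        refine Finset.sum_congr rfl fun b _ => ?_
        split_ifs <;> simp
    _ = _ := by
        rw [Finset.sum_comm]
        refine Finset.sum_congr rfl fun a _ => ?_
        rw [Finset.sum_eq_single (e a)]
        · simp
        · grind
        · simp

theorem push_id (t : A → ℝ) : push id t = t := by ext a; exact push_apply Function.injective_id t a

theorem push_smul (e : A → B) (r : ℝ) (t : A → ℝ) : push e (r • t) = r • push e t := by
  ext b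
  simp only [push, Pi.smul_apply, smul_eq_mul, Finset.mul_sum]
  exact Finset.sum_congr rfl fun a _ => by split_ifs <;> simp

theorem continuous_push (e : A → B) : Continuous (push e) := by
  refine continuous_pi fun b => continuous_finsetSum _ fun a _ => ?_
  split_ifs <;> fun_prop

theorem push_single (e : A → B) (a : A) : push e (Pi.single a 1) = Pi.single (e a) 1 := by
  ext b
  simp only [push]
  rw [Finset.sum_eq_single a]
  · grind
  · grind
  · simp

end push

section OCmap

variable [Fintype A] [Fintype B] [Fintype C] [PartialOrder A] [PartialOrder B] [PartialOrder C]

/-- The map of order complexes induced by a monotone map. -/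
def OC.map (e : A → B) (he : Monotone e) (t : OC A) : OC B :=
  ⟨push e t, push_nonneg t.nonneg, by rw [sum_push, t.sum_eq], by
    intro p q hp hq
    obtain ⟨a, rfl, ha⟩ := exists_of_push_ne hp
    obtain ⟨b, rfl, hb⟩ := exists_of_push_ne hq
    exact (t.chain a b ha hb).imp (he ·) (he ·)⟩

theorem OC.map_val (e : A → B) (he : Monotone e) (t : OC A) : (OC.map e he t).1 = push e t := rfl

theorem OC.continuous_map (e : A → B) (he : Monotone e) : Continuous (OC.map e he) :=
  Continuous.subtype_mk ((continuous_push e).comp continuous_subtype_val) _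

theorem OC.map_map (e : A → B) (he : Monotone e) (f : B → C) (hf : Monotone f) (t : OC A) :
    OC.map f hf (OC.map e he t) = OC.map (f ∘ e) (hf.comp he) t :=
  Subtype.ext (push_push e f t)

theorem OC.map_congr {e f : A → B} (h : e = f) (he : Monotone e) (t : OC A) :
    OC.map e he t = OC.map f (h ▸ he) t := by subst h; rfl

theorem OC.map_injective {e : A → B} (he : Monotone e) (hi : Injective e) :
    Injective (OC.map e he) := fun s t h => Subtype.ext <| funext fun a => by
  rw [← push_apply hi s.1, ← push_apply hi t.1]
  exact congrFun (congrArg Subtype.val h) (e a)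

theorem OC.exists_map_eq {e : A → B} (hm : Monotone e) (he : ∀ a a', e a ≤ e a' → a ≤ a')
    (t : OC B) (ht : ∀ b, t b ≠ 0 → b ∈ Set.range e) :
    ∃ s : OC A, OC.map e hm s = t := by
  have hi : Injective e := fun a a' h =>
    le_antisymm (he _ _ h.le) (he _ _ h.ge)
  have key : push e (t.1 ∘ e) = t.1 := by
    ext b
    by_cases hb : t b = 0
    · rw [hb]; exact push_eq_zero fun a ha => by simp [ha, hb]
    · obtain ⟨a, rfl⟩ := ht b hb; rw [push_apply hi]; rfl
  refine ⟨⟨t.1 ∘ e, fun a => t.nonneg _, ?_, fun p q hp hq => ?_⟩, Subtype.ext key⟩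
  · rw [← sum_push e, key, t.sum_eq]
  · exact (t.chain _ _ hp hq).imp (he _ _) (he _ _)

/-- The vertices of the order complex. -/
def OC.vtx (p : A) : OC A := ⟨Pi.single p 1, fun q => by
    by_cases h : q = p
    · subst h; simp
    · simp [h], by simp, fun a b ha hb => by
    have h1 : a = p := by grind
    have h2 : b = p := by grind
    subst h1; subst h2; simp⟩

theorem OC.vtx_apply (p q : A) : OC.vtx p q = if q = p then 1 else 0 := by
  simp only [OC.vtx, Pi.single_apply]

theorem OC.map_vtx (e : A → B) (he : Monotone e) (a : A) : OC.map e he (OC.vtx a) = OC.vtx (e a) :=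
  Subtype.ext (push_single e a)

theorem OC.eq_vtx {t : OC A} {p : A} (h : t p = 1) : t = OC.vtx p := by
  refine Subtype.ext (funext fun q => ?_)
  rw [OC.vtx_apply]
  split_ifs with hq
  · rw [hq, h]
  · have h1 := t.sum_eq
    have h2 : ∑ a ∈ {p, q}, t a ≤ ∑ a, t a :=
      Finset.sum_le_sum_of_subset_of_nonneg (Finset.subset_univ _) fun a _ _ => t.nonneg a
    rw [Finset.sum_pair (Ne.symm hq)] at h2
    have := t.nonneg q
    linarith

theorem OC.mix_mem (z w : OC A) (h : ∀ p q, z p ≠ 0 → w q ≠ 0 → p ≤ q ∨ q ≤ p) (x : I) :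
    (fun p => (1 - (x : ℝ)) * z p + x * w p) ∈ ocSet A := by
  have h0 := x.2.1
  have h1 : 0 ≤ 1 - (x : ℝ) := by grind
  refine ⟨fun p => add_nonneg (mul_nonneg h1 (z.nonneg p)) (mul_nonneg h0 (w.nonneg p)), ?_, ?_⟩
  · rw [Finset.sum_add_distrib, ← Finset.mul_sum, ← Finset.mul_sum, z.sum_eq, w.sum_eq]; ring
  · intro p q hp hq
    have hp' : z p ≠ 0 ∨ w p ≠ 0 := by grind
    have hq' : z q ≠ 0 ∨ w q ≠ 0 := by grind
    rcases hp' with hp' | hp' <;> rcases hq' with hq' | hq'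
    · exact z.chain _ _ hp' hq'
    · grind
    · grind
    · exact w.chain _ _ hp' hq'

/-- The segment joining two points of a common simplex. -/
def OC.mix (z w : OC A) (h : ∀ p q, z p ≠ 0 → w q ≠ 0 → p ≤ q ∨ q ≤ p) (x : I) : OC A :=
  ⟨_, OC.mix_mem z w h x⟩

theorem OC.mix_apply (z w : OC A) (h) (x : I) (p : A) :
    OC.mix z w h x p = (1 - (x : ℝ)) * z p + x * w p := rfl

/-- The point dividing the segment from `z` to the vertex `p`. -/
def OC.mixV (z : OC A) (p : A) (h : ∀ q, z q ≠ 0 → q ≤ p ∨ p ≤ q) (x : I) : OC A :=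
  OC.mix z (OC.vtx p) (fun a b ha hb => by
    have : b = p := by by_contra h; simp [OC.vtx_apply, h] at hb
    rw [this]; exact h a ha) x

theorem OC.mixV_apply (z : OC A) (p : A) (h) (x : I) (q : A) :
    OC.mixV z p h x q = (1 - (x : ℝ)) * z q + if q = p then (x : ℝ) else 0 := by
  simp only [OC.mixV, OC.mix_apply, OC.vtx_apply]
  split_ifs <;> simp

theorem OC.mixV_one (z : OC A) (p : A) (h) : OC.mixV z p h 1 = OC.vtx p := by
  refine Subtype.ext (funext fun q => ?_)
  simp [OC.mixV_apply, OC.vtx_apply]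

theorem OC.mixV_zero (z : OC A) (p : A) (h) : OC.mixV z p h 0 = z := by
  refine Subtype.ext (funext fun q => ?_)
  simp [OC.mixV_apply]

/-- Every point is on the segment from a vertex `p` to a point with zero `p`-coordinate. -/
theorem OC.exists_mixV (t : OC A) (p : A) (h0 : t p ≠ 0) (h1 : t p ≠ 1) :
    ∃ (z : OC A) (h : _) (x : I), z p = 0 ∧ (x : ℝ) = t p ∧ (∀ q, z q ≠ 0 → t q ≠ 0) ∧
      t = OC.mixV z p h x := by
  have hlt : t p < 1 := lt_of_le_of_ne (t.le_one p) h1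
  have hpos : 0 < 1 - t p := by linarith
  have hz : (fun q => if q = p then 0 else t q / (1 - t p)) ∈ ocSet A := by
    refine ⟨fun q => ?_, ?_, ?_⟩
    · dsimp only
      split_ifs
      · exact le_rfl
      · exact div_nonneg (t.nonneg q) hpos.le
    · have h2 := t.sum_eq
      rw [← Finset.add_sum_erase _ _ (Finset.mem_univ p)] at h2 ⊢
      simp only [if_true, zero_add]
      rw [Finset.sum_congr rfl (g := fun q => t q / (1 - t p)) (fun q hq => by
        rw [if_neg (Finset.ne_of_mem_erase hq)]), ← Finset.sum_div, div_eq_one_iff_eq hpos.ne']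
      linarith
    · intro a b ha hb
      refine t.chain a b ?_ ?_
      · grind
      · grind
  refine ⟨⟨_, hz⟩, fun q hq => ?_, ⟨t p, t.nonneg p, t.le_one p⟩, by simp, rfl, ?_, ?_⟩
  · refine t.chain q p ?_ h0; rintro h; simp [h] at hq
  · grind
  · refine Subtype.ext (funext fun q => ?_)
    rw [OC.mixV_apply]
    by_cases hq : q = p
    · simp [hq]
    · grind

end OCmap

end OrderComplex

section OrderComplex

open scoped Classical

variable {Q A B C : Type*}

/-! ### Masses of upper sets, and closure operators -/

section mass

variable [Fintype Q]

/-- The mass of a set. -/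
def mass (t : Q → ℝ) (U : Set Q) : ℝ := ∑ p, if p ∈ U then t p else 0

theorem continuous_mass (U : Set Q) : Continuous fun t : Q → ℝ => mass t U := by
  refine continuous_finsetSum _ fun a _ => ?_
  split_ifs <;> fun_prop

theorem mass_nonneg {t : Q → ℝ} (ht : ∀ p, 0 ≤ t p) (U : Set Q) : 0 ≤ mass t U :=
  Finset.sum_nonneg fun a _ => by split_ifs <;> simp [ht]

theorem mass_mono {t : Q → ℝ} (ht : ∀ p, 0 ≤ t p) {U V : Set Q}
    (h : ∀ p, t p ≠ 0 → p ∈ U → p ∈ V) : mass t U ≤ mass t V := by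
  refine Finset.sum_le_sum fun p _ => ?_
  by_cases h0 : t p = 0
  · simp [h0]
  · grind

theorem mass_congr {t : Q → ℝ} {U V : Set Q}
    (h : ∀ p, t p ≠ 0 → (p ∈ U ↔ p ∈ V)) : mass t U = mass t V := by
  refine Finset.sum_congr rfl fun p _ => ?_
  by_cases h0 : t p = 0
  · simp [h0]
  · simp [h p h0]

theorem mass_univ (t : Q → ℝ) : mass t Set.univ = ∑ p, t p := by simp [mass]

theorem mass_push [Fintype A] (e : A → Q) (t : A → ℝ) (U : Set Q) :
    mass (push e t) U = mass t (e ⁻¹' U) := by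
  simp only [mass, push]
  calc _ = ∑ p, ∑ a, if e a = p then (if p ∈ U then t a else 0) else 0 := by
        refine Finset.sum_congr rfl fun p _ => ?_
        split_ifs <;> simp
    _ = _ := by rw [Finset.sum_comm]; simp

variable [PartialOrder Q]

theorem mass_inter {t : Q → ℝ} (ht : ∀ p, 0 ≤ t p) (hc : ChainSupp t) {U V : Set Q}
    (hU : IsUpperSet U) (hV : IsUpperSet V) : mass t (U ∩ V) = min (mass t U) (mass t V) := by
  by_cases h : ∀ p, t p ≠ 0 → p ∈ U → p ∈ V
  · rw [min_eq_left (mass_mono ht h)]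
    exact mass_congr fun p hp => ⟨fun h' => h'.1, fun h' => ⟨h', h p hp h'⟩⟩
  · push Not at h
    obtain ⟨p, hp, hpU, hpV⟩ := h
    have h' : ∀ q, t q ≠ 0 → q ∈ V → q ∈ U := fun q hq hqV => by
      rcases hc p q hp hq with h | h
      · exact hU h hpU
      · exact absurd (hV h hqV) hpV
    rw [min_eq_right (mass_mono ht h')]
    exact mass_congr fun p hp => ⟨fun h'' => h''.2, fun h'' => ⟨h' p hp h'', h''⟩⟩

theorem mass_Ici (t : Q → ℝ) (p : Q) : mass t (Set.Ici p) = t p + mass t (Set.Ioi p) := by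
  have : t p = ∑ q, if q = p then t q else 0 := by simp
  rw [this, mass, mass, ← Finset.sum_add_distrib]
  refine Finset.sum_congr rfl fun q _ => ?_
  by_cases h : q = p
  · simp [h]
  · simp [h, lt_iff_le_and_ne, Ne.symm h]

theorem eq_of_mass_Ici_eq {s t : Q → ℝ} (h : ∀ p, mass s (Set.Ici p) = mass t (Set.Ici p)) :
    s = t := by
  ext p
  induction p using WellFoundedGT.induction with
  | ind p ih =>
    have h1 := h p
    rw [mass_Ici, mass_Ici] at h1
    have : mass s (Set.Ioi p) = mass t (Set.Ioi p) := by
      refine Finset.sum_congr rfl fun q _ => ?_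
      split_ifs with hq
      · exact ih q hq
      · rfl
    linarith

/-- The part of mass `s` of `t` which is at the top. -/
def topPart (s : ℝ) (t : Q → ℝ) (p : Q) : ℝ :=
  min (mass t (Set.Ici p)) s - min (mass t (Set.Ioi p)) s

theorem continuous_topPart : Continuous fun x : ℝ × (Q → ℝ) => topPart x.1 x.2 := by
  refine continuous_pi fun p => ?_
  have h := fun U : Set Q => (continuous_mass U).comp (continuous_snd (X := ℝ) (Y := Q → ℝ))
  exact ((h _).min continuous_fst).sub ((h _).min continuous_fst)

theorem topPart_nonneg {t : Q → ℝ} (ht : ∀ p, 0 ≤ t p) (s : ℝ) (p : Q) : 0 ≤ topPart s t p := by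
  rw [topPart, mass_Ici]
  have := min_le_min_right s (show mass t (Set.Ioi p) ≤ t p + mass t (Set.Ioi p) by linarith [ht p])
  linarith

theorem topPart_le {t : Q → ℝ} (ht : ∀ p, 0 ≤ t p) (s : ℝ) (p : Q) : topPart s t p ≤ t p := by
  rw [topPart, mass_Ici]
  rcases le_total (mass t (Set.Ioi p)) s with h | h
  · grind
  · grind

theorem topPart_one {t : Q → ℝ} (ht : ∀ p, 0 ≤ t p) {s : ℝ} (h1 : ∑ p, t p ≤ s) :
    topPart s t = t := by
  ext p
  have h : ∀ U, mass t U ≤ s := fun U => by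
    refine le_trans ?_ h1
    rw [← mass_univ]
    exact mass_mono ht fun _ _ _ => trivial
  rw [topPart, min_eq_left (h _), min_eq_left (h _), mass_Ici]
  ring

theorem topPart_zero {t : Q → ℝ} (ht : ∀ p, 0 ≤ t p) : topPart 0 t = 0 := by
  ext p
  rw [topPart, min_eq_right (mass_nonneg ht _), min_eq_right (mass_nonneg ht _)]
  simp

theorem topPart_chain {t : Q → ℝ} (ht : ∀ p, 0 ≤ t p) (hc : ChainSupp t) {s : ℝ} {p q : Q}
    (hp : topPart s t p ≠ 0) (hq : t q - topPart s t q ≠ 0) : q ≤ p := by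
  have hp0 : t p ≠ 0 := fun h => hp (le_antisymm (h ▸ topPart_le ht s p) (topPart_nonneg ht s p))
  have hq0 : t q ≠ 0 := fun h => hq (by
    rw [le_antisymm (h ▸ topPart_le ht s q) (topPart_nonneg ht s q), h, sub_zero])
  rcases hc p q hp0 hq0 with h | h
  · rcases h.eq_or_lt with h | h
    · exact h.ge
    exfalso
    have h1 : mass t (Set.Ici q) ≤ mass t (Set.Ioi p) := mass_mono ht fun r _ hr => h.trans_le hr
    have h2 : mass t (Set.Ioi p) < s := by
      by_contra! H
      apply hp
      rw [topPart, min_eq_right H, min_eq_right, sub_self]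
      rw [mass_Ici]; linarith [ht p]
    apply hq
    rw [topPart, min_eq_left (h1.trans h2.le), min_eq_left, mass_Ici]
    · ring
    · rw [mass_Ici] at h1; linarith [ht q]
  · exact h

theorem sum_topPart (s : ℝ) (hs : 0 ≤ s) {t : Q → ℝ} (ht : ∀ p, 0 ≤ t p) (hc : ChainSupp t) :
    ∑ p, topPart s t p = min (∑ p, t p) s := by
  induction hn : (Finset.univ.filter fun p => t p ≠ 0).card generalizing t with
  | zero =>
    have h0 : ∀ p, t p = 0 := by simp_all
    have : ∀ p, topPart s t p = 0 := fun p =>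
      le_antisymm (h0 p ▸ topPart_le ht s p) (topPart_nonneg ht s p)
    simp [this, h0, hs]
  | succ n ih =>
    obtain ⟨m, hm⟩ := (Finset.univ.filter fun p => t p ≠ 0).exists_minimal
      (Finset.card_pos.1 (by omega))
    have hm0 : t m ≠ 0 := by simpa using hm.1
    have hmin : ∀ p, t p ≠ 0 → m ≤ p := fun p hp => by
      rcases hc m p hm0 hp with h | h
      · exact h
      · exact hm.2 (by simp [hp]) h
    set t' : Q → ℝ := Function.update t m 0 with ht'
    have e1 : ∀ p, p ≠ m → t' p = t p := fun p hp => by simp [t', hp]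
    have e2 : t' m = 0 := by simp [t']
    have n1 : ∀ p, 0 ≤ t' p := fun p => by
      by_cases h : p = m
      · rw [h, e2]
      · grind
    have s1 : ∀ p, t' p ≠ 0 → t p ≠ 0 := fun p hp => by
      by_cases h : p = m
      · grind
      · grind
    have c1 : ChainSupp t' := fun p q hp hq => hc p q (s1 p hp) (s1 q hq)
    have hcard : (Finset.univ.filter fun p => t' p ≠ 0).card = n := by
      have : (Finset.univ.filter fun p => t' p ≠ 0) =
          (Finset.univ.filter fun p => t p ≠ 0).erase m := by grind
      rw [this, Finset.card_erase_of_mem (by simpa using hm0), hn]; rfl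
    have key := ih n1 c1 hcard
    have hm' : ∀ U : Set Q, m ∉ U → mass t U = mass t' U := fun U hU => by
      refine Finset.sum_congr rfl fun p _ => ?_
      by_cases h : p = m
      · simp [h, hU]
      · rw [e1 p h]
    have htop : ∀ p, p ≠ m → topPart s t p = topPart s t' p := fun p hp => by
      by_cases h0 : t p = 0
      · rw [le_antisymm (h0 ▸ topPart_le ht s p) (topPart_nonneg ht s p),
          le_antisymm ((show t' p = 0 by rw [e1 p hp, h0]) ▸ topPart_le n1 s p)
            (topPart_nonneg n1 s p)]
      · have hmp : m < p := lt_of_le_of_ne (hmin p h0) (Ne.symm hp)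
        rw [topPart, topPart, hm' _ (by simpa using hmp.not_ge), hm' _ (by simpa using hmp.not_gt)]
    have htm : topPart s t' m = 0 :=
      le_antisymm (e2 ▸ topPart_le n1 s m) (topPart_nonneg n1 s m)
    have hsum : ∑ p, t p = t m + ∑ p, t' p := by
      rw [← Finset.add_sum_erase _ _ (Finset.mem_univ m),
        ← Finset.add_sum_erase (f := t') _ (Finset.mem_univ m), e2, zero_add]
      congr 1
      exact Finset.sum_congr rfl fun p hp => (e1 p (Finset.ne_of_mem_erase hp)).symm
    have hm1 : mass t (Set.Ici m) = ∑ p, t p := by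
      rw [← mass_univ]
      exact mass_congr fun p hp => by simpa using hmin p hp
    have hm2 : mass t (Set.Ioi m) = ∑ p, t' p := by have := mass_Ici t m; linarith
    rw [← Finset.add_sum_erase _ _ (Finset.mem_univ m)] at key ⊢
    rw [htm, zero_add] at key
    rw [Finset.sum_congr rfl fun p hp => htop p (Finset.ne_of_mem_erase hp), key, topPart, hm1, hm2]
    ring

/-- A closure operator of a poset yields a strong deformation retraction of the order complex. -/
theorem OC.isStrongDeformationRetract {r : Q → Q} (hr : Monotone r) (hle : ∀ p, p ≤ r p)
    (hrr : ∀ p, r (r p) = r p) :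
    IsStrongDeformationRetract {t : OC Q | ∀ p, t p ≠ 0 → r p = p} := by
  have mem : ∀ (s : I) (t : OC Q),
      (push r (topPart s t.1) + (t.1 - topPart s t.1)) ∈ ocSet Q := fun s t => by
    have h1 := topPart_nonneg t.nonneg (s : ℝ)
    have h2 := topPart_le t.nonneg (s : ℝ)
    refine ⟨fun p => add_nonneg (push_nonneg h1 p) (sub_nonneg.2 (h2 p)), ?_, ?_⟩
    · simp only [Pi.add_apply, Pi.sub_apply, Finset.sum_add_distrib, Finset.sum_sub_distrib,
        sum_push, t.sum_eq]
      ring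
    · have h3 : ∀ p, topPart s t.1 p ≠ 0 → t p ≠ 0 := fun p hp h =>
        hp (le_antisymm (h ▸ h2 p) (h1 p))
      have h4 : ∀ p, t p - topPart s t.1 p ≠ 0 → t p ≠ 0 := fun p hp h =>
        hp (by rw [le_antisymm (h ▸ h2 p) (h1 p), h, sub_zero])
      have h5 : ∀ p, (push r (topPart s t.1) + (t.1 - topPart s t.1)) p ≠ 0 →
          (∃ a, r a = p ∧ topPart s t.1 a ≠ 0) ∨ t p - topPart s t.1 p ≠ 0 := fun p hp => by
        by_contra! H
        apply hp
        rw [Pi.add_apply, Pi.sub_apply, H.2, push_eq_zero H.1, add_zero]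
      intro p q hp hq
      rcases h5 p hp with ⟨a, rfl, ha⟩ | hp <;> rcases h5 q hq with ⟨b, rfl, hb⟩ | hq
      · exact (t.chain a b (h3 a ha) (h3 b hb)).imp (hr ·) (hr ·)
      · exact .inr ((topPart_chain t.nonneg t.chain ha hq).trans (hle a))
      · exact .inl ((topPart_chain t.nonneg t.chain hb hp).trans (hle b))
      · exact t.chain p q (h4 p hp) (h4 q hq)
  have cont : Continuous fun x : I × OC Q =>
      (⟨_, mem x.1 x.2⟩ : OC Q) := by
    refine Continuous.subtype_mk ?_ _
    have h : Continuous fun x : I × OC Q => topPart (x.1 : ℝ) x.2.1 :=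
      continuous_topPart.comp ((continuous_subtype_val.comp continuous_fst).prodMk
        (continuous_subtype_val.comp continuous_snd))
    exact ((continuous_push r).comp h).add
      ((continuous_subtype_val.comp continuous_snd).sub h)
  have e1 : ∀ t : OC Q, topPart 1 t.1 = t.1 := fun t => topPart_one t.nonneg t.sum_eq.le
  refine ⟨⟨OC.map r hr, OC.continuous_map r hr⟩, fun t p hp => ?_, ⟨⟨⟨⟨_, cont⟩, ?_, ?_⟩, ?_⟩⟩⟩
  · obtain ⟨a, rfl, -⟩ := exists_of_push_ne hp; exact hrr a
  · intro t
    refine Subtype.ext ?_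
    have : push r (0 : Q → ℝ) = 0 := by ext p; exact push_eq_zero fun _ _ => rfl
    simp [topPart_zero t.nonneg, this]
  · intro t; refine Subtype.ext ?_; simp [e1, OC.map_val]
  · intro s t ht
    refine Subtype.ext ?_
    have : push r (topPart s t.1) = topPart s t.1 := by
      have : ∀ p, topPart s t.1 p ≠ 0 → r p = p := fun p hp => ht p fun h =>
        hp (le_antisymm (h ▸ topPart_le t.nonneg _ p) (topPart_nonneg t.nonneg _ p))
      ext p
      by_cases h : ∃ a, r a = p ∧ topPart s t.1 a ≠ 0
      · obtain ⟨a, rfl, ha⟩ := h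
        rw [push, Finset.sum_eq_single a]
        · grind
        · grind
        · simp
      · push Not at h; rw [push_eq_zero h]; by_contra H; exact H (h p (this p (Ne.symm H))).symm
    simp [this]

end mass

end OrderComplex

section

open scoped Classical

/-! ### Products with the interval -/

/-- The faces of the unit interval. -/
inductive IF
  | en (b : Bool)
  | md
  deriving DecidableEq, Fintype

namespace IF

instance : PartialOrder IF where
  le a b := a = b ∨ b = md
  le_refl a := .inl rfl
  le_trans a b c := by grind
  le_antisymm a b := by grind

theorem le_def {a b : IF} : a ≤ b ↔ a = b ∨ b = md := Iff.rfl

@[simp] theorem le_md (a : IF) : a ≤ md := .inr rfl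
@[simp] theorem md_le {a : IF} : md ≤ a ↔ a = md := by simp [le_def, eq_comm]
@[simp] theorem le_en {a : IF} {b : Bool} : a ≤ en b ↔ a = en b := by simp [le_def]

theorem sum_eq (f : IF → ℝ) : ∑ τ, f τ = f (en false) + f (en true) + f md := by
  have : (Finset.univ : Finset IF) = {en false, en true, md} := by decide
  rw [this]
  simp [Finset.sum_insert, add_assoc]

end IF

open IF

theorem lower_nonneg (x : I) : 0 ≤ min (2 * (x : ℝ)) 1 ∧ 0 ≤ min (2 - 2 * (x : ℝ)) 1 :=
  ⟨le_min (by linarith [x.2.1]) zero_le_one, le_min (by linarith [x.2.2]) zero_le_one⟩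

/-- The barycentric coordinates of a point of the interval, as a function. -/
def iotaFun (x : I) : IF → ℝ
  | en false => 1 - min (2 * (x : ℝ)) 1
  | en true => 1 - min (2 - 2 * (x : ℝ)) 1
  | md => min (2 * (x : ℝ)) 1 + min (2 - 2 * (x : ℝ)) 1 - 1

theorem half_cases (x : I) :
    (min (2 * (x : ℝ)) 1 = 2 * x ∧ min (2 - 2 * (x : ℝ)) 1 = 1 ∧ (x : ℝ) ≤ 1 / 2) ∨
    (min (2 * (x : ℝ)) 1 = 1 ∧ min (2 - 2 * (x : ℝ)) 1 = 2 - 2 * x ∧ 1 / 2 ≤ (x : ℝ)) := by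
  grind

/-- The barycentric coordinates of a point of the interval. -/
def iota (x : I) : OC IF := ⟨iotaFun x, by
  have h0 := x.2.1
  have h1 := x.2.2
  refine ⟨?_, ?_, ?_⟩
  · rintro ((_ | _) | _) <;> rcases half_cases x with ⟨e1, e2, e3⟩ | ⟨e1, e2, e3⟩ <;>
      simp only [iotaFun, e1, e2] <;> linarith
  · rw [IF.sum_eq]; simp only [iotaFun]; ring
  · rintro ((_ | _) | _) ((_ | _) | _) hp hq <;> simp <;>
      rcases half_cases x with ⟨e1, e2, e3⟩ | ⟨e1, e2, e3⟩ <;>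
      simp [iotaFun, e1, e2] at hp hq⟩

theorem continuous_iota : Continuous iota := by
  refine OC.continuous_of_coord ?_
  rintro ((_ | _) | _) <;> simp only [iota, iotaFun] <;> fun_prop

theorem iota_zero : iota 0 = OC.vtx (en false) := OC.eq_vtx (by simp [iota, iotaFun])
theorem iota_one : iota 1 = OC.vtx (en true) := OC.eq_vtx (by simp [iota, iotaFun])

theorem iota_injective : Injective iota := fun x y h => by
  have h1 := congrFun (congrArg Subtype.val h) (en false)
  have h2 := congrFun (congrArg Subtype.val h) (en true)
  simp only [iota, iotaFun] at h1 h2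
  refine Subtype.ext ?_
  rcases half_cases x with ⟨e1, e2, e3⟩ | ⟨e1, e2, e3⟩ <;>
    rcases half_cases y with ⟨f1, f2, f3⟩ | ⟨f1, f2, f3⟩ <;> rw [e1, f1] at h1 <;>
    rw [e2, f2] at h2 <;> linarith

theorem iota_surjective : Surjective iota := fun t => by
  have hs := t.sum_eq
  rw [IF.sum_eq] at hs
  have h0 := t.nonneg (en false)
  have h1 := t.nonneg (en true)
  have h2 := t.nonneg md
  by_cases h : t (en true) = 0
  · have hx : t md / 2 ∈ Set.Icc (0 : ℝ) 1 := ⟨by linarith, by linarith⟩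
    refine ⟨⟨_, hx⟩, Subtype.ext (funext ?_)⟩
    have e1 : min (2 * (t md / 2)) 1 = t md := by grind
    have e2 : min (2 - 2 * (t md / 2)) 1 = 1 := by grind
    rintro ((_ | _) | _) <;> simp only [iota, iotaFun, e1, e2] <;> linarith
  · have h3 : t (en false) = 0 := by by_contra h'; have := t.chain _ _ h h'; simp at this
    have hx : 1 - t md / 2 ∈ Set.Icc (0 : ℝ) 1 := ⟨by linarith, by linarith⟩
    refine ⟨⟨_, hx⟩, Subtype.ext (funext ?_)⟩
    have e1 : min (2 * (1 - t md / 2)) 1 = 1 := by grind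
    have e2 : min (2 - 2 * (1 - t md / 2)) 1 = t md := by grind
    rintro ((_ | _) | _) <;> simp only [iota, iotaFun, e1, e2] <;> linarith

/-- The reflection of the interval. -/
def IF.flip : IF → IF
  | en b => en (!b)
  | md => md

theorem IF.monotone_flip : Monotone IF.flip := by rintro a b (rfl | rfl) <;> simp [IF.flip]

theorem iota_symm (x : I) : iota (σ x) = OC.map IF.flip IF.monotone_flip (iota x) := by
  refine Subtype.ext (funext fun τ => ?_)
  rw [OC.map_val, push, IF.sum_eq]
  rcases τ with (_ | _) | _ <;>
    simp [IF.flip, iota, iotaFun, unitInterval.coe_symm_eq] <;> ring_nf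

section prod

variable {A B C : Type*} [Fintype A] [PartialOrder A] [Fintype B] [PartialOrder B]
  [Fintype C] [PartialOrder C]

/-- A point of the order complex of a product is determined by its marginals. -/
theorem OC.ext_marginals {s t : OC (A × B)}
    (h1 : OC.map Prod.fst monotone_fst s = OC.map Prod.fst monotone_fst t)
    (h2 : OC.map Prod.snd monotone_snd s = OC.map Prod.snd monotone_snd t) : s = t := by
  have key : ∀ (u : OC (A × B)) (a : A) (b : B), mass u.1 (Set.Ici (a, b)) =
      min (mass (OC.map Prod.fst monotone_fst u).1 (Set.Ici a))
        (mass (OC.map Prod.snd monotone_snd u).1 (Set.Ici b)) := fun u a b => by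
    rw [OC.map_val, OC.map_val, mass_push, mass_push, ← mass_inter u.nonneg u.chain
      ((isUpperSet_Ici a).preimage monotone_fst) ((isUpperSet_Ici b).preimage monotone_snd)]
    rfl
  refine Subtype.ext (eq_of_mass_Ici_eq ?_)
  rintro ⟨a, b⟩
  rw [key, key, h1, h2]

/-- The product of a point of an order complex and a point of the interval. -/
def prodFun (s : A → ℝ) (x : I) : A × IF → ℝ
  | (a, en false) => s a - topPart (min (2 * (x : ℝ)) 1) s a
  | (a, en true) => s a - topPart (min (2 - 2 * (x : ℝ)) 1) s a
  | (a, md) => topPart (min (2 * (x : ℝ)) 1) s a + topPart (min (2 - 2 * (x : ℝ)) 1) s a - s a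

/-- The product of a point of an order complex and a point of the interval. -/
def OC.prod (s : OC A) (x : I) : OC (A × IF) := ⟨prodFun s.1 x, by
  have h1 : topPart 1 s.1 = s.1 := topPart_one s.nonneg s.sum_eq.le
  have hn := fun c => topPart_nonneg s.nonneg c
  have hl := fun c => topPart_le s.nonneg c
  have hne : ∀ c a, topPart c s.1 a ≠ 0 → s a ≠ 0 := fun c a ha h =>
    ha (le_antisymm (h ▸ hl c a) (hn c a))
  have hne' : ∀ c a, s a - topPart c s.1 a ≠ 0 → s a ≠ 0 := fun c a ha h =>
    ha (by rw [le_antisymm (h ▸ hl c a) (hn c a), h, sub_zero])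
  refine ⟨?_, ?_, ?_⟩
  · rintro ⟨a, (_ | _) | _⟩ <;> rcases half_cases x with ⟨e1, e2, e3⟩ | ⟨e1, e2, e3⟩ <;>
      simp only [prodFun, e1, e2, h1] <;> linarith [hn (2 * (x : ℝ)) a, hl (2 * (x : ℝ)) a,
        hn (2 - 2 * (x : ℝ)) a, hl (2 - 2 * (x : ℝ)) a]
  · rw [Fintype.sum_prod_type]
    simp only [IF.sum_eq, prodFun]
    rw [← s.sum_eq]
    exact Finset.sum_congr rfl fun a _ => by ring
  · rintro ⟨a, (_ | _) | _⟩ ⟨b, (_ | _) | _⟩ hp hq <;>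
      rcases half_cases x with ⟨e1, e2, e3⟩ | ⟨e1, e2, e3⟩ <;>
      simp only [prodFun, e1, e2, h1, sub_self, ne_eq, not_true_eq_false, add_sub_cancel_right,
        add_sub_cancel_left] at hp hq <;>
      first
      | exact (s.chain a b (hne' _ _ hp) (hne' _ _ hq)).imp (fun h => ⟨h, le_rfl⟩)
          (fun h => ⟨h, le_rfl⟩)
      | exact (s.chain a b (hne _ _ hp) (hne _ _ hq)).imp (fun h => ⟨h, le_rfl⟩)
          (fun h => ⟨h, le_rfl⟩)
      | exact .inl ⟨topPart_chain s.nonneg s.chain hq hp, le_md _⟩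
      | exact .inr ⟨topPart_chain s.nonneg s.chain hp hq, le_md _⟩⟩

theorem OC.continuous_prod : Continuous fun z : OC A × I => OC.prod z.1 z.2 := by
  have h : ∀ a, Continuous fun z : ℝ × (A → ℝ) => topPart z.1 z.2 a := fun a =>
    (continuous_apply a).comp continuous_topPart
  have h0 : ∀ a, Continuous fun z : OC A × I => z.1 a := fun a =>
    (OC.continuous_coord a).comp continuous_fst
  have h1 : ∀ a, Continuous fun z : OC A × I => topPart (min (2 * (z.2 : ℝ)) 1) z.1.1 a :=
    fun a => (h a).comp (Continuous.prodMk (by fun_prop)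
      (continuous_subtype_val.comp continuous_fst))
  have h2 : ∀ a, Continuous fun z : OC A × I => topPart (min (2 - 2 * (z.2 : ℝ)) 1) z.1.1 a :=
    fun a => (h a).comp (Continuous.prodMk (by fun_prop)
      (continuous_subtype_val.comp continuous_fst))
  refine OC.continuous_of_coord ?_
  rintro ⟨a, (_ | _) | _⟩
  · exact (h0 a).sub (h1 a)
  · exact (h0 a).sub (h2 a)
  · exact ((h1 a).add (h2 a)).sub (h0 a)

theorem OC.map_fst_prod (s : OC A) (x : I) : OC.map Prod.fst monotone_fst (OC.prod s x) = s := by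
  refine Subtype.ext (funext fun a => ?_)
  rw [OC.map_val, push, Fintype.sum_prod_type]
  simp only [IF.sum_eq]
  rw [Finset.sum_eq_single a]
  · simp only [if_true, OC.prod, prodFun]; ring
  · grind
  · simp

theorem OC.map_snd_prod (s : OC A) (x : I) :
    OC.map Prod.snd monotone_snd (OC.prod s x) = iota x := by
  have h := fun c hc => sum_topPart c hc s.nonneg s.chain
  rw [s.sum_eq] at h
  obtain ⟨p1, p2⟩ := lower_nonneg x
  refine Subtype.ext (funext fun τ => ?_)
  rw [OC.map_val, push, Fintype.sum_prod_type_right]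
  simp only [IF.sum_eq]
  rcases τ with (_ | _) | _ <;>
    simp [OC.prod, prodFun, iota, iotaFun, Finset.sum_sub_distrib, Finset.sum_add_distrib,
      s.sum_eq, h _ p1, h _ p2]

theorem OC.eq_prod {t : OC (A × IF)} {s : OC A} {x : I}
    (h1 : OC.map Prod.fst monotone_fst t = s) (h2 : OC.map Prod.snd monotone_snd t = iota x) :
    t = OC.prod s x :=
  OC.ext_marginals (by rw [h1, OC.map_fst_prod]) (by rw [h2, OC.map_snd_prod])

theorem OC.prod_injective {s s' : OC A} {x x' : I} (h : OC.prod s x = OC.prod s' x') :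
    s = s' ∧ x = x' := by
  constructor
  · rw [← OC.map_fst_prod s x, h, OC.map_fst_prod]
  · apply iota_injective; rw [← OC.map_snd_prod s x, h, OC.map_snd_prod]

theorem OC.exists_prod (t : OC (A × IF)) : ∃ s x, OC.prod s x = t := by
  obtain ⟨x, hx⟩ := iota_surjective (OC.map Prod.snd monotone_snd t)
  exact ⟨_, x, (OC.eq_prod rfl hx.symm).symm⟩

theorem OC.map_prod {e : A → B} (he : Monotone e) (s : OC A) (x : I) :
    OC.map (Prod.map e id) (he.prodMap monotone_id) (OC.prod s x) = OC.prod (OC.map e he s) x := by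
  refine OC.eq_prod ?_ ?_
  · conv_rhs => rw [← OC.map_fst_prod s x]
    rw [OC.map_map, OC.map_map]; rfl
  · rw [← OC.map_snd_prod s x, OC.map_map]; rfl

theorem OC.map_flip_prod (s : OC A) (x : I) :
    OC.map (Prod.map id IF.flip) (monotone_id.prodMap IF.monotone_flip) (OC.prod s x) =
      OC.prod s (σ x) := by
  refine OC.eq_prod ?_ ?_
  · conv_rhs => rw [← OC.map_fst_prod s x]
    rw [OC.map_map]; rfl
  · rw [iota_symm, ← OC.map_snd_prod s x, OC.map_map, OC.map_map]; rfl

theorem monotone_swap {A B : Type*} [PartialOrder A] [PartialOrder B] :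
    Monotone (Prod.swap : A × B → B × A) := fun _ _ h => Prod.swap_le_swap.2 h

theorem OC.map_swap_prod (x y : I) :
    OC.map Prod.swap monotone_swap (OC.prod (iota x) y) = OC.prod (iota y) x := by
  refine OC.eq_prod ?_ ?_
  · rw [← OC.map_snd_prod (iota x) y, OC.map_map]; rfl
  · rw [OC.map_map]; exact OC.map_fst_prod (iota x) y

omit [Fintype A] in
theorem monotone_prodMk (τ : IF) : Monotone fun a : A => (a, τ) := fun _ _ h => ⟨h, le_rfl⟩

theorem OC.prod_zero (s : OC A) :
    OC.prod s 0 = OC.map (fun a => (a, en false)) (monotone_prodMk _) s := by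
  refine (OC.eq_prod ?_ ?_).symm
  · rw [OC.map_map]; exact Subtype.ext (push_id _)
  · rw [OC.map_map, iota_zero]; refine OC.eq_vtx ?_; simp [OC.map_val, push, s.sum_eq]

theorem OC.prod_one (s : OC A) :
    OC.prod s 1 = OC.map (fun a => (a, en true)) (monotone_prodMk _) s := by
  have := OC.map_flip_prod s 0
  rw [unitInterval.symm_zero, OC.prod_zero, OC.map_map] at this
  exact this.symm

theorem OC.prod_md_ne {s : OC A} {x : I} (h0 : x ≠ 0) (h1 : x ≠ 1) :
    ∃ a, OC.prod s x (a, md) ≠ 0 := by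
  by_contra! H
  have h2 : iota x md = 0 := by
    rw [← OC.map_snd_prod s x, OC.map_val]
    refine push_eq_zero ?_
    rintro ⟨a, τ⟩ rfl
    exact H a
  have h0' : (x : ℝ) ≠ 0 := fun h => h0 (Subtype.ext h)
  have h1' : (x : ℝ) ≠ 1 := fun h => h1 (Subtype.ext h)
  simp only [iota, iotaFun] at h2
  rcases half_cases x with ⟨e1, e2, e3⟩ | ⟨e1, e2, e3⟩ <;> rw [e1, e2] at h2
  · grind
  · grind

end prod

end

/-! ### Polygons -/

/-- The cyclic successor. -/
def cyc {n : ℕ} (s : Fin n) : Fin n := ⟨(s.1 + 1) % n, Nat.mod_lt _ (Nat.zero_lt_of_lt s.2)⟩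

theorem cyc_injective {n : ℕ} : Injective (cyc : Fin n → Fin n) := fun s t h => by
  have h := congrArg Fin.val h
  simp only [cyc] at h
  have hs := s.2
  have ht := t.2
  refine Fin.ext ?_
  rcases Nat.lt_or_ge (s.1 + 1) n with h1 | h1 <;> rcases Nat.lt_or_ge (t.1 + 1) n with h2 | h2
  · rw [Nat.mod_eq_of_lt h1, Nat.mod_eq_of_lt h2] at h; omega
  · rw [Nat.mod_eq_of_lt h1, show t.1 + 1 = n by omega, Nat.mod_self] at h; omega
  · rw [Nat.mod_eq_of_lt h2, show s.1 + 1 = n by omega, Nat.mod_self] at h; omega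
  · omega

/-- The cells of a polygon with `2 n` sides, alternately legs and gaps; the vertex
`vt s false` starts the leg `s`, and `vt s true` ends it. -/
inductive Poly (n : ℕ)
  | vt (s : Fin n) (b : Bool)
  | lg (s : Fin n)
  | gp (s : Fin n)
  | tp
  deriving DecidableEq, Fintype

namespace Poly

variable {n : ℕ}

/-- Incidence of the cells of a polygon. -/
inductive Le : Poly n → Poly n → Prop
  | rfl (a : Poly n) : Le a a
  | tp (a : Poly n) : Le a tp
  | lg (s : Fin n) (b : Bool) : Le (vt s b) (lg s)
  | gp0 (s : Fin n) : Le (vt s true) (gp s)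
  | gp1 (s : Fin n) : Le (vt (cyc s) false) (gp s)

instance : PartialOrder (Poly n) where
  le := Le
  le_refl := Le.rfl
  le_trans a b c h1 h2 := by cases h1 <;> first | exact h2 | (cases h2 <;> constructor)
  le_antisymm a b h1 h2 := by cases h1 <;> cases h2 <;> rfl

theorem le_def {a b : Poly n} : a ≤ b ↔ Le a b := Iff.rfl

@[simp] theorem le_tp (a : Poly n) : a ≤ tp := Le.tp a
@[simp] theorem tp_le {a : Poly n} : tp ≤ a ↔ a = tp :=
  ⟨fun h => by cases h <;> rfl, fun h => h ▸ le_rfl⟩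
@[simp] theorem le_vt {a : Poly n} {s b} : a ≤ vt s b ↔ a = vt s b :=
  ⟨fun h => by cases h; rfl, fun h => h ▸ le_rfl⟩
@[simp] theorem lg_le_lg {s t : Fin n} : lg s ≤ lg t ↔ s = t :=
  ⟨fun h => by cases h; rfl, fun h => h ▸ le_rfl⟩
@[simp] theorem gp_le_gp {s t : Fin n} : gp s ≤ gp t ↔ s = t :=
  ⟨fun h => by cases h; rfl, fun h => h ▸ le_rfl⟩
@[simp] theorem not_lg_le_gp {s t : Fin n} : ¬ lg s ≤ gp t := fun h => by cases h
@[simp] theorem not_gp_le_lg {s t : Fin n} : ¬ gp s ≤ lg t := fun h => by cases h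
@[simp] theorem vt_le_lg {s t : Fin n} {b} : vt s b ≤ lg t ↔ s = t :=
  ⟨fun h => by cases h; rfl, fun h => h ▸ Le.lg s b⟩
@[simp] theorem vt_le_gp {s t : Fin n} {b} :
    vt s b ≤ gp t ↔ (b = true ∧ s = t) ∨ (b = false ∧ s = cyc t) :=
  ⟨fun h => by cases h <;> simp, by
    rintro (⟨rfl, rfl⟩ | ⟨rfl, rfl⟩)
    · exact Le.gp0 s
    · exact Le.gp1 t⟩

/-- The inclusion of an edge. -/
def edge (s : Fin n) : Bool → IF → Poly n
  | false, .en b => vt s b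
  | false, .md => lg s
  | true, .en false => vt s true
  | true, .en true => vt (cyc s) false
  | true, .md => gp s

theorem monotone_edge (s : Fin n) (k : Bool) : Monotone (edge s k) := by
  rintro a b (rfl | rfl)
  · exact le_rfl
  · rcases k <;> rcases a with (_ | _) | _ <;> simp [edge]

theorem edge_injective (s : Fin n) (k : Bool) : Injective (edge s k) := by
  intro a b h
  rcases k <;> rcases a with (_ | _) | _ <;> rcases b with (_ | _) | _ <;> simp_all [edge]

theorem edge_ne_tp (s : Fin n) (k : Bool) (τ : IF) : edge s k τ ≠ tp := by
  rcases k <;> rcases τ with (_ | _) | _ <;> simp [edge]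

/-- A point of the boundary of the polygon: on the leg or the gap `s` at the parameter `x`. -/
def bdry (a : Fin n × Bool × I) : OC (Poly n) :=
  OC.map (edge a.1 a.2.1) (monotone_edge _ _) (iota a.2.2)

theorem bdry_tp (a : Fin n × Bool × I) : bdry a tp = 0 :=
  push_eq_zero (e := edge a.1 a.2.1) fun _ h => absurd h (edge_ne_tp _ _ _)

theorem exists_edge_of_bdry_ne {a : Fin n × Bool × I} {p : Poly n} (h : bdry a p ≠ 0) :
    ∃ τ, edge a.1 a.2.1 τ = p :=
  (exists_of_push_ne (e := edge a.1 a.2.1) h).imp fun _ h => h.1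

theorem edge_end_inj {s t : Fin n} {k l c : Bool} (h : edge s k (.en c) = edge t l (.en c)) :
    s = t ∧ k = l := by
  rcases k <;> rcases l <;> rcases c <;> simp_all [edge, cyc_injective.eq_iff]

theorem edge_md_inj {s t : Fin n} {k l : Bool} {τ : IF} (h : edge s k .md = edge t l τ) :
    s = t ∧ k = l := by
  rcases k <;> rcases l <;> rcases τ with (_ | _) | _ <;> simp_all [edge]

/-- The number of an edge. -/
def num (a : Fin n × Bool × I) : ℕ := 2 * a.1.1 + a.2.1.toNat

theorem num_lt (a : Fin n × Bool × I) : num a < 2 * n := by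
  have := a.1.2
  have := a.2.1.toNat_le
  simp only [num]; omega

theorem num_inj {a b : Fin n × Bool × I} (h : num a = num b) (hx : a.2.2 = b.2.2) : a = b := by
  obtain ⟨⟨s, hs⟩, k, x⟩ := a
  obtain ⟨⟨t, ht⟩, l, y⟩ := b
  simp only [num] at h hx
  subst hx
  have : s = t ∧ k = l := by rcases k <;> rcases l <;> simp at h ⊢ <;> omega
  obtain ⟨rfl, rfl⟩ := this
  rfl

theorem exists_num {N : ℕ} (h : N < 2 * n) (x : I) :
    ∃ a : Fin n × Bool × I, num a = N ∧ a.2.2 = x := by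
  rcases Nat.even_or_odd' N with ⟨s, rfl | rfl⟩
  · exact ⟨(⟨s, by omega⟩, false, x), by simp [num], rfl⟩
  · exact ⟨(⟨s, by omega⟩, true, x), by simp [num], rfl⟩

/-- `a` is the end of an edge and `b` the beginning of the next one. -/
def Adj (a b : Fin n × Bool × I) : Prop :=
  (a.2.2 : ℝ) = 1 ∧ (b.2.2 : ℝ) = 0 ∧ num b = (num a + 1) % (2 * n)

theorem adj_iff {a b : Fin n × Bool × I} : Adj a b ↔ a.2.2 = 1 ∧ b.2.2 = 0 ∧
    edge a.1 a.2.1 (.en true) = edge b.1 b.2.1 (.en false) := by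
  obtain ⟨⟨s, hs⟩, k, x⟩ := a
  obtain ⟨⟨t, ht⟩, l, y⟩ := b
  simp only [Adj, num, Subtype.ext_iff, Set.Icc.coe_one, Set.Icc.coe_zero]
  refine and_congr_right fun _ => and_congr_right fun _ => ?_
  have e1 : (2 * s + 1 + 1) % (2 * n) = 2 * ((s + 1) % n) := by
    rw [show 2 * s + 1 + 1 = 2 * (s + 1) by ring, Nat.mul_mod_mul_left]
  rcases k <;> rcases l <;> simp [edge, cyc]
  · rw [Nat.mod_eq_of_lt (by omega)]; omega
  · rw [Nat.mod_eq_of_lt (by omega)]; omega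
  · omega
  · omega

theorem bdry_of_one {a : Fin n × Bool × I} (h : a.2.2 = 1) :
    bdry a = OC.vtx (edge a.1 a.2.1 (.en true)) := by
  rw [bdry, h, iota_one, OC.map_vtx]

theorem bdry_of_zero {a : Fin n × Bool × I} (h : a.2.2 = 0) :
    bdry a = OC.vtx (edge a.1 a.2.1 (.en false)) := by
  rw [bdry, h, iota_zero, OC.map_vtx]

theorem _root_.SingularManifold.OC.vtx_injective {A : Type*} [Fintype A] [PartialOrder A] :
    Injective (OC.vtx : A → OC A) := fun p q h => by
  classical
  have := congrFun (congrArg Subtype.val h) p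
  by_contra hne
  simp [OC.vtx_apply, hne] at this

theorem _root_.SingularManifold.iota_md_ne {x : I} (h0 : x ≠ 0) (h1 : x ≠ 1) : iota x .md ≠ 0 := by
  have h0' : (x : ℝ) ≠ 0 := fun h => h0 (Subtype.ext h)
  have h1' : (x : ℝ) ≠ 1 := fun h => h1 (Subtype.ext h)
  intro h2
  simp only [iota, iotaFun] at h2
  rcases half_cases x with ⟨e1, e2, e3⟩ | ⟨e1, e2, e3⟩ <;> rw [e1, e2] at h2
  · grind
  · grind

theorem eq_of_edge {a b : Fin n × Bool × I} (h : a.1 = b.1 ∧ a.2.1 = b.2.1)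
    (hx : a.2.2 = b.2.2) : a = b := Prod.ext h.1 (Prod.ext h.2 hx)

theorem eq_of_bdry_eq {a b : Fin n × Bool × I} (h : bdry a = bdry b) (h0 : a.2.2 ≠ 0)
    (h1 : a.2.2 ≠ 1) : a = b := by
  have h2 : bdry a (edge a.1 a.2.1 .md) ≠ 0 := by
    rw [bdry, OC.map_val, push_apply (edge_injective _ _)]
    exact iota_md_ne h0 h1
  rw [h] at h2
  obtain ⟨τ, hτ⟩ := exists_edge_of_bdry_ne h2
  have h3 := edge_md_inj hτ.symm
  obtain ⟨s, k, x⟩ := a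
  obtain ⟨t, l, y⟩ := b
  obtain ⟨rfl, rfl⟩ := h3
  exact eq_of_edge ⟨rfl, rfl⟩ (iota_injective (OC.map_injective (monotone_edge s k)
    (edge_injective s k) h))

theorem bdry_eq_iff {a b : Fin n × Bool × I} : bdry a = bdry b ↔ a = b ∨ Adj a b ∨ Adj b a := by
  constructor
  · intro h
    by_cases h0 : a.2.2 = 0
    · by_cases h0' : b.2.2 = 0
      · left
        have h' := h
        rw [bdry_of_zero h0, bdry_of_zero h0'] at h'
        exact eq_of_edge (edge_end_inj (OC.vtx_injective h')) (h0.trans h0'.symm)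
      · by_cases h1' : b.2.2 = 1
        · right; right
          rw [bdry_of_zero h0, bdry_of_one h1'] at h
          exact adj_iff.2 ⟨h1', h0, (OC.vtx_injective h).symm⟩
        · exact .inl (eq_of_bdry_eq h.symm h0' h1').symm
    · by_cases h1 : a.2.2 = 1
      · by_cases h0' : b.2.2 = 0
        · right; left
          rw [bdry_of_zero h0', bdry_of_one h1] at h
          exact adj_iff.2 ⟨h1, h0', OC.vtx_injective h⟩
        · by_cases h1' : b.2.2 = 1
          · left
            have h' := h
            rw [bdry_of_one h1, bdry_of_one h1'] at h'
            exact eq_of_edge (edge_end_inj (OC.vtx_injective h')) (h1.trans h1'.symm)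
          · exact .inl (eq_of_bdry_eq h.symm h0' h1').symm
      · exact .inl (eq_of_bdry_eq h h0 h1)
  · have key : ∀ a b : Fin n × Bool × I, Adj a b → bdry a = bdry b := fun a b h => by
      rw [adj_iff] at h
      rw [bdry_of_one h.1, bdry_of_zero h.2.1, h.2.2]
    rintro (rfl | h | h)
    · rfl
    · grind
    · grind

/-- Every point of the order complex without mass at the top is on the boundary. -/
theorem exists_bdry (t : OC (Poly n)) (ht : t tp = 0) : ∃ a, bdry a = t := by
  have key : ∀ s k, t (edge s k .md) ≠ 0 → ∃ a, bdry a = t := by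
    intro s k h
    have hr : ∀ p, t p ≠ 0 → p ∈ Set.range (edge s k) := by
      intro p hp
      have h1 := t.chain _ _ h hp
      have h2 : p ≠ tp := fun h => hp (h ▸ ht)
      rcases k <;> rcases p with ⟨u, b⟩ | _ | _ | _ <;> simp [edge] at h1 h2
      · exact ⟨.en b, by simp [edge, h1]⟩
      · exact ⟨.md, by rcases h1 with rfl | rfl <;> rfl⟩
      · rcases h1 with ⟨rfl, rfl⟩ | ⟨rfl, rfl⟩
        · exact ⟨.en false, rfl⟩
        · exact ⟨.en true, rfl⟩
      · exact ⟨.md, by rcases h1 with rfl | rfl <;> rfl⟩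
    have hle : ∀ a a', edge s k a ≤ edge s k a' → a ≤ a' := by
      intro a a' h
      rcases k <;> rcases a with (_ | _) | _ <;> rcases a' with (_ | _) | _ <;>
        simp_all [edge]
    obtain ⟨u, hu⟩ := OC.exists_map_eq (monotone_edge s k) hle t hr
    obtain ⟨x, rfl⟩ := iota_surjective u
    exact ⟨(s, k, x), hu⟩
  by_cases H : ∃ s k, t (edge s k .md) ≠ 0
  · grind
  · push Not at H
    have hv : ∀ p, t p ≠ 0 → ∃ s b, p = vt s b := by
      rintro (⟨s, b⟩ | s | s | _) hp
      · simp
      · exact absurd (H s false) hp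
      · exact absurd (H s true) hp
      · grind
    obtain ⟨p, hp⟩ := t.exists_ne
    obtain ⟨s, b, rfl⟩ := hv p hp
    have : t = OC.vtx (vt s b) := by
      refine OC.eq_vtx ?_
      rw [← t.sum_eq, Finset.sum_eq_single (vt s b)]
      · intro q _ hq
        by_contra h
        obtain ⟨s', b', rfl⟩ := hv q h
        have := t.chain _ _ hp h
        simp at this
        rcases this with h | h <;> simp [h] at hq
      · simp
    refine ⟨(s, false, if b then 1 else 0), ?_⟩
    rw [this]
    rcases b
    · exact bdry_of_zero rfl
    · exact bdry_of_one rfl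

theorem continuous_bdry : Continuous (bdry : Fin n × Bool × I → OC (Poly n)) := by
  refine continuous_prod_of_discrete_left.2 fun s => continuous_prod_of_discrete_left.2 fun k => ?_
  exact (OC.continuous_map (edge s k) (monotone_edge s k)).comp continuous_iota

/-- The polygon as a cone over its boundary. -/
def par (z : (Fin n × Bool × I) × I) : OC (Poly n) :=
  OC.mixV (bdry z.1) (tp : Poly n) (fun _ _ => .inl (le_tp _)) (σ z.2)

theorem par_apply (z : (Fin n × Bool × I) × I) (p : Poly n) :
    par z p = (z.2 : ℝ) * bdry z.1 p + if p = tp then 1 - (z.2 : ℝ) else 0 := by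
  classical
  rw [par, OC.mixV_apply, unitInterval.coe_symm_eq]
  congr 1
  · ring
  · simp

theorem par_tp (z : (Fin n × Bool × I) × I) : par z tp = 1 - (z.2 : ℝ) := by
  simp [par_apply, bdry_tp]

theorem continuous_par : Continuous (par : (Fin n × Bool × I) × I → OC (Poly n)) := by
  refine OC.continuous_of_coord fun p => ?_
  simp only [par_apply]
  refine Continuous.add (Continuous.mul (by fun_prop)
    ((OC.continuous_coord p).comp (continuous_bdry.comp continuous_fst))) ?_
  split_ifs <;> fun_prop

theorem par_eq_iff {z w : (Fin n × Bool × I) × I} :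
    par z = par w ↔ z.2 = w.2 ∧ ((z.2 : ℝ) = 0 ∨ bdry z.1 = bdry w.1) := by
  constructor
  · intro h
    have h1 : (z.2 : ℝ) = w.2 := by
      have := congrFun (congrArg Subtype.val h) tp
      rw [par_tp, par_tp] at this
      linarith
    refine ⟨Subtype.ext h1, or_iff_not_imp_left.2 fun h0 => Subtype.ext (funext fun p => ?_)⟩
    have := congrFun (congrArg Subtype.val h) p
    rw [par_apply, par_apply, ← h1] at this
    exact mul_left_cancel₀ h0 (add_right_cancel this)
  · rintro ⟨h1, h2⟩
    refine Subtype.ext (funext fun p => ?_)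
    rw [par_apply, par_apply, ← h1]
    rcases h2 with h2 | h2
    · simp [h2]
    · rw [h2]

theorem par_surjective (hn : 0 < n) :
    Surjective (par : (Fin n × Bool × I) × I → OC (Poly n)) := by
  intro t
  by_cases h1 : t tp = 1
  · refine ⟨((⟨0, hn⟩, false, 0), 0), ?_⟩; rw [OC.eq_vtx h1]; exact OC.eq_vtx (by simp [par_tp])
  by_cases h0 : t tp = 0
  · obtain ⟨a, rfl⟩ := exists_bdry t h0
    refine ⟨(a, 1), Subtype.ext (funext fun p => ?_)⟩
    simp [par_apply]
  · obtain ⟨z, h, x, hz, hx, -, rfl⟩ := OC.exists_mixV t tp h0 h1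
    obtain ⟨a, rfl⟩ := exists_bdry z hz
    refine ⟨(a, σ x), ?_⟩
    simp only [par, unitInterval.symm_symm]

/-- A space parametrised in the same way as a polygon is homeomorphic to its order complex. -/
theorem exists_homeomorph {E : Type*} [TopologicalSpace E] [T2Space E]
    (q : (Fin n × Bool × I) × I → E) (hn : 0 < n) (hc : Continuous q)
    (hs : Surjective q)
    (hq : ∀ z w, q z = q w ↔ z.2 = w.2 ∧ ((z.2 : ℝ) = 0 ∨ z.1 = w.1 ∨ Adj z.1 w.1 ∨ Adj w.1 z.1)) :
    ∃ h : E ≃ₜ OC (Poly n), ∀ z, h (q z) = par z := by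
  have key : ∀ z w, q z = q w ↔ par z = par w := fun z w => by rw [hq, par_eq_iff, bdry_eq_iff]
  have : CompactSpace E := ⟨by rw [← hs.range_eq]; exact isCompact_range hc⟩
  obtain ⟨f, hf⟩ : ∃ f : C(E, OC (Poly n)), ∀ z, f (q z) = par z := by
    have hqm : IsQuotientMap (⟨q, hc⟩ : C(_, E)) := hc.isClosedMap.isQuotientMap hc hs
    have H : FactorsThrough (⟨par, continuous_par⟩ : C(_, OC (Poly n)))
      (⟨q, hc⟩ : C(_, E)) := fun z w h => (key z w).1 h
    exact ⟨hqm.lift _ H, fun z => DFunLike.congr_fun (hqm.lift_comp _ H) z⟩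
  have hbij : Bijective f := by
    refine ⟨fun e e' h => ?_, fun t => ?_⟩
    · obtain ⟨z, rfl⟩ := hs e; obtain ⟨w, rfl⟩ := hs e'; rw [hf, hf] at h; exact (key z w).2 h
    · obtain ⟨z, rfl⟩ := par_surjective hn t; exact ⟨q z, hf z⟩
  exact ⟨f.continuous.homeoOfEquivCompactToT2 (f := Equiv.ofBijective f hbij), hf⟩

end Poly

open SingularManifold.Poly

/-! ### The disc and the rectangle as polygons -/

theorem continuous_polyPar {n : ℕ} {E : Type*} [TopologicalSpace E]
    {q : (Fin n × Bool × I) × I → E}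
    (h : ∀ s k, Continuous fun z : I × I => q ((s, k, z.1), z.2)) : Continuous q := by
  have e : (fun y : Fin n × Bool × (I × I) => q ((y.1, y.2.1, y.2.2.1), y.2.2.2)) ∘
      (fun z : (Fin n × Bool × I) × I => (z.1.1, z.1.2.1, (z.1.2.2, z.2))) = q := rfl
  rw [← e]
  refine Continuous.comp ?_ (by fun_prop)
  exact continuous_prod_of_discrete_left.2 fun s => continuous_prod_of_discrete_left.2 fun k => h s k

/-- A point at the angle of a boundary point of a polygon. -/
def angle {n : ℕ} (a : Fin n × Bool × I) : ℝ := ((a.1.1 + (a.2.1.toNat + (a.2.2 : ℝ)) / 2) / n : ℝ)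

theorem angle_eq {n : ℕ} (a : Fin n × Bool × I) :
    angle a = (num a + (a.2.2 : ℝ)) / (2 * n) := by
  simp only [angle, num]
  push_cast
  rcases Nat.eq_zero_or_pos n with h | h
  · simp [h]
  · grind

/-- The point of the unit circle at a given angle, in turns. -/
def turn (θ : ℝ) : ℂ := Complex.exp (2 * Real.pi * Complex.I * (θ : ℂ))

theorem norm_turn (θ : ℝ) : ‖turn θ‖ = 1 := by
  rw [turn, show (2 * Real.pi * Complex.I * (θ : ℂ) : ℂ) = ((2 * Real.pi * θ : ℝ) : ℂ) * Complex.I by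
    push_cast; ring]
  exact Complex.norm_exp_ofReal_mul_I _

theorem turn_eq_iff {a b : ℝ} : turn a = turn b ↔ ∃ m : ℤ, a = b + m := by
  rw [turn, turn, Complex.exp_eq_exp_iff_exists_int]
  refine exists_congr fun m => ?_
  have h2 : (2 * Real.pi * Complex.I : ℂ) ≠ 0 := by simp
  rw [show (2 * Real.pi * Complex.I * (b : ℂ) + m * (2 * Real.pi * Complex.I) : ℂ) =
    2 * Real.pi * Complex.I * (b + m) by ring, mul_right_inj' h2]
  exact_mod_cast Iff.rfl

theorem continuous_turn : Continuous turn := by unfold turn; fun_prop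

theorem exists_turn (z : ℂ) : ∃ θ : ℝ, 0 ≤ θ ∧ θ < 1 ∧ z = ‖z‖ * turn θ := by
  refine ⟨Int.fract (z.arg / (2 * Real.pi)), Int.fract_nonneg _, Int.fract_lt_one _, ?_⟩
  have : turn (Int.fract (z.arg / (2 * Real.pi))) = turn (z.arg / (2 * Real.pi)) :=
    turn_eq_iff.2 ⟨-⌊z.arg / (2 * Real.pi)⌋, by rw [Int.fract]; push_cast; ring⟩
  rw [this, turn, show (2 * Real.pi * Complex.I * ((z.arg / (2 * Real.pi) : ℝ) : ℂ) : ℂ) =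
    z.arg * Complex.I by
      push_cast
      have : (Real.pi : ℂ) ≠ 0 := by simp
      field_simp]
  exact (Complex.norm_mul_exp_arg_mul_I z).symm

/-- `x = N + y` with a natural number `N < M` and `y ∈ [0, 1]`. -/
theorem exists_nat_add {M : ℕ} (hM : 0 < M) {x : ℝ} (h0 : 0 ≤ x) (h1 : x ≤ M) :
    ∃ N < M, ∃ y : I, x = N + (y : ℝ) := by
  rcases h1.eq_or_lt with h1 | h1
  · refine ⟨M - 1, by omega, 1, ?_⟩
    rw [h1, Nat.cast_sub (by omega)]
    simp
  · refine ⟨⌊x⌋₊, (Nat.floor_lt h0).2 h1, ⟨x - ⌊x⌋₊, ?_, ?_⟩, by simp⟩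
    · linarith [Nat.floor_le h0]
    · linarith [Nat.lt_floor_add_one x]

theorem nat_add_eq {N M : ℕ} {x y : I} (h : (N : ℝ) + x = M + y) :
    (N = M ∧ x = y) ∨ (M = N + 1 ∧ (x : ℝ) = 1 ∧ (y : ℝ) = 0) ∨
      (N = M + 1 ∧ (y : ℝ) = 1 ∧ (x : ℝ) = 0) := by
  have hx0 := x.2.1
  have hx1 := x.2.2
  have hy0 := y.2.1
  have hy1 := y.2.2
  rcases lt_trichotomy N M with h1 | h1 | h1
  · right; left
    have h2 : (N : ℝ) + 1 ≤ M := by exact_mod_cast h1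
    have h3 : (M : ℝ) = N + 1 := by linarith
    exact ⟨by exact_mod_cast h3, by linarith, by linarith⟩
  · grind
  · right; right
    have h2 : (M : ℝ) + 1 ≤ N := by exact_mod_cast h1
    have h3 : (N : ℝ) = M + 1 := by linarith
    exact ⟨by exact_mod_cast h3, by linarith, by linarith⟩

theorem turn_angle_eq_iff {n : ℕ} {a b : Fin n × Bool × I} :
    turn (angle a) = turn (angle b) ↔ a = b ∨ Adj a b ∨ Adj b a := by
  have hn : 0 < n := Nat.zero_lt_of_lt a.1.2
  have hn' : (0 : ℝ) < 2 * n := by positivity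
  have ha := num_lt a
  have hb := num_lt b
  have step : ∀ a b : Fin n × Bool × I, Adj a b → turn (angle a) = turn (angle b) := by
    rintro a b ⟨h1, h2, h3⟩
    have ha := num_lt a
    rw [turn_eq_iff, angle_eq, angle_eq, h1, h2, h3]
    rcases Nat.lt_or_ge (num a + 1) (2 * n) with h | h
    · refine ⟨0, ?_⟩; rw [Nat.mod_eq_of_lt h]; push_cast; ring
    · refine ⟨1, ?_⟩
      have : num a + 1 = 2 * n := by omega
      rw [this, Nat.mod_self]
      have : (num a : ℝ) + 1 = 2 * n := by exact_mod_cast this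
      rw [this]
      push_cast
      field_simp
      simp
  constructor
  · intro h
    obtain ⟨m, hm⟩ := turn_eq_iff.1 h
    rw [angle_eq, angle_eq] at hm
    have h1 : (num a : ℝ) + a.2.2 = num b + b.2.2 + m * (2 * n) := by grind
    have a0 := a.2.2.2.1
    have a1 := a.2.2.2.2
    have b0 := b.2.2.2.1
    have b1 := b.2.2.2.2
    have ha' : (num a : ℝ) + 1 ≤ 2 * n := by exact_mod_cast ha
    have hb' : (num b : ℝ) + 1 ≤ 2 * n := by exact_mod_cast hb
    have na : (0 : ℝ) ≤ num a := by positivity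
    have nb : (0 : ℝ) ≤ num b := by positivity
    have m1 : m ≤ 1 := by
      by_contra! H
      have : (2 : ℝ) ≤ m := by exact_mod_cast H
      nlinarith
    have m2 : -1 ≤ m := by
      by_contra! H
      have : (m : ℝ) ≤ -2 := by exact_mod_cast (by omega : m ≤ -2)
      nlinarith
    rcases (by omega : m = 0 ∨ m = 1 ∨ m = -1) with rfl | rfl | rfl
    · simp only [Int.cast_zero, zero_mul, add_zero] at h1
      rcases nat_add_eq h1 with ⟨h2, h3⟩ | ⟨h2, h3, h4⟩ | ⟨h2, h3, h4⟩
      · exact .inl (num_inj h2 h3)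
      · exact .inr (.inl ⟨h3, h4, by rw [Nat.mod_eq_of_lt (by omega), h2]⟩)
      · exact .inr (.inr ⟨h3, h4, by rw [Nat.mod_eq_of_lt (by omega), h2]⟩)
    · simp only [Int.cast_one, one_mul] at h1
      have e1 : (num a : ℝ) + 1 = 2 * n := by linarith
      have e1' : num a + 1 = 2 * n := by exact_mod_cast e1
      have e2 : (num b : ℝ) = 0 := by linarith
      exact .inr (.inl ⟨by linarith, by linarith, by rw [e1', Nat.mod_self]; exact_mod_cast e2⟩)
    · simp only [Int.cast_neg, Int.cast_one, neg_mul, one_mul] at h1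
      have e1 : (num b : ℝ) + 1 = 2 * n := by linarith
      have e1' : num b + 1 = 2 * n := by exact_mod_cast e1
      have e2 : (num a : ℝ) = 0 := by linarith
      exact .inr (.inr ⟨by linarith, by linarith, by rw [e1', Nat.mod_self]; exact_mod_cast e2⟩)
  · grind

/-- The parametrisation of the disc as a polygon. -/
def discPar {n : ℕ} (z : (Fin n × Bool × I) × I) : FinPresentation.Disc :=
  ⟨(z.2 : ℝ) * turn (angle z.1), by
    rw [mem_closedBall_zero_iff, norm_mul, norm_turn, mul_one, Complex.norm_real,
      Real.norm_of_nonneg z.2.2.1]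
    exact z.2.2.2⟩

theorem norm_discPar {n : ℕ} (z : (Fin n × Bool × I) × I) : ‖(discPar z : ℂ)‖ = z.2 := by
  rw [discPar, norm_mul, norm_turn, mul_one, Complex.norm_real, Real.norm_of_nonneg z.2.2.1]

theorem discPar_surjective {n : ℕ} (hn : 0 < n) :
    Surjective (discPar : (Fin n × Bool × I) × I → FinPresentation.Disc) := by
  rintro ⟨z, hz⟩
  rw [mem_closedBall_zero_iff] at hz
  obtain ⟨θ, h0, h1, h2⟩ := exists_turn z
  obtain ⟨N, hN, y, hy⟩ := exists_nat_add (M := 2 * n) (by omega) (x := 2 * n * θ) (by positivity)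
    (by push_cast; nlinarith [show (0 : ℝ) < n by positivity])
  obtain ⟨a, ha, hax⟩ := exists_num hN y
  refine ⟨(a, ⟨‖z‖, norm_nonneg z, hz⟩), Subtype.ext ?_⟩
  have : angle a = θ := by
    rw [angle_eq, ha, hax, ← hy]
    have : (n : ℝ) ≠ 0 := by positivity
    field_simp
  simp only [discPar, this]
  exact h2.symm

theorem exists_discHomeo {n : ℕ} (hn : 0 < n) :
    ∃ h : FinPresentation.Disc ≃ₜ OC (Poly n), ∀ z, h (discPar z) = par z := by
  refine exists_homeomorph discPar hn ?_ (discPar_surjective hn) fun z w => ?_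
  · refine continuous_polyPar fun s k => Continuous.subtype_mk (Continuous.mul (by fun_prop) ?_) _
    refine continuous_turn.comp ?_
    simp only [angle]
    fun_prop
  · rw [← turn_angle_eq_iff]
    constructor
    · intro h
      have h1 : (z.2 : ℝ) = w.2 := by rw [← norm_discPar z, h, norm_discPar]
      refine ⟨Subtype.ext h1, or_iff_not_imp_left.2 fun h0 => ?_⟩
      have h2 := congrArg Subtype.val h
      simp only [discPar, ← h1] at h2
      exact mul_left_cancel₀ (by exact_mod_cast h0) h2
    · rintro ⟨h1, h2⟩
      refine Subtype.ext ?_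
      simp only [discPar, ← h1]
      rcases h2 with h2 | h2
      · simp [h2]
      · rw [h2]

/-- The disc as a polygon. -/
def discHomeo {n : ℕ} (hn : 0 < n) : FinPresentation.Disc ≃ₜ OC (Poly n) :=
  (exists_discHomeo hn).choose

theorem discHomeo_par {n : ℕ} (hn : 0 < n) (z : (Fin n × Bool × I) × I) :
    discHomeo hn (discPar z) = par z := (exists_discHomeo hn).choose_spec z

theorem discHomeo_tp {n : ℕ} (hn : 0 < n) (z : FinPresentation.Disc) :
    discHomeo hn z tp = 1 - ‖(z : ℂ)‖ := by
  obtain ⟨a, rfl⟩ := discPar_surjective hn z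
  rw [discHomeo_par, par_tp, norm_discPar]

theorem par_one {n : ℕ} (a : Fin n × Bool × I) : par (a, 1) = bdry a :=
  Subtype.ext (funext fun p => by simp [par_apply])

theorem discHomeo_boundary {n : ℕ} (hn : 0 < n) (a : Fin n × Bool × I)
    (z : FinPresentation.Disc) (hz : (z : ℂ) = turn (angle a)) : discHomeo hn z = bdry a := by
  rw [← par_one, ← discHomeo_par hn]
  congr 1
  refine Subtype.ext ?_
  simp [discPar, hz]

/-- The rectangle with `d` legs. -/
abbrev RectOf (d : ℕ) : Type := Set.Icc ((0, 0) : ℝ × ℝ) (2 * (d : ℝ) + 1, 1)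

/-- The number of an edge of the rectangle, from the left end of the lower side. -/
def rnum {d : ℕ} (a : Fin (d + 1) × Bool × I) : ℕ := (num a + 1) % (2 * (d + 1))

/-- A boundary point of the rectangle. -/
def rbd {d : ℕ} (a : Fin (d + 1) × Bool × I) : ℝ × ℝ :=
  if rnum a < 2 * d + 1 then (rnum a + (a.2.2 : ℝ), 0)
  else ((2 * d + 1) * max 0 (min 1 (2 - 3 * (a.2.2 : ℝ))),
    min 1 (min (3 * (a.2.2 : ℝ)) (3 - 3 * (a.2.2 : ℝ))))

/-- The distance from the centre of the rectangle, normalised to `1` on the boundary. -/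
def rgauge (d : ℕ) (p : ℝ × ℝ) : ℝ := max |2 * p.1 / (2 * d + 1) - 1| |2 * p.2 - 1|

/-- Membership in the boundary of the rectangle. -/
def RBd (d : ℕ) (p : ℝ × ℝ) : Prop := (0 ≤ p.1 ∧ p.1 ≤ 2 * d + 1) ∧ (0 ≤ p.2 ∧ p.2 ≤ 1) ∧
  (p.1 = 0 ∨ p.1 = 2 * d + 1 ∨ p.2 = 0 ∨ p.2 = 1)

theorem width_pos (d : ℕ) : (0 : ℝ) < 2 * d + 1 := by positivity

theorem rgauge_le (d : ℕ) (p : ℝ × ℝ) (r : ℝ) : rgauge d p ≤ r ↔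
    (2 * p.1 ≤ (1 + r) * (2 * d + 1) ∧ (1 - r) * (2 * d + 1) ≤ 2 * p.1) ∧
      (2 * p.2 ≤ 1 + r ∧ 1 - r ≤ 2 * p.2) := by
  have h := width_pos d
  have e : 2 * p.1 / (2 * (d : ℝ) + 1) - 1 = (2 * p.1 - (2 * d + 1)) / (2 * d + 1) := by field_simp
  rw [rgauge, max_le_iff, abs_le, abs_le, e, le_div_iff₀ h, div_le_iff₀ h]
  constructor
  · grind
  · grind

theorem rbd_iff {d : ℕ} {p : ℝ × ℝ} : RBd d p ↔ rgauge d p = 1 := by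
  have h := width_pos d
  have e : 2 * p.1 / (2 * (d : ℝ) + 1) - 1 = (2 * p.1 - (2 * d + 1)) / (2 * d + 1) := by field_simp
  constructor
  · rintro ⟨h1, h2, h3⟩
    refine le_antisymm ((rgauge_le d p 1).2 ⟨⟨by linarith, by linarith⟩, by linarith, by linarith⟩) ?_
    rw [rgauge, le_max_iff, e]
    rcases h3 with h3 | h3 | h3 | h3
    · grind
    · grind
    · grind
    · grind
  · intro h1
    obtain ⟨⟨a1, a2⟩, a3, a4⟩ := (rgauge_le d p 1).1 h1.le
    refine ⟨⟨by linarith, by linarith⟩, ⟨by linarith, by linarith⟩, ?_⟩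
    rw [rgauge, e] at h1
    rcases max_choice |(2 * p.1 - (2 * d + 1)) / (2 * (d : ℝ) + 1)| |2 * p.2 - 1| with h2 | h2
    · grind
    · grind

theorem rbd_cases {d : ℕ} (a : Fin (d + 1) × Bool × I) :
    (rnum a < 2 * d + 1 ∧ (rbd a).1 = rnum a + (a.2.2 : ℝ) ∧ (rbd a).2 = 0) ∨
    (rnum a = 2 * d + 1 ∧
      (((a.2.2 : ℝ) ≤ 1 / 3 ∧ (rbd a).1 = 2 * d + 1 ∧ (rbd a).2 = 3 * a.2.2) ∨
       (1 / 3 ≤ (a.2.2 : ℝ) ∧ (a.2.2 : ℝ) ≤ 2 / 3 ∧ (rbd a).1 = (2 * d + 1) * (2 - 3 * a.2.2) ∧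
          (rbd a).2 = 1) ∨
       (2 / 3 ≤ (a.2.2 : ℝ) ∧ (rbd a).1 = 0 ∧ (rbd a).2 = 3 - 3 * a.2.2))) := by
  have h0 := a.2.2.2.1
  have h1 := a.2.2.2.2
  have hlt : rnum a < 2 * (d + 1) := Nat.mod_lt _ (by omega)
  by_cases h : rnum a < 2 * d + 1
  · exact .inl ⟨h, by simp [rbd, h], by simp [rbd, h]⟩
  · refine .inr ⟨by omega, ?_⟩
    simp only [rbd, h, if_false]
    rcases le_total (a.2.2 : ℝ) (1 / 3) with h2 | h2
    · grind
    · grind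

theorem rbd_mem {d : ℕ} (a : Fin (d + 1) × Bool × I) : RBd d (rbd a) := by
  have h0 := a.2.2.2.1
  have h1 := a.2.2.2.2
  have hw := width_pos d
  rcases rbd_cases a with ⟨h, e1, e2⟩ | ⟨h, ⟨h2, e1, e2⟩ | ⟨h2, h3, e1, e2⟩ | ⟨h2, e1, e2⟩⟩
  · have : (rnum a : ℝ) + 1 ≤ 2 * d + 1 := by exact_mod_cast h
    have : (0 : ℝ) ≤ rnum a := by positivity
    exact ⟨⟨by linarith, by linarith⟩, ⟨by linarith, by linarith⟩, by simp [e2]⟩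
  · exact ⟨⟨by linarith, by linarith⟩, ⟨by linarith, by linarith⟩, by simp [e1]⟩
  · exact ⟨⟨by rw [e1]; exact mul_nonneg hw.le (by linarith), by rw [e1]; nlinarith⟩,
      ⟨by linarith, by linarith⟩, by simp [e2]⟩
  · exact ⟨⟨by linarith, by linarith⟩, ⟨by linarith, by linarith⟩, by simp [e1]⟩

theorem rnum_inj {d : ℕ} {a b : Fin (d + 1) × Bool × I} (h : rnum a = rnum b) :
    num a = num b := by
  have ha := num_lt a
  have hb := num_lt b
  simp only [rnum] at h
  rcases Nat.lt_or_ge (num a + 1) (2 * (d + 1)) with h1 | h1 <;>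
    rcases Nat.lt_or_ge (num b + 1) (2 * (d + 1)) with h2 | h2
  · rw [Nat.mod_eq_of_lt h1, Nat.mod_eq_of_lt h2] at h; omega
  · rw [Nat.mod_eq_of_lt h1, show num b + 1 = 2 * (d + 1) by omega, Nat.mod_self] at h; omega
  · rw [Nat.mod_eq_of_lt h2, show num a + 1 = 2 * (d + 1) by omega, Nat.mod_self] at h; omega
  · omega

theorem adj_of_rnum {d : ℕ} {a b : Fin (d + 1) × Bool × I} (h1 : (a.2.2 : ℝ) = 1)
    (h2 : (b.2.2 : ℝ) = 0) (h : rnum b = (rnum a + 1) % (2 * (d + 1))) : Adj a b := by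
  refine ⟨h1, h2, ?_⟩
  have hb := num_lt b
  simp only [rnum, Nat.mod_add_mod] at h
  have : num b ≡ num a + 1 [MOD 2 * (d + 1)] := Nat.ModEq.add_right_cancel' 1 h
  rw [← Nat.mod_eq_of_lt hb]
  exact this

theorem rnum_of_adj {d : ℕ} {a b : Fin (d + 1) × Bool × I} (h : Adj a b) :
    rnum b = (rnum a + 1) % (2 * (d + 1)) := by
  simp only [rnum, h.2.2, Nat.mod_add_mod]

theorem exists_rnum {d N : ℕ} (h : N < 2 * (d + 1)) (x : I) :
    ∃ a : Fin (d + 1) × Bool × I, rnum a = N ∧ a.2.2 = x := by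
  obtain ⟨a, ha, hx⟩ := exists_num (n := d + 1) (N := (N + (2 * d + 1)) % (2 * (d + 1)))
    (Nat.mod_lt _ (by omega)) x
  refine ⟨a, ?_, hx⟩
  rw [rnum, ha, Nat.mod_add_mod, show N + (2 * d + 1) + 1 = N + 2 * (d + 1) by ring,
    Nat.add_mod_right, Nat.mod_eq_of_lt h]

theorem rbd_eq_iff {d : ℕ} {a b : Fin (d + 1) × Bool × I} :
    rbd a = rbd b ↔ a = b ∨ Adj a b ∨ Adj b a := by
  have hw := width_pos d
  have step : ∀ a b : Fin (d + 1) × Bool × I, Adj a b → rbd a = rbd b := by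
    intro a b h
    have hr := rnum_of_adj h
    have hlt : rnum a < 2 * (d + 1) := Nat.mod_lt _ (by omega)
    obtain ⟨h1, h2, -⟩ := h
    rcases Nat.lt_or_ge (rnum a + 1) (2 * (d + 1)) with h | h
    · rw [Nat.mod_eq_of_lt h] at hr
      rcases rbd_cases a with ⟨h', e1, e2⟩ | ⟨h', -⟩
      swap
      · omega
      rcases rbd_cases b with ⟨h'', f1, f2⟩ | ⟨h'', ⟨h3, f1, f2⟩ | ⟨h3, -⟩ | ⟨h3, -⟩⟩
      · exact Prod.ext (by rw [e1, f1, h1, h2, hr]; push_cast; ring) (by rw [e2, f2])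
      · refine Prod.ext ?_ (by rw [e2, f2, h2]; ring)
        rw [e1, f1, h1, show rnum a = 2 * d by omega]; push_cast; ring
      · linarith
      · linarith
    · have : rnum a = 2 * d + 1 := by omega
      rw [this, show 2 * d + 1 + 1 = 2 * (d + 1) by ring, Nat.mod_self] at hr
      rcases rbd_cases a with ⟨h', e1, e2⟩ | ⟨h', ⟨h3, -⟩ | ⟨-, h3, -⟩ | ⟨h3, e1, e2⟩⟩
      · omega
      · linarith
      · linarith
      rcases rbd_cases b with ⟨h'', f1, f2⟩ | ⟨h'', -⟩
      · exact Prod.ext (by rw [e1, f1, h2, hr]; simp) (by rw [e2, f2, h1]; ring)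
      · omega
  have key : ∀ a b : Fin (d + 1) × Bool × I, rnum a < 2 * d + 1 → rnum b = 2 * d + 1 →
      rbd a = rbd b → Adj a b ∨ Adj b a := by
    intro a b h1 h2 h
    have p1 := congrArg Prod.fst h
    have p2 := congrArg Prod.snd h
    have a0 := a.2.2.2.1
    have a1 := a.2.2.2.2
    have b0 := b.2.2.2.1
    have b1 := b.2.2.2.2
    rcases rbd_cases a with ⟨-, e1, e2⟩ | ⟨h', -⟩
    swap
    · omega
    have hle : (rnum a : ℝ) + 1 ≤ 2 * d + 1 := by exact_mod_cast h1
    have hge : (0 : ℝ) ≤ rnum a := by positivity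
    rcases rbd_cases b with ⟨h', -⟩ | ⟨-, ⟨h3, f1, f2⟩ | ⟨h3, h4, f1, f2⟩ | ⟨h3, f1, f2⟩⟩
    · omega
    · left
      have e3 : (rnum a : ℝ) + 1 = 2 * d + 1 := by linarith
      have e3' : rnum a + 1 = 2 * d + 1 := by exact_mod_cast e3
      exact adj_of_rnum (by linarith) (by linarith) (by rw [h2, e3', Nat.mod_eq_of_lt]; omega)
    · linarith
    · right
      have e3 : (rnum a : ℝ) = 0 := by linarith
      have e3' : rnum a = 0 := by exact_mod_cast e3
      exact adj_of_rnum (by linarith) (by linarith) (by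
        rw [h2, e3', show 2 * d + 1 + 1 = 2 * (d + 1) by ring, Nat.mod_self])
  constructor
  · intro h
    have p1 := congrArg Prod.fst h
    have p2 := congrArg Prod.snd h
    have a0 := a.2.2.2.1
    have a1 := a.2.2.2.2
    have b0 := b.2.2.2.1
    have b1 := b.2.2.2.2
    rcases rbd_cases a with ⟨h1, e1, e2⟩ | ⟨h1, h1'⟩ <;>
      rcases rbd_cases b with ⟨h2, f1, f2⟩ | ⟨h2, h2'⟩
    · rw [e1, f1] at p1
      rcases nat_add_eq p1 with ⟨h3, h4⟩ | ⟨h3, h4, h5⟩ | ⟨h3, h4, h5⟩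
      · exact .inl (num_inj (rnum_inj h3) h4)
      · exact .inr (.inl (adj_of_rnum h4 h5 (by rw [Nat.mod_eq_of_lt (by omega), h3])))
      · exact .inr (.inr (adj_of_rnum h4 h5 (by rw [Nat.mod_eq_of_lt (by omega), h3])))
    · grind
    · grind
    · refine .inl (num_inj (rnum_inj (h1.trans h2.symm)) (Subtype.ext ?_))
      rcases h1' with ⟨h3, e1, e2⟩ | ⟨h3, h4, e1, e2⟩ | ⟨h3, e1, e2⟩ <;>
        rcases h2' with ⟨h5, f1, f2⟩ | ⟨h5, h6, f1, f2⟩ | ⟨h5, f1, f2⟩ <;>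
        rw [e1, f1] at p1 <;> rw [e2, f2] at p2
      · linarith
      · nlinarith
      · linarith
      · nlinarith
      · nlinarith [mul_left_cancel₀ hw.ne' p1]
      · nlinarith
      · linarith
      · nlinarith
      · linarith
  · grind

theorem exists_rbd {d : ℕ} {p : ℝ × ℝ} (hp : RBd d p) :
    ∃ a : Fin (d + 1) × Bool × I, rbd a = p := by
  have hw := width_pos d
  obtain ⟨⟨x0, x1⟩, ⟨y0, y1⟩, h⟩ := hp
  by_cases hy : p.2 = 0
  · obtain ⟨N, hN, y, hxy⟩ := exists_nat_add (M := 2 * d + 1) (by omega) x0 (by push_cast; linarith)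
    obtain ⟨a, ha, hx⟩ := exists_rnum (d := d) (N := N) (by omega) y
    refine ⟨a, ?_⟩
    rcases rbd_cases a with ⟨-, e1, e2⟩ | ⟨h', -⟩
    · grind
    · omega
  · have mk : ∀ (y : ℝ) (h0 : 0 ≤ y) (h1 : y ≤ 1),
        ((2 * d + 1) * max 0 (min 1 (2 - 3 * y)), min 1 (min (3 * y) (3 - 3 * y))) = p →
        ∃ a : Fin (d + 1) × Bool × I, rbd a = p := by
      intro y h0 h1 hp
      obtain ⟨a, ha, hx⟩ := exists_rnum (d := d) (N := 2 * d + 1) (by omega) ⟨y, h0, h1⟩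
      refine ⟨a, ?_⟩
      rw [← hp, rbd, if_neg (by omega), hx]
    rcases h with h | h | h | h
    · refine mk (1 - p.2 / 3) (by linarith) (by linarith) (Prod.ext ?_ ?_)
      · grind
      · grind
    · refine mk (p.2 / 3) (by linarith) (by linarith) (Prod.ext ?_ ?_)
      · grind
      · grind
    · grind
    · have h1 : p.1 / (2 * d + 1) ≤ 1 := (div_le_one hw).2 x1
      have h2 : 0 ≤ p.1 / (2 * d + 1) := div_nonneg x0 hw.le
      refine mk ((2 - p.1 / (2 * d + 1)) / 3) (by linarith) (by linarith) (Prod.ext ?_ ?_)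
      · simp only
        rw [min_eq_right (by linarith), max_eq_right (by linarith)]
        field_simp
        ring
      · grind

/-- The parametrisation of the rectangle as a polygon, before restriction of the codomain. -/
def rectParFun {d : ℕ} (z : (Fin (d + 1) × Bool × I) × I) : ℝ × ℝ :=
  ((2 * d + 1) / 2 + z.2 * ((rbd z.1).1 - (2 * d + 1) / 2), 1 / 2 + z.2 * ((rbd z.1).2 - 1 / 2))

theorem rgauge_rectParFun {d : ℕ} (z : (Fin (d + 1) × Bool × I) × I) :
    rgauge d (rectParFun z) = z.2 := by
  have hw := width_pos d
  have h := rbd_iff.1 (rbd_mem z.1)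
  rw [← mul_one (z.2 : ℝ), ← h, rgauge, rgauge, mul_max_of_nonneg _ _ z.2.2.1,
    ← abs_of_nonneg z.2.2.1, ← abs_mul, ← abs_mul]
  congr 2
  · simp only [rectParFun]; field_simp; ring
  · simp only [rectParFun]; ring

/-- The parametrisation of the rectangle as a polygon. -/
def rectPar {d : ℕ} (z : (Fin (d + 1) × Bool × I) × I) : RectOf d := ⟨rectParFun z, by
  have hw := width_pos d
  have h := (rgauge_le d _ 1).1 ((rgauge_rectParFun z).le.trans z.2.2.2)
  constructor <;> constructor <;> simp only <;> linarith [h.1.1, h.1.2, h.2.1, h.2.2]⟩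

theorem rectPar_surjective {d : ℕ} : Surjective (rectPar (d := d)) := by
  have hw := width_pos d
  intro p
  have hp0 := p.2.1
  have hp1 := p.2.2
  have hg : rgauge d p.1 ≤ 1 := (rgauge_le d _ 1).2
    ⟨⟨by linarith [hp1.1], by linarith [hp0.1]⟩, by linarith [hp1.2], by linarith [hp0.2]⟩
  have hg0 : 0 ≤ rgauge d p.1 := le_max_of_le_left (abs_nonneg _)
  rcases hg0.eq_or_lt with h | h
  · refine ⟨((0, false, 0), 0), Subtype.ext ?_⟩
    have := (rgauge_le d p.1 0).1 h.ge
    refine Prod.ext ?_ ?_ <;> simp only [rectPar, rectParFun, Set.Icc.coe_zero, zero_mul, add_zero]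
      <;> linarith [this.1.1, this.1.2, this.2.1, this.2.2]
  · set r := rgauge d p.1 with hr
    obtain ⟨a, ha⟩ : ∃ a : Fin (d + 1) × Bool × I, rbd a =
        ((2 * d + 1) / 2 + (p.1.1 - (2 * d + 1) / 2) / r, 1 / 2 + (p.1.2 - 1 / 2) / r) := by
      refine exists_rbd (rbd_iff.2 ?_)
      rw [← mul_right_inj' h.ne', mul_one]
      conv_rhs => rw [hr]
      rw [rgauge, rgauge, mul_max_of_nonneg _ _ hg0, ← abs_of_nonneg hg0, ← abs_mul, ← abs_mul,
        abs_of_nonneg hg0]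
      congr 2
      · grind
      · grind
    refine ⟨(a, ⟨r, hg0, hg⟩), Subtype.ext (Prod.ext ?_ ?_)⟩
    · simp only [rectPar, rectParFun, ha]; field_simp; ring
    · simp only [rectPar, rectParFun, ha]; field_simp; ring

theorem exists_rectHomeo (d : ℕ) :
    ∃ h : RectOf d ≃ₜ OC (Poly (d + 1)), ∀ z, h (rectPar z) = par z := by
  refine exists_homeomorph rectPar (Nat.succ_pos d) ?_ rectPar_surjective fun z w => ?_
  · refine continuous_polyPar fun s k => Continuous.subtype_mk ?_ _
    simp only [rectParFun, rbd]
    have e : ∀ z : I × I, rnum ((s, k, z.1) : Fin (d + 1) × Bool × I) = rnum (s, k, (0 : I)) :=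
      fun _ => rfl
    simp only [e]
    split_ifs <;> fun_prop
  · rw [← rbd_eq_iff]
    constructor
    · intro h
      have h' := congrArg Subtype.val h
      have h1 : (z.2 : ℝ) = w.2 := by
        rw [← rgauge_rectParFun z, ← rgauge_rectParFun w]; exact congrArg _ h'
      refine ⟨Subtype.ext h1, or_iff_not_imp_left.2 fun h0 => ?_⟩
      have p1 := congrArg Prod.fst h'
      have p2 := congrArg Prod.snd h'
      simp only [rectPar, rectParFun, ← h1] at p1 p2
      exact Prod.ext (by linarith [mul_left_cancel₀ h0 (add_left_cancel p1)])
        (by linarith [mul_left_cancel₀ h0 (add_left_cancel p2)])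
    · rintro ⟨h1, h2⟩
      refine Subtype.ext ?_
      simp only [rectPar, rectParFun, ← h1]
      rcases h2 with h2 | h2
      · simp [h2]
      · rw [h2]

/-- The rectangle as a polygon. -/
def rectHomeo (d : ℕ) : RectOf d ≃ₜ OC (Poly (d + 1)) := (exists_rectHomeo d).choose

theorem rectHomeo_par {d : ℕ} (z : (Fin (d + 1) × Bool × I) × I) :
    rectHomeo d (rectPar z) = par z := (exists_rectHomeo d).choose_spec z

theorem rectHomeo_boundary {d : ℕ} {p : RectOf d} {a : Fin (d + 1) × Bool × I} (h : p.1 = rbd a) :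
    rectHomeo d p = bdry a := by
  rw [← par_one, ← rectHomeo_par]
  congr 1
  refine Subtype.ext (Prod.ext ?_ ?_) <;> simp [rectPar, rectParFun, h]

theorem rnum_leg {d : ℕ} {s : Fin (d + 1)} (x : I) (hs : s.1 < d) :
    rnum (s, false, x) = 2 * s.1 + 1 := by
  simp only [rnum, num, Bool.toNat_false, add_zero]
  rw [Nat.mod_eq_of_lt]; omega

theorem rectHomeo_leg {d : ℕ} {p : RectOf d} (s : Fin (d + 1)) (x : I) (hs : s.1 < d)
    (hp : p.1 = (2 * (s.1 : ℝ) + 1 + x, 0)) : rectHomeo d p = bdry (s, false, x) := by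
  refine rectHomeo_boundary ?_
  rw [hp, rbd, rnum_leg x hs, if_pos (by omega)]
  push_cast
  rfl

theorem rectHomeo_boundary_iff {d : ℕ} (p : RectOf d) :
    (rectHomeo d p tp = 0 ∧ ∀ s : Fin (d + 1), s.1 < d → rectHomeo d p (lg s) = 0) ↔
      (p.1.1 = 0 ∨ p.1.1 = 2 * (d : ℝ) + 1 ∨ p.1.2 = 1 ∨ (p.1.2 = 0 ∧
        ∀ q : ℕ, q < d → ¬ (2 * (q : ℝ) + 1 < p.1.1 ∧ p.1.1 < 2 * q + 2))) := by
  have hw := width_pos d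
  constructor
  · rintro ⟨h1, h2⟩
    obtain ⟨⟨a, r⟩, rfl⟩ := rectPar_surjective p
    rw [rectHomeo_par, par_tp] at h1
    have hr : r = 1 := Subtype.ext (by simp only [Set.Icc.coe_one]; linarith)
    subst hr
    have e : (rectPar (a, 1)).1 = rbd a := by refine Prod.ext ?_ ?_ <;> simp [rectPar, rectParFun]
    rw [e]
    simp only [rectHomeo_par, par_one] at h2
    rcases rbd_cases a with ⟨h, e1, e2⟩ | ⟨h, ⟨h3, e1, e2⟩ | ⟨h3, h4, e1, e2⟩ | ⟨h3, e1, e2⟩⟩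
    · right; right; right
      refine ⟨e2, fun q hq H => ?_⟩
      rw [e1] at H
      have a0 := a.2.2.2.1
      have a1 := a.2.2.2.2
      have l1 : rnum a < 2 * q + 2 := by
        have : (rnum a : ℝ) < 2 * q + 2 := by grind
        exact_mod_cast this
      have l2 : 2 * q < rnum a := by
        have : (2 * q : ℝ) < rnum a := by grind
        exact_mod_cast this
      have l3 : rnum a = 2 * q + 1 := by omega
      have l3' : (rnum a : ℝ) = 2 * q + 1 := by simp_all
      have ha : a = (⟨q, by omega⟩, false, a.2.2) := num_inj (rnum_inj (by rw [l3, rnum_leg _ hq])) rfl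
      apply iota_md_ne (x := a.2.2)
      · intro h; rw [h, l3'] at H; simp at H
      · grind
      · rw [← h2 ⟨q, by omega⟩ hq, ha]
        exact (push_apply (edge_injective _ false) _ .md).symm
    · grind
    · grind
    · grind
  · intro h
    have hb : RBd d p.1 := ⟨⟨p.2.1.1, p.2.2.1⟩, ⟨p.2.1.2, p.2.2.2⟩, by tauto⟩
    obtain ⟨a, ha⟩ := exists_rbd hb
    rw [rectHomeo_boundary ha.symm]
    refine ⟨bdry_tp a, fun s hs => ?_⟩
    by_contra H
    obtain ⟨τ, hτ⟩ := exists_edge_of_bdry_ne H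
    obtain ⟨s', k, x⟩ := a
    have h1 : (s = s' ∧ false = k) := edge_md_inj (τ := τ) hτ.symm
    obtain ⟨rfl, rfl⟩ := h1
    have hx0 : x ≠ 0 := by
      rintro rfl
      apply H
      rw [bdry_of_zero rfl]
      simp [OC.vtx_apply, edge]
    have hx1 : x ≠ 1 := by
      rintro rfl
      apply H
      rw [bdry_of_one rfl]
      simp [OC.vtx_apply, edge]
    have x0 : 0 < (x : ℝ) := lt_of_le_of_ne x.2.1 fun h => hx0 (Subtype.ext h.symm)
    have x1 : (x : ℝ) < 1 := lt_of_le_of_ne x.2.2 fun h => hx1 (Subtype.ext h)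
    rw [← ha, rbd, rnum_leg x hs, if_pos (by omega)] at h
    push_cast at h
    have hs' : (s.1 : ℝ) + 1 ≤ d := by exact_mod_cast hs
    have hs0 : (0 : ℝ) ≤ s.1 := by positivity
    rcases h with h | h | h | ⟨-, h⟩
    · linarith
    · linarith
    · simp at h
    · grind

namespace FinPresentation

variable {P : FinPresentation}

/-! ### Numbering of the occurrences -/

theorem precedes_total (o o' : P.Occ) : Precedes o o' ∨ o = o' ∨ Precedes o' o := by
  obtain ⟨j, m⟩ := o
  obtain ⟨j', m'⟩ := o'
  simp only [Precedes]
  rcases lt_trichotomy j j' with h | h | h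
  · grind
  · subst h
    rcases lt_trichotomy m.1 m'.1 with h | h | h
    · grind
    · grind
    · grind
  · grind

theorem precedes_trans {a b c : P.Occ} (h1 : Precedes a b) (h2 : Precedes b c) : Precedes a c := by
  rcases h1 with h1 | ⟨h1, h1'⟩ <;> rcases h2 with h2 | ⟨h2, h2'⟩
  · exact .inl (h1.trans h2)
  · exact .inl (h2 ▸ h1)
  · exact .inl (h1 ▸ h2)
  · exact .inr ⟨h1.trans h2, h1'.trans h2'⟩

theorem precedes_irrefl (a : P.Occ) : ¬ Precedes a a := by
  rintro (h | h)
  · grind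
  · grind

theorem index_lt_index {o o' : P.Occ} (hg : gen o = gen o') (h : Precedes o o') :
    index o < index o' := by
  classical
  apply Finset.card_lt_card
  rw [Finset.ssubset_iff_of_subset]
  · refine ⟨o, ?_, ?_⟩
    · grind
    · intro h'; exact precedes_irrefl _ (Finset.mem_filter.1 h').2.2
  · intro a ha
    simp only [Finset.mem_filter, Finset.mem_univ, true_and] at ha ⊢
    exact ⟨ha.1.trans hg, precedes_trans ha.2 h⟩

theorem index_inj {o o' : P.Occ} (hg : gen o = gen o') (h : index o = index o') : o = o' := by
  rcases precedes_total o o' with h' | h' | h'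
  · exact absurd h (index_lt_index hg h').ne
  · exact h'
  · exact absurd h (index_lt_index hg.symm h').ne'

/-- The slot of an occurrence; the slot number `deg i` is a dummy. -/
def slot (o : P.Occ) : Fin (deg (gen o) + 1) := ⟨index o, (index_lt o).trans (Nat.lt_succ_self _)⟩

theorem slot_lt (o : P.Occ) : (slot o).1 < deg (gen o) := index_lt o

theorem slot_ne_last (o : P.Occ) : slot o ≠ Fin.last _ := fun h =>
  (slot_lt o).ne (congrArg Fin.val h)

theorem slot_inj {o o' : P.Occ}
    (h : (⟨gen o, slot o⟩ : Σ i : Fin P.n, Fin (deg i + 1)) = ⟨gen o', slot o'⟩) : o = o' := by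
  refine index_inj (congrArg Sigma.fst h) ?_
  exact congrArg (fun x : Σ i : Fin P.n, Fin (deg i + 1) => x.2.1) h

theorem exists_index {i : Fin P.n} {p : ℕ} (hp : p < deg i) : ∃ o : P.Occ, gen o = i ∧ index o = p := by
  classical
  let f : {o : P.Occ // gen o = i} → Fin (deg i) := fun o => ⟨index o.1, by
    have := index_lt o.1; rwa [o.2] at this⟩
  have hf : Injective f := fun o o' h =>
    Subtype.ext (index_inj (o.2.trans o'.2.symm) (congrArg Fin.val h))
  have hc : Fintype.card {o : P.Occ // gen o = i} = Fintype.card (Fin (deg i)) := by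
    rw [Fintype.card_fin, Fintype.card_subtype, deg]
  obtain ⟨o, ho⟩ := ((Fintype.bijective_iff_injective_and_card f).2 ⟨hf, hc⟩).2 ⟨p, hp⟩
  exact ⟨o.1, o.2, congrArg Fin.val ho⟩

theorem slot_cases {i : Fin P.n} (s : Fin (deg i + 1)) : s = Fin.last _ ∨
    ∃ o : P.Occ, (⟨i, s⟩ : Σ i : Fin P.n, Fin (deg i + 1)) = ⟨gen o, slot o⟩ := by
  rcases Nat.lt_or_ge s.1 (deg i) with h | h
  · right; obtain ⟨o, rfl, ho⟩ := exists_index h; exact ⟨o, by congr; exact Fin.ext ho.symm⟩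
  · grind

theorem next_injective : Injective (next : P.Occ → P.Occ) := by
  rintro ⟨j, m⟩ ⟨j', m'⟩ h
  have h1 : j = j' := congrArg Sigma.fst h
  subst h1
  simp only [next, Sigma.mk.injEq, heq_eq_eq, true_and] at h
  rw [cyc_injective (show cyc m = cyc m' from h)]

theorem next_surjective : Surjective (next : P.Occ → P.Occ) :=
  Finite.surjective_of_injective next_injective

/-- The end of a leg that is at the coordinate `u` of a ribbon. -/
def side (o : P.Occ) (u : Bool) : Bool := if sgn o then u else !u

/-- The leg of an occurrence, parametrised as in `leg`. -/
def legAt (o : P.Occ) : IF → Poly (deg (gen o) + 1)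
  | .en u => vt (slot o) (side o u)
  | .md => lg (slot o)

theorem side_inj {o : P.Occ} {u v : Bool} : side o u = side o v ↔ u = v := by
  simp only [side]; split_ifs <;> simp

@[simp] theorem side_side {o : P.Occ} {u : Bool} : side o (side o u) = u := by
  simp only [side]; split_ifs <;> simp

theorem monotone_legAt (o : P.Occ) : Monotone (legAt o) := by
  rintro a b (rfl | rfl)
  · exact le_rfl
  · rcases a with _ | _ <;> simp [legAt]

theorem legAt_injective (o : P.Occ) : Injective (legAt o) := by
  intro a b h
  rcases a with _ | _ <;> rcases b with _ | _ <;> simp_all [legAt, side_inj]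

theorem le_legAt {o : P.Occ} {a : Poly (deg (gen o) + 1)} {υ : IF} :
    a ≤ legAt o υ ↔ ∃ υ' ≤ υ, a = legAt o υ' := by
  constructor
  · intro h
    rcases υ with u | _
    · exact ⟨_, le_rfl, by simpa [legAt] using h⟩
    · rcases a with ⟨s, b⟩ | s | s | _ <;> simp [legAt] at h
      · subst h; exact ⟨.en (side o b), by simp, by simp [legAt]⟩
      · subst h; exact ⟨.md, le_rfl, rfl⟩
  · rintro ⟨υ', h, rfl⟩; exact monotone_legAt o h

theorem legAt_eq (o : P.Occ) (υ : IF) :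
    legAt o υ = edge (slot o) false (if sgn o then υ else υ.flip) := by
  rcases υ with u | _ <;> simp only [legAt, side] <;> split_ifs <;> rfl

variable (P)

/-! ### The cells of the singular 3-manifold -/

/-- The vertices of the boundary of the ribbon surface: slot, end of the leg, row. -/
abbrev BV : Type := Σ i : Fin P.n, Fin (deg i + 1) × Bool × Bool

/-- Two vertices are joined by an edge of the boundary of the ribbon surface. -/
inductive CapAdj : P.BV → P.BV → Prop
  | gap (i : Fin P.n) (s : Fin (deg i + 1)) (b : Bool) :
      CapAdj ⟨i, s, true, b⟩ ⟨i, cyc s, false, b⟩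
  | dummy (i : Fin P.n) (b : Bool) :
      CapAdj ⟨i, Fin.last _, false, b⟩ ⟨i, Fin.last _, true, b⟩
  | side (o : P.Occ) (u : Bool) :
      CapAdj ⟨gen o, slot o, side o u, sgn o⟩
        ⟨gen (next o), slot (next o), side (next o) u, !sgn (next o)⟩

/-- The boundary components of the ribbon surface. -/
def Caps : Type := Quot P.CapAdj

instance : Finite P.Caps := inferInstanceAs (Finite (Quot _))

/-- The cells of the singular 3-manifold. The cone on the closed ribbon surface is considered as
one cell `om`. -/
inductive Cell
  | hd (i : Fin P.n) (a : Poly (deg i + 1)) (τ : IF)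
  | rb (o : P.Occ) (υ : IF)
  | dc (j : Fin P.k) (υ : IF)
  | cp (c : P.Caps)
  | om

variable {P}

/-- The boundary component of a vertex. -/
def capV (v : P.BV) : P.Caps := Quot.mk _ v

theorem capV_eq {v w : P.BV} (h : P.CapAdj v w) : capV v = capV w := Quot.sound h

namespace Cell

instance : Finite P.Cell := by
  let f : P.Cell → (Σ i : Fin P.n, Poly (deg i + 1) × IF) ⊕ (P.Occ × IF) ⊕ (Fin P.k × IF) ⊕
    P.Caps ⊕ Unit := fun
    | hd i a τ => Sum.inl ⟨i, a, τ⟩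
    | rb o υ => Sum.inr (Sum.inl (o, υ))
    | dc j υ => Sum.inr (Sum.inr (Sum.inl (j, υ)))
    | cp c => Sum.inr (Sum.inr (Sum.inr (Sum.inl c)))
    | om => Sum.inr (Sum.inr (Sum.inr (Sum.inr ())))
  refine Finite.of_injective f ?_
  rintro (⟨i, a, τ⟩ | _ | _ | _ | _) (_ | _ | _ | _ | _) h <;> simp [f] at h ⊢ <;> try exact h
  obtain ⟨rfl, h⟩ := h
  simpa using eq_of_heq h

instance : Fintype P.Cell := Fintype.ofFinite _

/-- The boundary cells of the ribbon surface, with their boundary components. -/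
def Bd (p : P.Cell) (c : P.Caps) : Prop :=
  (∃ i s x b, p = hd i (vt s x) (.en b) ∧ c = capV ⟨i, s, x, b⟩) ∨
  (∃ i s b, p = hd i (gp s) (.en b) ∧ c = capV ⟨i, s, true, b⟩) ∨
  (∃ i b, p = hd i (lg (Fin.last _)) (.en b) ∧ c = capV ⟨i, Fin.last _, true, b⟩) ∨
  (∃ o u, p = rb o (.en u) ∧ c = capV ⟨gen o, slot o, side o u, sgn o⟩)

theorem Bd.unique {p : P.Cell} {c c' : P.Caps} (h : Bd p c) (h' : Bd p c') : c = c' := by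
  rcases h with ⟨i, s, x, b, rfl, rfl⟩ | ⟨i, s, b, rfl, rfl⟩ | ⟨i, b, rfl, rfl⟩ | ⟨o, u, rfl, rfl⟩ <;>
  rcases h' with ⟨i, s, x, b, h, rfl⟩ | ⟨i, s, b, h, rfl⟩ | ⟨i, b, h, rfl⟩ | ⟨o, u, h, rfl⟩ <;>
  cases h <;> rfl

/-- Incidence of cells. -/
def Le (p : P.Cell) : P.Cell → Prop
  | hd i a τ => ∃ a' ≤ a, ∃ τ' ≤ τ, p = hd i a' τ'
  | rb o υ => (∃ υ' ≤ υ, p = rb o υ') ∨ (∃ υ' ≤ υ, p = hd (gen o) (legAt o υ') (.en (sgn o))) ∨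
      (∃ υ' ≤ υ, p = hd (gen (next o)) (legAt (next o) υ') (.en !sgn (next o)))
  | dc j υ => (∃ υ' ≤ υ, p = dc j υ') ∨ (∃ o : P.Occ, o.1 = j ∧ ∃ υ' ≤ υ, p = rb o υ') ∨
      (∃ o : P.Occ, o.1 = j ∧ ∃ υ' ≤ υ, ∃ τ, p = hd (gen o) (legAt o υ') τ)
  | cp c => p = cp c ∨ Bd p c
  | om => p = om ∨ (∃ c, p = cp c) ∨ (∃ o υ, p = rb o υ) ∨ ∃ i a b, p = hd i a (.en b)

theorem Le.bd {p q : P.Cell} {c : P.Caps} (h : Le p q) (hq : Bd q c) : Bd p c := by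
  rcases hq with ⟨i, s, x, b, rfl, rfl⟩ | ⟨i, s, b, rfl, rfl⟩ | ⟨i, b, rfl, rfl⟩ | ⟨o, u, rfl, rfl⟩
  · obtain ⟨a, ha, τ, hτ, rfl⟩ := h
    simp only [le_vt, IF.le_en] at ha hτ
    subst ha hτ
    exact .inl ⟨i, s, x, b, rfl, rfl⟩
  · obtain ⟨a, ha, τ, hτ, rfl⟩ := h
    simp only [IF.le_en] at hτ
    subst hτ
    rcases a with ⟨t, x⟩ | t | t | _ <;> simp at ha
    · rcases ha with ⟨rfl, rfl⟩ | ⟨rfl, rfl⟩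
      · exact .inl ⟨i, _, _, b, rfl, rfl⟩
      · exact .inl ⟨i, _, _, b, rfl, capV_eq (.gap i s b)⟩
    · subst ha; exact .inr (.inl ⟨i, _, b, rfl, rfl⟩)
  · obtain ⟨a, ha, τ, hτ, rfl⟩ := h
    simp only [IF.le_en] at hτ
    subst hτ
    rcases a with ⟨t, x⟩ | t | t | _ <;> simp at ha
    · subst ha
      refine .inl ⟨i, _, x, b, rfl, ?_⟩
      rcases x
      · exact (capV_eq (.dummy i b)).symm
      · rfl
    · subst ha; exact .inr (.inr (.inl ⟨i, b, rfl, rfl⟩))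
  · rcases h with ⟨υ, hυ, rfl⟩ | ⟨υ, hυ, rfl⟩ | ⟨υ, hυ, rfl⟩ <;> simp only [IF.le_en] at hυ <;>
      subst hυ
    · exact .inr (.inr (.inr ⟨o, u, rfl, rfl⟩))
    · exact .inl ⟨_, _, _, _, rfl, rfl⟩
    · exact .inl ⟨_, _, _, _, rfl, capV_eq (.side o u)⟩

theorem Le.refl (p : P.Cell) : Le p p := by
  rcases p with ⟨i, a, τ⟩ | ⟨o, υ⟩ | ⟨j, υ⟩ | c | _
  · exact ⟨a, le_rfl, τ, le_rfl, rfl⟩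
  · exact .inl ⟨υ, le_rfl, rfl⟩
  · exact .inl ⟨υ, le_rfl, rfl⟩
  · exact .inl rfl
  · exact .inl rfl

theorem Bd.le_om {p : P.Cell} {c : P.Caps} (h : Bd p c) : Le p om := by
  rcases h with ⟨i, s, x, b, rfl, rfl⟩ | ⟨i, s, b, rfl, rfl⟩ | ⟨i, b, rfl, rfl⟩ | ⟨o, u, rfl, rfl⟩
  · exact .inr (.inr (.inr ⟨_, _, _, rfl⟩))
  · exact .inr (.inr (.inr ⟨_, _, _, rfl⟩))
  · exact .inr (.inr (.inr ⟨_, _, _, rfl⟩))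
  · exact .inr (.inr (.inl ⟨_, _, rfl⟩))

theorem Le.trans {p q r : P.Cell} (h1 : Le p q) (h2 : Le q r) : Le p r := by
  rcases r with ⟨i, a, τ⟩ | ⟨o, υ⟩ | ⟨j, υ⟩ | c | _
  · obtain ⟨a', ha, τ', hτ, rfl⟩ := h2
    obtain ⟨a'', ha', τ'', hτ', rfl⟩ := h1
    exact ⟨_, ha'.trans ha, _, hτ'.trans hτ, rfl⟩
  · rcases h2 with ⟨υ', hυ, rfl⟩ | ⟨υ', hυ, rfl⟩ | ⟨υ', hυ, rfl⟩
    · rcases h1 with ⟨υ'', h, rfl⟩ | ⟨υ'', h, rfl⟩ | ⟨υ'', h, rfl⟩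
      · exact .inl ⟨_, h.trans hυ, rfl⟩
      · exact .inr (.inl ⟨_, h.trans hυ, rfl⟩)
      · exact .inr (.inr ⟨_, h.trans hυ, rfl⟩)
    · obtain ⟨a, ha, τ, hτ, rfl⟩ := h1
      obtain ⟨υ'', h, rfl⟩ := le_legAt.1 ha
      rw [IF.le_en] at hτ
      exact .inr (.inl ⟨_, h.trans hυ, by rw [hτ]⟩)
    · obtain ⟨a, ha, τ, hτ, rfl⟩ := h1
      obtain ⟨υ'', h, rfl⟩ := le_legAt.1 ha
      rw [IF.le_en] at hτ
      exact .inr (.inr ⟨_, h.trans hυ, by rw [hτ]⟩)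
  · rcases h2 with ⟨υ', hυ, rfl⟩ | ⟨o, rfl, υ', hυ, rfl⟩ | ⟨o, rfl, υ', hυ, τ, rfl⟩
    · rcases h1 with ⟨υ'', h, rfl⟩ | ⟨o, rfl, υ'', h, rfl⟩ | ⟨o, rfl, υ'', h, τ, rfl⟩
      · exact .inl ⟨_, h.trans hυ, rfl⟩
      · exact .inr (.inl ⟨o, rfl, _, h.trans hυ, rfl⟩)
      · exact .inr (.inr ⟨o, rfl, _, h.trans hυ, _, rfl⟩)
    · rcases h1 with ⟨υ'', h, rfl⟩ | ⟨υ'', h, rfl⟩ | ⟨υ'', h, rfl⟩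
      · exact .inr (.inl ⟨o, rfl, _, h.trans hυ, rfl⟩)
      · exact .inr (.inr ⟨o, rfl, _, h.trans hυ, _, rfl⟩)
      · exact .inr (.inr ⟨next o, rfl, _, h.trans hυ, _, rfl⟩)
    · obtain ⟨a, ha, τ, hτ, rfl⟩ := h1
      obtain ⟨υ'', h, rfl⟩ := le_legAt.1 ha
      exact .inr (.inr ⟨o, rfl, _, h.trans hυ, _, rfl⟩)
  · rcases h2 with rfl | h2
    · exact h1
    · exact .inr (h1.bd h2)
  · rcases h2 with rfl | ⟨c, rfl⟩ | ⟨o, υ, rfl⟩ | ⟨i, a, b, rfl⟩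
    · exact h1
    · rcases h1 with rfl | h1
      · exact .inr (.inl ⟨_, rfl⟩)
      · exact h1.le_om
    · rcases h1 with ⟨υ', -, rfl⟩ | ⟨υ', -, rfl⟩ | ⟨υ', -, rfl⟩
      · exact .inr (.inr (.inl ⟨_, _, rfl⟩))
      · exact .inr (.inr (.inr ⟨_, _, _, rfl⟩))
      · exact .inr (.inr (.inr ⟨_, _, _, rfl⟩))
    · obtain ⟨a', -, τ', hτ, rfl⟩ := h1
      rw [IF.le_en] at hτ
      exact .inr (.inr (.inr ⟨_, _, b, by rw [hτ]⟩))

/-- The dimension of a face of the interval. -/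
def _root_.SingularManifold.IF.rank : IF → ℕ
  | .en _ => 0
  | .md => 1

/-- The dimension of a cell of a polygon. -/
def _root_.SingularManifold.Poly.rank {n : ℕ} : Poly n → ℕ
  | vt _ _ => 0
  | lg _ => 1
  | gp _ => 1
  | tp => 2

/-- The dimension of a cell. -/
def rank : P.Cell → ℕ
  | hd _ a τ => a.rank + τ.rank
  | rb _ υ => υ.rank + 1
  | dc _ υ => υ.rank + 2
  | cp _ => 2
  | om => 3

theorem _root_.SingularManifold.IF.rank_en (b : Bool) : (IF.en b).rank = 0 := rfl
theorem _root_.SingularManifold.IF.rank_md : IF.md.rank = 1 := rfl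

theorem _root_.SingularManifold.IF.rank_lt {a b : IF} (h : a ≤ b) : a = b ∨ a.rank < b.rank := by
  rcases h with rfl | rfl
  · simp
  · rcases a <;> simp [IF.rank]

theorem _root_.SingularManifold.Poly.rank_lt {n : ℕ} {a b : Poly n} (h : a ≤ b) :
    a = b ∨ a.rank < b.rank := by
  rcases h with _ | a | _ | _ | _
  · simp
  · rcases a <;> simp [Poly.rank]
  all_goals simp [Poly.rank]

theorem rank_legAt (o : P.Occ) (υ : IF) : (legAt o υ).rank = υ.rank := by rcases υ <;> rfl

theorem Le.rank_lt {p q : P.Cell} (h : Le p q) : p = q ∨ p.rank < q.rank := by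
  rcases q with ⟨i, a, τ⟩ | ⟨o, υ⟩ | ⟨j, υ⟩ | c | _
  · obtain ⟨a', ha, τ', hτ, rfl⟩ := h
    rcases Poly.rank_lt ha with rfl | h1 <;> rcases IF.rank_lt hτ with rfl | h2
    · simp
    all_goals simp only [rank]; right; omega
  · rcases h with ⟨υ', hυ, rfl⟩ | ⟨υ', hυ, rfl⟩ | ⟨υ', hυ, rfl⟩ <;>
      rcases IF.rank_lt hυ with rfl | h2 <;> simp [rank, rank_legAt, IF.rank_en] <;> omega
  · rcases h with ⟨υ', hυ, rfl⟩ | ⟨o, rfl, υ', hυ, rfl⟩ | ⟨o, rfl, υ', hυ, τ, rfl⟩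
    · rcases IF.rank_lt hυ with rfl | h2 <;> simp [rank] <;> omega
    · rcases IF.rank_lt hυ with rfl | h2 <;> simp [rank] <;> omega
    · rcases IF.rank_lt hυ with rfl | h2 <;> rcases τ <;> simp [rank, rank_legAt, IF.rank_en, IF.rank_md] <;> omega
  · rcases h with rfl | ⟨i, s, x, b, rfl, rfl⟩ | ⟨i, s, b, rfl, rfl⟩ | ⟨i, b, rfl, rfl⟩ |
      ⟨o, u, rfl, rfl⟩ <;> simp [rank, Poly.rank, IF.rank]
  · rcases h with rfl | ⟨c, rfl⟩ | ⟨o, υ, rfl⟩ | ⟨i, a, b, rfl⟩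
    · simp
    · simp [rank]
    · rcases υ <;> simp [rank, IF.rank]
    · rcases a <;> simp [rank, IF.rank, Poly.rank]

instance : PartialOrder P.Cell where
  le := Le
  le_refl := Le.refl
  le_trans _ _ _ := Le.trans
  le_antisymm p q h1 h2 := by
    rcases h1.rank_lt with h | h
    · exact h
    · rcases h2.rank_lt with h' | h'
      · exact h'.symm
      · omega

theorem rank_lt {p q : P.Cell} (h : p < q) : p.rank < q.rank := by
  rcases Le.rank_lt h.le with h' | h'
  · grind
  · exact h'

theorem le_hd {p : P.Cell} {i a τ} : p ≤ hd i a τ ↔ ∃ a' ≤ a, ∃ τ' ≤ τ, p = hd i a' τ' := Iff.rfl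
theorem le_rb {p : P.Cell} {o υ} : p ≤ rb o υ ↔ (∃ υ' ≤ υ, p = rb o υ') ∨
    (∃ υ' ≤ υ, p = hd (gen o) (legAt o υ') (.en (sgn o))) ∨
    (∃ υ' ≤ υ, p = hd (gen (next o)) (legAt (next o) υ') (.en !sgn (next o))) := Iff.rfl
theorem le_dc {p : P.Cell} {j υ} : p ≤ dc j υ ↔ (∃ υ' ≤ υ, p = dc j υ') ∨
    (∃ o : P.Occ, o.1 = j ∧ ∃ υ' ≤ υ, p = rb o υ') ∨
      (∃ o : P.Occ, o.1 = j ∧ ∃ υ' ≤ υ, ∃ τ, p = hd (gen o) (legAt o υ') τ) := Iff.rfl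
theorem le_cp {p : P.Cell} {c} : p ≤ cp c ↔ p = cp c ∨ Bd p c := Iff.rfl
theorem le_om {p : P.Cell} : p ≤ om ↔ p = om ∨ (∃ c, p = cp c) ∨ (∃ o υ, p = rb o υ) ∨
    ∃ i a b, p = hd i a (.en b) := Iff.rfl

theorem hd_le_hd {i : Fin P.n} {a a' τ τ'} :
    (hd i a τ : P.Cell) ≤ hd i a' τ' ↔ a ≤ a' ∧ τ ≤ τ' := by
  rw [le_hd]
  constructor
  · simp
  · simp

end Cell

end FinPresentation

open IF

theorem OC.mixV_inj {A : Type*} [Fintype A] [PartialOrder A] {z z' : OC A} {p : A} {h h'} {x x' : I}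
    (hz : z p = 0) (hz' : z' p = 0) (he : OC.mixV z p h x = OC.mixV z' p h' x') :
    x = x' ∧ (x = 1 ∨ z = z') := by
  have h1 : ∀ q, OC.mixV z p h x q = OC.mixV z' p h' x' q := fun q => by rw [he]
  have hx : x = x' := by
    have := h1 p
    simp only [OC.mixV_apply, hz, hz', mul_zero, zero_add, if_true] at this
    exact Subtype.ext this
  subst hx
  refine ⟨rfl, or_iff_not_imp_left.2 fun hx => Subtype.ext (funext fun q => ?_)⟩
  have := h1 q
  simp only [OC.mixV_apply, add_left_inj] at this
  exact mul_left_cancel₀ (sub_ne_zero.2 fun h => hx (Subtype.ext h.symm)) this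

theorem OC.continuous_prod' {A Y : Type*} [Fintype A] [PartialOrder A] [TopologicalSpace Y]
    {f : Y → OC A} {g : Y → I} (hf : Continuous f) (hg : Continuous g) :
    Continuous fun y => OC.prod (f y) (g y) :=
  OC.continuous_prod.comp (hf.prodMk hg)

theorem OC.map_ne {A B : Type*} [Fintype A] [PartialOrder A] [Fintype B] [PartialOrder B]
    {e : A → B} {he : Monotone e} {t : OC A} {b : B} (h : OC.map e he t b ≠ 0) :
    ∃ a, e a = b ∧ t a ≠ 0 :=
  exists_of_push_ne (e := e) (t := t.1) h

theorem OC.map_apply {A B : Type*} [Fintype A] [PartialOrder A] [Fintype B] [PartialOrder B]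
    {e : A → B} {he : Monotone e} (hi : Injective e) (t : OC A) (a : A) :
    OC.map e he t (e a) = t a :=
  push_apply hi t.1 a

namespace FinPresentation

open SingularManifold.Poly Cell

variable {P : FinPresentation}

/-! ### The pieces as subcomplexes -/

/-- The inclusion of a disc. -/
def discEmb (i : Fin P.n) (b : Bool) (a : Poly (deg i + 1)) : P.Cell := hd i a (.en b)

/-- The inclusion of a ribbon. -/
def ribEmb (o : P.Occ) : IF × IF → P.Cell
  | (υ, .md) => rb o υ
  | (υ, .en false) => hd (gen o) (legAt o υ) (.en (sgn o))
  | (υ, .en true) => hd (gen (next o)) (legAt (next o) υ) (.en !sgn (next o))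

/-- The inclusion of a 1-handle. -/
def hdEmb (i : Fin P.n) (a : Poly (deg i + 1) × IF) : P.Cell := hd i a.1 a.2

/-- The inclusion of a 2-handle. -/
def polyEmb (j : Fin P.k) : Poly (P.rel j).length × IF → P.Cell
  | (tp, υ) => dc j υ
  | (gp m, υ) => rb ⟨j, m⟩ υ
  | (lg m, υ) => hd (gen ⟨j, m⟩) (legAt ⟨j, m⟩ υ) .md
  | (vt m b, υ) => hd (gen ⟨j, m⟩) (legAt ⟨j, m⟩ υ) (.en (b == sgn ⟨j, m⟩))

theorem hd_legAt_inj {o o' : P.Occ} {υ υ' τ τ'} :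
    (hd (gen o) (legAt o υ) τ : P.Cell) = hd (gen o') (legAt o' υ') τ' ↔
      o = o' ∧ υ = υ' ∧ τ = τ' := by
  constructor
  · intro h
    have hs : (⟨gen o, slot o⟩ : Σ i : Fin P.n, Fin (deg i + 1)) = ⟨gen o', slot o'⟩ := by
      let f : P.Cell → Option (Σ i : Fin P.n, Fin (deg i + 1)) := fun
        | hd i (vt s _) _ => some ⟨i, s⟩
        | hd i (lg s) _ => some ⟨i, s⟩
        | _ => none
      have := congrArg f h
      rcases υ with u | _ <;> rcases υ' with u' | _ <;> exact Option.some.inj this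
    obtain rfl := slot_inj hs
    simp only [hd.injEq, heq_eq_eq, true_and] at h
    exact ⟨rfl, legAt_injective o h.1, h.2⟩
  · grind

theorem hd_legAt_le {o o' : P.Occ} {υ υ' τ τ'}
    (h : (hd (gen o) (legAt o υ) τ : P.Cell) ≤ hd (gen o') (legAt o' υ') τ') :
      o = o' ∧ υ ≤ υ' ∧ τ ≤ τ' := by
  obtain ⟨a, ha, τ'', hτ, h⟩ := le_hd.1 h
  obtain ⟨υ'', hυ, rfl⟩ := le_legAt.1 ha
  obtain ⟨h1, rfl, rfl⟩ := hd_legAt_inj.1 h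
  exact ⟨h1, hυ, hτ⟩

theorem hd_le_rb_iff {o o' : P.Occ} {υ υ' τ} :
    (hd (gen o) (legAt o υ) τ : P.Cell) ≤ rb o' υ' ↔
      υ ≤ υ' ∧ ((o = o' ∧ τ = .en (sgn o)) ∨ (o = next o' ∧ τ = .en !sgn o)) := by
  rw [le_rb]
  constructor
  · rintro (⟨υ'', -, h⟩ | ⟨υ'', hυ, h⟩ | ⟨υ'', hυ, h⟩)
    · cases h
    · obtain ⟨rfl, rfl, rfl⟩ := hd_legAt_inj.1 h; exact ⟨hυ, .inl ⟨rfl, rfl⟩⟩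
    · obtain ⟨rfl, rfl, rfl⟩ := hd_legAt_inj.1 h; exact ⟨hυ, .inr ⟨rfl, rfl⟩⟩
  · grind

theorem rb_le_rb {o o' : P.Occ} {υ υ'} : (rb o υ : P.Cell) ≤ rb o' υ' ↔ o = o' ∧ υ ≤ υ' := by
  rw [le_rb]
  constructor
  · grind
  · grind

theorem not_rb_le_hd {o : P.Occ} {υ i a τ} : ¬ (rb o υ : P.Cell) ≤ hd i a τ := by
  rw [le_hd]; rintro ⟨_, _, _, _, h⟩; cases h

theorem not_dc_le_hd {j υ i a τ} : ¬ (dc j υ : P.Cell) ≤ hd i a τ := by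
  rw [le_hd]; rintro ⟨_, _, _, _, h⟩; cases h

theorem not_dc_le_rb {o : P.Occ} {υ j υ'} : ¬ (dc j υ' : P.Cell) ≤ rb o υ := by
  rw [le_rb]; rintro (⟨_, _, h⟩ | ⟨_, _, h⟩ | ⟨_, _, h⟩) <;> cases h

theorem dc_le_dc {j j' : Fin P.k} {υ υ'} : (dc j υ : P.Cell) ≤ dc j' υ' ↔ j = j' ∧ υ ≤ υ' := by
  rw [le_dc]
  constructor
  · grind
  · grind

theorem rb_le_dc {o : P.Occ} {j : Fin P.k} {υ υ'} :
    (rb o υ : P.Cell) ≤ dc j υ' ↔ o.1 = j ∧ υ ≤ υ' := by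
  rw [le_dc]
  constructor
  · simp
  · simp

theorem hd_le_dc {o : P.Occ} {j : Fin P.k} {υ υ' τ} :
    (hd (gen o) (legAt o υ) τ : P.Cell) ≤ dc j υ' ↔ o.1 = j ∧ υ ≤ υ' := by
  rw [le_dc]
  constructor
  · rintro (⟨υ'', hυ, h⟩ | ⟨o, rfl, υ'', hυ, h⟩ | ⟨o, rfl, υ'', hυ, τ, h⟩)
    · cases h
    · cases h
    · obtain ⟨rfl, rfl, rfl⟩ := hd_legAt_inj.1 h; exact ⟨rfl, hυ⟩
  · grind

theorem monotone_discEmb (i : Fin P.n) (b : Bool) : Monotone (discEmb i b) := fun _ _ h =>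
  hd_le_hd.2 ⟨h, le_rfl⟩

theorem discEmb_reflect (i : Fin P.n) (b : Bool) (a a') (h : discEmb i b a ≤ discEmb i b a') :
    a ≤ a' := (hd_le_hd.1 h).1

theorem monotone_hdEmb (i : Fin P.n) : Monotone (hdEmb i) := fun _ _ h => hd_le_hd.2 h

theorem hdEmb_reflect (i : Fin P.n) (a a') (h : hdEmb i a ≤ hdEmb i a') : a ≤ a' := hd_le_hd.1 h

theorem hd_legAt_le_iff {o o' : P.Occ} {υ υ' τ τ'} :
    (hd (gen o) (legAt o υ) τ : P.Cell) ≤ hd (gen o') (legAt o' υ') τ' ↔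
      o = o' ∧ υ ≤ υ' ∧ τ ≤ τ' := by
  refine ⟨hd_legAt_le, ?_⟩
  rintro ⟨rfl, h, h'⟩
  exact hd_le_hd.2 ⟨monotone_legAt o h, h'⟩

theorem ribEmb_le_iff (o : P.Occ) (a a' : IF × IF) : ribEmb o a ≤ ribEmb o a' ↔ a ≤ a' := by
  obtain ⟨υ, τ⟩ := a
  obtain ⟨υ', τ'⟩ := a'
  rw [Prod.mk_le_mk]
  rcases τ with (_ | _) | _ <;> rcases τ' with (_ | _) | _ <;>
    simp only [ribEmb, hd_legAt_le_iff, hd_le_rb_iff, rb_le_rb, not_rb_le_hd]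
  · simp
  · simp only [le_en, en.injEq, reduceCtorEq, and_false, iff_false, not_and]
    intro h; rw [← h]; simp
  · simp
  · simp_all
  · simp
  · simp
  · simp
  · simp
  · simp

theorem next_mk (j : Fin P.k) (m) : next (⟨j, m⟩ : P.Occ) = ⟨j, cyc m⟩ := rfl

theorem polyEmb_le_iff (j : Fin P.k) (a a') : polyEmb j a ≤ polyEmb j a' ↔ a ≤ a' := by
  obtain ⟨a, υ⟩ := a
  obtain ⟨a', υ'⟩ := a'
  rw [Prod.mk_le_mk]
  rcases a with ⟨m, b⟩ | m | m | _ <;> rcases a' with ⟨m', b'⟩ | m' | m' | _ <;>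
    simp only [polyEmb, hd_legAt_le_iff, hd_le_rb_iff, rb_le_rb, not_rb_le_hd, rb_le_dc, hd_le_dc,
      dc_le_dc, not_dc_le_hd, not_dc_le_rb, next_mk, Sigma.mk.injEq, heq_eq_eq, true_and, le_vt,
      le_en, lg_le_lg, gp_le_gp, vt_le_lg, vt_le_gp, not_lg_le_gp, not_gp_le_lg, le_tp, tp_le,
      reduceCtorEq, false_and, le_md, and_true, en.injEq, vt.injEq, and_false]
  · constructor
    · rintro ⟨rfl, h, h'⟩; refine ⟨⟨rfl, ?_⟩, h⟩; revert h'; cases b <;> cases b' <;> simp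
    · grind
  · grind
  · simp

theorem monotone_ribEmb (o : P.Occ) : Monotone (ribEmb o) := fun _ _ => (ribEmb_le_iff o _ _).2

theorem monotone_polyEmb (j : Fin P.k) : Monotone (polyEmb j) := fun _ _ => (polyEmb_le_iff j _ _).2

theorem injective_of_le_iff {A B : Type*} [PartialOrder A] [PartialOrder B] {e : A → B}
    (h : ∀ a a', e a ≤ e a' → a ≤ a') : Injective e := fun _ _ he =>
  le_antisymm (h _ _ he.le) (h _ _ he.ge)

theorem le_rb_md {p : P.Cell} {o : P.Occ} : p ≤ rb o .md ↔ p ∈ Set.range (ribEmb o) := by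
  rw [le_rb]
  constructor
  · rintro (⟨υ, -, rfl⟩ | ⟨υ, -, rfl⟩ | ⟨υ, -, rfl⟩)
    · exact ⟨(υ, .md), rfl⟩
    · exact ⟨(υ, .en false), rfl⟩
    · exact ⟨(υ, .en true), rfl⟩
  · rintro ⟨⟨υ, (_ | _) | _⟩, rfl⟩
    · exact .inr (.inl ⟨υ, le_md _, rfl⟩)
    · exact .inr (.inr ⟨υ, le_md _, rfl⟩)
    · exact .inl ⟨υ, le_md _, rfl⟩

theorem le_dc_md {p : P.Cell} {j : Fin P.k} : p ≤ dc j .md ↔ p ∈ Set.range (polyEmb j) := by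
  rw [le_dc]
  constructor
  · rintro (⟨υ, -, rfl⟩ | ⟨⟨j, m⟩, rfl, υ, -, rfl⟩ | ⟨⟨j, m⟩, rfl, υ, -, τ, rfl⟩)
    · exact ⟨(tp, υ), rfl⟩
    · exact ⟨(gp m, υ), rfl⟩
    · rcases τ with b | _
      · refine ⟨(vt m (b == sgn ⟨j, m⟩), υ), ?_⟩
        have : ∀ b c : Bool, ((b == c) == c) = b := by decide
        simp only [polyEmb, this]
      · exact ⟨(lg m, υ), rfl⟩
  · rintro ⟨⟨⟨m, b⟩ | m | m | _, υ⟩, rfl⟩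
    · exact .inr (.inr ⟨_, rfl, υ, le_md _, _, rfl⟩)
    · exact .inr (.inr ⟨_, rfl, υ, le_md _, _, rfl⟩)
    · exact .inr (.inl ⟨_, rfl, υ, le_md _, rfl⟩)
    · exact .inl ⟨υ, le_md _, rfl⟩

theorem le_hd_top {p : P.Cell} {i : Fin P.n} : p ≤ hd i tp .md ↔ p ∈ Set.range (hdEmb i) := by
  rw [le_hd]
  constructor
  · rintro ⟨a, -, τ, -, rfl⟩; exact ⟨(a, τ), rfl⟩
  · rintro ⟨a, rfl⟩; exact ⟨_, le_tp _, _, le_md _, rfl⟩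

theorem le_disc {p : P.Cell} {i : Fin P.n} {b : Bool} :
    p ≤ hd i tp (.en b) ↔ p ∈ Set.range (discEmb i b) := by
  rw [le_hd]
  constructor
  · rintro ⟨a, -, τ, h, rfl⟩; exact ⟨a, by rw [le_en.1 h]; rfl⟩
  · rintro ⟨a, rfl⟩; exact ⟨_, le_tp _, _, le_rfl, rfl⟩

theorem rect_leg (o : P.Occ) (u : I) :
    rectHomeo (deg (gen o)) (leg o u) = OC.map (legAt o) (monotone_legAt o) (iota u) := by
  rw [rectHomeo_leg (slot o) (if sgn o then u else σ u) (slot_lt o)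
    (by simp only [leg, slot]; split_ifs <;> simp)]
  unfold bdry
  split_ifs with h
  · exact OC.map_congr (funext fun υ => by rw [legAt_eq, if_pos h]) _ _
  · dsimp only
    rw [iota_symm, OC.map_map]
    exact OC.map_congr (funext fun υ => by rw [legAt_eq, if_neg h]; rfl) _ _

/-! ### The ribbon surface as a complex -/

/-- The point of the complex given by a point of a piece of the ribbon surface. -/
def ribbonPiece : P.RibbonPieces → OC P.Cell
  | .inl ⟨i, x, b⟩ => OC.map (discEmb i b) (monotone_discEmb i b) (rectHomeo (deg i) x)
  | .inr (o, u, t) => OC.map (ribEmb o) (monotone_ribEmb o) (OC.prod (iota u) t)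

theorem continuous_ribbonPiece : Continuous (ribbonPiece : P.RibbonPieces → _) := by
  refine continuous_sum_dom.2 ⟨continuous_sigma fun i => ?_, ?_⟩
  · refine (continuous_prod_of_discrete_right.2 fun b => ?_)
    exact (OC.continuous_map _ (monotone_discEmb i b)).comp (rectHomeo (deg i)).continuous
  · refine continuous_prod_of_discrete_left.2 fun o => ?_
    exact (OC.continuous_map _ (monotone_ribEmb o)).comp
      (OC.continuous_prod' (continuous_iota.comp continuous_fst) continuous_snd)

theorem ribbonPiece_rel {a b : P.RibbonPieces} (h : P.RibbonRel a b) :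
    ribbonPiece a = ribbonPiece b := by
  rcases h with ⟨o, u⟩ | ⟨o, u⟩
  · simp only [ribbonPiece]; rw [OC.prod_zero, rect_leg, OC.map_map, OC.map_map]; rfl
  · simp only [ribbonPiece]; rw [OC.prod_one, rect_leg, OC.map_map, OC.map_map]; rfl

/-- The point of the complex given by a point of the ribbon surface. -/
def ribbonMap : P.Ribbon → OC P.Cell := Quot.lift ribbonPiece fun _ _ => ribbonPiece_rel

theorem continuous_ribbonMap : Continuous (ribbonMap : P.Ribbon → _) :=
  continuous_quot_lift _ continuous_ribbonPiece

theorem ribbonMap_disc (i : Fin P.n) (b : Bool) (x : Rect i) : ribbonMap (Ribbon.disc i b x) =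
    OC.map (discEmb i b) (monotone_discEmb i b) (rectHomeo (deg i) x) := rfl

theorem ribbonMap_strip (o : P.Occ) (u t : I) : ribbonMap (Ribbon.strip o u t) =
    OC.map (ribEmb o) (monotone_ribEmb o) (OC.prod (iota u) t) := rfl

theorem strip_zero (o : P.Occ) (u : I) :
    Ribbon.strip o u 0 = Ribbon.disc (gen o) (sgn o) (leg o u) := Quot.sound (.start o u)

theorem strip_one (o : P.Occ) (u : I) :
    Ribbon.strip o u 1 = Ribbon.disc (gen (next o)) (!sgn (next o)) (leg (next o) u) :=
  Quot.sound (.finish o u)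

theorem Ribbon.cases (z : P.Ribbon) : (∃ i b x, z = Ribbon.disc i b x) ∨
    ∃ o u t, t ≠ 0 ∧ t ≠ 1 ∧ z = Ribbon.strip o u t := by
  obtain ⟨⟨i, x, b⟩ | ⟨o, u, t⟩, rfl⟩ := Quot.exists_rep z
  · exact .inl ⟨i, b, x, rfl⟩
  · by_cases h0 : t = 0
    · subst h0; exact .inl ⟨_, _, _, strip_zero o u⟩
    · by_cases h1 : t = 1
      · subst h1; exact .inl ⟨_, _, _, strip_one o u⟩
      · exact .inr ⟨o, u, t, h0, h1, rfl⟩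

theorem ribbonMap_disc_ne {i : Fin P.n} {b : Bool} {x : Rect i} {p : P.Cell}
    (h : ribbonMap (Ribbon.disc i b x) p ≠ 0) : ∃ a, p = discEmb i b a := by
  obtain ⟨a, rfl, -⟩ := OC.map_ne (he := monotone_discEmb i b) h
  exact ⟨a, rfl⟩

theorem ribbonMap_strip_ne {o : P.Occ} {u t : I} (h0 : t ≠ 0) (h1 : t ≠ 1) :
    ∃ υ, ribbonMap (Ribbon.strip o u t) (rb o υ) ≠ 0 := by
  obtain ⟨υ, h⟩ := OC.prod_md_ne (s := iota u) h0 h1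
  refine ⟨υ, ?_⟩
  rw [ribbonMap_strip]
  have := OC.map_apply (he := monotone_ribEmb o)
    (injective_of_le_iff fun a a' => (ribEmb_le_iff o a a').1) (OC.prod (iota u) t) (υ, .md)
  rw [← this] at h
  exact h

theorem ribbonMap_rb_ne {o o' : P.Occ} {u t : I} {υ}
    (h : ribbonMap (Ribbon.strip o u t) (rb o' υ) ≠ 0) : o = o' := by
  obtain ⟨⟨υ', (_ | _) | _⟩, h, -⟩ := OC.map_ne (he := monotone_ribEmb o) h <;> simp only [ribEmb] at h <;> cases h
  rfl

theorem ribbonMap_injective : Injective (ribbonMap : P.Ribbon → _) := by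
  intro z w h
  have key : ∀ {i b} {x : Rect i} {o : P.Occ} {u t : I}, t ≠ 0 → t ≠ 1 →
      ribbonMap (Ribbon.disc i b x) ≠ ribbonMap (Ribbon.strip o u t) := by
    intro i b x o u t h0 h1 h
    obtain ⟨υ, hυ⟩ := ribbonMap_strip_ne (o := o) (u := u) h0 h1
    rw [← h] at hυ
    obtain ⟨a, ha⟩ := ribbonMap_disc_ne hυ
    cases ha
  rcases Ribbon.cases z with ⟨i, b, x, rfl⟩ | ⟨o, u, t, h0, h1, rfl⟩ <;>
  rcases Ribbon.cases w with ⟨i', b', x', rfl⟩ | ⟨o', u', t', h0', h1', rfl⟩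
  · obtain ⟨p, hp⟩ := OC.exists_ne (ribbonMap (Ribbon.disc i b x))
    obtain ⟨a, rfl⟩ := ribbonMap_disc_ne hp
    rw [h] at hp
    obtain ⟨a', ha⟩ := ribbonMap_disc_ne hp
    simp only [discEmb, hd.injEq, en.injEq] at ha
    obtain ⟨rfl, -, rfl⟩ := ha
    have := OC.map_injective (monotone_discEmb i b) (injective_of_le_iff (discEmb_reflect i b)) h
    rw [(rectHomeo (deg i)).injective this]
  · grind
  · grind
  · obtain ⟨υ, hυ⟩ := ribbonMap_strip_ne (o := o) (u := u) h0 h1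
    rw [h] at hυ
    obtain rfl := ribbonMap_rb_ne hυ
    have := OC.map_injective (monotone_ribEmb _)
      (injective_of_le_iff fun a a' => (ribEmb_le_iff _ a a').1) h
    obtain ⟨h1, h2⟩ := OC.prod_injective this
    rw [iota_injective h1, h2]

/-- The cells of the ribbon surface. -/
def Cell.Rib : P.Cell → Prop
  | hd _ _ τ => ∃ b, τ = .en b
  | rb _ _ => True
  | _ => False

theorem rib_discEmb (i : Fin P.n) (b : Bool) (a) : (discEmb i b a : P.Cell).Rib := ⟨b, rfl⟩

theorem rib_ribEmb (o : P.Occ) (a) : (ribEmb o a : P.Cell).Rib := by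
  rcases a with ⟨υ, (_ | _) | _⟩
  · exact ⟨_, rfl⟩
  · exact ⟨_, rfl⟩
  · trivial

theorem rib_of_ribbonMap_ne {z : P.Ribbon} {p : P.Cell} (h : ribbonMap z p ≠ 0) : p.Rib := by
  obtain ⟨⟨i, x, b⟩ | ⟨o, u, t⟩, rfl⟩ := Quot.exists_rep z
  · obtain ⟨a, rfl, -⟩ := OC.map_ne (he := monotone_discEmb i b) h; exact rib_discEmb i b a
  · obtain ⟨a, rfl, -⟩ := OC.map_ne (he := monotone_ribEmb o) h; exact rib_ribEmb o a

theorem exists_ribbonMap {t : OC P.Cell} (ht : ∀ p, t p ≠ 0 → p.Rib) : ∃ z, ribbonMap z = t := by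
  by_cases hr : ∃ o υ, t (rb o υ) ≠ 0
  · obtain ⟨o, υ, ho⟩ := hr
    obtain ⟨s, hs⟩ := OC.exists_map_eq (monotone_ribEmb o) (fun a a' => (ribEmb_le_iff o a a').1) t
      (by
        intro p hp
        rw [← le_rb_md]
        rcases t.chain p (rb o υ) hp ho with h | h
        · exact h.trans (rb_le_rb.2 ⟨rfl, le_md _⟩)
        · rcases p with ⟨i, a, τ⟩ | ⟨o', υ'⟩ | ⟨j, υ'⟩ | c | _
          · exact absurd h not_rb_le_hd
          · obtain ⟨rfl, -⟩ := rb_le_rb.1 h; exact rb_le_rb.2 ⟨rfl, le_md _⟩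
          all_goals exact (ht _ hp).elim)
    obtain ⟨s', x, rfl⟩ := OC.exists_prod s
    obtain ⟨u, rfl⟩ := iota_surjective s'
    exact ⟨Ribbon.strip o u x, hs⟩
  · obtain ⟨p, hp⟩ := t.exists_ne
    rcases p with ⟨i, a, τ⟩ | ⟨o', υ'⟩ | ⟨j, υ'⟩ | c | _
    · obtain ⟨b, rfl⟩ := ht _ hp
      obtain ⟨s, hs⟩ := OC.exists_map_eq (monotone_discEmb i b) (discEmb_reflect i b) t (by
        intro q hq
        rw [← le_disc]
        rcases q with ⟨i', a', τ'⟩ | ⟨o', υ'⟩ | ⟨j, υ'⟩ | c | _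
        · obtain ⟨b', rfl⟩ := ht _ hq
          rcases t.chain _ _ hp hq with h | h
          all_goals
            obtain ⟨_, _, _, hτ, h⟩ := le_hd.1 h
            cases h
            simp only [le_en, en.injEq] at hτ
            subst hτ
            exact hd_le_hd.2 ⟨le_tp _, le_rfl⟩
        · grind
        all_goals exact (ht _ hq).elim)
      refine ⟨Ribbon.disc i b ((rectHomeo (deg i)).symm s), ?_⟩
      rw [ribbonMap_disc, Homeomorph.apply_symm_apply, hs]
    · grind
    all_goals exact (ht _ hp).elim

end FinPresentation

theorem OC.exists_max {A : Type*} [Fintype A] [PartialOrder A] (t : OC A) :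
    ∃ p, t p ≠ 0 ∧ ∀ q, t q ≠ 0 → q ≤ p := by
  classical
  obtain ⟨q₀, h₀⟩ := t.exists_ne
  obtain ⟨p, hp, hm⟩ := (Finset.univ.filter fun p => t p ≠ 0).exists_maximal ⟨q₀, by simpa using h₀⟩
  simp only [Finset.mem_filter, Finset.mem_univ, true_and] at hp hm
  refine ⟨p, hp, fun q hq => ?_⟩
  rcases t.chain p q hp hq with h | h
  · exact hm hq h
  · exact h

theorem push_ne {A B : Type*} [Fintype A] {e : A → B} {t : A → ℝ} (h : ∀ a, 0 ≤ t a) {a : A}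
    (ha : t a ≠ 0) : push e t (e a) ≠ 0 := by
  classical
  refine fun h0 => ha (le_antisymm ?_ (h a))
  rw [← h0, push]
  refine (if_pos rfl).symm.le.trans (Finset.single_le_sum (f := fun a' => if e a' = e a then t a' else 0)
    (fun a' _ => ?_) (Finset.mem_univ a))
  split_ifs
  exacts [h a', le_rfl]

theorem OC.vtx_ne {A : Type*} [Fintype A] [PartialOrder A] {p q : A} (h : OC.vtx p q ≠ 0) :
    q = p := by
  rw [OC.vtx_apply] at h
  by_contra hq
  exact h (if_neg hq)

theorem OC.eq_vtx_of_ne {A : Type*} [Fintype A] [PartialOrder A] {t : OC A} {p : A}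
    (h : ∀ q, t q ≠ 0 → q = p) : t = OC.vtx p := by
  refine OC.eq_vtx ?_
  rw [← t.sum_eq, Finset.sum_eq_single p (fun q _ hq => by_contra fun h' => hq (h q h')) (by simp)]

theorem connectedComponent_eq_of_path {Y : Type*} [TopologicalSpace Y] {f : I → Y}
    (hf : Continuous f) (x y : I) : connectedComponent (f x) = connectedComponent (f y) :=
  connectedComponent_eq ((isPreconnected_range hf).subset_connectedComponent
    (Set.mem_range_self x) (Set.mem_range_self y))

namespace FinPresentation

open SingularManifold.Poly Cell

variable {P : FinPresentation}

/-! ### The boundary of the ribbon surface -/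

instance : TopologicalSpace P.Caps := ⊥
instance : DiscreteTopology P.Caps := ⟨rfl⟩

theorem not_bd_legAt {o : P.Occ} {τ : IF} {c : P.Caps} :
    ¬ Bd (hd (gen o) (lg (slot o)) τ) c := by
  rintro (⟨i, s, x, b, h, -⟩ | ⟨i, s, b, h, -⟩ | ⟨i, b, h, -⟩ | ⟨o, u, h, -⟩)
  · cases h
  · cases h
  · have hs : (⟨gen o, slot o⟩ : Σ i : Fin P.n, Fin (deg i + 1)) = ⟨i, Fin.last _⟩ := by
      grind
    have h1 := slot_lt o
    have h2 : (slot o).1 = deg i := congrArg (fun x : Σ i : Fin P.n, Fin (deg i + 1) => x.2.1) hs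
    have h3 : gen o = i := congrArg Sigma.fst hs
    rw [h2, h3] at h1
    exact lt_irrefl _ h1
  · cases h

theorem not_bd_lg {i : Fin P.n} {s : Fin (deg i + 1)} {τ : IF} {c : P.Caps} (hs : s.1 < deg i) :
    ¬ Bd (hd i (lg s) τ) c := by
  obtain ⟨o, rfl, ho⟩ := exists_index hs
  obtain rfl : slot o = s := Fin.ext ho
  exact not_bd_legAt

theorem not_bd_tp {i : Fin P.n} {τ : IF} {c : P.Caps} : ¬ Bd (hd i tp τ) c := by
  rintro (⟨i, s, x, b, h, -⟩ | ⟨i, s, b, h, -⟩ | ⟨i, b, h, -⟩ | ⟨o, u, h, -⟩) <;> cases h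

theorem not_bd_rb_md {o : P.Occ} {c : P.Caps} : ¬ Bd (rb o .md) c := by
  rintro (⟨i, s, x, b, h, -⟩ | ⟨i, s, b, h, -⟩ | ⟨i, b, h, -⟩ | ⟨o, u, h, -⟩) <;> cases h

theorem exists_bd_of_ne {i : Fin P.n} {a : Poly (deg i + 1)} {b : Bool} (h1 : a ≠ tp)
    (h2 : ∀ s : Fin (deg i + 1), s.1 < deg i → a ≠ lg s) : ∃ c, Bd (hd i a (.en b)) c := by
  rcases a with ⟨s, x⟩ | s | s | _
  · exact ⟨_, .inl ⟨_, _, _, _, rfl, rfl⟩⟩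
  · have : s = Fin.last _ := by grind
    subst this
    exact ⟨_, .inr (.inr (.inl ⟨_, _, rfl, rfl⟩))⟩
  · exact ⟨_, .inr (.inl ⟨_, _, _, rfl, rfl⟩)⟩
  · grind

theorem exists_bd_ribEmb (o : P.Occ) (u : Bool) (τ : IF) : ∃ c, Bd (ribEmb o (.en u, τ)) c := by
  rcases τ with (_ | _) | _
  · exact ⟨_, .inl ⟨_, _, _, _, rfl, rfl⟩⟩
  · exact ⟨_, .inl ⟨_, _, _, _, rfl, rfl⟩⟩
  · exact ⟨_, .inr (.inr (.inr ⟨_, _, rfl, rfl⟩))⟩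

theorem exists_bd_of_forall {t : OC P.Cell} (h : ∀ p, t p ≠ 0 → ∃ c, Bd p c) :
    ∃ c, ∀ p, t p ≠ 0 → Bd p c := by
  obtain ⟨p, hp, hm⟩ := t.exists_max
  obtain ⟨c, hc⟩ := h p hp
  exact ⟨c, fun q hq => (hm q hq).bd hc⟩

theorem iota_md_eq_zero {u : I} (h : iota u .md = 0) : u = 0 ∨ u = 1 := by
  by_contra! h'
  exact iota_md_ne h'.1 h'.2 h

theorem mem_boundary_iff {z : P.Ribbon} :
    z ∈ Ribbon.boundary P ↔ ∃ c, ∀ p, ribbonMap z p ≠ 0 → Bd p c := by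
  constructor
  · rintro (⟨i, b, x, rfl, hx⟩ | ⟨o, u, t, rfl, hu⟩)
    · apply exists_bd_of_forall
      intro p hp
      obtain ⟨a, rfl, ha⟩ := OC.map_ne (he := monotone_discEmb i b) hp
      obtain ⟨h1, h2⟩ := (rectHomeo_boundary_iff x).2 hx
      refine exists_bd_of_ne (fun h => ha (h ▸ h1)) fun s hs h => ha (h ▸ h2 s hs)
    · apply exists_bd_of_forall
      intro p hp
      obtain ⟨⟨υ, τ⟩, rfl, ha⟩ := OC.map_ne (he := monotone_ribEmb o) hp
      have : iota u υ ≠ 0 := by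
        rw [← OC.map_fst_prod (iota u) t]
        intro h
        refine ha ?_
        by_contra h'
        exact push_ne (e := Prod.fst) (OC.nonneg _) h' h
      rcases hu with rfl | rfl
      · rw [iota_zero] at this; rw [OC.vtx_ne this]; exact exists_bd_ribEmb o _ τ
      · rw [iota_one] at this; rw [OC.vtx_ne this]; exact exists_bd_ribEmb o _ τ
  · rintro ⟨c, hc⟩
    rcases Ribbon.cases z with ⟨i, b, x, rfl⟩ | ⟨o, u, t, h0, h1, rfl⟩
    · refine .inl ⟨i, b, x, rfl, (rectHomeo_boundary_iff x).1 ?_⟩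
      have key : ∀ a, ¬ Bd (discEmb i b a) c → rectHomeo (deg i) x a = 0 := by
        intro a ha
        by_contra h
        refine ha (hc _ ?_)
        rwa [ribbonMap_disc, OC.map_apply (injective_of_le_iff (discEmb_reflect i b))]
      exact ⟨key _ not_bd_tp, fun s hs => key _ (not_bd_lg hs)⟩
    · refine .inr ⟨o, u, t, rfl, iota_md_eq_zero ?_⟩
      by_contra h
      rw [← OC.map_fst_prod (iota u) t] at h
      obtain ⟨⟨υ, τ⟩, rfl, hτ⟩ := OC.map_ne (he := monotone_fst) h
      have := hc (ribEmb o (.md, τ)) (by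
        rw [ribbonMap_strip, OC.map_apply (injective_of_le_iff fun a a' => (ribEmb_le_iff o a a').1)]
        exact hτ)
      rcases τ with (_ | _) | _
      · exact not_bd_legAt this
      · exact not_bd_legAt this
      · exact not_bd_rb_md this

/-- The boundary component of a boundary point. -/
def capOf (z : Ribbon.boundary P) : P.Caps := (mem_boundary_iff.1 z.2).choose

theorem capOf_spec (z : Ribbon.boundary P) {p : P.Cell} (h : ribbonMap z.1 p ≠ 0) :
    Bd p (capOf z) := (mem_boundary_iff.1 z.2).choose_spec p h

theorem capOf_eq {z : Ribbon.boundary P} {p : P.Cell} {c : P.Caps} (h : ribbonMap z.1 p ≠ 0)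
    (hp : Bd p c) : capOf z = c := (capOf_spec z h).unique hp

theorem continuous_capOf : Continuous (capOf : Ribbon.boundary P → P.Caps) := by
  have key : ∀ c : P.Caps, IsClosed (capOf ⁻¹' {c} : Set (Ribbon.boundary P)) := by
    intro c
    have : (capOf ⁻¹' {c} : Set (Ribbon.boundary P)) =
        ⋂ (p : P.Cell) (_ : ¬ Bd p c), {z | ribbonMap z.1 p = 0} := by
      ext z
      simp only [Set.mem_preimage, Set.mem_singleton_iff, Set.mem_iInter, Set.mem_ofPred_eq]
      constructor
      · rintro rfl p hp; by_contra h; exact hp (capOf_spec z h)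
      · intro h
        obtain ⟨p, hp⟩ := (ribbonMap z.1).exists_ne
        exact capOf_eq hp (by_contra fun h' => hp (h p h'))
    rw [this]
    exact isClosed_iInter fun p => isClosed_iInter fun _ => isClosed_eq
      ((OC.continuous_coord p).comp (continuous_ribbonMap.comp continuous_subtype_val))
      continuous_const
  refine continuous_iff_isClosed.2 fun S _ => ?_
  rw [← Set.biUnion_preimage_singleton]
  exact S.toFinite.isClosed_biUnion fun c _ => key c

/-- A point of the edge of a disc, not on a leg. -/
def edgePoint (i : Fin P.n) (b : Bool) (s : Fin (deg i + 1)) (k : Bool)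
    (hk : k = true ∨ s = Fin.last _) (y : I) : Ribbon.boundary P :=
  ⟨Ribbon.disc i b ((rectHomeo (deg i)).symm (bdry (s, k, y))), mem_boundary_iff.2 (by
    rw [ribbonMap_disc, Homeomorph.apply_symm_apply]
    apply exists_bd_of_forall
    intro p hp
    obtain ⟨a, rfl, ha⟩ := OC.map_ne (he := monotone_discEmb i b) hp
    obtain ⟨τ, rfl⟩ := exists_edge_of_bdry_ne ha
    refine exists_bd_of_ne (edge_ne_tp _ _ _) fun s' hs h => ?_
    dsimp only at h
    rcases hk with rfl | rfl
    · rcases τ with (_ | _) | _ <;> cases h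
    · rcases k
      · rcases τ with b | _
        · cases h
        · simp only [edge, lg.injEq] at h; subst h; simp at hs
      · rcases τ with (_ | _) | _ <;> cases h)⟩

theorem continuous_edgePoint (i : Fin P.n) (b : Bool) (s : Fin (deg i + 1)) (k : Bool)
    (hk : k = true ∨ s = Fin.last _) : Continuous (edgePoint i b s k hk) := by
  refine Continuous.subtype_mk (continuous_quot_mk.comp (continuous_inl.comp
    ((@continuous_sigmaMk _ (fun i : Fin P.n => Rect i × Bool) _ i).comp
      (Continuous.prodMk ((rectHomeo (deg i)).symm.continuous.comp
        (continuous_bdry.comp (by fun_prop))) continuous_const)))) _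

/-- A vertex of the boundary. -/
def vertexPoint (v : P.BV) : Ribbon.boundary P :=
  ⟨Ribbon.disc v.1 v.2.2.2 ((rectHomeo (deg v.1)).symm (OC.vtx (vt v.2.1 v.2.2.1))),
    mem_boundary_iff.2 ⟨capV v, fun p hp => by
      rw [ribbonMap_disc, Homeomorph.apply_symm_apply, OC.map_vtx] at hp
      rw [OC.vtx_ne hp]
      exact .inl ⟨_, _, _, _, rfl, rfl⟩⟩⟩

theorem capOf_vertexPoint (v : P.BV) : capOf (vertexPoint v) = capV v := by
  refine capOf_eq (p := hd v.1 (vt v.2.1 v.2.2.1) (.en v.2.2.2)) ?_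
    (.inl ⟨_, _, _, _, rfl, rfl⟩)
  simp only [vertexPoint]
  rw [ribbonMap_disc, Homeomorph.apply_symm_apply, OC.map_vtx, OC.vtx_apply]
  simp [discEmb]

theorem vertexPoint_eq {v : P.BV} {z : Ribbon.boundary P}
    (h : ribbonMap z.1 = OC.vtx (hd v.1 (vt v.2.1 v.2.2.1) (.en v.2.2.2))) : z = vertexPoint v := by
  refine Subtype.ext (ribbonMap_injective ?_)
  simp only [vertexPoint]
  rw [h, ribbonMap_disc, Homeomorph.apply_symm_apply, OC.map_vtx]
  rfl

theorem ribbonMap_edgePoint (i : Fin P.n) (b : Bool) (s : Fin (deg i + 1)) (k : Bool)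
    (hk : k = true ∨ s = Fin.last _) (y : I) : ribbonMap (edgePoint i b s k hk y).1 =
      OC.map (discEmb i b) (monotone_discEmb i b) (bdry (s, k, y)) := by
  simp only [edgePoint]
  rw [ribbonMap_disc, Homeomorph.apply_symm_apply]

theorem edgePoint_zero (i : Fin P.n) (b : Bool) (s : Fin (deg i + 1)) (k : Bool)
    (hk : k = true ∨ s = Fin.last _) : edgePoint i b s k hk 0 = vertexPoint ⟨i, s, k, b⟩ := by
  refine vertexPoint_eq ?_
  rw [ribbonMap_edgePoint, bdry_of_zero rfl, OC.map_vtx]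
  rcases k <;> rfl

/-- A point of a long side of a ribbon. -/
def sidePoint (o : P.Occ) (u : Bool) (t : I) : Ribbon.boundary P :=
  ⟨Ribbon.strip o (if u then 1 else 0) t, .inr ⟨o, _, t, rfl, by rcases u <;> simp⟩⟩

theorem continuous_sidePoint (o : P.Occ) (u : Bool) : Continuous (sidePoint o u) :=
  Continuous.subtype_mk (continuous_quot_mk.comp (continuous_inr.comp
    (continuous_const.prodMk (continuous_const.prodMk continuous_id)))) _

theorem iota_bool (u : Bool) : iota (if u then 1 else 0) = OC.vtx (.en u) := by
  rcases u
  · exact iota_zero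
  · exact iota_one

theorem sidePoint_zero (o : P.Occ) (u : Bool) :
    sidePoint o u 0 = vertexPoint ⟨gen o, slot o, side o u, sgn o⟩ := by
  refine vertexPoint_eq ?_
  simp only [sidePoint]
  rw [strip_zero, ribbonMap_disc, rect_leg, iota_bool, OC.map_vtx, OC.map_vtx]
  rfl

theorem sidePoint_one (o : P.Occ) (u : Bool) : sidePoint o u 1 =
    vertexPoint ⟨gen (next o), slot (next o), side (next o) u, !sgn (next o)⟩ := by
  refine vertexPoint_eq ?_
  simp only [sidePoint]
  rw [strip_one, ribbonMap_disc, rect_leg, iota_bool, OC.map_vtx, OC.map_vtx]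
  rfl

theorem exists_vertexPoint (z : Ribbon.boundary P) :
    ∃ v, connectedComponent z = connectedComponent (vertexPoint v) := by
  obtain ⟨z, hz⟩ := z
  rcases hz with ⟨i, b, x, rfl, hx⟩ | ⟨o, u, t, rfl, hu⟩
  · obtain ⟨h1, h2⟩ := (rectHomeo_boundary_iff x).2 hx
    obtain ⟨⟨s, k, y⟩, ha⟩ := exists_bdry _ h1
    by_cases hk : k = true ∨ s = Fin.last _
    · refine ⟨⟨i, s, k, b⟩, ?_⟩
      have : (⟨Ribbon.disc i b x, .inl ⟨i, b, x, rfl, hx⟩⟩ : Ribbon.boundary P) =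
          edgePoint i b s k hk y := by
        refine Subtype.ext (ribbonMap_injective ?_)
        rw [ribbonMap_edgePoint, ha]
        rfl
      rw [this, ← edgePoint_zero i b s k hk]
      exact connectedComponent_eq_of_path (continuous_edgePoint i b s k hk) _ _
    · push Not at hk
      obtain ⟨hk, hs⟩ := hk
      obtain rfl : k = false := by grind
      have hs' : s.1 < deg i := by grind
      have hy : iota y .md = 0 := by
        have := h2 s hs'
        rw [← ha] at this
        rw [← this]
        exact (OC.map_apply (he := monotone_edge s false) (edge_injective s false) (iota y) .md).symm
      obtain ⟨c, hc⟩ : ∃ c : Bool, bdry (s, false, y) = OC.vtx (vt s c) := by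
        rcases iota_md_eq_zero hy with rfl | rfl
        · exact ⟨false, bdry_of_zero rfl⟩
        · exact ⟨true, bdry_of_one rfl⟩
      refine ⟨⟨i, s, c, b⟩, congrArg _ (vertexPoint_eq ?_)⟩
      dsimp only
      rw [ribbonMap_disc, ← ha, hc, OC.map_vtx]
      rfl
  · obtain ⟨c, rfl⟩ : ∃ c : Bool, u = if c then 1 else 0 := by simp_all
    refine ⟨⟨gen o, slot o, side o c, sgn o⟩, ?_⟩
    rw [← sidePoint_zero]
    exact connectedComponent_eq_of_path (continuous_sidePoint o c) t 0

theorem component_of_capV_eq {v w : P.BV} (h : capV v = capV w) :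
    connectedComponent (vertexPoint v) = connectedComponent (vertexPoint w) := by
  have h' := Quot.eqvGen_exact h
  clear h
  induction h' with
  | rel v w h =>
    rcases h with ⟨i, s, b⟩ | ⟨i, b⟩ | ⟨o, u⟩
    · rw [← edgePoint_zero i b s true (.inl rfl),
        connectedComponent_eq_of_path (continuous_edgePoint i b s true (.inl rfl)) 0 1]
      refine congrArg _ (vertexPoint_eq ?_)
      rw [ribbonMap_edgePoint, bdry_of_one rfl, OC.map_vtx]
      rfl
    · rw [← edgePoint_zero i b (Fin.last _) false (.inr rfl),
        connectedComponent_eq_of_path (continuous_edgePoint i b _ false (.inr rfl)) 0 1]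
      refine congrArg _ (vertexPoint_eq ?_)
      rw [ribbonMap_edgePoint, bdry_of_one rfl, OC.map_vtx]
      rfl
    · rw [← sidePoint_zero, ← sidePoint_one]
      exact connectedComponent_eq_of_path (continuous_sidePoint o u) 0 1
  | refl => rfl
  | symm _ _ _ ih => exact ih.symm
  | trans _ _ _ _ _ ih1 ih2 => exact ih1.trans ih2

theorem component_eq_iff {z z' : Ribbon.boundary P} :
    connectedComponent z = connectedComponent z' ↔ capOf z = capOf z' := by
  have key : ∀ {z z' : Ribbon.boundary P}, connectedComponent z = connectedComponent z' →
      capOf z = capOf z' := by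
    intro z z' h
    have hz : z ∈ connectedComponent z' := h ▸ mem_connectedComponent
    exact (isPreconnected_connectedComponent.image _ continuous_capOf.continuousOn).subsingleton
      (Set.mem_image_of_mem _ hz) (Set.mem_image_of_mem _ mem_connectedComponent)
  refine ⟨key, fun h => ?_⟩
  obtain ⟨v, hv⟩ := exists_vertexPoint z
  obtain ⟨w, hw⟩ := exists_vertexPoint z'
  rw [hv, hw]
  refine component_of_capV_eq ?_
  rw [← capOf_vertexPoint, ← capOf_vertexPoint, ← key hv, ← key hw, h]

end FinPresentation

open scoped Classical

namespace FinPresentation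

open SingularManifold.Poly Cell

variable {P : FinPresentation}

/-! ### The closed ribbon surface as a complex -/

theorem le_cp_of_ne (z : Ribbon.boundary P) (q : P.Cell) (h : ribbonMap z.1 q ≠ 0) :
    q ≤ cp (capOf z) ∨ cp (capOf z) ≤ q := .inl (.inr (capOf_spec z h))

/-- The point of the complex given by a point of a collar. -/
def collarMap (z : Ribbon.boundary P) (x : I) : OC P.Cell :=
  OC.mixV (ribbonMap z.1) (cp (capOf z)) (le_cp_of_ne z) x

theorem continuous_collarMap :
    Continuous fun z : Ribbon.boundary P × I => collarMap z.1 z.2 := by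
  refine OC.continuous_of_coord fun q => ?_
  simp only [collarMap, OC.mixV_apply]
  refine Continuous.add (Continuous.mul (by fun_prop) ((OC.continuous_coord q).comp
    (continuous_ribbonMap.comp (continuous_subtype_val.comp continuous_fst)))) ?_
  have : Continuous fun y : P.Caps × I => if q = cp y.1 then (y.2 : ℝ) else 0 := by
    refine continuous_prod_of_discrete_left.2 fun c => ?_
    by_cases h : q = cp c
    · simpa [h] using continuous_subtype_val
    · simpa [h] using continuous_const
  exact this.comp ((continuous_capOf.comp continuous_fst).prodMk continuous_snd)

/-- The point of the complex given by a point of the closed ribbon surface. -/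
def omegaMap : P.Omega → OC P.Cell :=
  Quot.lift (Sum.elim ribbonMap fun z => collarMap z.1 z.2) (by
    rintro _ _ (⟨z⟩ | ⟨z, z', h⟩)
    · simp only [Sum.elim_inl, Sum.elim_inr]; exact OC.mixV_zero _ _ _
    · simp only [Sum.elim_inr, collarMap]; rw [OC.mixV_one, OC.mixV_one, component_eq_iff.1 h])

theorem continuous_omegaMap : Continuous (omegaMap : P.Omega → _) :=
  continuous_quot_lift _ (continuous_sum_dom.2 ⟨continuous_ribbonMap, continuous_collarMap⟩)

/-- A point of a collar. -/
def collar (z : Ribbon.boundary P) (x : I) : P.Omega := Quot.mk _ (Sum.inr (z, x))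

theorem collar_zero (z : Ribbon.boundary P) : collar z 0 = z.1.toOmega := Quot.sound (.glue z)

theorem omegaMap_toOmega (z : P.Ribbon) : omegaMap z.toOmega = ribbonMap z := rfl

theorem omegaMap_collar (z : Ribbon.boundary P) (x : I) : omegaMap (collar z x) = collarMap z x :=
  rfl

theorem Omega.cases (y : P.Omega) : (∃ z : P.Ribbon, y = z.toOmega) ∨
    ∃ (z : Ribbon.boundary P) (x : I), x ≠ 0 ∧ y = collar z x := by
  obtain ⟨z | ⟨z, x⟩, rfl⟩ := Quot.exists_rep y
  · exact .inl ⟨z, rfl⟩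
  · by_cases h0 : x = 0
    · subst h0; exact .inl ⟨_, collar_zero z⟩
    · exact .inr ⟨z, x, h0, rfl⟩

theorem ribbonMap_cp (z : P.Ribbon) (c : P.Caps) : ribbonMap z (cp c) = 0 := by
  by_contra h
  exact rib_of_ribbonMap_ne h

theorem ribbonMap_om (z : P.Ribbon) : ribbonMap z om = 0 := by
  by_contra h
  exact rib_of_ribbonMap_ne h

theorem collarMap_cp (z : Ribbon.boundary P) (x : I) (c : P.Caps) :
    collarMap z x (cp c) = if c = capOf z then (x : ℝ) else 0 := by
  simp only [collarMap, OC.mixV_apply, ribbonMap_cp, cp.injEq]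
  simp

theorem omegaMap_om (y : P.Omega) : omegaMap y om = 0 := by
  rcases Omega.cases y with ⟨z, rfl⟩ | ⟨z, x, -, rfl⟩
  · exact ribbonMap_om z
  · rw [omegaMap_collar, collarMap, OC.mixV_apply, ribbonMap_om]; simp

theorem coe_ne_zero {x : I} (h : x ≠ 0) : (x : ℝ) ≠ 0 := fun h' => h (Subtype.ext h')

theorem omegaMap_injective : Injective (omegaMap : P.Omega → _) := by
  have key : ∀ (z : P.Ribbon) (w : Ribbon.boundary P) (x : I), x ≠ 0 →
      ribbonMap z ≠ collarMap w x := by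
    intro z w x hx h
    have h1 := collarMap_cp w x (capOf w)
    rw [← h, ribbonMap_cp, if_pos rfl] at h1
    exact coe_ne_zero hx h1.symm
  intro y y' h
  rcases Omega.cases y with ⟨z, rfl⟩ | ⟨z, x, hx, rfl⟩ <;>
    rcases Omega.cases y' with ⟨z', rfl⟩ | ⟨z', x', hx', rfl⟩
  · rw [ribbonMap_injective h]
  · exact absurd h (key _ _ _ hx')
  · exact absurd h.symm (key _ _ _ hx)
  · simp only [omegaMap_collar] at h
    have hc : capOf z = capOf z' := by
      have h1 := collarMap_cp z x (capOf z)
      rw [h, collarMap_cp, if_pos rfl] at h1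
      by_contra hc
      rw [if_neg hc] at h1
      exact coe_ne_zero hx h1.symm
    simp only [collarMap] at h
    have h2 : ∃ h', OC.mixV (ribbonMap z'.1) (cp (capOf z')) (le_cp_of_ne z') x' =
        OC.mixV (ribbonMap z'.1) (cp (capOf z)) h' x' := by
      rw [hc]; exact ⟨le_cp_of_ne z', rfl⟩
    obtain ⟨h3, h2⟩ := h2
    rw [h2] at h
    obtain ⟨rfl, h4⟩ := OC.mixV_inj (ribbonMap_cp _ _) (ribbonMap_cp _ _) h
    rcases h4 with rfl | h4
    · exact Quot.sound (.collapse _ _ (component_eq_iff.2 hc))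
    · rw [Subtype.ext (ribbonMap_injective h4)]

theorem rib_of_bd {p : P.Cell} {c : P.Caps} (h : Bd p c) : p.Rib := by
  rcases h with ⟨i, s, x, b, rfl, -⟩ | ⟨i, s, b, rfl, -⟩ | ⟨i, b, rfl, -⟩ | ⟨o, u, rfl, -⟩
  · exact ⟨_, rfl⟩
  · exact ⟨_, rfl⟩
  · exact ⟨_, rfl⟩
  · trivial

theorem le_om_iff {p : P.Cell} : p ≤ om ↔ p = om ∨ (∃ c, p = cp c) ∨ p.Rib := by
  rw [le_om]
  refine or_congr_right (or_congr_right ⟨?_, ?_⟩)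
  · rintro (⟨o, υ, rfl⟩ | ⟨i, a, b, rfl⟩)
    · trivial
    · exact ⟨_, rfl⟩
  · intro h
    rcases p with ⟨i, a, τ⟩ | ⟨o', υ'⟩ | ⟨j, υ'⟩ | c | _
    · obtain ⟨b, rfl⟩ := h; exact .inr ⟨_, _, _, rfl⟩
    · simp
    all_goals exact h.elim

theorem om_le {p : P.Cell} : om ≤ p ↔ p = om := by
  refine ⟨fun h => ?_, fun h => h ▸ le_rfl⟩
  rcases p with ⟨i, a, τ⟩ | ⟨o', υ'⟩ | ⟨j, υ'⟩ | c | _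
  · obtain ⟨_, _, _, _, h⟩ := le_hd.1 h; cases h
  · rcases le_rb.1 h with ⟨_, _, h⟩ | ⟨_, _, h⟩ | ⟨_, _, h⟩ <;> cases h
  · rcases le_dc.1 h with ⟨_, _, h⟩ | ⟨_, _, _, _, h⟩ | ⟨_, _, _, _, _, h⟩ <;> cases h
  · rcases le_cp.1 h with h | h
    · cases h
    · exact (rib_of_bd h).elim
  · rfl

theorem cp_le {p : P.Cell} {c : P.Caps} : cp c ≤ p ↔ p = cp c ∨ p = om := by
  constructor
  · intro h
    rcases p with ⟨i, a, τ⟩ | ⟨o', υ'⟩ | ⟨j, υ'⟩ | c | _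
    · obtain ⟨_, _, _, _, h⟩ := le_hd.1 h; cases h
    · rcases le_rb.1 h with ⟨_, _, h⟩ | ⟨_, _, h⟩ | ⟨_, _, h⟩ <;> cases h
    · rcases le_dc.1 h with ⟨_, _, h⟩ | ⟨_, _, _, _, h⟩ | ⟨_, _, _, _, _, h⟩ <;> cases h
    · rcases le_cp.1 h with h | h
      · grind
      · exact (rib_of_bd h).elim
    · simp
  · rintro (rfl | rfl)
    · exact le_rfl
    · exact .inr (.inl ⟨_, rfl⟩)

theorem omegaMap_le {y : P.Omega} {p : P.Cell} (h : omegaMap y p ≠ 0) : p ≤ om := by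
  rcases Omega.cases y with ⟨z, rfl⟩ | ⟨z, x, -, rfl⟩
  · exact le_om_iff.2 (.inr (.inr (rib_of_ribbonMap_ne h)))
  · rw [omegaMap_collar, collarMap, OC.mixV_apply] at h
    by_cases hp : p = cp (capOf z)
    · exact le_om_iff.2 (.inr (.inl ⟨_, hp⟩))
    · rw [if_neg hp, add_zero] at h
      exact le_om_iff.2 (.inr (.inr (rib_of_ribbonMap_ne (right_ne_zero_of_mul h))))

theorem exists_omegaMap {t : OC P.Cell} (ht : ∀ p, t p ≠ 0 → p < om) : ∃ y, omegaMap y = t := by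
  by_cases hc : ∃ c, t (cp c) ≠ 0
  · obtain ⟨c, hc⟩ := hc
    by_cases h1 : t (cp c) = 1
    · obtain ⟨v, rfl⟩ := Quot.exists_rep c
      refine ⟨collar (vertexPoint v) 1, ?_⟩
      rw [omegaMap_collar, collarMap, OC.mixV_one, capOf_vertexPoint, OC.eq_vtx h1]
      rfl
    · obtain ⟨z, h, x, hz, hx, hs, rfl⟩ := OC.exists_mixV t (cp c) hc h1
      have hb : ∀ q, z q ≠ 0 → Bd q c := by
        intro q hq
        rcases h q hq with h | h
        · rcases le_cp.1 h with rfl | h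
          · grind
          · exact h
        · rcases cp_le.1 h with rfl | rfl
          · grind
          · grind
      obtain ⟨w, rfl⟩ := exists_ribbonMap fun p hp => rib_of_bd (hb p hp)
      have hw : w ∈ Ribbon.boundary P := mem_boundary_iff.2 ⟨c, hb⟩
      refine ⟨collar ⟨w, hw⟩ x, ?_⟩
      obtain ⟨p, hp⟩ := (ribbonMap w).exists_ne
      have : capOf ⟨w, hw⟩ = c := capOf_eq (z := ⟨w, hw⟩) hp (hb p hp)
      subst this
      rfl
  · obtain ⟨z, hz⟩ := exists_ribbonMap (t := t) fun p hp => by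
      rcases le_om_iff.1 (ht p hp).le with rfl | ⟨c, rfl⟩ | h
      · grind
      · grind
      · exact h
    exact ⟨z.toOmega, hz⟩

/-! ### The singular 3-manifold as a complex -/

theorem le_om_of_ne (y : P.Omega) (q : P.Cell) (h : omegaMap y q ≠ 0) :
    q ≤ om ∨ om ≤ q := .inl (omegaMap_le h)

/-- The point of the complex given by a point of the cone. -/
def coneMap : Cone P.Omega → OC P.Cell :=
  Quot.lift (Sum.elim (fun _ => OC.vtx om) fun y => OC.mixV (omegaMap y.1) om (le_om_of_ne y.1) y.2)
    (by rintro _ _ ⟨y⟩; exact OC.mixV_one _ _ (le_om_of_ne y))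

theorem continuous_coneMap : Continuous (coneMap : Cone P.Omega → _) := by
  refine continuous_quot_lift _ (continuous_sum_dom.2 ⟨continuous_const, ?_⟩)
  refine OC.continuous_of_coord fun q => ?_
  simp only [comp_def, Sum.elim_inr, OC.mixV_apply]
  refine Continuous.add (Continuous.mul (by fun_prop) ((OC.continuous_coord q).comp
    (continuous_omegaMap.comp continuous_fst))) ?_
  split_ifs
  · fun_prop
  · exact continuous_const

theorem coneMap_apex : coneMap (Cone.apex P.Omega) = OC.vtx om := rfl

theorem coneMap_mk (y : P.Omega) (x : I) : coneMap (Quot.mk _ (Sum.inr (y, x))) =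
    OC.mixV (omegaMap y) om (le_om_of_ne y) x := rfl

theorem coneMap_base (y : P.Omega) : coneMap (Cone.base y) = omegaMap y :=
  OC.mixV_zero _ _ (le_om_of_ne y)

theorem Cone.cases {Y : Type*} [TopologicalSpace Y] (c : Cone Y) : c = Cone.apex Y ∨
    ∃ (y : Y) (x : I), x ≠ 1 ∧ c = Quot.mk _ (Sum.inr (y, x)) := by
  obtain ⟨⟨⟩ | ⟨y, x⟩, rfl⟩ := Quot.exists_rep c
  · exact .inl rfl
  · by_cases h : x = 1
    · subst h; exact .inl (Quot.sound (.top y))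
    · grind

theorem coneMap_om (y : P.Omega) (x : I) : coneMap (Quot.mk _ (Sum.inr (y, x))) om = x := by
  rw [coneMap_mk, OC.mixV_apply, omegaMap_om]
  simp

theorem coneMap_injective : Injective (coneMap : Cone P.Omega → _) := by
  have key : ∀ (y : P.Omega) (x : I), x ≠ 1 → coneMap (Cone.apex P.Omega) ≠
      coneMap (Quot.mk _ (Sum.inr (y, x))) := by
    intro y x hx h
    have h1 := coneMap_om y x
    rw [← h, coneMap_apex, OC.vtx_apply, if_pos rfl] at h1
    exact hx (Subtype.ext h1.symm)
  intro c c' h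
  rcases Cone.cases c with rfl | ⟨y, x, hx, rfl⟩ <;> rcases Cone.cases c' with rfl | ⟨y', x', hx', rfl⟩
  · rfl
  · grind
  · grind
  · obtain ⟨rfl, h'⟩ := OC.mixV_inj (h := le_om_of_ne y) (h' := le_om_of_ne y')
      (omegaMap_om y) (omegaMap_om y') h
    rw [omegaMap_injective (h'.resolve_left hx)]

theorem coneMap_le {c : Cone P.Omega} {p : P.Cell} (h : coneMap c p ≠ 0) : p ≤ om := by
  rcases Cone.cases c with rfl | ⟨y, x, hx, rfl⟩
  · rw [OC.vtx_ne h]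
  · rw [coneMap_mk, OC.mixV_apply] at h
    by_cases hp : p = om
    · rw [hp]
    · rw [if_neg hp, add_zero] at h; exact omegaMap_le (right_ne_zero_of_mul h)

theorem exists_coneMap {t : OC P.Cell} (ht : ∀ p, t p ≠ 0 → p ≤ om) : ∃ c, coneMap c = t := by
  by_cases h0 : t om = 0
  · obtain ⟨y, hy⟩ := exists_omegaMap (t := t) fun p hp =>
      lt_of_le_of_ne (ht p hp) fun h => hp (h ▸ h0)
    exact ⟨Cone.base y, by rw [coneMap_base, hy]⟩
  · by_cases h1 : t om = 1
    · exact ⟨Cone.apex _, by rw [OC.eq_vtx h1, coneMap_apex]⟩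
    · obtain ⟨z, h, x, hz, hx, hs, rfl⟩ := OC.exists_mixV t om h0 h1
      obtain ⟨y, rfl⟩ := exists_omegaMap (t := z) fun p hp =>
        lt_of_le_of_ne (ht p (hs p hp)) fun h => hp (h ▸ hz)
      exact ⟨Quot.mk _ (Sum.inr (y, x)), rfl⟩

/-- The point of the complex given by a point of a piece. -/
def pieceMap : P.Pieces → OC P.Cell
  | .inl c => coneMap c
  | .inr (.inl ⟨i, x, t⟩) =>
    OC.map (hdEmb i) (monotone_hdEmb i) (OC.prod (rectHomeo (deg i) x) t)
  | .inr (.inr (j, z, u)) => OC.map (polyEmb j) (monotone_polyEmb j)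
      (OC.prod (discHomeo (List.length_pos_of_ne_nil (P.rel_ne_nil j)) z) u)

theorem continuous_pieceMap : Continuous (pieceMap : P.Pieces → _) := by
  refine continuous_sum_dom.2 ⟨continuous_coneMap, continuous_sum_dom.2
    ⟨continuous_sigma fun i => ?_, continuous_prod_of_discrete_left.2 fun j => ?_⟩⟩
  · exact (OC.continuous_map _ (monotone_hdEmb i)).comp (OC.continuous_prod'
      ((rectHomeo (deg i)).continuous.comp continuous_fst) continuous_snd)
  · exact (OC.continuous_map _ (monotone_polyEmb j)).comp (OC.continuous_prod'
      ((discHomeo _).continuous.comp continuous_fst) continuous_snd)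

theorem pieceMap_rel {a b : P.Pieces} (h : P.AttachRel a b) : pieceMap a = pieceMap b := by
  rcases h with ⟨i, x⟩ | ⟨i, x⟩ | ⟨o, u, t, z, hz⟩ | ⟨o, u, t, z, hz⟩
  · simp only [pieceMap]
    rw [coneMap_base, omegaMap_toOmega, ribbonMap_disc, OC.prod_one, OC.map_map]
    rfl
  · simp only [pieceMap]
    rw [coneMap_base, omegaMap_toOmega, ribbonMap_disc, OC.prod_zero, OC.map_map]
    rfl
  · simp only [pieceMap]
    rw [discHomeo_boundary _ (o.2, false, t) z (by rw [hz, turn, angle]; simp), rect_leg]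
    simp only [bdry]
    rw [← OC.map_prod, ← OC.map_prod, ← OC.map_swap_prod, OC.map_map, OC.map_map]
    split_ifs with hs
    · rw [OC.map_map]
      refine OC.map_congr (funext ?_) _ _
      rintro ⟨υ, (_ | _) | _⟩ <;> simp [polyEmb, hdEmb, edge, hs]
    · rw [← OC.map_flip_prod, OC.map_map, OC.map_map]
      refine OC.map_congr (funext ?_) _ _
      rintro ⟨υ, (_ | _) | _⟩ <;> simp [polyEmb, hdEmb, edge, hs, IF.flip]
  · simp only [pieceMap]
    rw [discHomeo_boundary _ (o.2, true, t) z (by rw [hz, turn, angle]; simp), coneMap_base,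
      omegaMap_toOmega, ribbonMap_strip]
    simp only [bdry]
    rw [← OC.map_prod, ← OC.map_swap_prod, OC.map_map, OC.map_map]
    refine OC.map_congr (funext ?_) _ _
    rintro ⟨υ, (_ | _) | _⟩ <;> simp only [polyEmb, ribEmb, edge, Function.comp_apply, Prod.map,
      Prod.swap, id_eq]
    · simp
    · rw [show (⟨o.1, cyc o.2⟩ : P.Occ) = next o from rfl]; simp

/-- The point of the complex given by a point of the singular 3-manifold. -/
def xMap : P.X → OC P.Cell := Quot.lift pieceMap fun _ _ => pieceMap_rel

theorem continuous_xMap : Continuous (xMap : P.X → _) := continuous_quot_lift _ continuous_pieceMap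

/-- A point of the cone. -/
def conePt (c : Cone P.Omega) : P.X := Quot.mk _ (Sum.inl c)

/-- A point of a 1-handle. -/
def handlePt (i : Fin P.n) (x : Rect i) (t : I) : P.X := Quot.mk _ (Sum.inr (Sum.inl ⟨i, x, t⟩))

/-- A point of a 2-handle. -/
def platePt (j : Fin P.k) (z : Disc) (u : I) : P.X := Quot.mk _ (Sum.inr (Sum.inr (j, z, u)))

theorem xMap_conePt (c : Cone P.Omega) : xMap (conePt c) = coneMap c := rfl

theorem xMap_handlePt (i : Fin P.n) (x : Rect i) (t : I) : xMap (handlePt i x t) =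
    OC.map (hdEmb i) (monotone_hdEmb i) (OC.prod (rectHomeo (deg i) x) t) := rfl

theorem xMap_platePt (j : Fin P.k) (z : Disc) (u : I) : xMap (platePt j z u) =
    OC.map (polyEmb j) (monotone_polyEmb j)
      (OC.prod (discHomeo (List.length_pos_of_ne_nil (P.rel_ne_nil j)) z) u) := rfl

theorem handlePt_cases (i : Fin P.n) (x : Rect i) (t : I) :
    (∃ c, handlePt i x t = conePt c) ∨ (t ≠ 0 ∧ t ≠ 1) := by
  by_cases h0 : t = 0
  · subst h0; exact .inl ⟨_, Quot.sound (.handleBot i x)⟩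
  · by_cases h1 : t = 1
    · subst h1; exact .inl ⟨_, Quot.sound (.handleTop i x)⟩
    · grind

theorem platePt_boundary (j : Fin P.k) (z : Disc) (u : I) (hz : ‖(z : ℂ)‖ = 1) :
    (∃ c, platePt j z u = conePt c) ∨ (∃ i x t, platePt j z u = handlePt i x t) := by
  have hn := List.length_pos_of_ne_nil (P.rel_ne_nil j)
  have h0 : discHomeo hn z tp = 0 := by rw [discHomeo_tp, hz, sub_self]
  obtain ⟨⟨⟨m, k, t⟩, y⟩, rfl⟩ := discPar_surjective hn z
  have hy : y = 1 := by rw [norm_discPar] at hz; exact Subtype.ext hz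
  subst hy
  have hz' : (discPar ((m, k, t), 1) : ℂ) = turn (angle (m, k, t)) := by simp [discPar]
  rcases k
  · refine .inr ⟨_, _, _, Quot.sound (.overHandle ⟨j, m⟩ u t _ ?_)⟩; rw [hz', turn, angle]; simp
  · refine .inl ⟨_, Quot.sound (.alongRibbon ⟨j, m⟩ u t _ ?_)⟩; rw [hz', turn, angle]; simp

theorem X.cases (x : P.X) : (∃ c, x = conePt c) ∨
    (∃ i y t, t ≠ 0 ∧ t ≠ 1 ∧ x = handlePt i y t) ∨
    ∃ j, ∃ z : Disc, ∃ u, ‖(z : ℂ)‖ ≠ 1 ∧ x = platePt j z u := by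
  have key : ∀ i y t, (∃ c, handlePt (P := P) i y t = conePt c) ∨
    (∃ i' y' t', t' ≠ 0 ∧ t' ≠ 1 ∧ handlePt i y t = handlePt i' y' t') := by
    intro i y t
    rcases handlePt_cases i y t with h | h
    · exact .inl h
    · exact .inr ⟨i, y, t, h.1, h.2, rfl⟩
  obtain ⟨c | ⟨i, y, t⟩ | ⟨j, z, u⟩, rfl⟩ := Quot.exists_rep x
  · exact .inl ⟨c, rfl⟩
  · exact (key i y t).imp_right .inl
  · by_cases hz : ‖(z : ℂ)‖ = 1
    · rcases platePt_boundary j z u hz with ⟨c, h⟩ | ⟨i, x, t, h⟩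
      · exact .inl ⟨c, h⟩
      · rcases key i x t with ⟨c, h'⟩ | ⟨i', y', t', h1, h2, h'⟩
        · exact .inl ⟨c, h.trans h'⟩
        · exact .inr (.inl ⟨i', y', t', h1, h2, h.trans h'⟩)
    · exact .inr (.inr ⟨j, z, u, hz, rfl⟩)

theorem hdEmb_injective (i : Fin P.n) : Injective (hdEmb i) :=
  injective_of_le_iff (hdEmb_reflect i)

theorem polyEmb_injective (j : Fin P.k) : Injective (polyEmb j) :=
  injective_of_le_iff fun a a' => (polyEmb_le_iff j a a').1

theorem exists_hd_md {i : Fin P.n} {y : Rect i} {t : I} (h0 : t ≠ 0) (h1 : t ≠ 1) :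
    ∃ a, xMap (handlePt i y t) (hd i a .md) ≠ 0 := by
  obtain ⟨a, ha⟩ := OC.prod_md_ne (s := rectHomeo (deg i) y) h0 h1
  refine ⟨a, ?_⟩
  rw [← OC.map_apply (he := monotone_hdEmb i) (hdEmb_injective i)] at ha
  exact ha

theorem exists_dc {j : Fin P.k} {z : Disc} {u : I} (hz : ‖(z : ℂ)‖ ≠ 1) :
    ∃ υ, xMap (platePt j z u) (dc j υ) ≠ 0 := by
  have hn := List.length_pos_of_ne_nil (P.rel_ne_nil j)
  have h0 : discHomeo hn z tp ≠ 0 := by rw [discHomeo_tp, sub_ne_zero]; exact hz.symm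
  rw [← OC.map_fst_prod (discHomeo hn z) u] at h0
  obtain ⟨⟨a, υ⟩, rfl, h⟩ := OC.map_ne (he := monotone_fst) h0
  refine ⟨υ, ?_⟩
  rw [← OC.map_apply (he := monotone_polyEmb j) (polyEmb_injective j)] at h
  exact h

theorem xMap_injective : Injective (xMap : P.X → _) := by
  have k1 : ∀ c i y t, t ≠ 0 → t ≠ 1 → xMap (conePt (P := P) c) ≠ xMap (handlePt i y t) := by
    intro c i y t h0 h1 h
    obtain ⟨a, ha⟩ := exists_hd_md (i := i) (y := y) h0 h1
    rw [← h, xMap_conePt] at ha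
    rcases le_om_iff.1 (coneMap_le ha) with h | ⟨c, h⟩ | ⟨b, h⟩ <;> cases h
  have k2 : ∀ c j (z : Disc) u, ‖(z : ℂ)‖ ≠ 1 → xMap (conePt (P := P) c) ≠ xMap (platePt j z u) := by
    intro c j z u hz h
    obtain ⟨υ, hυ⟩ := exists_dc (j := j) (u := u) hz
    rw [← h, xMap_conePt] at hυ
    rcases le_om_iff.1 (coneMap_le hυ) with h | ⟨c, h⟩ | h <;> cases h
  have k3 : ∀ i y t j (z : Disc) u, ‖(z : ℂ)‖ ≠ 1 →
      xMap (handlePt (P := P) i y t) ≠ xMap (platePt j z u) := by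
    intro i y t j z u hz h
    obtain ⟨υ, hυ⟩ := exists_dc (j := j) (u := u) hz
    rw [← h, xMap_handlePt] at hυ
    obtain ⟨a, h, -⟩ := OC.map_ne (he := monotone_hdEmb i) hυ
    cases h
  intro x x' h
  rcases X.cases x with ⟨c, rfl⟩ | ⟨i, y, t, h0, h1, rfl⟩ | ⟨j, z, u, hz, rfl⟩ <;>
    rcases X.cases x' with ⟨c', rfl⟩ | ⟨i', y', t', h0', h1', rfl⟩ | ⟨j', z', u', hz', rfl⟩
  · rw [coneMap_injective h]
  · grind
  · grind
  · grind
  · obtain ⟨a, ha⟩ := exists_hd_md (i := i) (y := y) h0 h1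
    rw [h, xMap_handlePt] at ha
    obtain ⟨a, h', -⟩ := OC.map_ne (he := monotone_hdEmb i') ha
    simp only [hdEmb, hd.injEq] at h'
    obtain ⟨rfl, -⟩ := h'
    obtain ⟨h1, h2⟩ := OC.prod_injective (OC.map_injective (monotone_hdEmb _) (hdEmb_injective _) h)
    rw [(rectHomeo _).injective h1, h2]
  · grind
  · grind
  · grind
  · obtain ⟨υ, hυ⟩ := exists_dc (j := j) (u := u) hz
    rw [h, xMap_platePt] at hυ
    obtain ⟨⟨⟨m, b⟩ | m | m | _, υ'⟩, h', -⟩ := OC.map_ne (he := monotone_polyEmb j') hυ <;>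
      simp only [polyEmb] at h' <;> cases h'
    obtain ⟨h1, h2⟩ := OC.prod_injective
      (OC.map_injective (monotone_polyEmb _) (polyEmb_injective _) h)
    rw [(discHomeo _).injective h1, h2]

theorem xMap_surjective : Surjective (xMap : P.X → _) := by
  intro t
  obtain ⟨p, hp, hm⟩ := t.exists_max
  have hcone : (p ≤ om) → ∃ x, xMap x = t := by
    intro h
    obtain ⟨c, hc⟩ := exists_coneMap (t := t) fun q hq => (hm q hq).trans h
    exact ⟨conePt c, hc⟩
  rcases p with ⟨i, a, τ⟩ | ⟨o', υ'⟩ | ⟨j, υ'⟩ | c | _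
  · obtain ⟨s, rfl⟩ := OC.exists_map_eq (monotone_hdEmb i) (hdEmb_reflect i) t fun q hq =>
      le_hd_top.1 ((hm q hq).trans (hd_le_hd.2 ⟨le_tp _, le_md _⟩))
    obtain ⟨s, x, rfl⟩ := OC.exists_prod s
    refine ⟨handlePt i ((rectHomeo _).symm s) x, ?_⟩
    rw [xMap_handlePt, Homeomorph.apply_symm_apply]
  · exact hcone (.inr (.inr (.inl ⟨_, _, rfl⟩)))
  · obtain ⟨s, rfl⟩ := OC.exists_map_eq (monotone_polyEmb j) (fun a a' => (polyEmb_le_iff j a a').1) t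
      fun q hq => le_dc_md.1 ((hm q hq).trans (dc_le_dc.2 ⟨rfl, le_md _⟩))
    obtain ⟨s, x, rfl⟩ := OC.exists_prod s
    refine ⟨platePt j ((discHomeo (List.length_pos_of_ne_nil (P.rel_ne_nil j))).symm s) x, ?_⟩
    rw [xMap_platePt, Homeomorph.apply_symm_apply]
  · exact hcone (.inr (.inl ⟨_, rfl⟩))
  · grind

/-! ### Compactness and the homeomorphisms -/

instance : CompactSpace P.Ribbon := inferInstanceAs (CompactSpace (Quot P.RibbonRel))

instance : CompactSpace (Ribbon.boundary P) := by
  rw [← isCompact_iff_compactSpace]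
  refine IsClosed.isCompact ?_
  have : Ribbon.boundary P = ⋃ c : P.Caps, ⋂ (p : P.Cell) (_ : ¬ Bd p c), {z | ribbonMap z p = 0} := by
    ext z
    rw [mem_boundary_iff]
    simp only [Set.mem_iUnion, Set.mem_iInter, Set.mem_ofPred_eq]
    exact exists_congr fun c => forall_congr' fun p => not_imp_comm
  rw [this]
  exact isClosed_iUnion_of_finite fun c => isClosed_iInter fun p => isClosed_iInter fun _ =>
    isClosed_eq ((OC.continuous_coord p).comp continuous_ribbonMap) continuous_const

instance : CompactSpace P.Omega := inferInstanceAs (CompactSpace (Quot P.CapRel))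

instance (Y : Type*) [TopologicalSpace Y] [CompactSpace Y] : CompactSpace (Cone Y) :=
  inferInstanceAs (CompactSpace (Quot (ConeRel Y)))

instance : CompactSpace P.X := inferInstanceAs (CompactSpace (Quot P.AttachRel))

/-- The singular 3-manifold as an order complex. -/
def xHomeo : P.X ≃ₜ OC P.Cell :=
  continuous_xMap.homeoOfEquivCompactToT2 (f := Equiv.ofBijective _ ⟨xMap_injective, xMap_surjective⟩)

instance : T2Space P.X := xHomeo.symm.t2Space

variable (P) in
/-- The cells of the closed ribbon surface. -/
abbrev OmegaCell : Type := {p : P.Cell // p < om}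

instance : Fintype P.OmegaCell := Fintype.ofFinite _

theorem monotone_omegaCell : Monotone (Subtype.val : P.OmegaCell → P.Cell) := fun _ _ h => h

theorem exists_omegaHomeo (y : P.Omega) :
    ∃ s : OC P.OmegaCell, OC.map Subtype.val monotone_omegaCell s = omegaMap y :=
  OC.exists_map_eq monotone_omegaCell (fun _ _ h => h) _ fun p hp =>
    ⟨⟨p, lt_of_le_of_ne (omegaMap_le hp) fun h => hp (h ▸ omegaMap_om y)⟩, rfl⟩

theorem exists_omega_of_complex (s : OC P.OmegaCell) :
    ∃ y, omegaMap y = OC.map Subtype.val monotone_omegaCell s :=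
  exists_omegaMap fun p hp => by
    obtain ⟨a, rfl, -⟩ := OC.map_ne (he := monotone_omegaCell) hp
    exact a.2

theorem isEmbedding_omegaMap : IsEmbedding (omegaMap : P.Omega → OC P.Cell) :=
  (continuous_omegaMap.isClosedEmbedding omegaMap_injective).isEmbedding

instance : T2Space P.Omega := isEmbedding_omegaMap.t2Space

/-- The closed ribbon surface as an order complex. -/
def omegaHomeo : OC P.OmegaCell ≃ₜ P.Omega := by
  refine Continuous.homeoOfEquivCompactToT2 (f := Equiv.ofBijective
    (fun s => (exists_omega_of_complex s).choose) ⟨fun s s' h => ?_, fun y => ?_⟩) ?_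
  · refine OC.map_injective monotone_omegaCell Subtype.val_injective ?_
    rw [← (exists_omega_of_complex s).choose_spec, ← (exists_omega_of_complex s').choose_spec]
    exact congrArg _ h
  · obtain ⟨s, hs⟩ := exists_omegaHomeo y
    refine ⟨s, omegaMap_injective ?_⟩
    rw [← hs]
    exact (exists_omega_of_complex s).choose_spec
  · rw [isEmbedding_omegaMap.continuous_iff]
    have : omegaMap ∘ (fun s : OC P.OmegaCell => (exists_omega_of_complex s).choose) =
        OC.map Subtype.val monotone_omegaCell :=
      funext fun s => (exists_omega_of_complex s).choose_spec
    change Continuous (omegaMap ∘ (fun s : OC P.OmegaCell => (exists_omega_of_complex s).choose))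
    rw [this]
    exact OC.continuous_map _ _

theorem hasLink_omega : HasLink P.X P.omega P.Omega := by
  refine ⟨conePt, ?_, rfl, ?_⟩
  · have hc : Continuous (conePt : Cone P.Omega → P.X) := continuous_quot_mk.comp continuous_inl
    refine (hc.isClosedEmbedding fun c c' h => coneMap_injective ?_).isEmbedding
    rw [← xMap_conePt, h, xMap_conePt]
  · have ho : IsOpen {x : P.X | xMap x om ≠ 0} :=
      isOpen_ne_fun ((OC.continuous_coord om).comp continuous_xMap) continuous_const
    refine Filter.mem_of_superset (ho.mem_nhds ?_) ?_
    · change coneMap (Cone.apex P.Omega) om ≠ 0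
      rw [coneMap_apex, OC.vtx_apply, if_pos rfl]
      exact one_ne_zero
    · intro x hx
      obtain ⟨c, hc⟩ := exists_coneMap (t := xMap x) fun p hp => by
        rcases (xMap x).chain p om hp hx with h | h
        · exact h
        · rw [om_le.1 h]
      exact ⟨c, xMap_injective hc⟩

end FinPresentation

/-! ### Balls -/

/-- A space that can be embedded as an open subset into each of its nonempty open subsets. -/
def Shrinks (C : Type*) [TopologicalSpace C] : Prop :=
  ∀ W : Set C, IsOpen W → W.Nonempty → ∃ f : C → C, IsOpenEmbedding f ∧ Set.range f ⊆ W

theorem Shrinks.of_subsingleton {C : Type*} [TopologicalSpace C] [Subsingleton C] : Shrinks C :=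
  fun W _ hW => ⟨id, .id, fun x _ => by obtain ⟨y, hy⟩ := hW; rwa [Subsingleton.elim x y]⟩

theorem Shrinks.of_homeomorph {C D : Type*} [TopologicalSpace C] [TopologicalSpace D] (h : C ≃ₜ D)
    (hD : Shrinks D) : Shrinks C := by
  intro W hW hne
  obtain ⟨f, hf, hr⟩ := hD (h.symm ⁻¹' W) (hW.preimage h.symm.continuous)
    (hne.preimage h.symm.surjective)
  refine ⟨h.symm ∘ f ∘ h, h.symm.isOpenEmbedding.comp (hf.comp h.isOpenEmbedding), ?_⟩
  rintro _ ⟨x, rfl⟩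
  exact hr ⟨h x, rfl⟩

theorem Shrinks.prod {C D : Type*} [TopologicalSpace C] [TopologicalSpace D] (hC : Shrinks C)
    (hD : Shrinks D) : Shrinks (C × D) := by
  rintro W hW ⟨⟨x, y⟩, h⟩
  obtain ⟨U, V, hU, hV, hx, hy, hs⟩ := isOpen_prod_iff.1 hW x y h
  obtain ⟨f, hf, hfr⟩ := hC U hU ⟨x, hx⟩
  obtain ⟨g, hg, hgr⟩ := hD V hV ⟨y, hy⟩
  refine ⟨Prod.map f g, hf.prodMap hg, ?_⟩
  rintro _ ⟨⟨a, b⟩, rfl⟩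
  exact hs ⟨hfr ⟨a, rfl⟩, hgr ⟨b, rfl⟩⟩

theorem Shrinks.of_isBounded {C E : Type*} [TopologicalSpace C] [NormedAddCommGroup E]
    [NormedSpace ℝ E] {j : C → E} (hj : IsOpenEmbedding j)
    (hb : Bornology.IsBounded (Set.range j)) : Shrinks C := by
  rintro W hW ⟨x₀, h₀⟩
  obtain ⟨r, hr, hs⟩ := Metric.isOpen_iff.1 (hj.isOpenMap W hW) (j x₀) ⟨x₀, h₀, rfl⟩
  obtain ⟨R, hR⟩ := hb.exists_norm_le
  have hR0 : 0 ≤ R := (norm_nonneg _).trans (hR _ ⟨x₀, rfl⟩)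
  obtain ⟨ε, hε0, hε1, hε⟩ : ∃ ε : ℝ, 0 < ε ∧ ε ≤ 1 ∧ ε * (2 * R) < r := by
    refine ⟨min 1 (r / (2 * R + 1)), by positivity, min_le_left _ _, ?_⟩
    calc _ ≤ r / (2 * R + 1) * (2 * R) := by gcongr; exact min_le_right _ _
      _ < r := by
        rw [div_mul_eq_mul_div, div_lt_iff₀ (by positivity)]
        nlinarith
  have hm : ∀ x : C, ∃ y ∈ W, j y = j x₀ + ε • (j x - j x₀) := by
    intro x
    refine hs ?_
    rw [Metric.mem_ball, dist_eq_norm, add_sub_cancel_left, norm_smul, Real.norm_of_nonneg hε0.le]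
    refine lt_of_le_of_lt (mul_le_mul_of_nonneg_left ((norm_sub_le _ _).trans ?_) hε0.le) hε
    linarith [hR _ ⟨x, rfl⟩, hR _ ⟨x₀, rfl⟩]
  choose f hfW hf using hm
  refine ⟨f, ?_, by rintro _ ⟨x, rfl⟩; exact hfW x⟩
  refine IsOpenEmbedding.of_comp _ hj ?_
  let h : E ≃ₜ E := ((Homeomorph.addRight (-j x₀)).trans
    (Homeomorph.smulOfNeZero ε hε0.ne')).trans (Homeomorph.addLeft (j x₀))
  have : j ∘ f = h ∘ j := by
    funext x
    simp only [Function.comp_apply, hf, h, Homeomorph.trans_apply, Homeomorph.coe_addRight,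
      Homeomorph.smulOfNeZero_apply, Homeomorph.coe_addLeft, sub_eq_add_neg]
  rw [this]
  exact h.isOpenEmbedding.comp hj

/-- The product with the interval as an order complex. -/
def prodHomeo (A : Type*) [Fintype A] [PartialOrder A] : OC A × I ≃ₜ OC (A × IF) :=
  OC.continuous_prod.homeoOfEquivCompactToT2 (f := Equiv.ofBijective (fun z => OC.prod z.1 z.2)
    ⟨fun z w h => Prod.ext (OC.prod_injective h).1 (OC.prod_injective h).2, fun t => by
      obtain ⟨s, x, h⟩ := OC.exists_prod t
      exact ⟨(s, x), h⟩⟩)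

theorem OC.prod_top_ne {A : Type*} [Fintype A] [PartialOrder A] {a : A} (ha : ∀ b, b ≤ a)
    (s : OC A) (x : I) : OC.prod s x (a, md) ≠ 0 ↔ s a ≠ 0 ∧ x ≠ 0 ∧ x ≠ 1 := by
  have hx : iota x md ≠ 0 ↔ x ≠ 0 ∧ x ≠ 1 := by
    refine ⟨fun h => ⟨?_, ?_⟩, fun h => iota_md_ne h.1 h.2⟩ <;> rintro rfl
    · rw [iota_zero, OC.vtx_apply] at h; simp at h
    · rw [iota_one, OC.vtx_apply] at h; simp at h
  have ht := OC.prod s x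
  have key : OC.prod s x (a, md) = min (s a) (iota x md) := by
    have h1 : s a = mass (OC.prod s x).1 (Prod.fst ⁻¹' Set.Ici a) := by
      rw [← mass_push, ← OC.map_val _ monotone_fst, OC.map_fst_prod, mass_Ici]
      rw [mass_congr (V := ∅) fun p _ => by simpa using fun h => (h.not_ge (ha p)).elim]
      simp [mass]
    have h2 : iota x md = mass (OC.prod s x).1 (Prod.snd ⁻¹' Set.Ici md) := by
      rw [← mass_push, ← OC.map_val _ monotone_snd, OC.map_snd_prod, mass_Ici]
      rw [mass_congr (V := ∅) fun p _ => by simpa using fun h => (h.not_ge (le_md p)).elim]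
      simp [mass]
    rw [h1, h2, ← mass_inter (OC.nonneg _) (OC.chain _)]
    · rw [show Prod.fst ⁻¹' Set.Ici a ∩ Prod.snd ⁻¹' Set.Ici md = Set.Ici (a, md) from by
        ext ⟨b, c⟩; simp [Prod.le_def], mass_Ici]
      rw [mass_congr (V := ∅) fun p _ => by
        simpa using fun h => (h.not_ge ⟨ha p.1, le_md p.2⟩).elim]
      simp [mass]
    · exact (isUpperSet_Ici a).preimage monotone_fst
    · exact (isUpperSet_Ici md).preimage monotone_snd
  rw [key, ← hx]
  constructor
  · intro h
    refine ⟨fun h' => h ?_, fun h' => h ?_⟩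
    · rw [h', min_eq_left (OC.nonneg _ _)]
    · rw [h', min_eq_right (OC.nonneg _ _)]
  · grind

section IsBall

variable {Q R : Type} [PartialOrder Q] [PartialOrder R]

/-- The open cell of `p` is a ball. -/
def IsBall (p : Q) : Prop :=
  ∃ (A : Type) (_ : Fintype A) (_ : PartialOrder A) (e : A → Q) (a : A),
    (∀ x y, e x ≤ e y ↔ x ≤ y) ∧ Set.range e = Set.Iic p ∧ e a = p ∧
      Shrinks {t : OC A // t a ≠ 0}

theorem IsBall.map {p : Q} (h : IsBall p) {j : Q → R} (hj : ∀ x y, j x ≤ j y ↔ x ≤ y)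
    (hr : ∀ x y, x ≤ j y → x ∈ Set.range j) : IsBall (j p) := by
  obtain ⟨A, _, _, e, a, h1, h2, h3, h4⟩ := h
  refine ⟨A, _, _, j ∘ e, a, fun x y => (hj _ _).trans (h1 _ _), ?_, congrArg j h3, h4⟩
  rw [Set.range_comp, h2]
  ext x
  constructor
  · grind
  · grind

theorem IsBall.of_map {p : Q} {j : Q → R} (h : IsBall (j p)) (hj : ∀ x y, j x ≤ j y ↔ x ≤ y)
    (hr : ∀ x y, x ≤ j y → x ∈ Set.range j) : IsBall p := by
  obtain ⟨A, _, _, e, a, h1, h2, h3, h4⟩ := h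
  have hi : Injective j := FinPresentation.injective_of_le_iff fun x y => (hj x y).1
  have hm : ∀ x : A, ∃ y, j y = e x := fun x => hr _ p (by
    have : e x ∈ Set.range e := ⟨x, rfl⟩
    rwa [h2] at this)
  choose f hf using hm
  refine ⟨A, _, _, f, a, fun x y => by rw [← hj, hf, hf, h1], ?_, hi (by rw [hf, h3]), h4⟩
  ext x
  rw [Set.mem_Iic, ← hj, ← Set.mem_Iic, ← h2]
  constructor
  · grind
  · grind

theorem IsBall.of_minimal {p : Q} (h : ∀ q ≤ p, q = p) : IsBall p := by
  refine ⟨Unit, inferInstance, inferInstance, fun _ => p, (), fun _ _ => by simp, ?_, rfl, ?_⟩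
  · grind
  · have : Subsingleton (OC Unit) := ⟨fun s t => by
      rw [OC.eq_vtx_of_ne (t := s) (p := ()) fun _ _ => rfl,
        OC.eq_vtx_of_ne (t := t) (p := ()) fun _ _ => rfl]⟩
    exact Shrinks.of_subsingleton

theorem IsBall.prod_md {p : Q} (h : IsBall p) : IsBall (p, md) := by
  obtain ⟨A, _, _, e, a, h1, h2, h3, h4⟩ := h
  refine ⟨A × IF, inferInstance, inferInstance, Prod.map e id, (a, md), fun x y => ?_, ?_, ?_, ?_⟩
  · simp [Prod.le_def, h1]
  · rw [Set.range_prodMap, h2]; ext ⟨x, y⟩; simp [Prod.le_def]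
  · simp [h3]
  · have ha : ∀ b, b ≤ a := fun b => by rw [← h1, h3, ← Set.mem_Iic, ← h2]; exact ⟨b, rfl⟩
    have hI : Shrinks {x : I // x ≠ 0 ∧ x ≠ 1} := by
      have hr : Set.range (fun x : {x : I // x ≠ 0 ∧ x ≠ 1} => (x : ℝ)) = Set.Ioo 0 1 := by
        ext y
        constructor
        · grind
        · rintro ⟨h0, h1⟩
          refine ⟨⟨⟨y, h0.le, h1.le⟩, fun h => h0.ne' (congrArg Subtype.val h),
            fun h => h1.ne (congrArg Subtype.val h)⟩, rfl⟩
      refine Shrinks.of_isBounded (j := fun x : {x : I // x ≠ 0 ∧ x ≠ 1} => (x : ℝ))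
        ⟨IsEmbedding.subtypeVal.comp .subtypeVal, hr ▸ isOpen_Ioo⟩ ?_
      exact hr ▸ Metric.isBounded_Ioo 0 1
    refine Shrinks.of_homeomorph ?_ (h4.prod hI)
    let f := (prodHomeo A).symm.subtype (p := fun t => t (a, md) ≠ 0)
      (q := fun z => z.1 a ≠ 0 ∧ (z.2 ≠ 0 ∧ z.2 ≠ 1)) fun t => by
        rw [← OC.prod_top_ne ha]
        conv_lhs => rw [← (prodHomeo A).apply_symm_apply t]
        rfl
    exact f.trans
      { toFun := fun z => (⟨z.1.1, z.2.1⟩, ⟨z.1.2, z.2.2⟩)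
        invFun := fun z => ⟨(z.1.1, z.2.1), z.1.2, z.2.2⟩
        left_inv := fun _ => rfl
        right_inv := fun _ => rfl
        continuous_toFun := by fun_prop
        continuous_invFun := by fun_prop }

theorem IsBall.prod_en {p : Q} (h : IsBall p) (b : Bool) : IsBall (p, en b) :=
  h.map (j := fun q => (q, en b)) (fun x y => by simp [Prod.le_def]) fun x y hx =>
    ⟨x.1, by rw [← le_en.1 hx.2]⟩

theorem IsBall.prod {p : Q} (h : IsBall p) (τ : IF) : IsBall (p, τ) := by
  rcases τ with b | _
  · exact h.prod_en b
  · exact h.prod_md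

theorem isBall_if (τ : IF) : IsBall τ :=
  ((IsBall.of_minimal (Q := Unit) (p := ()) fun _ _ => rfl).prod τ).of_map (j := fun τ => ((), τ))
    (fun x y => by simp [Prod.le_def]) fun x _ _ => ⟨x.2, rfl⟩

theorem isBall_poly {n : ℕ} (hn : 0 < n) (a : Poly n) : IsBall a := by
  have he : ∀ s k τ, IsBall (Poly.edge (n := n) s k τ) := fun s k τ =>
    (isBall_if τ).map (j := Poly.edge s k) (fun x y => by
      refine ⟨fun h => ?_, fun h => Poly.monotone_edge s k h⟩
      rcases k <;> rcases x with (_ | _) | _ <;> rcases y with (_ | _) | _ <;>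
        simp_all [Poly.edge]) fun x y hx => by
      have hx := hx.trans (Poly.monotone_edge s k (le_md y))
      rcases k <;> rcases x with ⟨t, b⟩ | t | t | _ <;> simp [Poly.edge] at hx
      · exact ⟨.en b, by simp [Poly.edge, hx]⟩
      · exact ⟨.md, by simp [Poly.edge, hx]⟩
      · rcases hx with ⟨rfl, rfl⟩ | ⟨rfl, rfl⟩
        · exact ⟨.en false, rfl⟩
        · exact ⟨.en true, rfl⟩
      · exact ⟨.md, by simp [Poly.edge, hx]⟩
  rcases a with ⟨s, b⟩ | s | s | _
  · exact he s false (.en b)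
  · exact he s false .md
  · exact he s true .md
  · refine ⟨Poly n, inferInstance, inferInstance, id, .tp, fun _ _ => Iff.rfl, ?_, rfl, ?_⟩
    · ext x; simp
    · let j : {t : OC (Poly n) // t .tp ≠ 0} → ℂ := fun t => ((discHomeo hn).symm t.1 : ℂ)
      have hr : Set.range j = Metric.ball 0 1 := by
        ext z
        rw [mem_ball_zero_iff]
        constructor
        · rintro ⟨t, rfl⟩
          have h1 := t.2
          rw [← (discHomeo hn).apply_symm_apply t.1, discHomeo_tp, sub_ne_zero] at h1
          exact lt_of_le_of_ne (mem_closedBall_zero_iff.1 ((discHomeo hn).symm t.1).2) h1.symm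
        · intro hz
          refine ⟨⟨discHomeo hn ⟨z, mem_closedBall_zero_iff.2 hz.le⟩, ?_⟩, ?_⟩
          · rw [discHomeo_tp, sub_ne_zero]; exact hz.ne'
          · simp [j]
      refine Shrinks.of_isBounded (j := j) ⟨IsEmbedding.subtypeVal.comp
        ((discHomeo hn).symm.isEmbedding.comp .subtypeVal), hr ▸ Metric.isOpen_ball⟩
        (hr ▸ Metric.isBounded_ball)

end IsBall

/-! ### Stars -/

section Star

variable {Q : Type} [Fintype Q] [PartialOrder Q]

/-- The open star of `p`. -/
abbrev Star (p : Q) : Type := {t : OC Q // t p ≠ 0}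

theorem isOpen_star (p : Q) : IsOpen {t : OC Q | t p ≠ 0} :=
  isOpen_ne_fun (OC.continuous_coord p) continuous_const

/-- The upper part of the star. -/
abbrev Upper (p : Q) : Type :=
  {g : Q → ℝ // (∀ q, 0 ≤ g q) ∧ ChainSupp g ∧ (∀ q, g q ≠ 0 → p < q) ∧ ∑ q, g q < 1}

variable {A : Type} [Fintype A] [PartialOrder A] {p : Q} {e : A → Q} {a : A}

theorem star_decomposition (he : ∀ x y, e x ≤ e y ↔ x ≤ y)
    (hr : Set.range e = Set.Iic p) (ha : e a = p) :
    ∃ h : Star p ≃ₜ {s : OC A // s a ≠ 0} × Upper p, ∀ t x, (h t).1.1 x ≠ 0 ↔ t.1 (e x) ≠ 0 := by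
  subst ha
  have hi : Injective e := FinPresentation.injective_of_le_iff fun x y => (he x y).1
  have hle : ∀ x, e x ≤ e a := fun x => by rw [← Set.mem_Iic, ← hr]; exact ⟨x, rfl⟩
  let m : OC Q → ℝ := fun t => ∑ x, t (e x)
  let g : OC Q → Q → ℝ := fun t q => if e a < q then t q else 0
  have hg : ∀ t : Star (e a), t.1.1 = push e (fun x => t.1 (e x)) + g t.1 := by
    intro t
    funext q
    simp only [Pi.add_apply, g]
    by_cases hq : q ≤ e a
    · obtain ⟨x, rfl⟩ : q ∈ Set.range e := by rw [hr]; exact hq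
      rw [push_apply hi, if_neg hq.not_gt, add_zero]
    · rw [push_eq_zero (e := e) fun x (h : e x = q) => absurd (h ▸ hle x) hq, zero_add]
      split_ifs with h
      · rfl
      · by_contra h'
        rcases t.1.chain (e a) q t.2 h' with h1 | h1
        · exact h (lt_of_le_of_ne h1 fun h2 => hq h2.ge)
        · exact hq h1
  have hs : ∀ t : Star (e a), m t.1 + ∑ q, g t.1 q = 1 := by
    intro t
    rw [← t.1.sum_eq]
    conv_rhs => rw [hg t]
    simp only [Pi.add_apply, Finset.sum_add_distrib, sum_push]
    rfl
  have hm : ∀ t : Star (e a), 0 < m t.1 := fun t =>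
    lt_of_lt_of_le ((t.1.nonneg (e a)).lt_of_ne t.2.symm) (by
      exact Finset.single_le_sum (f := fun x => t.1 (e x)) (fun x _ => t.1.nonneg _)
        (Finset.mem_univ a))
  have hgc : ∀ q, Continuous fun t : OC Q => g t q := fun q => by
    simp only [g]
    split_ifs
    · exact OC.continuous_coord q
    · exact continuous_const
  have hmc : Continuous m := continuous_finsetSum _ fun x _ => OC.continuous_coord _
  let lower : Star (e a) → OC A := fun t => ⟨fun x => t.1 (e x) / m t.1,
    fun x => div_nonneg (t.1.nonneg _) (hm t).le,
    by rw [← Finset.sum_div]; exact div_self (hm t).ne', fun x y hx hy => by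
      rw [← he, ← he]
      exact t.1.chain _ _ (fun h => hx (by simp only [h, zero_div])) fun h => hy (by simp only [h, zero_div])⟩
  have hlow : ∀ t x, lower t x ≠ 0 ↔ t.1 (e x) ≠ 0 := fun t x => by
    simp only [lower, ne_eq, div_eq_zero_iff, (hm t).ne', or_false]
  let upper : Star (e a) → Upper (e a) := fun t => ⟨g t.1, fun q => by
      simp only [g]; split_ifs; exacts [t.1.nonneg q, le_rfl], fun q q' hq hq' => by
      simp only [g, ne_eq, ite_eq_right_iff, Classical.not_imp] at hq hq'
      exact t.1.chain _ _ hq.2 hq'.2, fun q hq => by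
      simp only [g, ne_eq, ite_eq_right_iff, Classical.not_imp] at hq
      exact hq.1, by have := hs t; have := hm t; linarith⟩
  have hz : ∀ (u : Upper (e a)) x, u.1 (e x) = 0 := fun u x => by
    by_contra h
    exact (u.2.2.2.1 _ h).not_ge (hle x)
  have hval : ∀ (s : OC A) (u : Upper (e a)) x,
      ((1 - ∑ q, u.1 q) • push e s.1 + u.1) (e x) = (1 - ∑ q, u.1 q) * s x := fun s u x => by
    simp only [Pi.add_apply, Pi.smul_apply, smul_eq_mul, push_apply hi, hz, add_zero]
  have hu : ∀ u : Upper (e a), 0 < 1 - ∑ q, u.1 q := fun u => sub_pos.2 u.2.2.2.2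
  let inv : {s : OC A // s a ≠ 0} × Upper (e a) → Star (e a) := fun z =>
    ⟨⟨(1 - ∑ q, z.2.1 q) • push e z.1.1.1 + z.2.1, fun q =>
      add_nonneg (mul_nonneg (hu z.2).le (push_nonneg z.1.1.nonneg q)) (z.2.2.1 q), by
        simp only [Pi.add_apply, Pi.smul_apply, smul_eq_mul, Finset.sum_add_distrib,
          ← Finset.mul_sum, sum_push, OC.sum_eq]
        ring, by
        have key : ∀ q, ((1 - ∑ q, z.2.1 q) • push e z.1.1.1 + z.2.1) q ≠ 0 →
            (∃ x, e x = q ∧ z.1.1 x ≠ 0) ∨ z.2.1 q ≠ 0 := by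
          intro q hq
          by_contra! h
          refine hq ?_
          rw [Pi.add_apply, h.2, Pi.smul_apply, push_eq_zero h.1]
          simp
        intro q q' hq hq'
        rcases key q hq with ⟨x, rfl, hx⟩ | h <;> rcases key q' hq' with ⟨y, rfl, hy⟩ | h'
        · rw [he, he]; exact z.1.1.chain x y hx hy
        · grind
        · grind
        · exact z.2.2.2.1 q q' h h'⟩, by
      change ((1 - ∑ q, z.2.1 q) • push e z.1.1.1 + z.2.1) (e a) ≠ 0
      rw [hval]
      exact mul_ne_zero (hu z.2).ne' z.1.2⟩
  have hminv : ∀ z, m (inv z).1 = 1 - ∑ q, z.2.1 q := fun z => by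
    change ∑ x, ((1 - ∑ q, z.2.1 q) • push e z.1.1.1 + z.2.1) (e x) = _
    simp only [hval]
    rw [← Finset.mul_sum, OC.sum_eq, mul_one]
  refine ⟨{ toFun := fun t => (⟨lower t, by rw [hlow]; exact t.2⟩, upper t)
            invFun := inv, left_inv := fun t => ?_, right_inv := fun z => ?_,
            continuous_toFun := ?_, continuous_invFun := ?_ }, hlow⟩
  · refine Subtype.ext (Subtype.ext ?_)
    change (1 - ∑ q, g t.1 q) • push e (lower t).1 + g t.1 = t.1.1
    conv_rhs => rw [hg t]
    rw [← push_smul]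
    congr 2
    funext x
    rw [← hs t, add_sub_cancel_right]
    exact mul_div_cancel₀ _ (hm t).ne'
  · refine Prod.ext (Subtype.ext (Subtype.ext (funext fun x => ?_))) (Subtype.ext (funext fun q => ?_))
    · grind
    · change (if e a < q then ((1 - ∑ q, z.2.1 q) • push e z.1.1.1 + z.2.1) q else 0) = z.2.1 q
      split_ifs with h
      · simp only [Pi.add_apply, Pi.smul_apply]
        rw [push_eq_zero (e := e) fun x (hx : e x = q) => absurd h (hx ▸ hle x).not_gt]
        simp
      · grind
  · refine Continuous.prodMk (Continuous.subtype_mk (OC.continuous_of_coord fun x => ?_) _)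
      (Continuous.subtype_mk (continuous_pi fun q => (hgc q).comp continuous_subtype_val) _)
    exact ((OC.continuous_coord (e x)).comp continuous_subtype_val).div
      (hmc.comp continuous_subtype_val) fun t => (hm t).ne'
  · have h1 : Continuous fun z : {s : OC A // s a ≠ 0} × Upper (e a) => push e z.1.1.1 :=
      (continuous_push e).comp (by fun_prop)
    refine Continuous.subtype_mk (Continuous.subtype_mk ?_ _) _
    fun_prop

/-- Each star of a cell above `v` can be embedded as an open subset into the star of `v`. -/
theorem exists_star_embedding {v p : Q} (hp : IsBall p) (hv : v ≤ p) :
    ∃ f : Star p → Star v, IsOpenEmbedding f := by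
  obtain ⟨A, _, _, e, a, h1, h2, h3, h4⟩ := hp
  obtain ⟨h, hh⟩ := star_decomposition h1 h2 h3
  obtain ⟨b, rfl⟩ : v ∈ Set.range e := by grind
  have hba : b ≤ a := by grind
  let y : OC A := OC.mixV (OC.vtx b) a (fun q hq => .inl (OC.vtx_ne hq ▸ hba)) ⟨1 / 2, by norm_num, by norm_num⟩
  have hy : y a ≠ 0 ∧ y b ≠ 0 := by
    simp only [y, OC.mixV_apply, OC.vtx_apply]
    constructor <;> split_ifs <;> norm_num
  obtain ⟨φ, hφ, hφr⟩ := h4 {s | s.1 b ≠ 0} ((isOpen_star b).preimage continuous_subtype_val)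
    ⟨⟨y, hy.1⟩, hy.2⟩
  have hm : ∀ t, (h.symm (Prod.map φ id (h t))).1 (e b) ≠ 0 := by
    intro t
    rw [← hh, Homeomorph.apply_symm_apply]
    exact hφr ⟨_, rfl⟩
  refine ⟨fun t => ⟨(h.symm (Prod.map φ id (h t))).1, hm t⟩, ?_⟩
  refine IsOpenEmbedding.of_comp _ (isOpen_star _).isOpenEmbedding_subtypeVal ?_
  exact (isOpen_star p).isOpenEmbedding_subtypeVal.comp
    (h.symm.isOpenEmbedding.comp ((hφ.prodMap .id).comp h.isOpenEmbedding))

end Star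

/-- A space covered by open subsets that can be embedded as open subsets into `H` is
locally `H`. -/
theorem nonempty_chartedSpace {Y H : Type*} [TopologicalSpace Y] [TopologicalSpace H]
    (h : ∀ y : Y, ∃ (Z : Type) (_ : TopologicalSpace Z) (j : Z → Y) (f : Z → H),
      IsOpenEmbedding j ∧ IsOpenEmbedding f ∧ y ∈ Set.range j) :
    Nonempty (ChartedSpace H Y) := by
  have h' : ∀ y : Y, ∃ c : OpenPartialHomeomorph Y H, y ∈ c.source := by
    intro y
    obtain ⟨Z, _, j, f, hj, hf, z, rfl⟩ := h y
    have : Nonempty Z := ⟨z⟩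
    refine ⟨(hj.toOpenPartialHomeomorph j).symm.trans (hf.toOpenPartialHomeomorph f), ?_⟩
    simp
  choose c hc using h'
  exact ⟨{ atlas := Set.range c
           chartAt := c
           mem_chart_source := hc
           chart_mem_atlas := fun y => ⟨y, rfl⟩ }⟩

attribute [fun_prop] OC.continuous_coord

/-! ### Charts of stars of vertices -/

open scoped Classical in
theorem exists_model_chart {M H : Type} [Fintype M] [PartialOrder M] [TopologicalSpace H] {v : M}
    (hv : ∀ q, v ≤ q) (G : OC M → H) (hG : Continuous G) (Φ : H → M → ℝ)
    (hΦ : ∀ q, Continuous fun z => Φ z q) (h0 : ∀ z q, 0 ≤ Φ z q) (hv0 : ∀ z, Φ z v = 0)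
    (hc : ∀ z, ChainSupp (Φ z)) (h1 : ∀ t q, q ≠ v → Φ (G t) q = t q)
    (h2 : ∀ z (t : OC M), (∀ q, q ≠ v → t q = Φ z q) → G t = z) :
    ∃ f : Star v → H, IsOpenEmbedding f := by
  have hsum : Continuous fun z => ∑ q, Φ z q := continuous_finsetSum _ fun q _ => hΦ q
  have hU : IsOpen {z : H | ∑ q, Φ z q < 1} := isOpen_lt hsum continuous_const
  have hs : ∀ t : OC M, ∑ q, Φ (G t) q = 1 - t v := by
    intro t
    rw [← t.sum_eq, ← Finset.sum_erase_add _ _ (Finset.mem_univ v), hv0, add_zero,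
      ← Finset.sum_erase_add (f := fun q => t q) _ (Finset.mem_univ v), add_sub_cancel_right]
    exact Finset.sum_congr rfl fun q hq => h1 t q (Finset.ne_of_mem_erase hq)
  let inv : {z : H | ∑ q, Φ z q < 1} → OC M := fun z =>
    ⟨fun q => Φ z.1 q + if q = v then 1 - ∑ q, Φ z.1 q else 0, fun q => by
      have := z.2
      simp only [Set.mem_ofPred_eq] at this
      refine add_nonneg (h0 _ _) ?_
      split_ifs <;> linarith, by
      rw [Finset.sum_add_distrib]
      simp, fun p q hp hq => by
      by_cases h3 : p = v
      · grind
      · by_cases h4 : q = v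
        · grind
        · refine hc z.1 p q ?_ ?_
          · grind
          · grind⟩
  have hinv : ∀ z q, q ≠ v → inv z q = Φ z.1 q := fun z q hq => by
    simp only [inv, if_neg hq, add_zero]
  have hinvv : ∀ z, inv z v = 1 - ∑ q, Φ z.1 q := fun z => by
    simp only [inv, if_true, hv0, zero_add]
  let e : Star v ≃ₜ {z : H | ∑ q, Φ z q < 1} :=
    { toFun := fun t => ⟨G t.1, by
        have := hs t.1
        have := (t.1.nonneg v).lt_of_ne t.2.symm
        simp only [Set.mem_ofPred_eq]
        linarith⟩
      invFun := fun z => ⟨inv z, by rw [hinvv]; exact (sub_pos.2 z.2).ne'⟩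
      left_inv := fun t => by
        refine Subtype.ext (Subtype.ext (funext fun q => ?_))
        by_cases hq : q = v
        · grind
        · grind
      right_inv := fun z => Subtype.ext (h2 z.1 _ fun q hq => hinv z q hq)
      continuous_toFun := by fun_prop
      continuous_invFun := by
        refine Continuous.subtype_mk (OC.continuous_of_coord fun q => ?_) _
        refine Continuous.add ((hΦ q).comp continuous_subtype_val) ?_
        split_ifs
        · exact continuous_const.sub (hsum.comp continuous_subtype_val)
        · exact continuous_const }
  exact ⟨_, hU.isOpenEmbedding_subtypeVal.comp e.isOpenEmbedding⟩

/-- The poset of the proper subsets of a set with three elements. -/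
inductive Hex
  | o | a | b | c | ab | ac | bc
  deriving DecidableEq

namespace Hex

instance : Fintype Hex := ⟨{o, a, b, c, ab, ac, bc}, by rintro (_ | _) <;> decide⟩

instance : PartialOrder Hex where
  le x y := x = y ∨ x = o ∨ (x = a ∧ (y = ab ∨ y = ac)) ∨ (x = b ∧ (y = ab ∨ y = bc)) ∨
    (x = c ∧ (y = ac ∨ y = bc))
  le_refl x := .inl rfl
  le_trans := by decide
  le_antisymm := by decide

instance : DecidableLE Hex := fun x y => inferInstanceAs (Decidable (x = y ∨ x = o ∨
  (x = a ∧ (y = ab ∨ y = ac)) ∨ (x = b ∧ (y = ab ∨ y = bc)) ∨ (x = c ∧ (y = ac ∨ y = bc))))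

theorem exists_chart : ∃ f : Star o → ℝ × ℝ, IsOpenEmbedding f := by
  have ho : ∀ q : Hex, o ≤ q := by decide
  let G : OC Hex → ℝ × ℝ := fun t => (t a + t ab - t c - t bc, t b + t ab - t c - t ac)
  let m : ℝ × ℝ → ℝ := fun z => min (min z.1 z.2) 0
  let Φ : ℝ × ℝ → Hex → ℝ := fun z q => match q with
    | o => 0
    | a => max (z.1 - max z.2 0) 0
    | b => max (z.2 - max z.1 0) 0
    | c => max (- max z.1 z.2) 0
    | ab => max (min z.1 z.2) 0
    | ac => max (min (z.1 - z.2) (-z.2)) 0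
    | bc => max (min (z.2 - z.1) (-z.1)) 0
  refine exists_model_chart ho G ?_ Φ ?_ ?_ (fun _ => rfl) ?_ ?_ ?_
  · exact Continuous.prodMk (by fun_prop)
      (by fun_prop)
  · rintro (_ | _ | _ | _ | _ | _ | _) <;> simp only [Φ] <;> fun_prop
  · grind
  · intro z p q hp hq
    cases p <;> cases q <;>
      first
      | (left; decide)
      | (right; decide)
      | (exfalso; simp only [Φ] at hp hq; grind)
  · intro t q hq
    have hc := t.chain
    have hab : t a = 0 ∨ t b = 0 := by by_contra! h; exact absurd (hc a b h.1 h.2) (by decide)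
    have hac : t a = 0 ∨ t c = 0 := by by_contra! h; exact absurd (hc a c h.1 h.2) (by decide)
    have hbc : t b = 0 ∨ t c = 0 := by by_contra! h; exact absurd (hc b c h.1 h.2) (by decide)
    have h1 : t ab = 0 ∨ t ac = 0 := by by_contra! h; exact absurd (hc ab ac h.1 h.2) (by decide)
    have h2 : t ab = 0 ∨ t bc = 0 := by by_contra! h; exact absurd (hc ab bc h.1 h.2) (by decide)
    have h3 : t ac = 0 ∨ t bc = 0 := by by_contra! h; exact absurd (hc ac bc h.1 h.2) (by decide)
    have h4 : t a = 0 ∨ t bc = 0 := by by_contra! h; exact absurd (hc a bc h.1 h.2) (by decide)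
    have h5 : t b = 0 ∨ t ac = 0 := by by_contra! h; exact absurd (hc b ac h.1 h.2) (by decide)
    have h6 : t c = 0 ∨ t ab = 0 := by by_contra! h; exact absurd (hc c ab h.1 h.2) (by decide)
    have n1 := t.nonneg a
    have n2 := t.nonneg b
    have n3 := t.nonneg c
    have n4 := t.nonneg ab
    have n5 := t.nonneg ac
    have n6 := t.nonneg bc
    cases q
    · grind
    all_goals simp only [Φ, G]; grind
  · intro z t ht
    have ha := ht a (by decide)
    have hb := ht b (by decide)
    have hc := ht c (by decide)
    have hab := ht ab (by decide)
    have hac := ht ac (by decide)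
    have hbc := ht bc (by decide)
    simp only [Φ] at ha hb hc hab hac hbc
    refine Prod.ext ?_ ?_ <;> simp only [G] <;> grind

end Hex

/-- The cells of the closed ribbon surface at a vertex that is not on a leg. -/
inductive Fourgon
  | o | l | g | d | c
  deriving DecidableEq

namespace Fourgon

instance : Fintype Fourgon := ⟨{o, l, g, d, c}, by rintro (_ | _) <;> decide⟩

instance : PartialOrder Fourgon where
  le x y := x = y ∨ x = o ∨ ((x = l ∨ x = g) ∧ (y = d ∨ y = c))
  le_refl x := .inl rfl
  le_trans := by decide
  le_antisymm := by decide

instance : DecidableLE Fourgon := fun x y =>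
  inferInstanceAs (Decidable (x = y ∨ x = o ∨ ((x = l ∨ x = g) ∧ (y = d ∨ y = c))))

theorem exists_chart : ∃ f : Star o → ℝ × ℝ, IsOpenEmbedding f := by
  have ho : ∀ q : Fourgon, o ≤ q := by decide
  let G : OC Fourgon → ℝ × ℝ := fun t => (t l - t g, t d - t c)
  let Φ : ℝ × ℝ → Fourgon → ℝ := fun z q => match q with
    | o => 0
    | l => max z.1 0
    | g => max (- z.1) 0
    | d => max z.2 0
    | c => max (- z.2) 0
  refine exists_model_chart ho G ?_ Φ ?_ ?_ (fun _ => rfl) ?_ ?_ ?_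
  · exact Continuous.prodMk (by fun_prop)
      (by fun_prop)
  · rintro (_ | _ | _ | _ | _) <;> simp only [Φ] <;> fun_prop
  · grind
  · intro z p q hp hq
    cases p <;> cases q <;>
      first
      | (left; decide)
      | (right; decide)
      | (exfalso; simp only [Φ] at hp hq; grind)
  · intro t q hq
    have hc := t.chain
    have hab : t l = 0 ∨ t g = 0 := by by_contra! h; exact absurd (hc l g h.1 h.2) (by decide)
    have hac : t d = 0 ∨ t c = 0 := by by_contra! h; exact absurd (hc d c h.1 h.2) (by decide)
    have n1 := t.nonneg l
    have n2 := t.nonneg g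
    have n3 := t.nonneg d
    have n4 := t.nonneg c
    cases q
    · grind
    all_goals simp only [Φ, G]; grind
  · grind

end Fourgon

/-- The cells of the singular 3-manifold at a vertex that is not on a leg. -/
inductive Fin9
  | o | l | g | w | d | c | li | gi | om | h
  deriving DecidableEq

namespace Fin9

instance : Fintype Fin9 := ⟨{o, l, g, w, d, c, li, gi, om, h}, by rintro (_ | _) <;> decide⟩

/-- The order relation. -/
def leBool : Fin9 → Fin9 → Bool
  | o, _ => true
  | l, y => y == l || y == d || y == c || y == li || y == om || y == h
  | g, y => y == g || y == d || y == c || y == gi || y == om || y == h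
  | w, y => y == w || y == li || y == gi || y == h
  | d, y => y == d || y == om || y == h
  | c, y => y == c || y == om
  | li, y => y == li || y == h
  | gi, y => y == gi || y == h
  | om, y => y == om
  | h, y => y == h

instance : PartialOrder Fin9 where
  le x y := leBool x y = true
  le_refl := by decide
  le_trans := by decide
  le_antisymm := by decide

instance : DecidableLE Fin9 := fun x y => inferInstanceAs (Decidable (leBool x y = true))

/-- The inverse of the chart. -/
def coord (x y z : ℝ) : Fin9 → ℝ
  | o => 0
  | om => max (-z) 0
  | c => max (-y) 0
  | h => max (min y z) 0
  | d => max (y - max z 0) 0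
  | li => min (max (z - max y 0) 0) (max x 0)
  | gi => min (max (z - max y 0) 0) (max (- x) 0)
  | l => max (max x 0 - max (z - max y 0) 0) 0
  | g => max (max (- x) 0 - max (z - max y 0) 0) 0
  | w => max (max (z - max y 0) 0 - max x (- x)) 0

theorem chainSupp_coord {x y z : ℝ} (hyz : 0 ≤ y ∨ z ≤ 0) : ChainSupp (coord x y z) := by
  obtain ⟨Y, hY⟩ : ∃ Y, max y 0 = Y := ⟨_, rfl⟩
  have hy1 : y ≤ Y := hY ▸ le_max_left _ _
  have hy0 : 0 ≤ Y := hY ▸ le_max_right _ _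
  have com : coord x y z om ≠ 0 → z < 0 := by simp only [coord]; grind
  have cc : coord x y z c ≠ 0 → y < 0 ∧ z ≤ 0 := by simp only [coord]; grind
  have ch : coord x y z h ≠ 0 → 0 < y ∧ 0 < z := by simp only [coord]; grind
  have cd : coord x y z d ≠ 0 → 0 < y ∧ z < y := by simp only [coord]; grind
  have cli : coord x y z li ≠ 0 → Y < z ∧ 0 < x := by simp only [coord, hY]; grind
  have cgi : coord x y z gi ≠ 0 → Y < z ∧ x < 0 := by simp only [coord, hY]; grind
  have cl : coord x y z l ≠ 0 → 0 < x ∧ z - Y < x := by simp only [coord, hY]; grind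
  have cg : coord x y z g ≠ 0 → x < 0 ∧ z - Y < -x := by simp only [coord, hY]; grind
  have cw : coord x y z w ≠ 0 → Y < z ∧ x < z - Y ∧ -x < z - Y := by
    clear com cc ch cd cli cgi cl cg
    simp only [coord, hY]
    grind
  clear hyz hY
  intro p q hp hq
  cases p <;>
    cases q <;>
    first
    | (left; decide)
    | (right; decide)
    | (exfalso
       first
       | have hp := com hp | have hp := cc hp | have hp := ch hp | have hp := cd hp
       | have hp := cli hp | have hp := cgi hp | have hp := cl hp | have hp := cg hp
       | have hp := cw hp
       first
       | have hq := com hq | have hq := cc hq | have hq := ch hq | have hq := cd hq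
       | have hq := cli hq | have hq := cgi hq | have hq := cl hq | have hq := cg hq
       | have hq := cw hq
       clear com cc ch cd cli cgi cl cg cw
       grind)

theorem eq_coord (t : OC Fin9) : ∃ x y z : ℝ, x = t l + t li - t g - t gi ∧
    y = t d + t h - t c ∧ z = t w + t li + t gi + t h - t om ∧ (0 ≤ y ∨ z ≤ 0) ∧
    ∀ q, q ≠ o → t q = coord x y z q := by
  refine ⟨_, _, _, rfl, rfl, rfl, ?_⟩
  have incomp : ∀ p q, ¬ (p ≤ q ∨ q ≤ p) → t p = 0 ∨ t q = 0 := by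
    intro p q h
    by_contra! h'
    exact h (t.chain p q h'.1 h'.2)
  have n := t.nonneg
  have h1 := incomp l g (by decide)
  have h2 : (t om = 0 ∧ t c = 0) ∨ (t w = 0 ∧ t li = 0 ∧ t gi = 0 ∧ t h = 0) := by
    have := incomp om w (by decide)
    have := incomp om li (by decide)
    have := incomp om gi (by decide)
    have := incomp om h (by decide)
    have := incomp c w (by decide)
    have := incomp c li (by decide)
    have := incomp c gi (by decide)
    have := incomp c h (by decide)
    clear incomp n h1
    grind
  have key : ∀ x y z, (0 ≤ y ∨ z ≤ 0) ∧ t om = coord x y z om ∧ t c = coord x y z c ∧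
      t h = coord x y z h ∧ t d = coord x y z d ∧ t li = coord x y z li ∧ t gi = coord x y z gi ∧
      t l = coord x y z l ∧ t g = coord x y z g ∧ t w = coord x y z w →
      (0 ≤ y ∨ z ≤ 0) ∧ ∀ q, q ≠ o → t q = coord x y z q := by
    rintro x y z ⟨h0, h1, h2, h3, h4, h5, h6, h7, h8, h9⟩
    refine ⟨h0, fun q hq => ?_⟩
    cases q
    · grind
    all_goals assumption
  refine key _ _ _ ?_
  have nl := n l
  have ng := n g
  have nd := n d
  rcases h2 with ⟨h2, h3⟩ | ⟨h2, h3, h4, h5⟩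
  · have : (t g = 0 ∧ t w = 0 ∧ t gi = 0 ∧ t li = 0) ∨ (t g = 0 ∧ t w = 0 ∧ t gi = 0 ∧ t d = 0) ∨
        (t l = 0 ∧ t w = 0 ∧ t gi = 0 ∧ t li = 0) ∨ (t l = 0 ∧ t w = 0 ∧ t li = 0 ∧ t d = 0) ∨
        (t l = 0 ∧ t g = 0 ∧ t gi = 0 ∧ t d = 0) ∨ (t l = 0 ∧ t g = 0 ∧ t li = 0 ∧ t d = 0) := by
      have h4 := incomp l w (by decide)
      have h5 := incomp g w (by decide)
      have h6 := incomp l gi (by decide)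
      have h7 := incomp g li (by decide)
      have h8 := incomp li gi (by decide)
      have h9 := incomp d w (by decide)
      have h10 := incomp d li (by decide)
      have h11 := incomp d gi (by decide)
      clear incomp key n nl ng nd h2 h3
      grind
    have nw := n w
    have ni := n li
    have nj := n gi
    have nh := n h
    clear h1 incomp key n
    have hk : max ((t w + t li + t gi + t h) - max (t d + t h) 0) 0 = t w + t li + t gi := by grind
    have hx : max (t l + t li - t g - t gi) 0 = t l + t li := by grind
    have hx' : max (-(t l + t li - t g - t gi)) 0 = t g + t gi := by grind
    have hxx : max (t l + t li - t g - t gi) (-(t l + t li - t g - t gi)) =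
        t l + t li + t g + t gi := by grind
    simp only [h2, h3, coord, sub_zero, hk, hx, hx', hxx]
    clear hk hx hx' hxx
    rw [max_eq_left (a := t w + t li + t gi + t h) (by positivity)]
    rcases this with ⟨e1, e2, e3, e4⟩ | ⟨e1, e2, e3, e4⟩ | ⟨e1, e2, e3, e4⟩ | ⟨e1, e2, e3, e4⟩ |
      ⟨e1, e2, e3, e4⟩ | ⟨e1, e2, e3, e4⟩ <;>
    simp only [e1, e2, e3, e4, add_zero, zero_add, sub_zero, zero_sub, sub_self] <;>
    clear e1 e2 e3 e4 h2 h3 <;>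
    refine ⟨?_, ?_, ?_, ?_, ?_, ?_, ?_, ?_, ?_, ?_⟩ <;> grind
  · have h6 := incomp d c (by decide)
    have n4 := n om
    have n5 := n c
    clear incomp key n
    have hk : max (-t om - max (t d - t c) 0) 0 = 0 :=
      max_eq_right (by linarith [le_max_right (t d - t c) 0])
    simp only [h2, h3, h4, h5, coord, add_zero, sub_zero, zero_sub, hk]
    clear hk
    rcases h1 with h1 | h1 <;> rcases h6 with h6 | h6 <;>
    simp only [h1, h6, sub_zero, zero_sub] <;>
    clear h1 h6 h2 h3 h4 h5 <;>
    refine ⟨?_, ?_, ?_, ?_, ?_, ?_, ?_, ?_, ?_, ?_⟩ <;> grind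

theorem coord_y (x y z : ℝ) :
    coord x y z d + coord x y z h - coord x y z c = y := by
  simp only [coord]; grind

theorem coord_x (x y z : ℝ) :
    coord x y z l + coord x y z li - coord x y z g - coord x y z gi = x := by
  have hk : 0 ≤ max (z - max y 0) 0 := le_max_right _ _
  simp only [coord]
  generalize max (z - max y 0) 0 = k at *
  grind

theorem coord_z {x y z : ℝ} (hyz : 0 ≤ y ∨ z ≤ 0) :
    coord x y z w + coord x y z li + coord x y z gi + coord x y z h - coord x y z om = z := by
  have hk : 0 ≤ max (z - max y 0) 0 := le_max_right _ _
  have h1 : max (z - max y 0) 0 + max (min y z) 0 - max (-z) 0 = z := by grind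
  simp only [coord]
  generalize max (z - max y 0) 0 = k at *
  have h2 : max (k - max x (-x)) 0 + min k (max x 0) + min k (max (-x) 0) = k := by
    rcases le_total 0 x with hx | hx
    · rw [max_eq_left (by linarith : -x ≤ x), max_eq_left hx, max_eq_right (by linarith : -x ≤ 0),
        min_eq_right hk]
      rcases le_total k x with h | h
      · rw [max_eq_right (by linarith), min_eq_left h]; ring
      · rw [max_eq_left (by linarith), min_eq_right h]; ring
    · rw [max_eq_right (by linarith : x ≤ -x), max_eq_right hx, max_eq_left (by linarith : 0 ≤ -x),
        min_eq_right hk]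
      rcases le_total k (-x) with h | h
      · rw [max_eq_right (by linarith), min_eq_left h]; ring
      · rw [max_eq_left (by linarith), min_eq_right h]; ring
  linarith

theorem exists_chart :
    ∃ f : Star o → {z : ℝ × ℝ × ℝ // 0 ≤ z.1}, IsOpenEmbedding f := by
  let x : OC Fin9 → ℝ := fun t => t l + t li - t g - t gi
  let y : OC Fin9 → ℝ := fun t => t d + t h - t c
  let z : OC Fin9 → ℝ := fun t => t w + t li + t gi + t h - t om
  have main : ∀ t, (0 ≤ y t ∨ z t ≤ 0) ∧ ∀ q, q ≠ o → t q = coord (x t) (y t) (z t) q := by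
    intro t
    obtain ⟨_, _, _, rfl, rfl, rfl, h⟩ := eq_coord t
    exact h
  let Φ : {z : ℝ × ℝ × ℝ // 0 ≤ z.1} → Fin9 → ℝ := fun v => coord v.1.2.2
    (v.1.1 + min v.1.2.1 0) (max v.1.2.1 0 - v.1.1)
  let G : OC Fin9 → {z : ℝ × ℝ × ℝ // 0 ≤ z.1} := fun t =>
    ⟨(max (y t) (-z t), y t + z t, x t), by
      rcases (main t).1 with h | h
      · grind
      · grind⟩
  have hΦG : ∀ t, Φ (G t) = coord (x t) (y t) (z t) := by grind
  refine exists_model_chart (by decide) G (by fun_prop) Φ ?_ ?_ (fun _ => rfl) ?_ ?_ ?_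
  · rintro (_ | _ | _ | _ | _ | _ | _ | _ | _ | _) <;> simp only [Φ, coord] <;> fun_prop
  · rintro v (_ | _ | _ | _ | _ | _ | _ | _ | _ | _) <;> simp [Φ, coord]
  · rintro ⟨⟨m, e, x⟩, hm⟩; refine chainSupp_coord ?_; dsimp only at hm ⊢; grind
  · simp_all
  · rintro ⟨⟨m, e, x'⟩, hm⟩ t ht
    have hyz : 0 ≤ m + min e 0 ∨ max e 0 - m ≤ 0 := by grind
    have hq : ∀ q, q ≠ o → t q = coord x' (m + min e 0) (max e 0 - m) q := ht
    have e1 : y t = m + min e 0 := by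
      simp only [y]
      rw [hq _ (by decide), hq _ (by decide), hq _ (by decide), coord_y]
    have e2 : z t = max e 0 - m := by
      simp only [z]
      rw [hq _ (by decide), hq _ (by decide), hq _ (by decide), hq _ (by decide),
        hq _ (by decide), coord_z hyz]
    have e3 : x t = x' := by
      simp only [x]
      rw [hq _ (by decide), hq _ (by decide), hq _ (by decide), hq _ (by decide), coord_x]
    refine Subtype.ext (Prod.ext ?_ (Prod.ext ?_ e3))
    · grind
    · grind

end Fin9

/-! ### Stars of vertices in terms of models -/

section

variable {M Q : Type} [Fintype M] [PartialOrder M] [Fintype Q] [PartialOrder Q]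

theorem star_homeo {e : M → Q} {b : M} {v : Q} (he : ∀ x y, e x ≤ e y ↔ x ≤ y)
    (hr : Set.range e = Set.Ici v) (hb : e b = v) (hv : ∀ q ≤ v, q = v) :
    Nonempty (Star v ≃ₜ Star b) := by
  subst hb
  have hm : Monotone e := fun x y h => (he x y).2 h
  have hi : Injective e := FinPresentation.injective_of_le_iff fun x y => (he x y).1
  have hex : ∀ t : Star (e b), ∃ s : OC M, OC.map e hm s = t.1 := fun t =>
    OC.exists_map_eq hm (fun x y => (he x y).1) t.1 fun q hq => by
      rw [hr]
      rcases t.1.chain q (e b) hq t.2 with h | h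
      · grind
      · exact h
  choose f hf using hex
  have hc : ∀ t x, f t x = t.1 (e x) := fun t x => by rw [← hf t, OC.map_apply hi]
  refine ⟨{ toFun := fun t => ⟨f t, by rw [hc]; exact t.2⟩
            invFun := fun s => ⟨OC.map e hm s.1, by rw [OC.map_apply hi]; exact s.2⟩
            left_inv := fun t => Subtype.ext (hf t)
            right_inv := fun s => Subtype.ext (OC.map_injective hm hi (hf _))
            continuous_toFun := by
              refine Continuous.subtype_mk (OC.continuous_of_coord fun x => ?_) _
              simp only [hc]
              exact (OC.continuous_coord (e x)).comp continuous_subtype_val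
            continuous_invFun := by
              refine Continuous.subtype_mk ?_ _
              exact (OC.continuous_map e hm).comp continuous_subtype_val }⟩

theorem iota_half {x : I} : iota x (.en true) = 0 ↔ (x : ℝ) ≤ 1 / 2 := by
  simp only [iota, iotaFun]
  rcases half_cases x with ⟨e1, e2, e3⟩ | ⟨e1, e2, e3⟩ <;> rw [e2] <;> constructor <;> intro h <;> linarith

theorem iota_ne {x : I} : iota x (.en false) ≠ 0 ↔ (x : ℝ) < 1 / 2 := by
  simp only [iota, iotaFun]
  rcases half_cases x with ⟨e1, e2, e3⟩ | ⟨e1, e2, e3⟩ <;> rw [e1] <;> constructor <;> intro h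
  · grind
  · grind
  · grind
  · grind

/-- The inclusion of the lower half. -/
def halfEmb (z : M × Bool) : M × IF := (z.1, if z.2 then md else en false)

theorem halfEmb_le_iff (x y : M × Bool) : halfEmb x ≤ halfEmb y ↔ x ≤ y := by
  rcases x with ⟨a, _ | _⟩ <;> rcases y with ⟨b, _ | _⟩ <;> simp [halfEmb]

theorem exists_chart_prod {b : M} {E : Type} [TopologicalSpace E]
    (h : ∃ f : Star b → E, IsOpenEmbedding f) :
    ∃ f : Star ((b, false) : M × Bool) → {z : ℝ × E // 0 ≤ z.1}, IsOpenEmbedding f := by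
  obtain ⟨f, hf⟩ := h
  have hm : Monotone (halfEmb (M := M)) := fun x y h => (halfEmb_le_iff x y).2 h
  have hi : Injective (halfEmb (M := M)) :=
    FinPresentation.injective_of_le_iff fun x y => (halfEmb_le_iff x y).1
  have hex : ∀ (s : OC M) (x : I), (x : ℝ) < 1 / 2 →
      ∃ t : OC (M × Bool), OC.map halfEmb hm t = OC.prod s x := fun s x hx =>
    OC.exists_map_eq hm (fun x y => (halfEmb_le_iff x y).1) _ fun q hq => by
      have h1 : iota x q.2 ≠ 0 := by
        rw [← OC.map_snd_prod s x]
        exact push_ne (e := Prod.snd) (OC.nonneg _) hq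
      obtain ⟨a, (_ | _) | _⟩ := q
      · exact ⟨(a, false), rfl⟩
      · exact absurd (iota_half.2 hx.le) h1
      · exact ⟨(a, true), rfl⟩
  let W : Set (Star b × {x : I // (x : ℝ) < 1 / 2}) :=
    {z | OC.prod z.1.1 z.2.1 (b, en false) ≠ 0}
  have hW : IsOpen W := isOpen_ne_fun ((OC.continuous_coord _).comp
    (OC.continuous_prod' (by fun_prop) (by fun_prop))) continuous_const
  let g : OC (M × Bool) → OC M × I := fun t => (prodHomeo M).symm (OC.map halfEmb hm t)
  have hg : ∀ t, OC.prod (g t).1 (g t).2 = OC.map halfEmb hm t := fun t =>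
    (prodHomeo M).apply_symm_apply _
  have hgc : Continuous g := (prodHomeo M).symm.continuous.comp (OC.continuous_map _ hm)
  have hg1 : ∀ t, (g t).1 = OC.map Prod.fst monotone_fst (OC.map halfEmb hm t) := fun t => by
    rw [← hg, OC.map_fst_prod]
  have hg2 : ∀ t, iota (g t).2 = OC.map Prod.snd monotone_snd (OC.map halfEmb hm t) := fun t => by
    rw [← hg, OC.map_snd_prod]
  have hne : ∀ t : Star ((b, false) : M × Bool), OC.map halfEmb hm t.1 (b, en false) ≠ 0 := by
    intro t
    have := OC.map_apply (he := hm) hi t.1 (b, false)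
    simp only [halfEmb, Bool.false_eq_true, if_false] at this
    rw [this]
    exact t.2
  have : Nonempty (OC (M × Bool)) := ⟨OC.vtx (b, false)⟩
  choose! k hk using hex
  have hkc : ∀ (s : OC M) (x : I), (x : ℝ) < 1 / 2 → ∀ q, k s x q = OC.prod s x (halfEmb q) := by
    intro s x hx q
    rw [← hk s x hx, OC.map_apply hi]
  let e : Star ((b, false) : M × Bool) ≃ₜ W :=
    { toFun := fun t => ⟨(⟨(g t.1).1, by
          rw [hg1]
          exact push_ne (e := Prod.fst) (OC.nonneg _) (hne t)⟩, ⟨(g t.1).2, by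
          rw [← iota_ne, hg2]
          exact push_ne (e := Prod.snd) (OC.nonneg _) (hne t)⟩), by
          change OC.prod (g t.1).1 (g t.1).2 (b, en false) ≠ 0
          rw [hg]
          exact hne t⟩
      invFun := fun z => ⟨k z.1.1.1 z.1.2.1, by rw [hkc _ _ z.1.2.2]; exact z.2⟩
      left_inv := fun t => Subtype.ext (OC.map_injective hm hi (by
        dsimp only
        rw [hk, hg]
        rw [← iota_ne, hg2]
        exact push_ne (e := Prod.snd) (OC.nonneg _) (hne t)))
      right_inv := fun z => by
        have h1 : g (k z.1.1.1 z.1.2.1) = (z.1.1.1, z.1.2.1) := by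
          simp only [g]
          rw [hk _ _ z.1.2.2]
          exact (prodHomeo M).symm_apply_apply (z.1.1.1, z.1.2.1)
        refine Subtype.ext (Prod.ext (Subtype.ext ?_) (Subtype.ext ?_))
        · grind
        · grind
      continuous_toFun := by fun_prop
      continuous_invFun := by
        refine Continuous.subtype_mk (OC.continuous_of_coord fun q => ?_) _
        have : (fun z : W => k z.1.1.1 z.1.2.1 q) = fun z : W =>
            OC.prod z.1.1.1 z.1.2.1 (halfEmb q) := funext fun z => hkc _ _ z.1.2.2 q
        rw [this]
        exact (OC.continuous_coord _).comp (OC.continuous_prod' (by fun_prop) (by fun_prop)) }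
  let r : {x : I // (x : ℝ) < 1 / 2} → {y : ℝ // 0 ≤ y} := fun x => ⟨x.1, x.1.2.1⟩
  have hr : IsOpenEmbedding r := by
    have hs : IsEmbedding fun x : {x : I // (x : ℝ) < 1 / 2} => ((x : I) : ℝ) :=
      IsEmbedding.comp (g := ((↑) : I → ℝ)) .subtypeVal .subtypeVal
    refine ⟨.of_comp (by fun_prop) continuous_subtype_val hs, ?_⟩
    have : Set.range r = {y : {y : ℝ // 0 ≤ y} | (y : ℝ) < 1 / 2} := by
      ext y
      constructor
      · grind
      · intro hy; exact ⟨⟨⟨y, y.2, (show (y : ℝ) < 1 / 2 from hy).le.trans (by norm_num)⟩, hy⟩, rfl⟩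
    rw [this]
    exact isOpen_lt continuous_subtype_val continuous_const
  let l : E × {y : ℝ // 0 ≤ y} ≃ₜ {z : ℝ × E // 0 ≤ z.1} :=
    { toFun := fun z => ⟨(z.2.1, z.1), z.2.2⟩
      invFun := fun z => (z.1.2, ⟨z.1.1, z.2⟩)
      left_inv := fun _ => rfl
      right_inv := fun _ => rfl
      continuous_toFun := by fun_prop
      continuous_invFun := by fun_prop }
  exact ⟨_, l.isOpenEmbedding.comp ((hf.prodMap hr).comp
    (hW.isOpenEmbedding_subtypeVal.comp e.isOpenEmbedding))⟩

end

namespace FinPresentation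

open SingularManifold.Poly Cell

variable {P : FinPresentation}

theorem exists_cyc {n : ℕ} (s : Fin n) : ∃ t, cyc t = s :=
  (Finite.surjective_of_injective cyc_injective) s

theorem exists_gap {n : ℕ} (s : Fin n) (b : Bool) : ∃ t, vt s b ≤ gp t := by
  rcases b
  · obtain ⟨t, rfl⟩ := exists_cyc s; exact ⟨t, by simp⟩
  · simp

theorem gap_unique {n : ℕ} {s t t' : Fin n} {b : Bool} (h : vt s b ≤ gp t) (h' : vt s b ≤ gp t') :
    t = t' := by
  rcases b <;> simp at h h'
  · exact cyc_injective (h.symm.trans h')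
  · grind

theorem capV_gap {i : Fin P.n} {s t : Fin (deg i + 1)} {x : Bool} (b : Bool) (h : vt s x ≤ gp t) :
    capV ⟨i, s, x, b⟩ = capV (P := P) ⟨i, t, true, b⟩ := by
  rcases x <;> simp at h <;> subst h
  · exact (capV_eq (.gap i t b)).symm
  · rfl

theorem vt_le {n : ℕ} {s : Fin n} {x : Bool} {a : Poly n} (h : vt s x ≤ a) :
    a = vt s x ∨ a = lg s ∨ (∃ t, a = gp t) ∨ a = tp := by
  rcases a with ⟨t, y⟩ | t | t | _
  · simp_all
  · simp_all
  · simp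
  · simp

theorem hd_le_cp {i : Fin P.n} {a τ c} : (hd i a τ : P.Cell) ≤ cp c ↔ Bd (hd i a τ) c := by
  rw [le_cp]; simp

theorem rb_le_cp {o : P.Occ} {υ c} : (rb o υ : P.Cell) ≤ cp c ↔ Bd (rb o υ) c := by rw [le_cp]; simp

theorem hd_le_om {i : Fin P.n} {a τ} : (hd i a τ : P.Cell) ≤ om ↔ ∃ b, τ = en b := by
  rw [le_om_iff]; simp [Rib]

theorem rb_le_om {o : P.Occ} {υ} : (rb o υ : P.Cell) ≤ om := le_om_iff.2 (.inr (.inr trivial))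

theorem not_dc_le_om {j : Fin P.k} {υ} : ¬ (dc j υ : P.Cell) ≤ om := by rw [le_om_iff]; simp [Rib]

theorem not_dc_le_cp {j : Fin P.k} {υ c} : ¬ (dc j υ : P.Cell) ≤ cp c := by
  rw [le_cp]
  rintro (h | h)
  · cases h
  · exact rib_of_bd h

theorem not_bd_hd_md {i : Fin P.n} {a c} : ¬ Bd (hd i a md : P.Cell) c := fun h => by
  obtain ⟨b, h⟩ := rib_of_bd h; cases h

theorem not_hd_le_rb {o : P.Occ} {i a τ υ} (h : ∀ s x, a ≠ vt s x)
    (h' : ∀ s, a ≠ lg s) : ¬ (hd i a τ : P.Cell) ≤ rb o υ := by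
  rw [le_rb]
  rintro (⟨υ', -, h2⟩ | ⟨υ', -, h2⟩ | ⟨υ', -, h2⟩)
  · cases h2
  all_goals
    rcases υ' with u | _ <;> simp only [legAt, hd.injEq] at h2 <;> obtain ⟨rfl, h2, -⟩ := h2
    · grind
    · grind

theorem not_hd_le_dc {j : Fin P.k} {i a τ υ} (h : ∀ s x, a ≠ vt s x)
    (h' : ∀ s, a ≠ lg s) : ¬ (hd i a τ : P.Cell) ≤ dc j υ := by
  rw [le_dc]
  rintro (⟨υ', -, h2⟩ | ⟨o, -, υ', -, h2⟩ | ⟨o, -, υ', -, τ', h2⟩)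
  · cases h2
  · cases h2
  · rcases υ' with u | _ <;> simp only [legAt, hd.injEq] at h2 <;> obtain ⟨rfl, h2, -⟩ := h2
    · grind
    · grind

/-- The cells at a vertex on a leg. -/
def legModel (o o' : P.Occ) (u b : Bool) (t : Fin (deg (gen o) + 1)) : Hex × Bool → P.Cell
  | (.o, c) => hd (gen o) (legAt o (if c then md else en u)) (en b)
  | (.a, c) => rb o' (if c then md else en u)
  | (.b, c) => hd (gen o) (if c then tp else gp t) (en b)
  | (.c, c) => hd (gen o) (legAt o (if c then md else en u)) md
  | (.ab, c) => if c then om else cp (capV ⟨gen o, slot o, side o u, b⟩)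
  | (.ac, c) => dc o.1 (if c then md else en u)
  | (.bc, c) => hd (gen o) (if c then tp else gp t) md

/-- The cells at a vertex that is not on a leg. -/
def dummyModel (i : Fin P.n) (x b : Bool) (t : Fin (deg i + 1)) : Fin9 → P.Cell
  | .o => hd i (vt (Fin.last _) x) (en b)
  | .l => hd i (lg (Fin.last _)) (en b)
  | .g => hd i (gp t) (en b)
  | .w => hd i (vt (Fin.last _) x) md
  | .d => hd i tp (en b)
  | .c => cp (capV ⟨i, Fin.last _, x, b⟩)
  | .li => hd i (lg (Fin.last _)) md
  | .gi => hd i (gp t) md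
  | .om => om
  | .h => hd i tp md

theorem dummyModel_le_iff {i : Fin P.n} {x b : Bool} {t : Fin (deg i + 1)}
    (ht : vt (Fin.last _) x ≤ gp t) (p q : Fin9) :
    dummyModel i x b t p ≤ dummyModel i x b t q ↔ p ≤ q := by
  have b1 : Bd (hd i (vt (Fin.last _) x) (en b)) (capV (P := P) ⟨i, Fin.last _, x, b⟩) :=
    .inl ⟨_, _, _, _, rfl, rfl⟩
  have b2 : Bd (hd i (lg (Fin.last _)) (en b)) (capV (P := P) ⟨i, Fin.last _, x, b⟩) := by
    refine .inr (.inr (.inl ⟨_, _, rfl, ?_⟩))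
    rcases x
    · exact capV_eq (.dummy i b)
    · rfl
  have b3 : Bd (hd i (gp t) (en b)) (capV (P := P) ⟨i, Fin.last _, x, b⟩) :=
    .inr (.inl ⟨_, _, _, rfl, capV_gap b ht⟩)
  cases p <;>
    cases q <;>
    simp only [dummyModel, hd_le_hd, hd_le_cp, hd_le_om, cp_le, om_le, ht, b1, b2, b3, le_refl,
      not_bd_hd_md, not_bd_tp, le_tp, tp_le, le_vt, le_md, le_en, vt_le_lg, not_lg_le_gp,
      not_gp_le_lg, reduceCtorEq, and_true, and_false, or_self,
      or_true, exists_false, en.injEq, exists_eq', true_iff, false_iff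
      ] <;> decide

theorem legModel_le_iff {o o' : P.Occ} {u b : Bool} {t : Fin (deg (gen o) + 1)}
    (ht : vt (slot o) (side o u) ≤ gp t) (ho : (b = sgn o ∧ o' = o) ∨ (b = (!sgn o) ∧ o = next o'))
    (p q : Hex × Bool) : legModel o o' u b t p ≤ legModel o o' u b t q ↔ p ≤ q := by
  have b1 : Bd (hd (gen o) (legAt o (en u)) (en b)) (capV (P := P) ⟨gen o, slot o, side o u, b⟩) :=
    .inl ⟨_, _, _, _, rfl, rfl⟩
  have b2 : Bd (rb o' (en u)) (capV (P := P) ⟨gen o, slot o, side o u, b⟩) := by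
    refine .inr (.inr (.inr ⟨_, _, rfl, ?_⟩))
    rcases ho with ⟨rfl, rfl⟩ | ⟨rfl, rfl⟩
    · rfl
    · exact (capV_eq (.side o' u)).symm
  have b3 : Bd (hd (gen o) (gp t) (en b)) (capV (P := P) ⟨gen o, slot o, side o u, b⟩) :=
    .inr (.inl ⟨_, _, _, rfl, capV_gap b ht⟩)
  have b4 : ∀ τ c, ¬ Bd (hd (gen o) (legAt o md) τ : P.Cell) c := fun τ c => not_bd_legAt
  have r1 : ∀ υ υ', (hd (gen o) (legAt o υ) (en b) : P.Cell) ≤ rb o' υ' ↔ υ ≤ υ' := by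
    intro υ υ'
    rw [hd_le_rb_iff]
    rcases ho with ⟨rfl, rfl⟩ | ⟨rfl, rfl⟩ <;> simp
  have r2 : ∀ υ υ', ¬ (hd (gen o) (legAt o υ) md : P.Cell) ≤ rb o' υ' := by
    intro υ υ'
    rw [hd_le_rb_iff]
    simp
  have r3 : ∀ τ υ, ¬ (hd (gen o) (gp t) τ : P.Cell) ≤ rb o' υ := fun τ υ =>
    not_hd_le_rb (by simp) (by simp)
  have r4 : ∀ τ υ, ¬ (hd (gen o) tp τ : P.Cell) ≤ rb o' υ := fun τ υ =>
    not_hd_le_rb (by simp) (by simp)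
  have r5 : ∀ τ υ, ¬ (hd (gen o) (gp t) τ : P.Cell) ≤ dc o.1 υ := fun τ υ =>
    not_hd_le_dc (by simp) (by simp)
  have r6 : ∀ τ υ, ¬ (hd (gen o) tp τ : P.Cell) ≤ dc o.1 υ := fun τ υ =>
    not_hd_le_dc (by simp) (by simp)
  have r7 : o'.1 = o.1 := by rcases ho with ⟨-, rfl⟩ | ⟨-, rfl⟩ <;> rfl
  have l1 : legAt o (en u) ≤ gp t := ht
  have l2 : ¬ legAt o md ≤ gp t := not_lg_le_gp
  have l3 : ∀ υ, ¬ gp t ≤ legAt o υ := by rintro (_ | _) <;> simp [legAt]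
  have l4 : ∀ υ, ¬ tp ≤ legAt o υ := by rintro (_ | _) <;> simp [legAt]
  have l5 : legAt o (en u) ≤ legAt o md := monotone_legAt o (by simp)
  have l6 : ¬ legAt o md ≤ legAt o (en u) := by simp [legAt]
  rcases p with ⟨_ | _ | _ | _ | _ | _ | _, _ | _⟩ <;>
    rcases q with ⟨_ | _ | _ | _ | _ | _ | _, _ | _⟩ <;>
    simp only [legModel, if_true, Bool.false_eq_true, if_false, hd_le_hd, rb_le_rb,
      rb_le_dc, hd_le_dc, dc_le_dc, not_dc_le_rb, not_dc_le_hd, not_rb_le_hd, not_dc_le_om, not_dc_le_cp,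
      hd_le_cp, rb_le_cp, rb_le_om, not_bd_rb_md, hd_le_om, cp_le, om_le, b1, b2, b3, b4, le_refl,
      r1, r2, r3, r4, r5, r6, r7, l1, l2, l3, l4, l5, l6,
      not_bd_hd_md, not_bd_tp, le_tp, tp_le, le_md, le_en,
      reduceCtorEq, and_true, and_false, or_self,
      or_true, exists_false, en.injEq, exists_eq', true_iff, false_iff
      ] <;> decide

end FinPresentation

/-- An orbit of an injective self-map of a finite set is a cycle. -/
theorem exists_cycle {A : Type*} [Finite A] {f : A → A} (hf : Injective f) (a : A) :
    ∃ (m : ℕ) (g : Fin m → A), 0 < m ∧ Injective g ∧ (∀ k, f (g k) = g (cyc k)) ∧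
      a ∈ Set.range g ∧ ∀ p : A → Prop, p a → (∀ x, p x → p (f x)) → ∀ k, p (g k) := by
  have hp : a ∈ periodicPts f := hf.mem_periodicPts a
  have hm := minimalPeriod_pos_of_mem_periodicPts hp
  refine ⟨minimalPeriod f a, fun k => f^[k] a, hm, fun k l h => Fin.ext ?_, fun k => ?_,
    ⟨⟨0, hm⟩, rfl⟩, fun p h0 h k => ?_⟩
  · exact iterate_injOn_Iio_minimalPeriod k.2 l.2 h
  · rw [← Function.iterate_succ_apply' f]; exact (iterate_mod_minimalPeriod_eq (f := f)).symm
  · have : ∀ n, p (f^[n] a) := fun n => by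
      induction n with
      | zero => exact h0
      | succ n ih => rw [Function.iterate_succ_apply']; exact h _ ih
    exact this k

namespace FinPresentation

open SingularManifold.Poly Cell

variable {P : FinPresentation}

/-! ### The caps are polygons -/

/-- The long sides of the ribbons, and the sides of the dummy legs. -/
abbrev SideEdge (P : FinPresentation) : Type := (Fin P.n × Bool) ⊕ (P.Occ × Bool)

/-- The gaps between the legs. -/
abbrev GapEdge (P : FinPresentation) : Type := Σ i : Fin P.n, Fin (deg i + 1) × Bool

/-- The ends of a side. -/
def sideEnd : P.SideEdge → Bool → P.BV
  | .inl (i, b), y => ⟨i, Fin.last _, y == b, b⟩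
  | .inr (o, u), y => if y = u then ⟨gen o, slot o, side o u, sgn o⟩
      else ⟨gen (next o), slot (next o), side (next o) u, !sgn (next o)⟩

/-- The ends of a gap. -/
def gapEnd (g : P.GapEdge) (y : Bool) : P.BV :=
  ⟨g.1, if y == g.2.2 then g.2.1 else cyc g.2.1, y == g.2.2, g.2.2⟩

theorem sideEnd_start (o : P.Occ) (u : Bool) :
    sideEnd (.inr (o, u)) u = ⟨gen o, slot o, side o u, sgn o⟩ := if_pos rfl

theorem sideEnd_finish (o : P.Occ) (u : Bool) : sideEnd (.inr (o, u)) (!u) =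
    ⟨gen (next o), slot (next o), side (next o) u, !sgn (next o)⟩ := if_neg (by cases u <;> decide)

theorem bool_cases (y u : Bool) : y = u ∨ y = !u := by decide +revert

/-- The parity of a vertex, which distinguishes the ends of a side, and those of a gap. -/
def parity (w : P.BV) : Bool := w.2.2.1 == w.2.2.2

theorem parity_gapEnd (g : P.GapEdge) (y : Bool) : parity (gapEnd g y) = y := by
  have : ∀ b c : Bool, ((b == c) == c) = b := by decide
  exact this _ _

theorem parity_sideEnd (g : P.SideEdge) (y : Bool) : parity (sideEnd g y) = y := by
  rcases g with ⟨i, b⟩ | ⟨o, u⟩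
  · have : ∀ b c : Bool, ((b == c) == c) = b := by decide
    exact this _ _
  · rcases bool_cases y u with rfl | rfl
    · rw [sideEnd_start]; simp only [parity, side]; cases sgn o <;> cases y <;> rfl
    · rw [sideEnd_finish]; simp only [parity, side]; cases sgn (next o) <;> cases u <;> rfl

theorem gapEnd_injective (y : Bool) : Injective fun g : P.GapEdge => gapEnd g y := by
  rintro ⟨i, s, b⟩ ⟨i', s', b'⟩ h
  simp only [gapEnd, Sigma.mk.injEq] at h
  obtain ⟨rfl, h⟩ := h
  simp only [heq_eq_eq, Prod.mk.injEq] at h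
  obtain ⟨h1, -, rfl⟩ := h
  split_ifs at h1
  · rw [h1]
  · rw [cyc_injective h1]

theorem gapEnd_surjective (w : P.BV) : ∃ g, gapEnd g (parity w) = w := by
  obtain ⟨i, s, x, b⟩ := w
  have : ∀ b c : Bool, ((b == c) == c) = b := by decide
  rcases x
  · obtain ⟨t, rfl⟩ := exists_cyc s; exact ⟨⟨i, t, b⟩, by simp [gapEnd, parity]⟩
  · exact ⟨⟨i, s, b⟩, by simp [gapEnd, parity]⟩

theorem slot_sigma_ne_last (o : P.Occ) (i : Fin P.n) :
    (⟨gen o, slot o⟩ : Σ i : Fin P.n, Fin (deg i + 1)) ≠ ⟨i, Fin.last _⟩ := by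
  intro h
  have h1 : gen o = i := congrArg Sigma.fst h
  subst h1
  simp only [Sigma.mk.injEq, heq_eq_eq, true_and] at h
  exact slot_ne_last o h

theorem legVertex_inj {o o' : P.Occ} {u u' b b' : Bool}
    (h : (⟨gen o, slot o, side o u, b⟩ : P.BV) = ⟨gen o', slot o', side o' u', b'⟩) :
    o = o' ∧ u = u' ∧ b = b' := by
  have := congrArg (fun w : P.BV => (hd w.1 (vt w.2.1 w.2.2.1) (en w.2.2.2) : P.Cell)) h
  obtain ⟨h1, h2, h3⟩ := hd_legAt_inj (υ := en u) (υ' := en u') (τ := en b) (τ' := en b') |>.1 this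
  exact ⟨h1, by simpa using h2, by simpa using h3⟩

theorem sideEnd_cases (o : P.Occ) (u y : Bool) :
    (y = u ∧ sideEnd (.inr (o, u)) y = ⟨gen o, slot o, side o u, sgn o⟩) ∨
    (y = (!u) ∧ sideEnd (.inr (o, u)) y =
      ⟨gen (next o), slot (next o), side (next o) u, !sgn (next o)⟩) := by
  rcases bool_cases y u with rfl | rfl
  · exact .inl ⟨rfl, sideEnd_start _ _⟩
  · exact .inr ⟨rfl, sideEnd_finish _ _⟩

theorem sideEnd_injective (y : Bool) : Injective fun g : P.SideEdge => sideEnd g y := by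
  have hs : ∀ {w w' : P.BV}, w = w' →
      (⟨w.1, w.2.1⟩ : Σ i : Fin P.n, Fin (deg i + 1)) = ⟨w'.1, w'.2.1⟩ ∧ w.2.2 = w'.2.2 := by
    simp
  rintro (⟨i, b⟩ | ⟨o, u⟩) (⟨i', b'⟩ | ⟨o', u'⟩) h
  · have h1 := congrArg Sigma.fst h
    have h2 := (hs h).2
    simp only [sideEnd, Prod.mk.injEq] at h1 h2
    rw [h1, h2.2]
  · have h1 := (hs h).1
    rcases bool_cases y u' with rfl | rfl
    · dsimp only at h1; rw [sideEnd_start] at h1; exact absurd h1.symm (slot_sigma_ne_last _ _)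
    · dsimp only at h1; rw [sideEnd_finish] at h1; exact absurd h1.symm (slot_sigma_ne_last _ _)
  · have h1 := (hs h).1
    rcases bool_cases y u with rfl | rfl
    · dsimp only at h1; rw [sideEnd_start] at h1; exact absurd h1 (slot_sigma_ne_last _ _)
    · dsimp only at h1; rw [sideEnd_finish] at h1; exact absurd h1 (slot_sigma_ne_last _ _)
  · change sideEnd _ _ = sideEnd _ _ at h
    rcases sideEnd_cases o u y with ⟨e1, e2⟩ | ⟨e1, e2⟩ <;>
      rcases sideEnd_cases o' u' y with ⟨e3, e4⟩ | ⟨e3, e4⟩ <;> rw [e2, e4] at h <;>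
      obtain ⟨h1, h2, h3⟩ := legVertex_inj h
    · rw [h1, h2]
    · grind
    · grind
    · rw [next_injective h1, h2]

theorem sideEnd_surjective (w : P.BV) : ∃ g, sideEnd g (parity w) = w := by
  obtain ⟨i, s, x, b⟩ := w
  have hb : ∀ b c : Bool, ((b == c) == c) = b := by decide
  rcases slot_cases s with rfl | ⟨o, h⟩
  · exact ⟨.inl (i, b), by simp only [sideEnd, parity, hb]⟩
  · obtain rfl : i = gen o := congrArg Sigma.fst h
    simp only [Sigma.mk.injEq, heq_eq_eq, true_and] at h
    subst h
    by_cases hs : b = sgn o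
    · refine ⟨.inr (o, side o x), ?_⟩
      have : parity (⟨gen o, slot o, x, b⟩ : P.BV) = side o x := by
        simp only [parity, side, hs]; cases sgn o <;> cases x <;> rfl
      rw [this, sideEnd_start, side_side, hs]
    · obtain ⟨o, rfl⟩ := next_surjective o
      obtain rfl : b = !sgn (next o) := by revert hs; cases b <;> cases sgn (next o) <;> decide
      refine ⟨.inr (o, side (next o) x), ?_⟩
      have : parity (⟨gen (next o), slot (next o), x, !sgn (next o)⟩ : P.BV) =
          !side (next o) x := by
        simp only [parity, side]; cases sgn (next o) <;> cases x <;> rfl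
      rw [this, sideEnd_finish, side_side]

/-- The vertices as cells. -/
def vertexCell (w : P.BV) : P.Cell := hd w.1 (vt w.2.1 w.2.2.1) (en w.2.2.2)

/-- The sides as cells. -/
def sideCell : P.SideEdge → P.Cell
  | .inl (i, b) => hd i (lg (Fin.last _)) (en b)
  | .inr (o, u) => rb o (en u)

/-- The gaps as cells. -/
def gapCell (g : P.GapEdge) : P.Cell := hd g.1 (gp g.2.1) (en g.2.2)

theorem vertexCell_injective : Injective (vertexCell : P.BV → P.Cell) := by
  rintro ⟨i, s, x, b⟩ ⟨i', s', x', b'⟩ h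
  simp only [vertexCell, hd.injEq] at h
  obtain ⟨rfl, h, h'⟩ := h
  cases h
  cases h'
  rfl

theorem le_vertexCell {p : P.Cell} {w : P.BV} : p ≤ vertexCell w ↔ p = vertexCell w := by
  rw [vertexCell, le_hd]
  simp

theorem le_gapCell {p : P.Cell} {g : P.GapEdge} :
    p ≤ gapCell g ↔ p = gapCell g ∨ ∃ y, p = vertexCell (gapEnd g y) := by
  obtain ⟨i, s, b⟩ := g
  rw [gapCell, le_hd]
  constructor
  · rintro ⟨a, ha, τ, hτ, rfl⟩
    rw [le_en] at hτ
    subst hτ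
    rcases a with ⟨t, x⟩ | t | t | _ <;> simp at ha
    · right
      refine ⟨x == b, ?_⟩
      have : ∀ b c : Bool, ((b == c) == c) = b := by decide
      rcases ha with ⟨rfl, h⟩ | ⟨rfl, h⟩ <;> simp only [vertexCell, gapEnd, this] <;> simp [h]
    · left; rw [ha]
  · rintro (rfl | ⟨y, rfl⟩)
    · simp
    · refine ⟨_, ?_, _, le_rfl, rfl⟩; simp only [gapEnd]; split_ifs with h <;> simp [h]

theorem le_sideCell {p : P.Cell} {g : P.SideEdge} :
    p ≤ sideCell g ↔ p = sideCell g ∨ ∃ y, p = vertexCell (sideEnd g y) := by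
  have hb : ∀ b c : Bool, ((b == c) == c) = b := by decide
  rcases g with ⟨i, b⟩ | ⟨o, u⟩
  · rw [sideCell, le_hd]
    constructor
    · rintro ⟨a, ha, τ, hτ, rfl⟩
      rw [le_en] at hτ
      subst hτ
      rcases a with ⟨t, x⟩ | t | t | _ <;> simp at ha
      · subst ha; exact .inr ⟨x == b, by simp [vertexCell, sideEnd, hb]⟩
      · grind
    · rintro (rfl | ⟨y, rfl⟩)
      · simp
      · exact ⟨_, by simp [sideEnd], _, le_rfl, rfl⟩
  · rw [sideCell, le_rb]
    constructor
    · rintro (⟨υ, hυ, rfl⟩ | ⟨υ, hυ, rfl⟩ | ⟨υ, hυ, rfl⟩) <;> rw [le_en] at hυ <;> subst hυ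
      · simp
      · exact .inr ⟨u, by rw [sideEnd_start]; rfl⟩
      · exact .inr ⟨!u, by rw [sideEnd_finish]; rfl⟩
    · rintro (rfl | ⟨y, rfl⟩)
      · simp
      · rcases bool_cases y u with rfl | rfl
        · rw [sideEnd_start]; exact .inr (.inl ⟨_, le_rfl, rfl⟩)
        · rw [sideEnd_finish]; exact .inr (.inr ⟨_, le_rfl, rfl⟩)

theorem bd_vertexCell {w : P.BV} {c : P.Caps} : Bd (vertexCell w) c ↔ c = capV w := by
  have h : Bd (vertexCell w) (capV w) := .inl ⟨_, _, _, _, rfl, rfl⟩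
  exact ⟨fun h' => h'.unique h, fun h' => h' ▸ h⟩

theorem capV_gapEnd (g : P.GapEdge) (y y' : Bool) : capV (gapEnd g y) = capV (gapEnd g y') := by
  have h : ∀ y, Bd (vertexCell (gapEnd g y)) (capV ⟨g.1, g.2.1, true, g.2.2⟩) := fun y =>
    (show Cell.Le (vertexCell (gapEnd g y)) (gapCell g) from le_gapCell.2 (.inr ⟨y, rfl⟩)).bd
      (.inr (.inl ⟨_, _, _, rfl, rfl⟩))
  rw [← bd_vertexCell.1 (h y), ← bd_vertexCell.1 (h y')]

theorem exists_bd_sideCell (g : P.SideEdge) : ∃ c, Bd (sideCell g) c := by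
  rcases g with ⟨i, b⟩ | ⟨o, u⟩
  · exact ⟨_, .inr (.inr (.inl ⟨_, _, rfl, rfl⟩))⟩
  · exact ⟨_, .inr (.inr (.inr ⟨_, _, rfl, rfl⟩))⟩

theorem bd_sideCell {g : P.SideEdge} {c : P.Caps} (y : Bool) :
    Bd (sideCell g) c ↔ c = capV (sideEnd g y) := by
  obtain ⟨c', h'⟩ := exists_bd_sideCell g
  have := bd_vertexCell.1 (Cell.Le.bd (show Cell.Le _ _ from le_sideCell.2 (.inr ⟨y, rfl⟩)) h')
  rw [← this]
  exact ⟨fun h => h.unique h', fun h => h ▸ h'⟩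

theorem capV_sideEnd (g : P.SideEdge) (y y' : Bool) : capV (sideEnd g y) = capV (sideEnd g y') := by
  obtain ⟨c, h⟩ := exists_bd_sideCell g
  rw [← (bd_sideCell y).1 h, ← (bd_sideCell y').1 h]

theorem bd_gapCell {g : P.GapEdge} {c : P.Caps} (y : Bool) :
    Bd (gapCell g) c ↔ c = capV (gapEnd g y) := by
  have h' : Bd (gapCell g) (capV ⟨g.1, g.2.1, true, g.2.2⟩) := .inr (.inl ⟨_, _, _, rfl, rfl⟩)
  have := bd_vertexCell.1 (Cell.Le.bd (show Cell.Le _ _ from le_gapCell.2 (.inr ⟨y, rfl⟩)) h')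
  rw [← this]
  exact ⟨fun h => h.unique h', fun h => h ▸ h'⟩

theorem bd_cases {p : P.Cell} {c : P.Caps} (h : Bd p c) :
    (∃ w, p = vertexCell w) ∨ (∃ g, p = sideCell g) ∨ ∃ g, p = gapCell g := by
  rcases h with ⟨i, s, x, b, rfl, -⟩ | ⟨i, s, b, rfl, -⟩ | ⟨i, b, rfl, -⟩ | ⟨o, u, rfl, -⟩
  · exact .inl ⟨⟨i, s, x, b⟩, rfl⟩
  · exact .inr (.inr ⟨⟨i, s, b⟩, rfl⟩)
  · exact .inr (.inl ⟨.inl (i, b), rfl⟩)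
  · exact .inr (.inl ⟨.inr (o, u), rfl⟩)

theorem capAdj_cases {w w' : P.BV} (h : P.CapAdj w w') :
    (∃ g y, w = sideEnd g y ∧ w' = sideEnd g !y) ∨ (∃ g y, w = gapEnd g y ∧ w' = gapEnd g !y) := by
  rcases h with ⟨i, s, b⟩ | ⟨i, b⟩ | ⟨o, u⟩
  · exact .inr ⟨⟨i, s, b⟩, b, by simp [gapEnd], by simp [gapEnd]⟩
  · refine .inl ⟨.inl (i, b), !b, by simp [sideEnd], by simp [sideEnd]⟩
  · exact .inl ⟨.inr (o, u), u, (sideEnd_start o u).symm, (sideEnd_finish o u).symm⟩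

theorem sideCell_injective : Injective (sideCell : P.SideEdge → P.Cell) := by
  rintro (⟨i, b⟩ | ⟨o, u⟩) (⟨i', b'⟩ | ⟨o', u'⟩) h <;> cases h <;> rfl

theorem gapCell_injective : Injective (gapCell : P.GapEdge → P.Cell) := by
  rintro ⟨i, s, b⟩ ⟨i', s', b'⟩ h
  cases h
  rfl

theorem vertexCell_ne_sideCell {w : P.BV} {g : P.SideEdge} : vertexCell w ≠ sideCell g := by
  rcases g with ⟨i, b⟩ | ⟨o, u⟩ <;> intro h <;> cases h

theorem vertexCell_ne_gapCell {w : P.BV} {g : P.GapEdge} : vertexCell w ≠ gapCell g := by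
  intro h
  simp only [vertexCell, gapCell, hd.injEq] at h
  obtain ⟨h1, h2, -⟩ := h
  obtain ⟨i, s⟩ := w
  obtain ⟨i', s'⟩ := g
  dsimp only at h1
  subst h1
  cases h2

theorem sideCell_ne_gapCell {g : P.SideEdge} {g' : P.GapEdge} : sideCell g ≠ gapCell g' := by
  rcases g with ⟨i, b⟩ | ⟨o, u⟩ <;> intro h <;> cases h

theorem isBall_cp (c : P.Caps) : IsBall (cp c : P.Cell) := by
  have e1 : ∀ a : P.SideEdge, ∃ g : P.GapEdge, gapEnd g true = sideEnd a true := fun a => by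
    obtain ⟨g, hg⟩ := gapEnd_surjective (sideEnd a true)
    exact ⟨g, by rwa [parity_sideEnd] at hg⟩
  have e2 : ∀ g : P.GapEdge, ∃ a : P.SideEdge, sideEnd a false = gapEnd g false := fun g => by
    obtain ⟨a, ha⟩ := sideEnd_surjective (gapEnd g false)
    exact ⟨a, by rwa [parity_gapEnd] at ha⟩
  choose τ hτ using e1
  choose υ hυ using e2
  have hinj : Injective fun a => υ (τ a) := fun a a' h => by
    have h1 := (hυ (τ a)).symm.trans ((congrArg (sideEnd · false) h).trans (hυ (τ a')))
    have h2 := gapEnd_injective false h1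
    exact sideEnd_injective true ((hτ a).symm.trans ((congrArg (gapEnd · true) h2).trans (hτ a')))
  obtain ⟨w, rfl⟩ : ∃ w, capV w = c := Quot.exists_rep c
  obtain ⟨a₀, ha₀⟩ := sideEnd_surjective w
  obtain ⟨m, f, hm, hf, hcyc, ⟨k₀, rfl⟩, hind⟩ := exists_cycle hinj a₀
  have hτi : Injective τ := fun a a' h => hinj (congrArg υ h)
  let j : Poly m → P.Cell := fun
    | vt k y => vertexCell (sideEnd (f k) y)
    | lg k => sideCell (f k)
    | gp k => gapCell (τ (f k))
    | tp => cp (capV w)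
  have hside : ∀ a a' y y', sideEnd (P := P) a y = sideEnd a' y' ↔ a = a' ∧ y = y' := by
    refine fun a a' y y' => ⟨fun h => ?_, fun h => by rw [h.1, h.2]⟩
    have := congrArg parity h
    rw [parity_sideEnd, parity_sideEnd] at this
    subst this
    exact ⟨sideEnd_injective y h, rfl⟩
  have hgap0 : ∀ k, gapEnd (τ (f k)) false = sideEnd (f (cyc k)) false := fun k => by
    rw [← hcyc, hυ]
  have key : ∀ w', (∃ k y, w' = sideEnd (f k) y) ↔ capV w' = capV w := by
    have hstep : ∀ v v', P.CapAdj v v' → ((∃ k y, v = sideEnd (f k) y) ↔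
        ∃ k y, v' = sideEnd (f k) y) := by
      have hg : ∀ g y, (∃ k y', gapEnd g y = sideEnd (f k) y') → ∃ k, g = τ (f k) := by
        rintro g y ⟨k, y', h⟩
        obtain rfl : y = y' := by
          have := congrArg parity h
          rwa [parity_sideEnd, parity_gapEnd] at this
        rcases y
        · obtain ⟨k', rfl⟩ := exists_cyc k; rw [← hgap0] at h; exact ⟨k', gapEnd_injective false h⟩
        · rw [← hτ] at h; exact ⟨k, gapEnd_injective true h⟩
      have hg' : ∀ k y, ∃ k' y', gapEnd (τ (f k)) y = sideEnd (f k') y' := by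
        rintro k (_ | _)
        · grind
        · grind
      intro v v' h
      rcases capAdj_cases h with ⟨g, y, rfl, rfl⟩ | ⟨g, y, rfl, rfl⟩
      · grind
      · constructor
        · intro h; obtain ⟨k, rfl⟩ := hg _ _ h; exact hg' _ _
        · intro h; obtain ⟨k, rfl⟩ := hg _ _ h; exact hg' _ _
    have hcl : ∀ v v', capV v = capV v' → ((∃ k y, v = sideEnd (f k) y) ↔
        ∃ k y, v' = sideEnd (f k) y) := by
      intro v v' h
      have h' := Quot.eqvGen_exact h
      clear h
      clear_value j
      clear j
      induction h' with
      | rel v v' h => exact hstep v v' h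
      | refl => exact Iff.rfl
      | symm v v' _ ih => exact ih.symm
      | trans u v v' _ _ ih1 ih2 => exact ih1.trans ih2
    refine fun w' => ⟨?_, fun h => (hcl _ _ h).2 ⟨k₀, _, ha₀.symm⟩⟩
    have h1 : ∀ k, capV (sideEnd (f k) true) = capV w := by
      refine hind (fun a => capV (sideEnd a true) = capV w) ?_ fun a ha => ?_
      · rw [capV_sideEnd _ _ (parity w), ha₀]
      · rw [capV_sideEnd _ _ false, hυ, capV_gapEnd _ _ true, hτ, ha]
    rintro ⟨k, y, rfl⟩
    rw [capV_sideEnd _ _ true, h1]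
  have hcap : ∀ k y, capV (sideEnd (f k) y) = capV w := fun k y => (key _).1 ⟨k, y, rfl⟩
  have hgap : ∀ k y l y', gapEnd (τ (f k)) y = sideEnd (f l) y' ↔
      y = y' ∧ ((y = true ∧ k = l) ∨ (y = false ∧ cyc k = l)) := by
    intro k y l y'
    rcases y
    · rw [hgap0, hside, hf.eq_iff]; simp [and_comm]
    · rw [hτ, hside, hf.eq_iff]; simp [and_comm]
  refine (isBall_poly hm tp).map (j := j) ?_ ?_
  · rintro (⟨k, y⟩ | k | k | _) (⟨l, z⟩ | l | l | _) <;> simp only [j]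
    · rw [le_vertexCell, vertexCell_injective.eq_iff, hside, hf.eq_iff]; simp
    · rw [le_sideCell, or_iff_right vertexCell_ne_sideCell]
      simp only [vertexCell_injective.eq_iff, hside, hf.eq_iff]
      simp
    · rw [le_gapCell, or_iff_right vertexCell_ne_gapCell]
      simp only [vertexCell_injective.eq_iff, eq_comm (a := sideEnd _ _), hgap]
      rw [vt_le_gp]
      cases y <;> simp [eq_comm]
    · rw [le_cp, bd_vertexCell, hcap]; simp
    · rw [le_vertexCell]; simp [vertexCell_ne_sideCell.symm]
    · rw [le_sideCell, sideCell_injective.eq_iff, hf.eq_iff]; simp [vertexCell_ne_sideCell.symm]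
    · rw [le_gapCell]; simp [vertexCell_ne_sideCell.symm, sideCell_ne_gapCell]
    · rw [le_cp, bd_sideCell true, hcap]; simp
    · rw [le_vertexCell]; simp [vertexCell_ne_gapCell.symm]
    · rw [le_sideCell]; simp [vertexCell_ne_gapCell.symm, sideCell_ne_gapCell.symm]
    · rw [le_gapCell, gapCell_injective.eq_iff, hτi.eq_iff, hf.eq_iff]
      simp [vertexCell_ne_gapCell.symm]
    · rw [le_cp, bd_gapCell true, hτ, hcap]; simp
    · rw [le_vertexCell, vertexCell]; simp
    · rw [le_sideCell]
      simp only [tp_le, reduceCtorEq, iff_false, not_or, not_exists]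
      exact ⟨by rcases f l with ⟨i, b⟩ | ⟨o, u⟩ <;> simp [sideCell], by simp [vertexCell]⟩
    · rw [le_gapCell]; simp [vertexCell, gapCell]
    · simp
  · intro x y hx
    have hx : x ≤ cp (capV w) := by
      refine hx.trans ?_
      rcases y with ⟨k, y⟩ | k | k | _
      · exact le_cp.2 (.inr (bd_vertexCell.2 (hcap _ _).symm))
      · exact le_cp.2 (.inr ((bd_sideCell true).2 (hcap _ _).symm))
      · exact le_cp.2 (.inr ((bd_gapCell true).2 (by rw [hτ, hcap])))
      · exact le_rfl
    rcases le_cp.1 hx with rfl | hx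
    · exact ⟨tp, rfl⟩
    rcases bd_cases hx with ⟨v, rfl⟩ | ⟨g, rfl⟩ | ⟨g, rfl⟩
    · obtain ⟨k, y, rfl⟩ := (key v).2 (bd_vertexCell.1 hx).symm; exact ⟨vt k y, rfl⟩
    · obtain ⟨k, y, h⟩ := (key _).2 ((bd_sideCell true).1 hx).symm
      exact ⟨lg k, congrArg sideCell ((hside _ _ _ _).1 h).1.symm⟩
    · obtain ⟨k, y, h⟩ := (key _).2 ((bd_gapCell true).1 hx).symm
      have hy := congrArg parity h
      rw [parity_sideEnd, parity_gapEnd] at hy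
      subst hy
      rw [← hτ] at h
      exact ⟨gp k, congrArg gapCell (gapEnd_injective true h).symm⟩

/-! ### Charts -/

theorem isBall_hd (i : Fin P.n) (a : Poly (deg i + 1)) (τ : IF) : IsBall (hd i a τ : P.Cell) :=
  ((isBall_poly (Nat.succ_pos _) a).prod τ).map (j := hdEmb i)
    (fun x y => ⟨hdEmb_reflect i x y, fun h => monotone_hdEmb i h⟩) fun x y hx =>
      le_hd_top.1 (hx.trans (le_hd_top.2 ⟨y, rfl⟩))

theorem isBall_rb (o : P.Occ) (υ : IF) : IsBall (rb o υ : P.Cell) :=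
  ((isBall_if υ).prod md).map (j := ribEmb o) (ribEmb_le_iff o) fun x y hx =>
    le_rb_md.1 (hx.trans (le_rb_md.2 ⟨y, rfl⟩))

theorem isBall_dc (j : Fin P.k) (υ : IF) : IsBall (dc j υ : P.Cell) :=
  ((isBall_poly (List.length_pos_iff.2 (P.rel_ne_nil j)) tp).prod υ).map (j := polyEmb j)
    (polyEmb_le_iff j) fun x y hx => le_dc_md.1 (hx.trans (le_dc_md.2 ⟨y, rfl⟩))

theorem isBall_of_ne_om {p : P.Cell} (hp : p ≠ om) : IsBall p := by
  rcases p with ⟨i, a, τ⟩ | ⟨o, υ⟩ | ⟨j, υ⟩ | c | _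
  · exact isBall_hd _ _ _
  · exact isBall_rb _ _
  · exact isBall_dc _ _
  · exact isBall_cp _
  · grind

theorem isBall_omegaCell (p : P.OmegaCell) : IsBall p :=
  (isBall_of_ne_om p.2.ne).of_map (j := Subtype.val) (fun _ _ => Iff.rfl) fun x y hx =>
    ⟨⟨x, hx.trans_lt y.2⟩, rfl⟩

theorem if_vt_le (τ : IF) : ∃ b, en b ≤ τ := by
  rcases τ with b | _
  · simp
  · simp

theorem exists_vt_le {n : ℕ} (hn : 0 < n) (a : Poly n) : ∃ s x, vt s x ≤ a := by
  rcases a with ⟨s, x⟩ | s | s | _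
  · simp
  · simp
  · simp
  · exact ⟨⟨0, hn⟩, true, le_tp _⟩

theorem exists_vertexCell_le {p : P.Cell} (hp : p ≠ om) : ∃ w, vertexCell w ≤ p := by
  rcases p with ⟨i, a, τ⟩ | ⟨o, υ⟩ | ⟨j, υ⟩ | c | _
  · obtain ⟨s, x, h1⟩ := exists_vt_le (Nat.succ_pos _) a
    obtain ⟨b, h2⟩ := if_vt_le τ
    exact ⟨⟨i, s, x, b⟩, hd_le_hd.2 ⟨h1, h2⟩⟩
  · obtain ⟨u, h⟩ := if_vt_le υ
    exact ⟨⟨gen o, slot o, side o u, sgn o⟩, le_rb.2 (.inr (.inl ⟨_, h, rfl⟩))⟩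
  · obtain ⟨u, h⟩ := if_vt_le υ
    have hl := List.length_pos_iff.2 (P.rel_ne_nil j)
    exact ⟨⟨gen ⟨j, ⟨0, hl⟩⟩, slot ⟨j, ⟨0, hl⟩⟩, side ⟨j, ⟨0, hl⟩⟩ u, true⟩,
      le_dc.2 (.inr (.inr ⟨_, rfl, _, h, _, rfl⟩))⟩
  · obtain ⟨w, rfl⟩ : ∃ w, capV w = c := Quot.exists_rep c
    exact ⟨w, le_cp.2 (.inr (bd_vertexCell.2 rfl))⟩
  · grind

theorem vertexCell_minimal (w : P.BV) : ∀ q ≤ vertexCell w, q = vertexCell w :=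
  fun _ => le_vertexCell.1

theorem if_ge {b : Bool} {τ : IF} (h : en b ≤ τ) : τ = en b ∨ τ = md := by
  rcases h with rfl | rfl
  · simp
  · simp

/-- The cells above a vertex. -/
theorem vertexCell_le {w : P.BV} {q : P.Cell} (h : vertexCell w ≤ q) :
    (∃ a τ, q = hd w.1 a τ ∧ vt w.2.1 w.2.2.1 ≤ a ∧ (τ = en w.2.2.2 ∨ τ = md)) ∨
    (∃ o υ, q = rb o υ) ∨ (∃ j υ, q = dc j υ) ∨ q = cp (capV w) ∨ q = om := by
  rcases q with ⟨i, a, τ⟩ | ⟨o, υ⟩ | ⟨j, υ⟩ | c | _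
  · left
    obtain ⟨a', ha, τ', hτ, h⟩ := le_hd.1 h
    obtain ⟨i', s, x, b⟩ := w
    simp only [vertexCell, hd.injEq] at h
    obtain ⟨rfl, h, rfl⟩ := h
    cases h
    exact ⟨a, τ, rfl, ha, if_ge hτ⟩
  · simp
  · simp
  · rcases le_cp.1 h with h | h
    · cases h
    · rw [bd_vertexCell.1 h]; simp
  · simp

theorem not_last_le_rb {i : Fin P.n} {x τ} {o : P.Occ} {υ} :
    ¬ (hd i (vt (Fin.last _) x) τ : P.Cell) ≤ rb o υ := by
  rw [le_rb]
  rintro (⟨υ', -, h⟩ | ⟨υ', -, h⟩ | ⟨υ', -, h⟩)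
  · cases h
  all_goals
    rcases υ' with u | _ <;> simp only [legAt, hd.injEq] at h <;> obtain ⟨rfl, h, -⟩ := h
    · simp only [heq_eq_eq, vt.injEq] at h; exact slot_ne_last _ h.1.symm
    · simp at h

theorem not_last_le_dc {i : Fin P.n} {x τ} {j : Fin P.k} {υ} :
    ¬ (hd i (vt (Fin.last _) x) τ : P.Cell) ≤ dc j υ := by
  rw [le_dc]
  rintro (⟨υ', -, h⟩ | ⟨o, -, υ', -, h⟩ | ⟨o, -, υ', -, τ', h⟩)
  · cases h
  · cases h
  · rcases υ' with u | _ <;> simp only [legAt, hd.injEq] at h <;> obtain ⟨rfl, h, -⟩ := h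
    · simp only [heq_eq_eq, vt.injEq] at h; exact slot_ne_last _ h.1.symm
    · simp at h

theorem range_dummyModel {i : Fin P.n} {x b : Bool} {t : Fin (deg i + 1)}
    (ht : vt (Fin.last _) x ≤ gp t) :
    Set.range (dummyModel i x b t) = Set.Ici (vertexCell ⟨i, Fin.last _, x, b⟩) := by
  ext q
  constructor
  · rintro ⟨z, rfl⟩; exact (dummyModel_le_iff ht .o z).2 (by revert z; decide)
  · intro h
    rcases vertexCell_le h with ⟨a, τ, rfl, ha, hτ⟩ | ⟨o, υ, rfl⟩ | ⟨j, υ, rfl⟩ | rfl | rfl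
    · dsimp only at ha hτ
      rcases vt_le ha with rfl | rfl | ⟨t', rfl⟩ | rfl <;> rcases hτ with rfl | rfl
      · exact ⟨.o, rfl⟩
      · exact ⟨.w, rfl⟩
      · exact ⟨.l, rfl⟩
      · exact ⟨.li, rfl⟩
      · rw [gap_unique ha ht]; exact ⟨.g, rfl⟩
      · rw [gap_unique ha ht]; exact ⟨.gi, rfl⟩
      · exact ⟨.d, rfl⟩
      · exact ⟨.h, rfl⟩
    · exact absurd h not_last_le_rb
    · exact absurd h not_last_le_dc
    · exact ⟨.c, rfl⟩
    · exact ⟨.om, rfl⟩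

theorem range_legModel {o o' : P.Occ} {u b : Bool} {t : Fin (deg (gen o) + 1)}
    (ht : vt (slot o) (side o u) ≤ gp t)
    (ho : (b = sgn o ∧ o' = o) ∨ (b = (!sgn o) ∧ o = next o')) :
    Set.range (legModel o o' u b t) = Set.Ici (vertexCell ⟨gen o, slot o, side o u, b⟩) := by
  ext q
  constructor
  · rintro ⟨z, rfl⟩; exact (legModel_le_iff ht ho (.o, false) z).2 (by revert z; decide)
  · intro h
    rcases vertexCell_le h with ⟨a, τ, rfl, ha, hτ⟩ | ⟨o'', υ, rfl⟩ | ⟨j, υ, rfl⟩ | rfl | rfl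
    · dsimp only at ha hτ
      rcases vt_le ha with rfl | rfl | ⟨t', rfl⟩ | rfl <;> rcases hτ with rfl | rfl
      · exact ⟨(.o, false), rfl⟩
      · exact ⟨(.c, false), rfl⟩
      · exact ⟨(.o, true), rfl⟩
      · exact ⟨(.c, true), rfl⟩
      · rw [gap_unique ha ht]; exact ⟨(.b, false), rfl⟩
      · rw [gap_unique ha ht]; exact ⟨(.bc, false), rfl⟩
      · exact ⟨(.b, true), rfl⟩
      · exact ⟨(.bc, true), rfl⟩
    · obtain ⟨h1, h2⟩ := hd_le_rb_iff (υ := en u) |>.1 h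
      obtain rfl : o' = o'' := by
        rcases ho with ⟨rfl, rfl⟩ | ⟨rfl, rfl⟩ <;> rcases h2 with ⟨h2, h3⟩ | ⟨h2, h3⟩
        · exact h2
        · simp at h3
        · simp at h3
        · exact next_injective h2
      rcases if_ge h1 with rfl | rfl
      · exact ⟨(.a, false), rfl⟩
      · exact ⟨(.a, true), rfl⟩
    · obtain ⟨rfl, h1⟩ := hd_le_dc (υ := en u) |>.1 h
      rcases if_ge h1 with rfl | rfl
      · exact ⟨(.ac, false), rfl⟩
      · exact ⟨(.ac, true), rfl⟩
    · exact ⟨(.ab, false), rfl⟩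
    · exact ⟨(.ab, true), rfl⟩

/-- The vertices are those on a leg and those of the dummy legs. -/
theorem vertex_cases (w : P.BV) :
    (∃ i x b t, w = ⟨i, Fin.last _, x, b⟩ ∧ vt (Fin.last (deg i)) x ≤ gp t) ∨
    ∃ o o' u b t, w = ⟨gen o, slot o, side o u, b⟩ ∧ vt (slot o) (side o u) ≤ gp t ∧
      ((b = sgn o ∧ o' = o) ∨ (b = (!sgn o) ∧ o = next o')) := by
  obtain ⟨i, s, x, b⟩ := w
  obtain ⟨t, ht⟩ := exists_gap s x
  rcases slot_cases s with rfl | ⟨o, h⟩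
  · grind
  · obtain rfl : i = gen o := congrArg Sigma.fst h
    simp only [Sigma.mk.injEq, heq_eq_eq, true_and] at h
    subst h
    right
    rcases bool_cases b (sgn o) with hb | hb
    · exact ⟨o, o, side o x, b, t, by rw [side_side], by rwa [side_side], .inl ⟨hb, rfl⟩⟩
    · obtain ⟨o', rfl⟩ := next_surjective o
      exact ⟨_, o', side _ x, b, t, by rw [side_side], by rwa [side_side], .inr ⟨hb, rfl⟩⟩

theorem exists_vertex_chart (w : P.BV) :
    ∃ f : Star (vertexCell w) → {z : ℝ × ℝ × ℝ // 0 ≤ z.1}, IsOpenEmbedding f := by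
  rcases vertex_cases w with ⟨i, x, b, t, rfl, ht⟩ | ⟨o, o', u, b, t, rfl, ht, ho⟩
  · obtain ⟨h⟩ := star_homeo (dummyModel_le_iff ht) (range_dummyModel ht) (b := .o) rfl
      (vertexCell_minimal _)
    obtain ⟨f, hf⟩ := Fin9.exists_chart
    exact ⟨f ∘ h, hf.comp h.isOpenEmbedding⟩
  · obtain ⟨h⟩ := star_homeo (legModel_le_iff ht ho) (range_legModel ht ho) (b := (.o, false)) rfl
      (vertexCell_minimal _)
    obtain ⟨f, hf⟩ := exists_chart_prod Hex.exists_chart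
    exact ⟨f ∘ h, hf.comp h.isOpenEmbedding⟩

/-- The cells of the surface at a vertex on a leg. -/
def hexCell : Hex → Hex × Bool
  | .o => (.o, false)
  | .a => (.a, false)
  | .b => (.b, false)
  | .c => (.o, true)
  | .ab => (.ab, false)
  | .ac => (.a, true)
  | .bc => (.b, true)

/-- The cells of the surface at a vertex that is not on a leg. -/
def fourgonCell : Fourgon → Fin9
  | .o => .o
  | .l => .l
  | .g => .g
  | .d => .d
  | .c => .c

theorem exists_star_homeo_restrict {M N : Type} [Fintype M] [PartialOrder M] [Fintype N]
    [PartialOrder N] {e : N → P.Cell} {κ : M → N} {v : P.OmegaCell} {top : N} {b : M}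
    (he : ∀ x y, e x ≤ e y ↔ x ≤ y) (htop : e top = om) (hκ : ∀ x y, κ x ≤ κ y ↔ x ≤ y)
    (hr : ∀ z, (z ≤ top ∧ ¬ top ≤ z) ↔ ∃ x, κ x = z) (hre : Set.range e = Set.Ici v.1)
    (hb : e (κ b) = v.1) (hv : ∀ q ≤ v, q = v) : Nonempty (Star v ≃ₜ Star b) := by
  have hlt : ∀ z, e z < om ↔ z ≤ top ∧ ¬ top ≤ z := fun z => by
    rw [← htop, lt_iff_le_not_ge, he, he]
  refine star_homeo (e := fun x => (⟨e (κ x), (hlt _).2 ((hr _).2 ⟨x, rfl⟩)⟩ : P.OmegaCell))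
    (fun x y => (he _ _).trans (hκ _ _)) ?_ (Subtype.ext hb) hv
  ext q
  constructor
  · rintro ⟨x, rfl⟩; have : e (κ x) ∈ Set.range e := ⟨_, rfl⟩; rwa [hre] at this
  · intro hq
    obtain ⟨z, hz⟩ : q.1 ∈ Set.range e := by simp_all
    obtain ⟨x, rfl⟩ := (hr z).1 ((hlt z).1 (by rw [hz]; exact q.2))
    exact ⟨x, Subtype.ext hz⟩

theorem vertexCell_lt_om (w : P.BV) : vertexCell w < om :=
  lt_of_le_of_ne (hd_le_om.2 ⟨_, rfl⟩) (by simp [vertexCell])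

theorem exists_vertex_chart_omega (w : P.BV) :
    ∃ f : Star (⟨vertexCell w, vertexCell_lt_om w⟩ : P.OmegaCell) → ℝ × ℝ,
      IsOpenEmbedding f := by
  have hmin : ∀ q ≤ (⟨vertexCell w, vertexCell_lt_om w⟩ : P.OmegaCell), q = ⟨_, vertexCell_lt_om w⟩ :=
    fun q hq => Subtype.ext (vertexCell_minimal w _ hq)
  rcases vertex_cases w with ⟨i, x, b, t, rfl, ht⟩ | ⟨o, o', u, b, t, rfl, ht, ho⟩
  · obtain ⟨h⟩ := exists_star_homeo_restrict (κ := fourgonCell) (b := .o) (top := .om)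
      (dummyModel_le_iff ht) rfl (by decide) (by decide) (range_dummyModel ht) rfl hmin
    obtain ⟨f, hf⟩ := Fourgon.exists_chart
    exact ⟨f ∘ h, hf.comp h.isOpenEmbedding⟩
  · obtain ⟨h⟩ := exists_star_homeo_restrict (κ := hexCell) (b := .o) (top := (.ab, true))
      (legModel_le_iff ht ho) rfl (by decide) (by decide) (range_legModel ht ho) rfl hmin
    obtain ⟨f, hf⟩ := Hex.exists_chart
    exact ⟨f ∘ h, hf.comp h.isOpenEmbedding⟩

theorem exists_chart_omega (p : P.OmegaCell) :
    ∃ f : Star p → ℝ × ℝ, IsOpenEmbedding f := by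
  obtain ⟨w, hw⟩ := exists_vertexCell_le p.2.ne
  obtain ⟨f, hf⟩ := exists_star_embedding (v := ⟨vertexCell w, vertexCell_lt_om w⟩)
    (isBall_omegaCell p) hw
  obtain ⟨g, hg⟩ := exists_vertex_chart_omega w
  exact ⟨g ∘ f, hg.comp hf⟩

theorem exists_chart {p : P.Cell} (hp : p ≠ om) :
    ∃ f : Star p → {z : ℝ × ℝ × ℝ // 0 ≤ z.1}, IsOpenEmbedding f := by
  obtain ⟨w, hw⟩ := exists_vertexCell_le hp
  obtain ⟨f, hf⟩ := exists_star_embedding (isBall_of_ne_om hp) hw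
  obtain ⟨g, hg⟩ := exists_vertex_chart w
  exact ⟨g ∘ f, hg.comp hf⟩

end FinPresentation

/-- Coordinates of the plane. -/
def planeHomeo : ℝ × ℝ ≃ₜ EuclideanSpace ℝ (Fin 2) where
  toFun z := !₂[z.1, z.2]
  invFun x := (x 0, x 1)
  left_inv _ := rfl
  right_inv x := by ext i; fin_cases i <;> rfl
  continuous_toFun := by
    refine (PiLp.continuous_toLp 2 _).comp (continuous_pi fun i => ?_)
    fin_cases i
    · exact continuous_fst
    · exact continuous_snd
  continuous_invFun := by fun_prop

/-- Coordinates of the half space. -/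
def halfSpaceHomeo : {z : ℝ × ℝ × ℝ // 0 ≤ z.1} ≃ₜ EuclideanHalfSpace 3 where
  toFun z := ⟨!₂[z.1.1, z.1.2.1, z.1.2.2], z.2⟩
  invFun x := ⟨(x.1 0, x.1 1, x.1 2), x.2⟩
  left_inv _ := rfl
  right_inv x := by apply Subtype.ext; ext i; fin_cases i <;> rfl
  continuous_toFun := by
    refine Continuous.subtype_mk ((PiLp.continuous_toLp 2 _).comp (continuous_pi fun i => ?_)) _
    fin_cases i
    · exact continuous_fst.comp continuous_subtype_val
    · exact continuous_fst.comp (continuous_snd.comp continuous_subtype_val)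
    · exact continuous_snd.comp (continuous_snd.comp continuous_subtype_val)
  continuous_invFun := by refine Continuous.subtype_mk ?_ _; fun_prop

namespace FinPresentation

open SingularManifold.Poly Cell

variable {P : FinPresentation}

theorem locallyPlane_omega : Nonempty (ChartedSpace (EuclideanSpace ℝ (Fin 2)) P.Omega) := by
  refine nonempty_chartedSpace fun y => ?_
  obtain ⟨t, rfl⟩ := omegaHomeo.surjective y
  obtain ⟨p, hp⟩ := t.exists_ne
  obtain ⟨f, hf⟩ := exists_chart_omega p
  exact ⟨Star p, inferInstance, omegaHomeo ∘ Subtype.val, planeHomeo ∘ f,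
    omegaHomeo.isOpenEmbedding.comp (isOpen_star p).isOpenEmbedding_subtypeVal,
    planeHomeo.isOpenEmbedding.comp hf, ⟨t, hp⟩, rfl⟩

theorem xHomeo_omega : P.xHomeo P.omega = OC.vtx om := coneMap_apex

theorem manifold_compl_omega :
    Nonempty (ChartedSpace (EuclideanHalfSpace 3) ({P.omega}ᶜ : Set P.X)) := by
  refine nonempty_chartedSpace fun y => ?_
  obtain ⟨p, hp, hpo⟩ : ∃ p, P.xHomeo y.1 p ≠ 0 ∧ p ≠ om := by
    by_contra! h
    refine y.2 (P.xHomeo.injective ?_)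
    rw [OC.eq_vtx_of_ne h, xHomeo_omega]
  obtain ⟨f, hf⟩ := exists_chart hpo
  have hne : ∀ t : Star p, P.xHomeo.symm t.1 ∈ ({P.omega}ᶜ : Set P.X) := fun t h => by
    have := congrArg P.xHomeo h
    rw [Homeomorph.apply_symm_apply, xHomeo_omega] at this
    refine t.2 ?_
    rw [this, OC.vtx_apply, if_neg hpo]
  refine ⟨Star p, inferInstance, fun t => ⟨P.xHomeo.symm t.1, hne t⟩, halfSpaceHomeo ∘ f, ?_,
    halfSpaceHomeo.isOpenEmbedding.comp hf, ⟨P.xHomeo y.1, hp⟩,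
    Subtype.ext (P.xHomeo.symm_apply_apply _)⟩
  refine IsOpenEmbedding.of_comp _ (g := Subtype.val)
    (isOpen_compl_singleton.isOpenEmbedding_subtypeVal) ?_
  exact P.xHomeo.symm.isOpenEmbedding.comp (isOpen_star p).isOpenEmbedding_subtypeVal

end FinPresentation

/-! ### Order complexes as simplicial complexes -/

section Triangulation

variable (Q : Type) [Fintype Q] [PartialOrder Q]

/-- The vertices of the geometric realisation of the order complex. -/
def realVertex (q : Q) : EuclideanSpace ℝ (Fin (Fintype.card Q)) :=
  EuclideanSpace.single (Fintype.equivFin Q q) 1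

theorem realVertex_apply (q q' : Q) :
    realVertex Q q (Fintype.equivFin Q q') = if q' = q then 1 else 0 := by
  simp [realVertex]

theorem realVertex_injective : Injective (realVertex Q) := fun q q' h => by
  have := congrArg (fun x => x (Fintype.equivFin Q q)) h
  simp only [realVertex_apply, if_true] at this
  by_contra h'
  simp [h'] at this

theorem affineIndependent_realVertex : AffineIndependent ℝ (realVertex Q) := by
  have h := (EuclideanSpace.basisFun (Fin (Fintype.card Q)) ℝ).orthonormal.linearIndependent
  have h2 := h.comp _ (Fintype.equivFin Q).injective
  have : realVertex Q =
      ⇑(EuclideanSpace.basisFun (Fin (Fintype.card Q)) ℝ) ∘ ⇑(Fintype.equivFin Q) := by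
    ext q
    simp [realVertex]
  rw [this]
  exact h2.affineIndependent

/-- The order complex as a geometric simplicial complex. -/
def orderComplex : Geometry.SimplicialComplex ℝ (EuclideanSpace ℝ (Fin (Fintype.card Q))) :=
  .ofAffineIndependent
    { faces := {s | s.Nonempty ∧ (∀ x ∈ s, ∃ q, realVertex Q q = x) ∧
        ∀ p q, realVertex Q p ∈ s → realVertex Q q ∈ s → p ≤ q ∨ q ≤ p}
      isRelLowerSet_faces := fun s hs => ⟨hs.1, fun t hts ht =>
        ⟨ht, fun x hx => hs.2.1 x (hts hx), fun p q hp hq => hs.2.2 p q (hts hp) (hts hq)⟩⟩ }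
    ((affineIndependent_realVertex Q).range.mono (by
      intro x hx
      simp only [Set.mem_iUnion, Finset.mem_coe] at hx
      obtain ⟨s, hs, hx⟩ := hx
      exact hs.2.1 x hx))

theorem finite_orderComplex : (orderComplex Q).faces.Finite := by
  refine (Finset.univ.image (realVertex Q)).powerset.finite_toSet.subset fun s hs => ?_
  simp only [Finset.coe_powerset, Set.mem_preimage, Set.mem_powerset_iff, Finset.coe_image]
  intro x hx
  obtain ⟨q, rfl⟩ := hs.2.1 x hx
  exact ⟨q, by simp, rfl⟩

theorem sum_realVertex (x : EuclideanSpace ℝ (Fin (Fintype.card Q))) :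
    ∑ q, x (Fintype.equivFin Q q) • realVertex Q q = x := by
  ext i
  obtain ⟨q, rfl⟩ := (Fintype.equivFin Q).surjective i
  simp only [WithLp.ofLp_sum, WithLp.ofLp_smul, Finset.sum_apply, Pi.smul_apply, realVertex_apply,
    smul_eq_mul, mul_ite, mul_one, mul_zero]
  simp

theorem mem_space_orderComplex {x : EuclideanSpace ℝ (Fin (Fintype.card Q))} :
    x ∈ (orderComplex Q).space ↔ (fun q => x (Fintype.equivFin Q q)) ∈ ocSet Q := by
  rw [Geometry.SimplicialComplex.mem_space_iff]
  constructor
  · rintro ⟨s, hs, hx⟩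
    let C : Set (EuclideanSpace ℝ (Fin (Fintype.card Q))) :=
      {x | (∀ q, 0 ≤ x (Fintype.equivFin Q q)) ∧ ∑ q, x (Fintype.equivFin Q q) = 1 ∧
        ∀ q, realVertex Q q ∉ s → x (Fintype.equivFin Q q) = 0}
    have hC : Convex ℝ C := by
      intro y hy z hz a b ha hb hab
      refine ⟨fun q => ?_, ?_, fun q hq => ?_⟩
      · exact add_nonneg (mul_nonneg ha (hy.1 q)) (mul_nonneg hb (hz.1 q))
      · simp only [PiLp.add_apply, PiLp.smul_apply, smul_eq_mul]
        rw [Finset.sum_add_distrib, ← Finset.mul_sum, ← Finset.mul_sum, hy.2.1, hz.2.1]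
        linarith
      · simp only [PiLp.add_apply, PiLp.smul_apply, smul_eq_mul]
        rw [hy.2.2 q hq, hz.2.2 q hq]; simp
    have hsC : (s : Set _) ⊆ C := by
      intro y hy
      obtain ⟨p, rfl⟩ := hs.2.1 y hy
      refine ⟨fun q => ?_, ?_, fun q hq => ?_⟩
      · rw [realVertex_apply]; split_ifs <;> norm_num
      · simp [realVertex_apply]
      · rw [realVertex_apply, if_neg]; rintro rfl; exact hq hy
    obtain ⟨h1, h2, h3⟩ := convexHull_min hsC hC hx
    exact ⟨h1, h2, fun p q hp hq => hs.2.2 p q (by_contra fun h => hp (h3 p h))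
      (by_contra fun h => hq (h3 q h))⟩
  · rintro ⟨h1, h2, h3⟩
    let c := Finset.univ.filter fun q => x (Fintype.equivFin Q q) ≠ 0
    have hsum : ∑ q ∈ c, x (Fintype.equivFin Q q) = 1 := by
      rw [← h2]; exact Finset.sum_filter_ne_zero _
    refine ⟨c.image (realVertex Q), ⟨?_, ?_, ?_⟩, ?_⟩
    · rw [Finset.image_nonempty]
      by_contra h
      rw [Finset.not_nonempty_iff_eq_empty] at h
      rw [h] at hsum
      simp at hsum
    · simp
    · intro p q hp hq
      rw [(realVertex_injective Q).mem_finset_image] at hp hq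
      exact h3 p q (Finset.mem_filter.1 hp).2 (Finset.mem_filter.1 hq).2
    · rw [← sum_realVertex Q x]
      have : ∑ q, x (Fintype.equivFin Q q) • realVertex Q q =
          ∑ q ∈ c, x (Fintype.equivFin Q q) • realVertex Q q := by
        symm
        refine Finset.sum_subset (Finset.subset_univ _) fun q _ hq => ?_
        have : x (Fintype.equivFin Q q) = 0 := by simpa [c] using hq
        rw [this, zero_smul]
      rw [this]
      refine (convex_convexHull ℝ _).sum_mem (fun q _ => h1 q) hsum fun q hq => ?_
      exact subset_convexHull ℝ _ (Finset.mem_coe.2 (Finset.mem_image_of_mem _ hq))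

/-- The geometric realisation of the order complex. -/
def orderComplexHomeo : (orderComplex Q).space ≃ₜ OC Q where
  toFun x := ⟨fun q => x.1 (Fintype.equivFin Q q), (mem_space_orderComplex Q).1 x.2⟩
  invFun t := ⟨WithLp.toLp 2 fun i => t ((Fintype.equivFin Q).symm i),
    (mem_space_orderComplex Q).2 (by simpa using t.2)⟩
  left_inv x := by ext i; simp
  right_inv t := by ext q; simp
  continuous_toFun := by
    refine OC.continuous_of_coord fun q => ?_
    change Continuous fun x : (orderComplex Q).space => x.1 (Fintype.equivFin Q q)
    fun_prop
  continuous_invFun := by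
    refine Continuous.subtype_mk ((PiLp.continuous_toLp 2 _).comp (continuous_pi fun i => ?_)) _
    exact OC.continuous_coord _

variable {Q}

/-- A sign of flags that changes whenever one element of the flag is changed orients the order
complex. -/
theorem orientablyTriangulable_orderComplex {n : ℕ} {rank : Q → Fin (n + 1)}
    (hrank : StrictMono rank) (S : (Fin (n + 1) → Q) → ℤˣ)
    (hS : ∀ p q : Fin (n + 1) → Q, ∀ k, StrictMono p → StrictMono q → (∀ i, rank (p i) = i) →
      (∀ i, rank (q i) = i) → (∀ i, i ≠ k → p i = q i) → p k ≠ q k → S q = - S p) :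
    OrientablyTriangulable n (OC Q) := by
  refine ⟨_, orderComplex Q, finite_orderComplex Q, ⟨orderComplexHomeo Q⟩, ?_⟩
  have hface : ∀ (v : Fin (n + 1) → _) (hv : Injective v),
      Finset.univ.map ⟨v, hv⟩ ∈ (orderComplex Q).faces →
      ∃ w : Fin (n + 1) → Q, v = realVertex Q ∘ w ∧ Injective w ∧
        ∀ i j, w i ≤ w j ∨ w j ≤ w i := by
    rintro v hv ⟨-, h1, h2⟩
    have : ∀ i, ∃ q, realVertex Q q = v i := fun i => h1 _ (by simp)
    choose w hw using this
    obtain rfl : v = realVertex Q ∘ w := funext fun i => (hw i).symm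
    exact ⟨w, rfl, hv.of_comp, fun i j => h2 _ _ (by simp) (by simp)⟩
  rcases isEmpty_or_nonempty Q with hQ | hQ
  · simp_all
  have hri : ∀ w : Fin (n + 1) → Q, Injective w → (∀ i j, w i ≤ w j ∨ w j ≤ w i) →
      Bijective (rank ∘ w) := by
    intro w hw hc
    refine (Finite.injective_iff_bijective).1 fun i j h => ?_
    rcases hc i j with h' | h'
    · rcases h'.eq_or_lt with h' | h'
      · exact hw h'
      · exact absurd h (hrank h').ne
    · rcases h'.eq_or_lt with h' | h'
      · grind
      · exact absurd h (hrank h').ne'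
  have hflag : ∀ (w : Fin (n + 1) → Q) (π : Equiv.Perm (Fin (n + 1))), (∀ i, rank (w i) = π i) →
      (∀ i j, w i ≤ w j ∨ w j ≤ w i) →
      StrictMono (w ∘ π.symm) ∧ ∀ i, rank ((w ∘ π.symm) i) = i := by
    intro w π hπ hc
    have h2 : ∀ i, rank ((w ∘ π.symm) i) = i := fun i => by simp [hπ]
    refine ⟨fun i j hij => ?_, h2⟩
    rcases hc (π.symm i) (π.symm j) with h | h
    · refine lt_of_le_of_ne h fun h' => hij.ne ?_; rw [← h2 i, ← h2 j, h']
    · have := hrank.monotone h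
      rw [hπ, hπ, Equiv.apply_symm_apply, Equiv.apply_symm_apply] at this
      exact absurd this (not_le.2 hij)
  let oQ : (Fin (n + 1) → Q) → ℤˣ := fun w =>
    if h : Bijective (rank ∘ w) then
      Equiv.Perm.sign (Equiv.ofBijective _ h) * S (w ∘ (Equiv.ofBijective _ h).symm) else 1
  have hoQ : ∀ (w : Fin (n + 1) → Q) (π : Equiv.Perm (Fin (n + 1))), (∀ i, rank (w i) = π i) →
      oQ w = Equiv.Perm.sign π * S (w ∘ π.symm) := by
    intro w π hπ
    have hb : Bijective (rank ∘ w) := by simp_all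
    have : Equiv.ofBijective _ hb = π := Equiv.ext hπ
    simp only [oQ]
    rw [dif_pos hb, this]
  let ψ := Function.invFun (realVertex Q)
  have hψ : ∀ w : Fin (n + 1) → Q, ψ ∘ realVertex Q ∘ w = w := fun w => by
    rw [← Function.comp_assoc, invFun_comp (realVertex_injective Q), Function.id_comp]
  refine ⟨fun v => oQ (ψ ∘ v), fun v hv h π => ?_, fun v w hv hw h h' h0 hs => ?_⟩
  · obtain ⟨w, rfl, hw, hc⟩ := hface v hv h
    let ρ : Equiv.Perm (Fin (n + 1)) := Equiv.ofBijective _ (hri w hw hc)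
    have hρ : ∀ i, rank (w i) = ρ i := fun _ => rfl
    dsimp only
    rw [Function.comp_assoc, hψ, hψ, hoQ w ρ hρ, hoQ (w ∘ π) (ρ * π) fun i => hρ _,
      Equiv.Perm.sign_mul, mul_comm (Equiv.Perm.sign ρ), mul_assoc]
    congr 3
    ext i
    simp [Equiv.Perm.mul_def]
  · obtain ⟨v, rfl, hv', hc⟩ := hface v hv h
    obtain ⟨w, rfl, hw', hc'⟩ := hface w hw h'
    let ρ : Equiv.Perm (Fin (n + 1)) := Equiv.ofBijective _ (hri v hv' hc)
    let ρ' : Equiv.Perm (Fin (n + 1)) := Equiv.ofBijective _ (hri w hw' hc')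
    have hρ : ∀ i, rank (v i) = ρ i := fun _ => rfl
    have hρ' : ∀ i, rank (w i) = ρ' i := fun _ => rfl
    have hvw : ∀ i, i ≠ 0 → v i = w i := fun i hi => by
      obtain ⟨j, rfl⟩ := Fin.exists_succ_eq.2 hi
      exact realVertex_injective Q (hs j)
    have hne : v 0 ≠ w 0 := fun h => h0 (congrArg (realVertex Q) h)
    have hs : ∀ i, i ≠ 0 → ρ i = ρ' i := fun i hi => by rw [← hρ, ← hρ', hvw i hi]
    have hρρ : ρ = ρ' := by
      refine Equiv.ext fun i => ?_
      by_cases hi : i = 0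
      · subst hi
        by_contra hne
        obtain ⟨j, hj⟩ := ρ'.surjective (ρ 0)
        have hj0 : j ≠ 0 := fun h => hne (by rw [← hj, h])
        rw [← hs j hj0] at hj
        exact hj0 (ρ.injective hj)
      · exact hs i hi
    dsimp only
    rw [hψ, hψ, hoQ v ρ hρ, hoQ w ρ' hρ', ← hρρ, hS (v ∘ ρ.symm) (w ∘ ρ.symm) (ρ 0)
      (hflag v ρ hρ hc).1 (hflag w ρ (fun i => by rw [hρρ, hρ']) hc').1
      (hflag v ρ hρ hc).2 (hflag w ρ (fun i => by rw [hρρ, hρ']) hc').2, mul_neg]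
    · grind
    · grind

end Triangulation

theorem OrientablyTriangulable.of_homeomorph {n : ℕ} {X Y : Type*} [TopologicalSpace X]
    [TopologicalSpace Y] (h : X ≃ₜ Y) (hX : OrientablyTriangulable n X) :
    OrientablyTriangulable n Y := by
  obtain ⟨N, K, hK, ⟨e⟩, o⟩ := hX
  exact ⟨N, K, hK, ⟨e.trans h⟩, o⟩

namespace FinPresentation

/-! ### Orientations -/

/-- The kinds of faces of a rectangle. -/
inductive RectKind
  | vt (x : Bool) | lg | gp | tp
  deriving DecidableEq

/-- The kinds of cells. -/
inductive CellKind
  | hd (a : RectKind) (τ : IF)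
  | rb (υ : IF)
  | dc (υ : IF)
  | cp
  | om
  deriving DecidableEq

/-- The dimension of a cell of the given kind. -/
def CellKind.rank : CellKind → ℕ
  | hd (.vt _) τ => τ.rank
  | hd .lg τ => τ.rank + 1
  | hd .gp τ => τ.rank + 1
  | hd .tp τ => τ.rank + 2
  | rb υ => υ.rank + 1
  | dc υ => υ.rank + 2
  | cp => 2
  | om => 3

/-- The incidence numbers of cells, where `true` stands for `1` and `false` for `-1`. -/
def CellKind.inc : CellKind → CellKind → Bool
  | hd .lg (.en _), hd (.vt x) _ => x
  | hd .gp (.en _), hd (.vt x) _ => !x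
  | hd (.vt _) .md, hd _ (.en b) => b
  | hd .lg .md, hd _ (.en b) => !b
  | hd .lg .md, hd (.vt x) .md => x
  | hd .gp .md, hd _ (.en b) => !b
  | hd .gp .md, hd (.vt x) .md => !x
  | hd .tp .md, hd _ (.en b) => b
  | rb (.en u), hd (.vt x) (.en b) => !((x == b) == u)
  | rb .md, rb (.en u) => u
  | rb .md, hd _ (.en b) => b
  | dc (.en u), hd (.vt x) .md => x == u
  | dc .md, dc (.en u) => u
  | dc .md, _ => false
  | cp, hd _ (.en b) => b
  | cp, rb (.en u) => !u
  | om, hd _ (.en b) => !b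
  | _, _ => true

open SingularManifold.Poly Cell

variable {P : FinPresentation}

/-- The kind of a face of a rectangle. -/
def rectKind {n : ℕ} : Poly n → RectKind
  | vt _ x => .vt x
  | lg _ => .lg
  | gp _ => .gp
  | tp => .tp

/-- The kind of a cell. -/
def cellKind : P.Cell → CellKind
  | hd _ a τ => .hd (rectKind a) τ
  | rb _ υ => .rb υ
  | dc _ υ => .dc υ
  | cp _ => .cp
  | om => .om

theorem rank_cellKind (p : P.Cell) : (cellKind p).rank = p.rank := by
  rcases p with ⟨i, ⟨s, x⟩ | s | s | _, τ⟩ | ⟨o, υ⟩ | ⟨j, υ⟩ | c | _ <;>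
    simp [cellKind, CellKind.rank, Cell.rank, rectKind, Poly.rank, add_comm]

/-- The kinds of the cells at a vertex on a leg. -/
def legKind (u b x : Bool) : Hex × Bool → CellKind
  | (.o, c) => .hd (if c then .lg else .vt x) (en b)
  | (.a, c) => .rb (if c then md else en u)
  | (.b, c) => .hd (if c then .tp else .gp) (en b)
  | (.c, c) => .hd (if c then .lg else .vt x) md
  | (.ab, c) => if c then .om else .cp
  | (.ac, c) => .dc (if c then md else en u)
  | (.bc, c) => .hd (if c then .tp else .gp) md

/-- The kinds of the cells at a vertex that is not on a leg. -/
def dummyKind (x b : Bool) : Fin9 → CellKind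
  | .o => .hd (.vt x) (en b)
  | .l => .hd .lg (en b)
  | .g => .hd .gp (en b)
  | .w => .hd (.vt x) md
  | .d => .hd .tp (en b)
  | .c => .cp
  | .li => .hd .lg md
  | .gi => .hd .gp md
  | .om => .om
  | .h => .hd .tp md

theorem cellKind_legModel {o o' : P.Occ} {u b : Bool} {t : Fin (deg (gen o) + 1)} (z : Hex × Bool) :
    cellKind (legModel o o' u b t z) = legKind u b (side o u) z := by
  rcases z with ⟨_ | _ | _ | _ | _ | _ | _, _ | _⟩ <;> rfl

theorem cellKind_dummyModel {i : Fin P.n} {x b : Bool} {t : Fin (deg i + 1)} (z : Fin9) :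
    cellKind (dummyModel i x b t z) = dummyKind x b z := by
  rcases z with _ | _ <;> rfl

/-- Compatibility of the incidence numbers in a model of the star of a vertex. -/
structure Coherent {M : Type} [PartialOrder M] (κ : M → CellKind) (b : M) : Prop where
  one : ∀ e, (κ e).rank = 1 → ∀ e', (κ e').rank = 1 → e ≠ e' → ∀ f, (κ f).rank = 2 → e ≤ f → e' ≤ f →
    ((κ f).inc (κ e) == (κ e).inc (κ b)) = !((κ f).inc (κ e') == (κ e').inc (κ b))
  two : ∀ f, (κ f).rank = 2 → ∀ f', (κ f').rank = 2 → f ≠ f' → ∀ c, (κ c).rank = 3 → f ≤ c → f' ≤ c →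
    ∀ e, (κ e).rank = 1 → e ≤ f → e ≤ f' →
    ((κ c).inc (κ f) == (κ f).inc (κ e)) = !((κ c).inc (κ f') == (κ f').inc (κ e))
  three : ∀ c, (κ c).rank = 3 → ∀ c', (κ c').rank = 3 → c ≠ c' → ∀ f, (κ f).rank = 2 → f ≤ c → f ≤ c' →
    (κ c).inc (κ f) = !(κ c').inc (κ f)

set_option synthInstance.maxSize 2000 in
set_option synthInstance.maxHeartbeats 200000 in
theorem coherent_legKind (u b x : Bool) : Coherent (legKind u b x) (.o, false) := by
  refine ⟨?_, ?_, ?_⟩ <;> revert u b x <;> decide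

set_option synthInstance.maxSize 2000 in
set_option synthInstance.maxHeartbeats 200000 in
theorem coherent_dummyKind (x b : Bool) : Coherent (dummyKind x b) .o := by
  refine ⟨?_, ?_, ?_⟩ <;> revert x b <;> decide

theorem coherent_star (w : P.BV) : ∃ (M : Type) (_ : PartialOrder M) (e : M → P.Cell) (b : M),
    (∀ x y, e x ≤ e y ↔ x ≤ y) ∧ Set.range e = Set.Ici (vertexCell w) ∧ e b = vertexCell w ∧
      Coherent (cellKind ∘ e) b := by
  rcases vertex_cases w with ⟨i, x, b, t, rfl, ht⟩ | ⟨o, o', u, b, t, rfl, ht, ho⟩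
  · refine ⟨_, _, _, .o, dummyModel_le_iff ht, range_dummyModel ht, rfl, ?_⟩
    rw [show cellKind ∘ dummyModel i x b t = dummyKind x b from funext cellKind_dummyModel]
    exact coherent_dummyKind x b
  · refine ⟨_, _, _, (.o, false), legModel_le_iff ht ho, range_legModel ht ho, rfl, ?_⟩
    rw [show cellKind ∘ legModel o o' u b t = legKind u b (side o u) from funext cellKind_legModel]
    exact coherent_legKind _ _ _

/-- The incidence number of cells. -/
def inc (p q : P.Cell) : Bool := (cellKind p).inc (cellKind q)

theorem exists_vertexCell_eq {v : P.Cell} (h : v.rank = 0) : ∃ w, v = vertexCell w := by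
  rcases v with ⟨i, ⟨s, x⟩ | s | s | _, b | _⟩ | ⟨o, υ⟩ | ⟨j, υ⟩ | c | _ <;>
    simp [Cell.rank, Poly.rank, IF.rank] at h
  exact ⟨⟨i, s, x, b⟩, rfl⟩

theorem inc_edge {e v v' : P.Cell} (he : e.rank = 1) (hv : v.rank = 0) (hv' : v'.rank = 0)
    (h : v ≤ e) (h' : v' ≤ e) (hne : v ≠ v') : inc e v = !inc e v' := by
  obtain ⟨w, rfl⟩ := exists_vertexCell_eq hv
  obtain ⟨w', rfl⟩ := exists_vertexCell_eq hv'
  have hside : ∀ g : P.SideEdge, vertexCell w ≤ sideCell g → vertexCell w' ≤ sideCell g →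
      ∃ y, w = sideEnd g y ∧ w' = sideEnd g !y := by
    intro g h h'
    rw [le_sideCell, or_iff_right vertexCell_ne_sideCell] at h h'
    obtain ⟨y, h⟩ := h
    obtain ⟨y', h'⟩ := h'
    rw [vertexCell_injective.eq_iff] at h h'
    subst h h'
    rcases bool_cases y' y with rfl | rfl
    · grind
    · grind
  rcases e with ⟨i, ⟨s, x⟩ | s | s | _, b | _⟩ | ⟨o, u | _⟩ | ⟨j, υ⟩ | c | _ <;>
    simp [Cell.rank, Poly.rank, IF.rank] at he
  · obtain ⟨a, ha, τ, hτ, h⟩ := le_hd.1 h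
    obtain ⟨a', ha', τ', hτ', h'⟩ := le_hd.1 h'
    rw [le_vt] at ha ha'
    rw [h] at hv hne ⊢
    rw [h'] at hv' hne ⊢
    subst ha ha'
    rcases τ with b | _ <;> rcases τ' with b' | _ <;>
      simp [Cell.rank, Poly.rank, IF.rank] at hv hv'
    rcases bool_cases b' b with rfl | rfl
    · grind
    · exact (Bool.not_not b).symm
  · obtain ⟨a, ha, τ, hτ, h⟩ := le_hd.1 h
    obtain ⟨a', ha', τ', hτ', h'⟩ := le_hd.1 h'
    rw [h] at hv hne ⊢
    rw [h'] at hv' hne ⊢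
    rw [le_en] at hτ hτ'
    subst hτ hτ'
    rcases a with ⟨s, x⟩ | s | s | _ <;> rcases a' with ⟨s', x'⟩ | s' | s' | _ <;>
      simp [Cell.rank, Poly.rank, IF.rank] at hv hv'
    simp only [vt_le_lg] at ha ha'
    subst ha ha'
    rcases bool_cases x' x with rfl | rfl
    · grind
    · simp [inc, cellKind, CellKind.inc, rectKind]
  · obtain ⟨a, ha, τ, hτ, h⟩ := le_hd.1 h
    obtain ⟨a', ha', τ', hτ', h'⟩ := le_hd.1 h'
    rw [h] at hv hne ⊢
    rw [h'] at hv' hne ⊢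
    rw [le_en] at hτ hτ'
    subst hτ hτ'
    rcases a with ⟨t, x⟩ | t | t | _ <;> rcases a' with ⟨t', x'⟩ | t' | t' | _ <;>
      simp [Cell.rank, Poly.rank, IF.rank] at hv hv'
    rcases bool_cases x' x with rfl | rfl
    · refine absurd ?_ hne
      rw [vt_le_gp] at ha ha'
      rcases ha with ⟨rfl, rfl⟩ | ⟨rfl, rfl⟩ <;> simp at ha' <;> rw [ha']
    · simp [inc, cellKind, CellKind.inc, rectKind]
  · obtain ⟨y, h1, h2⟩ := hside (.inr (o, u)) h h'
    have e1 : parity w = y := by rw [h1, parity_sideEnd]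
    have e2 : parity w' = !y := by rw [h2, parity_sideEnd]
    have e3 : ∀ w : P.BV, inc (rb o (en u)) (vertexCell w) = !(parity w == u) := fun _ => rfl
    rw [e3, e3, e1, e2]
    cases y <;> cases u <;> rfl

/-- The sign of a flag. -/
def flagSign (p₀ p₁ p₂ p₃ : P.Cell) : ℤˣ :=
  if inc p₃ p₂ == (inc p₂ p₁ == inc p₁ p₀) then 1 else -1

theorem sign_ne {a b : Bool} (h : a = !b) : (if b then (1 : ℤˣ) else -1) = - if a then 1 else -1 := by
  subst h; cases b <;> simp

/-- The dimension, as a function on cells. -/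
def rankFin (p : P.Cell) : Fin 4 := ⟨p.rank, by
  rcases p with ⟨i, ⟨s, x⟩ | s | s | _, b | _⟩ | ⟨o, u | _⟩ | ⟨j, u | _⟩ | c | _ <;>
    simp [Cell.rank, Poly.rank, IF.rank]⟩

theorem flagSign_adjacent (p q : Fin 4 → P.Cell) (k : Fin 4) (hp : StrictMono p) (hq : StrictMono q)
    (hpr : ∀ i, (p i).rank = i) (hqr : ∀ i, (q i).rank = i) (h : ∀ i, i ≠ k → p i = q i)
    (hk : p k ≠ q k) : flagSign (q 0) (q 1) (q 2) (q 3) = - flagSign (p 0) (p 1) (p 2) (p 3) := by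
  have p01 : p 0 ≤ p 1 := hp.monotone (by decide)
  have p12 : p 1 ≤ p 2 := hp.monotone (by decide)
  have p23 : p 2 ≤ p 3 := hp.monotone (by decide)
  have q01 : q 0 ≤ q 1 := hq.monotone (by decide)
  have q12 : q 1 ≤ q 2 := hq.monotone (by decide)
  have q23 : q 2 ≤ q 3 := hq.monotone (by decide)
  refine sign_ne ?_
  by_cases hk0 : k = 0
  · subst hk0
    rw [h 1 (by decide), h 2 (by decide), h 3 (by decide),
      inc_edge (hqr 1) (hpr 0) (hqr 0) (h 1 (by decide) ▸ p01) q01 hk]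
    cases inc (q 3) (q 2) <;> cases inc (q 2) (q 1) <;> cases inc (q 1) (q 0) <;> rfl
  obtain ⟨w, hw⟩ := exists_vertexCell_eq (hpr 0)
  obtain ⟨M, _, e, b, he, hr, hb, hc⟩ := coherent_star w
  have hm : ∀ r, p 0 ≤ r → ∃ z, e z = r := fun r hr' => by
    have : r ∈ Set.range e := by grind
    exact this
  have h0 := h 0 (Ne.symm hk0)
  obtain ⟨a1, ha1⟩ := hm _ p01
  obtain ⟨a2, ha2⟩ := hm _ (p01.trans p12)
  obtain ⟨a3, ha3⟩ := hm _ (p01.trans (p12.trans p23))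
  obtain ⟨b1, hb1⟩ := hm (q 1) (h0 ▸ q01)
  obtain ⟨b2, hb2⟩ := hm (q 2) (h0 ▸ q01.trans q12)
  obtain ⟨b3, hb3⟩ := hm (q 3) (h0 ▸ q01.trans (q12.trans q23))
  have rk : ∀ {z r n}, e z = r → r.rank = n → ((cellKind ∘ e) z).rank = n := fun h h' => by
    rw [Function.comp, rank_cellKind, h, h']
  have le' : ∀ {z z' r r'}, e z = r → e z' = r' → r ≤ r' → z ≤ z' := fun h h' hl => by
    rwa [← he, h, h']
  have hb : e b = p 0 := hb.trans hw.symm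
  have hne : ∀ {z z' r r'}, e z = r → e z' = r' → r ≠ r' → z ≠ z' := fun h h' hl hz => by
    subst hz; exact hl (h.symm.trans h')
  have hk' : ∀ k : Fin 4, k ≠ 0 → k = 1 ∨ k = 2 ∨ k = 3 := by decide
  have hk' := hk' k hk0
  rcases hk' with rfl | rfl | rfl
  · have key := hc.one a1 (rk ha1 (hpr 1)) b1 (rk hb1 (hqr 1)) (hne ha1 hb1 hk) a2 (rk ha2 (hpr 2))
      (le' ha1 ha2 p12) (le' hb1 ha2 (by rw [h 2 (by decide)]; exact q12))
    simp only [Function.comp, ha1, ha2, hb1, hb] at key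
    change (inc _ _ == inc _ _) = !(inc _ _ == inc _ _) at key
    rw [← h 0 (by decide), ← h 2 (by decide), ← h 3 (by decide), key]
    cases inc (p 3) (p 2) <;> cases (inc (p 2) (q 1) == inc (q 1) (p 0)) <;> rfl
  · have key := hc.two a2 (rk ha2 (hpr 2)) b2 (rk hb2 (hqr 2)) (hne ha2 hb2 hk) a3 (rk ha3 (hpr 3))
      (le' ha2 ha3 p23) (le' hb2 ha3 (by rw [h 3 (by decide)]; exact q23)) a1 (rk ha1 (hpr 1))
      (le' ha1 ha2 p12) (le' ha1 hb2 (by rw [h 1 (by decide)]; exact q12))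
    simp only [Function.comp, ha1, ha2, hb2, ha3] at key
    change (inc _ _ == inc _ _) = !(inc _ _ == inc _ _) at key
    rw [← h 0 (by decide), ← h 1 (by decide), ← h 3 (by decide)]
    revert key
    cases inc (p 3) (p 2) <;> cases inc (p 2) (p 1) <;> cases inc (p 3) (q 2) <;>
      cases inc (q 2) (p 1) <;> cases inc (p 1) (p 0) <;> decide
  · have key := hc.three a3 (rk ha3 (hpr 3)) b3 (rk hb3 (hqr 3)) (hne ha3 hb3 hk) a2 (rk ha2 (hpr 2))
      (le' ha2 ha3 p23) (le' ha2 hb3 (by rw [h 2 (by decide)]; exact q23))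
    simp only [Function.comp, ha2, ha3, hb3] at key
    change inc _ _ = !(inc _ _) at key
    rw [← h 0 (by decide), ← h 1 (by decide), ← h 2 (by decide), key]
    cases inc (q 3) (p 2) <;> cases (inc (p 2) (p 1) == inc (p 1) (p 0)) <;> rfl

theorem orientablyTriangulable_x : OrientablyTriangulable 3 P.X :=
  .of_homeomorph xHomeo.symm <| orientablyTriangulable_orderComplex (rank := rankFin)
    (fun _ _ h => Fin.lt_def.2 (Cell.rank_lt h)) (fun p => flagSign (p 0) (p 1) (p 2) (p 3))
    fun p q k hp hq hpr hqr h hk => flagSign_adjacent p q k hp hq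
      (fun i => congrArg Fin.val (hpr i)) (fun i => congrArg Fin.val (hqr i)) h hk

theorem orientablyTriangulable_omega : OrientablyTriangulable 2 P.Omega := by
  have hr : ∀ p : P.OmegaCell, p.1.rank < 3 := fun p => Cell.rank_lt p.2
  refine .of_homeomorph omegaHomeo <| orientablyTriangulable_orderComplex
    (rank := fun p : P.OmegaCell => ⟨p.1.rank, hr p⟩) (fun _ _ h => Fin.lt_def.2 (Cell.rank_lt h))
    (fun p => flagSign (p 0).1 (p 1).1 (p 2).1 om) fun p q k hp hq hpr hqr h hk => ?_
  let ext : (Fin 3 → P.OmegaCell) → Fin 4 → P.Cell := fun p => Fin.snoc (fun i => (p i).1) om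
  have hlast : ∀ p, ext p (Fin.last 3) = om := fun p => Fin.snoc_last _ _
  have hcast : ∀ p (i : Fin 3), ext p i.castSucc = (p i).1 := fun p i => Fin.snoc_castSucc _ _ _
  have hmono : ∀ p, StrictMono p → StrictMono (ext p) := fun p hp i j hij => by
    induction j using Fin.lastCases with
    | last =>
      obtain ⟨i, rfl⟩ := Fin.eq_castSucc_of_ne_last hij.ne
      rw [hlast, hcast]
      exact (p i).2
    | cast j =>
      obtain ⟨i, rfl⟩ := Fin.eq_castSucc_of_ne_last (hij.trans (Fin.castSucc_lt_last j)).ne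
      rw [hcast, hcast]
      exact hp (by simpa using hij)
  have hrank : ∀ p : Fin 3 → P.OmegaCell, (∀ i, (⟨(p i).1.rank, hr (p i)⟩ : Fin 3) = i) →
      ∀ i, (ext p i).rank = i := fun p hp i => by
    induction i using Fin.lastCases with
    | last => rw [hlast]; rfl
    | cast i => rw [hcast]; exact congrArg Fin.val (hp i)
  refine flagSign_adjacent (ext p) (ext q) k.castSucc (hmono p hp) (hmono q hq) (hrank p hpr)
    (hrank q hqr) (fun i hi => ?_) fun hk' => hk (Subtype.ext (by rwa [hcast, hcast] at hk'))
  induction i using Fin.lastCases with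
  | last => rw [hlast, hlast]
  | cast i => rw [hcast, hcast, h i fun hik => hi (by rw [hik])]

theorem isClosedOrientableSurface_omega : IsClosedOrientableSurface P.Omega :=
  ⟨inferInstance, inferInstance, locallyPlane_omega, orientablyTriangulable_omega⟩

theorem isCompactOrientableSingularThreeManifold_x (h : ConnectedSpace P.Omega) :
    IsCompactOrientableSingularThreeManifold P.X {P.omega} where
  compact := inferInstance
  hausdorff := inferInstance
  finite := Set.finite_singleton _
  manifold := manifold_compl_omega
  link s hs := by
    rw [Set.mem_singleton_iff] at hs
    subst hs
    exact ⟨P.Omega, inferInstance, isClosedOrientableSurface_omega, h, hasLink_omega⟩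
  orientable := orientablyTriangulable_x

end FinPresentation

/-! ### The discs of the presentation complex -/

theorem push_apply_of {A B : Type*} [Fintype A] {e : A → B} {t : A → ℝ} {a : A}
    (h : ∀ b, e b = e a → t b ≠ 0 → b = a) : push e t (e a) = t a := by
  classical
  simp only [push]
  rw [Finset.sum_eq_single a]
  · simp
  · grind
  · simp

theorem OC.eq_of_forall_ne {A : Type*} [Fintype A] [PartialOrder A] {s t : OC A}
    (h : ∀ p, t p ≠ 0 → s p = t p) : s = t := by
  classical
  have h0 : ∑ p, (s p - t p) = 0 := by rw [Finset.sum_sub_distrib, s.sum_eq, t.sum_eq, sub_self]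
  have h1 : ∀ p ∈ Finset.univ, 0 ≤ s p - t p := fun p _ => by
    by_cases hp : t p = 0
    · rw [hp, sub_zero]; exact s.nonneg p
    · grind
  exact Subtype.ext (funext fun p =>
    sub_eq_zero.1 ((Finset.sum_eq_zero_iff_of_nonneg h1).1 h0 p (Finset.mem_univ p)))

theorem OC.exists_push_eq {A B : Type*} [Fintype A] [PartialOrder A] [Fintype B] [PartialOrder B]
    {e : A → B} (hi : Injective e) (he : ∀ a a', e a ≤ e a' → a ≤ a' ∨ a' ≤ a)
    (t : OC B) (ht : ∀ b, t b ≠ 0 → b ∈ Set.range e) : ∃ s : OC A, push e s = t.1 := by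
  have key : push e (t.1 ∘ e) = t.1 := by
    ext b
    by_cases hb : t b = 0
    · rw [hb]; exact push_eq_zero (e := e) fun a ha => by simp [ha, hb]
    · obtain ⟨a, rfl⟩ := ht b hb; rw [push_apply hi]; rfl
  refine ⟨⟨t.1 ∘ e, fun a => t.nonneg _, ?_, fun p q hp hq => ?_⟩, key⟩
  · rw [← sum_push e, key, t.sum_eq]
  · rcases t.chain _ _ hp hq with h | h
    · grind
    · grind

theorem OC.exists_min {A : Type*} [Fintype A] [PartialOrder A] (t : OC A) :
    ∃ p, t p ≠ 0 ∧ ∀ q, t q ≠ 0 → p ≤ q := by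
  classical
  obtain ⟨p, hp, hm⟩ := (Finset.univ.filter fun p => t p ≠ 0).exists_minimal
    (by obtain ⟨p, hp⟩ := t.exists_ne; exact ⟨p, by simpa using hp⟩)
  simp only [Finset.mem_filter, Finset.mem_univ, true_and] at hp hm
  refine ⟨p, hp, fun q hq => ?_⟩
  rcases t.chain p q hp hq with h | h
  · exact h
  · exact hm hq h

namespace Poly

variable {n : ℕ}

/-- The weights, in barycentric coordinates, of a point of a polygon in the smaller polygon
into which the outer half of the polygon is subdivided radially. -/
def inW (t : Poly n → ℝ) : Poly n → ℝ
  | tp => max (2 * t tp - 1) 0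
  | vt s b => 2 * min (t (vt s b)) (max (t tp - ∑ s, (t (lg s) + t (gp s))) 0)
  | lg s => 2 * min (t (lg s)) (t tp)
  | gp s => 2 * min (t (gp s)) (t tp)

/-- The weights of the inner and of the outer polygon. -/
def wt (t : Poly n → ℝ) (q : Poly n × Bool) : ℝ :=
  if q.2 then (if q.1 = tp then 0 else t q.1 - inW t q.1 / 2) else inW t q.1

theorem continuous_inW (a : Poly n) : Continuous fun t : Poly n → ℝ => inW t a := by
  cases a <;> simp only [inW] <;> fun_prop

theorem continuous_wt (q : Poly n × Bool) : Continuous fun t : Poly n → ℝ => wt t q := by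
  have := continuous_inW q.1
  simp only [wt]
  split_ifs <;> fun_prop

theorem exists_flag (hn : 0 < n) (t : OC (Poly n)) : ∃ s k b, ∀ a, t a ≠ 0 →
    a = tp ∨ a = edge s k .md ∨ a = edge s k (.en b) := by
  have key : ∀ s k, t (edge s k .md) ≠ 0 → ∃ b, ∀ a, t a ≠ 0 →
      a = tp ∨ a = edge s k .md ∨ a = edge s k (.en b) := by
    intro s k h
    have h1 : ∀ a, t a ≠ 0 → a = tp ∨ ∃ τ, a = edge s k τ := by
      intro a ha
      have h2 := t.chain _ _ ha h
      rcases k with _ | _ <;> rcases a with ⟨s', b⟩ | s' | s' | _ <;> simp [edge, le_def] at h2 ⊢ <;>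
        rcases h2 with h2 | h2 <;> cases h2
      · exact ⟨.en b, rfl⟩
      · exact ⟨.md, rfl⟩
      · exact ⟨.md, rfl⟩
      · exact ⟨.en false, rfl⟩
      · exact ⟨.en true, rfl⟩
      · exact ⟨.md, rfl⟩
      · exact ⟨.md, rfl⟩
    by_cases h3 : t (edge s k (.en true)) = 0
    · refine ⟨false, fun a ha => ?_⟩; rcases h1 a ha with h4 | ⟨(_ | _) | _, rfl⟩ <;> tauto
    · refine ⟨true, fun a ha => ?_⟩
      rcases h1 a ha with h4 | ⟨(_ | _) | _, rfl⟩
      · exact .inl h4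
      · have := t.chain _ _ h3 ha; rcases k with _ | _ <;> simp [edge] at this
      · tauto
      · tauto
  by_cases h1 : ∃ s k, t (edge s k .md) ≠ 0
  · obtain ⟨s, k, h⟩ := h1; obtain ⟨b, hb⟩ := key s k h; exact ⟨s, k, b, hb⟩
  push Not at h1
  by_cases h2 : ∃ s b, t (vt s b) ≠ 0
  · obtain ⟨s, b, h⟩ := h2
    refine ⟨s, false, b, fun a ha => ?_⟩
    rcases a with ⟨s', b'⟩ | s' | s' | _
    · have := t.chain _ _ ha h; simp only [le_vt] at this; rcases this with h | h <;> simp [edge, h]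
    · exact absurd (h1 s' false) ha
    · exact absurd (h1 s' true) ha
    · simp
  · push Not at h2
    refine ⟨⟨0, hn⟩, false, false, fun a ha => ?_⟩
    rcases a with ⟨s', b'⟩ | s' | s' | _
    · grind
    · exact absurd (h1 s' false) ha
    · exact absurd (h1 s' true) ha
    · simp

section Flag

variable {t : Poly n → ℝ} {s : Fin n} {k b : Bool}

theorem sum_flag {f : Poly n → ℝ} (hf : ∀ a, f a ≠ 0 → a = tp ∨ a = edge s k .md ∨ a = edge s k (.en b)) :
    ∑ a, f a = f tp + f (edge s k .md) + f (edge s k (.en b)) := by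
  have h1 : tp ∉ ({edge s k .md, edge s k (.en b)} : Finset (Poly n)) := by
    simp [Ne.symm (edge_ne_tp s k _)]
  have h2 : edge s k .md ≠ edge s k (.en b) := fun h => by cases edge_injective s k h
  rw [← Finset.sum_subset (Finset.subset_univ {tp, edge s k .md, edge s k (.en b)}),
    Finset.sum_insert h1, Finset.sum_pair h2, add_assoc]
  intro a _ ha
  by_contra h
  exact ha (by simpa using hf a h)

variable (hf : ∀ a, t a ≠ 0 → a = tp ∨ a = edge s k .md ∨ a = edge s k (.en b))
include hf

theorem sum_edges_flag : ∑ s, (t (lg s) + t (gp s)) = t (edge s k .md) := by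
  rw [Finset.sum_eq_single s]
  · rcases k with _ | _
    · have : t (gp s) = 0 := by by_contra h; rcases hf _ h with h | h | h <;> cases b <;> cases h
      simp [edge, this]
    · have : t (lg s) = 0 := by by_contra h; rcases hf _ h with h | h | h <;> cases b <;> cases h
      simp [edge, this]
  · intro s' _ hs
    have h1 : t (gp s') = 0 := by
      by_contra h; rcases hf _ h with h | h | h <;> cases b <;> cases k <;> cases h <;> exact hs rfl
    have h2 : t (lg s') = 0 := by
      by_contra h; rcases hf _ h with h | h | h <;> cases b <;> cases k <;> cases h <;> exact hs rfl
    rw [h1, h2, add_zero]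
  · simp

theorem inW_edge : inW t (edge s k .md) = 2 * min (t (edge s k .md)) (t tp) := by cases k <;> rfl

theorem inW_end : inW t (edge s k (.en b)) =
    2 * min (t (edge s k (.en b))) (max (t tp - t (edge s k .md)) 0) := by
  rw [← sum_edges_flag hf]
  cases k <;> cases b <;> rfl

theorem inW_ne (hc : 0 ≤ t tp) {a : Poly n} (h : inW t a ≠ 0) : t a ≠ 0 := by
  intro h0
  apply h
  rcases a with ⟨s, b⟩ | s | s | _ <;> simp [inW, h0, hc]

theorem wt_ne (hc : 0 ≤ t tp) {q : Poly n × Bool} (h : wt t q ≠ 0) : t q.1 ≠ 0 := by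
  intro h0
  have h1 : inW t q.1 = 0 := by by_contra h1; exact inW_ne hf hc h1 h0
  simp [wt, h0, h1] at h

end Flag

variable (t : OC (Poly n))

theorem wt_nonneg (hn : 0 < n) (q : Poly n × Bool) : 0 ≤ wt t q := by
  obtain ⟨s, k, b, hf⟩ := exists_flag hn t
  obtain ⟨a, y⟩ := q
  have h1 : 0 ≤ inW t a := by have := t.nonneg; cases a <;> simp [inW, this]
  cases y
  · simpa [wt] using h1
  · simp only [wt, if_true]
    split_ifs with h
    · exact le_rfl
    · have : inW t a ≤ 2 * t a := by cases a <;> simp [inW] at h ⊢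
      linarith

theorem weights_sum {c e v : ℝ} (hc : 0 ≤ c) (he : 0 ≤ e) (hv : 0 ≤ v) (h : c + e + v = 1) :
    0 + max (2 * c - 1) 0 + (e - 2 * min e c / 2 + 2 * min e c) +
      (v - 2 * min v (max (c - e) 0) / 2 + 2 * min v (max (c - e) 0)) = 1 := by
  rcases le_total e c with h1 | h1
  · rw [min_eq_left h1, max_eq_left (sub_nonneg.2 h1)]
    rcases le_total v (c - e) with h2 | h2
    · rw [min_eq_left h2, max_eq_left (by linarith)]; linarith
    · rw [min_eq_right h2, max_eq_right (by linarith)]; linarith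
  · rw [min_eq_right h1, max_eq_right (by linarith), max_eq_right (by linarith), min_eq_right hv]
    linarith

theorem sum_wt (hn : 0 < n) : ∑ q, wt t q = 1 := by
  obtain ⟨s, k, b, hf⟩ := exists_flag hn t
  have h0 := t.sum_eq
  rw [sum_flag hf] at h0
  rw [Fintype.sum_prod_type, sum_flag (s := s) (k := k) (b := b)]
  · simp only [Fintype.sum_bool, wt, edge_ne_tp, if_true, if_false, inW_edge hf, inW_end hf]
    simp only [inW, Bool.false_eq_true, if_false]
    exact weights_sum (t.nonneg _) (t.nonneg _) (t.nonneg _) h0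
  · intro a h
    refine hf a fun h0 => h ?_
    refine Finset.sum_eq_zero fun y _ => ?_
    by_contra h1
    exact wt_ne hf (t.nonneg _) h1 h0

theorem wt_chain (hn : 0 < n) {a b : Poly n} (ha : wt t (a, false) ≠ 0) (hb : wt t (b, true) ≠ 0) :
    b ≠ tp ∧ a ≠ tp ∧ b ≤ a := by
  obtain ⟨s, k, c, hf⟩ := exists_flag hn t
  have hbt : b ≠ tp := by rintro rfl; simp [wt] at hb
  have h0 := t.sum_eq
  rw [sum_flag hf] at h0
  have h1 := t.nonneg (edge s k .md)
  have h2 := t.nonneg (edge s k (.en c))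
  have h3 := t.nonneg tp
  have ht := wt_ne hf h3 hb
  have ht' := wt_ne hf h3 ha
  simp only [wt, hbt, if_true, if_false, Bool.false_eq_true] at ha hb
  have hat : a ≠ tp := by
    rintro rfl
    rcases hf b ht with rfl | rfl | rfl
    · exact hbt rfl
    · rw [inW_edge hf] at hb; simp only [inW] at ha; grind
    · rw [inW_end hf] at hb; simp only [inW] at ha; grind
  refine ⟨hbt, hat, ?_⟩
  rcases hf b ht with rfl | rfl | rfl
  · grind
  · rcases hf a ht' with rfl | rfl | rfl
    · exact le_tp _
    · exact le_rfl
    · rw [inW_edge hf] at hb; rw [inW_end hf] at ha; grind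
  · rcases hf a ht' with rfl | rfl | rfl
    · exact le_tp _
    · exact monotone_edge s k (by simp)
    · exact le_rfl

theorem eq_of_wt_eq {t' : OC (Poly n)} (h : wt t = wt t') : t = t' := by
  refine OC.eq_of_forall_ne fun a ha => ?_
  have h1 : ∀ a, a ≠ tp → t a = t' a := fun a ha => by
    have h1 := congrFun h (a, false)
    have h2 := congrFun h (a, true)
    simp only [wt, ha, if_true, if_false, Bool.false_eq_true] at h1 h2
    linarith
  by_cases hat : a = tp
  · have h2 := t.sum_eq.trans t'.sum_eq.symm
    rw [Fintype.sum_eq_add_sum_compl tp, Fintype.sum_eq_add_sum_compl (f := t'.1) tp,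
      Finset.sum_congr rfl fun a ha => h1 a (by simpa using ha)] at h2
    rw [hat]
    linarith
  · grind

theorem exists_inW_ne (hn : 0 < n) (h : t tp ≠ 0) : ∃ a, wt t (a, false) ≠ 0 := by
  obtain ⟨s, k, b, hf⟩ := exists_flag hn t
  by_contra! H
  have h0 := t.sum_eq
  rw [sum_flag hf] at h0
  have h1 := H tp
  have h2 := H (edge s k .md)
  have h3 := H (edge s k (.en b))
  simp only [wt, if_false, Bool.false_eq_true, inW_edge hf, inW_end hf] at h1 h2 h3
  simp only [inW] at h1
  have := t.nonneg (edge s k .md)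
  have := t.nonneg (edge s k (.en b))
  have := t.nonneg tp
  grind

/-- Every admissible system of weights comes from a point. -/
theorem exists_wt (s : Fin n) (k b : Bool) (d m D M N : ℝ) (hd : 0 ≤ d) (hm : 0 ≤ m) (hD : 0 ≤ D)
    (hM : 0 ≤ M) (hN : 0 ≤ N) (hs : d + m + D + M + N = 1) (h1 : m = 0 ∨ D = 0) (h2 : N = 0 ∨ D = 0)
    (h3 : N = 0 ∨ M = 0) : ∃ t : OC (Poly n),
      (∀ a, wt t (a, true) ≠ 0 → a ≤ edge s k .md) ∧ wt t (edge s k .md, false) = d ∧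
      wt t (edge s k (.en b), false) = m ∧ wt t (edge s k .md, true) = D ∧
      wt t (edge s k (.en b), true) = M ∧ wt t (tp, false) = N := by
  have e1 : edge s k (.en b) ≠ edge s k .md := fun h => by cases edge_injective s k h
  let f : Poly n → ℝ := fun a => if a = tp then N + d / 2 + m / 2 else
    if a = edge s k .md then D + d / 2 else if a = edge s k (.en b) then M + m / 2 else 0
  have hf : ∀ a, f a ≠ 0 → a = tp ∨ a = edge s k .md ∨ a = edge s k (.en b) := by grind
  have f1 : f tp = N + d / 2 + m / 2 := by simp [f]
  have f2 : f (edge s k .md) = D + d / 2 := by simp [f, edge_ne_tp]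
  have f3 : f (edge s k (.en b)) = M + m / 2 := by simp [f, edge_ne_tp, e1]
  refine ⟨⟨f, fun a => ?_, ?_, fun a c ha hc => ?_⟩, ?_⟩
  · grind
  · rw [sum_flag hf, f1, f2, f3]; linarith
  · have h4 : edge s k (.en b) ≤ edge s k .md := monotone_edge s k (by simp)
    rcases hf a ha with rfl | rfl | rfl <;> rcases hf c hc with rfl | rfl | rfl <;> simp [h4]
  · refine ⟨fun a ha => ?_, ?_⟩
    · rcases hf a (wt_ne hf (f1 ▸ by positivity) ha) with rfl | rfl | rfl
      · simp [wt] at ha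
      · exact le_rfl
      · exact monotone_edge s k (by simp)
    simp only [wt, if_false, if_true, Bool.false_eq_true, inW_edge hf, inW_end hf, edge_ne_tp, f2, f3]
    simp only [inW, f1]
    have g1 : min (D + d / 2) (N + d / 2 + m / 2) = d / 2 := by grind
    have g2 : min (M + m / 2) (max (N + d / 2 + m / 2 - (D + d / 2)) 0) = m / 2 := by grind
    have g3 : max (2 * (N + d / 2 + m / 2) - 1) 0 = N := by grind
    rw [g1, g2, g3]
    refine ⟨?_, ?_, ?_, ?_, rfl⟩ <;> ring

end Poly

namespace Poly

variable {n : ℕ}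

/-- The duality of the boundary of a polygon that exchanges vertices and edges. -/
def dual : Poly n → Poly n
  | vt s false => gp (FinPresentation.exists_cyc s).choose
  | vt s true => lg s
  | lg s => vt s false
  | gp s => vt s true
  | tp => tp

theorem dual_cyc (s : Fin n) : dual (vt (cyc s) false) = gp s := by
  simp only [dual, cyc_injective (FinPresentation.exists_cyc (cyc s)).choose_spec]

theorem dual_ne_tp {a : Poly n} : dual a ≠ tp ↔ a ≠ tp := by
  rcases a with ⟨s, _ | _⟩ | s | s | _ <;> simp [dual]

theorem dual_injective : Injective (dual : Poly n → Poly n) := by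
  intro a b h
  rcases a with ⟨s, _ | _⟩ | s | s | _ <;> rcases b with ⟨t, _ | _⟩ | t | t | _ <;>
    simp [dual] at h ⊢ <;> try exact h
  rw [← (FinPresentation.exists_cyc s).choose_spec, h, (FinPresentation.exists_cyc t).choose_spec]

theorem dual_le {a b : Poly n} (h : a ≤ b) (hb : b ≠ tp) : dual b ≤ dual a := by
  cases h with
  | rfl => exact le_rfl
  | tp => exact absurd rfl hb
  | lg s c => cases c
              · simp [dual, (FinPresentation.exists_cyc s).choose_spec]
              · simp [dual]
  | gp0 s => simp [dual]
  | gp1 s => rw [dual_cyc]; simp [dual]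

end Poly

namespace FinPresentation

open SingularManifold.Poly Cell

variable {P : FinPresentation}

/-- The cells at the outside of the disc of a relator. -/
def outCell (j : Fin P.k) : Poly (P.rel j).length → P.Cell
  | vt m b => hd (gen ⟨j, m⟩) tp (.en (b == sgn ⟨j, m⟩))
  | lg m => hd (gen ⟨j, m⟩) tp .md
  | gp _ => om
  | tp => om

/-- The cells of the disc of a relator: those inside the 2-handle, and those outside. -/
def kCell (j : Fin P.k) (q : Poly (P.rel j).length × Bool) : P.Cell :=
  if q.2 then outCell j (dual q.1) else polyEmb j (dual q.1, .md)

theorem outCell_mono (j : Fin P.k) {x y : Poly (P.rel j).length} (h : x ≤ y) (hy : y ≠ tp) :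
    outCell j x ≤ outCell j y := by
  cases h with
  | rfl => exact le_rfl
  | tp => exact absurd rfl hy
  | lg s c => exact hd_le_hd.2 ⟨le_rfl, by simp⟩
  | gp0 s => exact hd_le_om.2 ⟨_, rfl⟩
  | gp1 s => exact hd_le_om.2 ⟨_, rfl⟩

theorem polyEmb_le_outCell (j : Fin P.k) {x : Poly (P.rel j).length} (hx : x ≠ tp) :
    polyEmb j (x, .md) ≤ outCell j x := by
  rcases x with ⟨s, b⟩ | s | s | _
  · exact hd_le_hd.2 ⟨le_tp _, le_rfl⟩
  · exact hd_le_hd.2 ⟨le_tp _, le_rfl⟩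
  · exact rb_le_om
  · grind

theorem polyEmb_le_dc {j j' : Fin P.k} {z υ} (h : polyEmb j z ≤ dc j' υ) : j = j' := by
  obtain ⟨x, τ⟩ := z
  rcases x with ⟨s, b⟩ | s | s | _
  · exact (hd_le_dc.1 h).1
  · exact (hd_le_dc.1 h).1
  · exact (rb_le_dc.1 h).1
  · exact (dc_le_dc.1 h).1

/-- Whether a cell is the vertex or in a 1-cell of the presentation complex. -/
def isOut : P.Cell → Bool
  | hd _ tp _ => true
  | om => true
  | _ => false

theorem isOut_polyEmb {j : Fin P.k} {x} : isOut (polyEmb j (x, .md)) = false := by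
  rcases x with ⟨s, b⟩ | s | s | _ <;> rfl

theorem polyEmb_ne_outCell {j j' : Fin P.k} {x y} : polyEmb j (x, .md) ≠ outCell j' y := by
  intro h
  have h' := congrArg isOut h
  rw [isOut_polyEmb] at h'
  rcases y with ⟨s', b'⟩ | s' | s' | _ <;> cases h'

theorem length_pos (j : Fin P.k) : 0 < (P.rel j).length := List.length_pos_of_ne_nil (P.rel_ne_nil j)

theorem kCell_in {j j' : Fin P.k} {a q} (h : kCell j' q = kCell j (a, false)) : j' = j ∧ q.2 = false := by
  obtain ⟨x, y⟩ := q
  cases y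
  · refine ⟨polyEmb_le_dc (z := (dual x, .md)) (υ := .md) ?_, rfl⟩
    simp only [kCell, if_false, Bool.false_eq_true] at h
    rw [h]
    exact (polyEmb_le_iff j _ (tp, .md)).2 ⟨le_tp _, le_rfl⟩
  · exact absurd h.symm polyEmb_ne_outCell

theorem kCell_in_inj {j : Fin P.k} {a q} (h : kCell j q = kCell j (a, false)) : q = (a, false) := by
  obtain ⟨x, y⟩ := q
  obtain rfl := (kCell_in h).2
  simp only [kCell, if_false, Bool.false_eq_true] at h
  have := polyEmb_injective j h
  rw [Prod.mk.injEq] at this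
  rw [dual_injective this.1]

theorem kCell_out_inj {j : Fin P.k} {a b c : Poly (P.rel j).length} (hc : c ≠ tp) (ha : a ≤ c)
    (hb : b ≤ c) (h : kCell j (a, true) = kCell j (b, true)) : a = b := by
  have h1 := dual_le ha hc
  have h2 := dual_le hb hc
  refine dual_injective ?_
  simp only [kCell, if_true] at h
  have h3 : dual a ≠ tp := dual_ne_tp.2 fun h => hc (by simpa [h] using ha)
  have h4 : dual b ≠ tp := dual_ne_tp.2 fun h => hc (by simpa [h] using hb)
  generalize dual a = x at *
  generalize dual b = y at *
  generalize dual c = z at *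
  rcases x with ⟨s, b⟩ | s | s | _ <;> rcases y with ⟨s', b'⟩ | s' | s' | _ <;>
    first | exact absurd rfl h3 | exact absurd rfl h4 | skip
  all_goals rcases z with ⟨s'', b''⟩ | s'' | s'' | _ <;> simp [outCell, le_vt] at h1 h2 h ⊢
  all_goals try grind [cyc_injective]

theorem kCell_chain (j : Fin P.k) (t : OC (Poly (P.rel j).length)) {p q} (hp : wt t p ≠ 0)
    (hq : wt t q ≠ 0) : kCell j p ≤ kCell j q ∨ kCell j q ≤ kCell j p := by
  obtain ⟨s, k, b, hf⟩ := exists_flag (length_pos j) t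
  have h0 := t.chain _ _ (wt_ne hf (t.nonneg _) hp) (wt_ne hf (t.nonneg _) hq)
  have key : ∀ {a b}, wt t (a, false) ≠ 0 → wt t (b, true) ≠ 0 →
      kCell j (a, false) ≤ kCell j (b, true) := by
    intro a b ha hb
    obtain ⟨h1, h2, h3⟩ := wt_chain t (length_pos j) ha hb
    exact le_trans (b := polyEmb j (dual b, .md)) ((polyEmb_le_iff j (_, _) (_, _)).2
      ⟨dual_le h3 h2, le_rfl⟩) (polyEmb_le_outCell j (dual_ne_tp.2 h1))
  have hin : ∀ {a b}, a ≤ b → kCell j (a, false) ≤ kCell j (b, false) ∨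
      kCell j (b, false) ≤ kCell j (a, false) := by
    intro a b h
    by_cases hb : b = tp
    · subst hb; exact .inl ((polyEmb_le_iff j (dual a, .md) (tp, .md)).2 ⟨le_tp _, le_rfl⟩)
    · exact .inr ((polyEmb_le_iff j (_, _) (_, _)).2 ⟨dual_le h hb, le_rfl⟩)
  have hout : ∀ {a b}, a ≤ b → wt t (a, true) ≠ 0 → wt t (b, true) ≠ 0 →
      kCell j (b, true) ≤ kCell j (a, true) := by
    intro a b h ha hb
    have h1 : ∀ {a}, wt t (a, true) ≠ 0 → a ≠ tp := by rintro a ha rfl; simp [wt] at ha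
    exact outCell_mono j (dual_le h (h1 hb)) (dual_ne_tp.2 (h1 ha))
  obtain ⟨a, _ | _⟩ := p <;> obtain ⟨b, _ | _⟩ := q
  · grind
  · grind
  · grind
  · grind

/-- The disc of a relator. -/
def kDisc (j : Fin P.k) (t : OC (Poly (P.rel j).length)) : OC P.Cell :=
  ⟨push (kCell j) (wt t.1), push_nonneg (wt_nonneg t (length_pos j)),
    by rw [sum_push, sum_wt t (length_pos j)], fun p q hp hq => by
      obtain ⟨a, rfl, ha⟩ := exists_of_push_ne hp
      obtain ⟨b, rfl, hb⟩ := exists_of_push_ne hq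
      exact kCell_chain j t ha hb⟩

theorem continuous_kDisc (j : Fin P.k) : Continuous (kDisc j) := by
  refine Continuous.subtype_mk ((continuous_push _).comp ?_) _
  exact continuous_pi fun q => (continuous_wt q).comp continuous_subtype_val

theorem kDisc_in (j : Fin P.k) (t : OC (Poly (P.rel j).length)) (a) :
    kDisc j t (kCell j (a, false)) = wt t (a, false) :=
  push_apply_of fun _ hb _ => kCell_in_inj hb

theorem kDisc_out (j : Fin P.k) (t : OC (Poly (P.rel j).length)) {a b} (ha : wt t (a, false) ≠ 0)
    (hab : b ≤ a) (hat : a ≠ tp) : kDisc j t (kCell j (b, true)) = wt t (b, true) := by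
  refine push_apply_of fun q hq h => ?_
  obtain ⟨c, _ | _⟩ := q
  · exact absurd (kCell_in_inj hq.symm) (by simp)
  · rw [kCell_out_inj hat (wt_chain t (length_pos j) ha h).2.2 hab hq]

theorem kDisc_injective (j : Fin P.k) {t t' : OC (Poly (P.rel j).length)} (h : kDisc j t = kDisc j t')
    (h0 : t tp ≠ 0) : t = t' := by
  have h1 : ∀ a, wt t (a, false) = wt t' (a, false) := fun a => by rw [← kDisc_in, h, kDisc_in]
  obtain ⟨a, ha⟩ := exists_inW_ne t (length_pos j) h0
  have ha' := h1 a ▸ ha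
  refine eq_of_wt_eq t (funext fun q => ?_)
  obtain ⟨b, _ | _⟩ := q
  · exact h1 b
  · by_cases hb : b ≤ a ∧ a ≠ tp
    · rw [← kDisc_out j t ha hb.1 hb.2, h, kDisc_out j t' ha' hb.1 hb.2]
    · have h2 : wt t (b, true) = 0 := by
        by_contra h2
        have := wt_chain t (length_pos j) ha h2
        exact hb ⟨this.2.2, this.2.1⟩
      have h3 : wt t' (b, true) = 0 := by
        by_contra h2
        have := wt_chain t' (length_pos j) ha' h2
        exact hb ⟨this.2.2, this.2.1⟩
      rw [h2, h3]

/-- Half of the 1-cell of a generator. -/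
def halfCell (i : Fin P.n) (b : Bool) : IF → P.Cell
  | en false => om
  | md => hd i tp (.en b)
  | en true => hd i tp .md

theorem halfCell_injective (i : Fin P.n) (b : Bool) : Injective (halfCell i b) := by
  intro x y h
  rcases x with (_ | _) | _ <;> rcases y with (_ | _) | _ <;> cases h <;> rfl

theorem halfCell_le (i : Fin P.n) (b : Bool) {x y : IF} (h : x ≤ y) :
    halfCell i b y ≤ halfCell i b x := by
  rcases h with rfl | rfl
  · exact le_rfl
  · rcases x with (_ | _) | _
    · exact hd_le_om.2 ⟨_, rfl⟩
    · exact hd_le_hd.2 ⟨le_rfl, by simp⟩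
    · exact le_rfl

/-- The path along half of the 1-cell of a generator, starting from the vertex. -/
def halfPath (i : Fin P.n) (b : Bool) (x : I) : OC P.Cell :=
  ⟨push (halfCell i b) (iota x).1, push_nonneg (iota x).nonneg, by rw [sum_push, (iota x).sum_eq],
    fun p q hp hq => by
      obtain ⟨a, rfl, ha⟩ := exists_of_push_ne hp
      obtain ⟨c, rfl, hc⟩ := exists_of_push_ne hq
      exact ((iota x).chain a c ha hc).symm.imp (halfCell_le i b ·) (halfCell_le i b ·)⟩

theorem continuous_halfPath (i : Fin P.n) (b : Bool) : Continuous (halfPath i b) :=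
  Continuous.subtype_mk ((continuous_push _).comp (continuous_subtype_val.comp continuous_iota)) _

theorem halfPath_vtx {i : Fin P.n} {b : Bool} {x : I} {τ : IF} (h : iota x = OC.vtx τ) :
    halfPath i b x = OC.vtx (halfCell i b τ) :=
  Subtype.ext (by simp only [halfPath, h]; exact push_single _ _)

theorem halfPath_apply (i : Fin P.n) (b : Bool) (x : I) (τ : IF) :
    halfPath i b x (halfCell i b τ) = iota x τ := push_apply (halfCell_injective i b) _ _

/-- Twice a number in the lower half, and its mirror image. -/
def dbl (x : I) : I := ⟨min (2 * (x : ℝ)) 1, (lower_nonneg x).1, min_le_right _ _⟩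

theorem continuous_dbl : Continuous dbl := Continuous.subtype_mk (by fun_prop) _

/-- The 1-cell of a generator. -/
def cellPath (i : Fin P.n) (x : I) : OC P.Cell :=
  if (x : ℝ) ≤ 1 / 2 then halfPath i false (dbl x) else halfPath i true (dbl (σ x))

theorem dbl_eq_one {x : I} : dbl x = 1 ↔ 1 / 2 ≤ (x : ℝ) := by
  rw [dbl, ← Subtype.coe_inj]
  simp only [Set.Icc.coe_one, min_eq_right_iff]
  constructor <;> intro h <;> linarith

theorem continuous_cellPath (i : Fin P.n) : Continuous (cellPath i) := by
  refine Continuous.if_le ((continuous_halfPath i _).comp continuous_dbl)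
    ((continuous_halfPath i _).comp (continuous_dbl.comp unitInterval.continuous_symm))
    continuous_subtype_val continuous_const fun x hx => ?_
  rw [dbl_eq_one.2 hx.ge, dbl_eq_one.2 (by simp [hx]; norm_num), halfPath_vtx iota_one,
    halfPath_vtx iota_one]
  rfl

/-- The 1-cell of a generator, reversed if the sign is negative. -/
theorem cellPath_letter (i : Fin P.n) (s : Bool) (x : I) : cellPath i (if s then x else σ x) =
    if (x : ℝ) ≤ 1 / 2 then halfPath i (!s) (dbl x) else halfPath i s (dbl (σ x)) := by
  cases s
  · simp only [cellPath, Bool.false_eq_true, if_false, Bool.not_false, unitInterval.coe_symm_eq,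
      unitInterval.symm_symm]
    rcases lt_trichotomy (x : ℝ) (1 / 2) with h | h | h
    · grind
    · rw [if_pos (by linarith), if_pos h.le, dbl_eq_one.2 h.ge, dbl_eq_one.2 (by simp [h]; norm_num),
        halfPath_vtx iota_one, halfPath_vtx iota_one]
      rfl
    · grind
  · rfl

theorem kDisc_bdry (j : Fin P.k) (m : Fin (P.rel j).length) (k : Bool) (x : I) :
    kDisc j (bdry (m, k, x)) = if k then halfPath (gen ⟨j, m⟩) (sgn ⟨j, m⟩) (σ x) else
      halfPath (gen ⟨j, m⟩) (!sgn ⟨j, m⟩) x := by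
  have h0 : ∀ a, inW (bdry (m, k, x)).1 a = 0 := by
    intro a
    have h1 := bdry_tp (m, k, x)
    have h2 := (bdry (m, k, x)).nonneg
    cases a <;> simp only [inW, h1]
    · rw [max_eq_right, min_eq_right (h2 _), mul_zero]
      rw [zero_sub]
      exact neg_nonpos.2 (Finset.sum_nonneg fun s _ => add_nonneg (h2 _) (h2 _))
    · grind
    · grind
    · norm_num
  have h1 : (kDisc j (bdry (m, k, x))).1 = push (fun a => kCell j (a, true)) (bdry (m, k, x)).1 := by
    ext p
    simp only [kDisc, push, Fintype.sum_prod_type, Fintype.sum_bool]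
    refine Finset.sum_congr rfl fun a _ => ?_
    simp only [wt, h0, Bool.false_eq_true, if_false, if_true, ite_self, add_zero, zero_div, sub_zero]
    split_ifs with h2 h3
    · rw [h3, bdry_tp]
    · rfl
    · rfl
  refine Subtype.ext (h1.trans ?_)
  simp only [bdry, OC.map_val, push_push]
  cases k
  · simp only [Bool.false_eq_true, if_false, halfPath]
    congr 1
    ext τ
    rcases τ with (_ | _) | _
    · simp [kCell, edge, dual, outCell, halfCell]
    · simp [kCell, edge, dual, outCell, halfCell]
    · simp [kCell, edge, dual, outCell, halfCell]
  · simp only [if_true, halfPath, iota_symm, OC.map_val, push_push]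
    congr 1
    ext τ
    rcases τ with (_ | _) | _
    · simp [kCell, edge, dual, outCell, halfCell, IF.flip]
    · simp [kCell, edge, dual_cyc, outCell, halfCell, IF.flip]
    · simp [kCell, edge, dual, outCell, halfCell, IF.flip]

/-! ### The map of the presentation complex -/

theorem turn_half (n m : ℕ) (t : I) (x : I) (k : Bool) (h : (k.toNat + (x : ℝ)) / 2 = t) (hm : m < n) :
    Complex.exp (2 * Real.pi * Complex.I * (((m + (t : ℝ)) / n : ℝ) : ℂ)) =
      turn (angle ((⟨m, hm⟩ : Fin n), k, x)) := by
  rw [turn, angle]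
  simp only [h]

/-- The map of the pieces of the presentation complex. -/
def kPiece : Unit ⊕ (Fin P.n × I) ⊕ (Fin P.k × Disc) → OC P.Cell
  | .inl _ => OC.vtx om
  | .inr (.inl (i, x)) => cellPath i x
  | .inr (.inr (j, z)) => kDisc j (discHomeo (length_pos j) z)

theorem continuous_kPiece : Continuous (kPiece (P := P)) := by
  refine continuous_sum_dom.2 ⟨continuous_const, continuous_sum_dom.2
    ⟨continuous_prod_of_discrete_left.2 fun i => continuous_cellPath i,
      continuous_prod_of_discrete_left.2 fun j => ?_⟩⟩
  exact (continuous_kDisc j).comp (discHomeo _).continuous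

theorem dbl_zero {x : I} : dbl x = 0 ↔ x = 0 := by
  rw [dbl, ← Subtype.coe_inj, ← Subtype.coe_inj]
  have := x.2.1
  simp only [Set.Icc.coe_zero]
  grind

theorem cellPath_zero (i : Fin P.n) : cellPath i 0 = OC.vtx om := by
  rw [cellPath, if_pos (by norm_num), dbl_zero.2 rfl, halfPath_vtx iota_zero]
  rfl

theorem cellPath_one (i : Fin P.n) : cellPath i 1 = OC.vtx om := by
  rw [cellPath, if_neg (by norm_num), dbl_zero.2 (by simp), halfPath_vtx iota_zero]
  rfl

theorem kPiece_rel {a b} (h : P.CellRel a b) : kPiece a = kPiece b := by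
  rcases h with i | i | ⟨⟨j, m⟩, t, z, hz⟩
  · exact cellPath_zero i
  · exact cellPath_one i
  · simp only [kPiece]
    rw [cellPath_letter]
    split_ifs with ht
    · rw [discHomeo_boundary (length_pos j) (m, false, dbl t) z, kDisc_bdry]
      · rfl
      · rw [hz]
        refine turn_half _ _ t _ _ ?_ m.2
        rw [dbl]
        simp only [Bool.toNat_false, Nat.cast_zero, zero_add]
        rw [min_eq_left (by linarith)]
        ring
    · rw [discHomeo_boundary (length_pos j) (m, true, σ (dbl (σ t))) z, kDisc_bdry,
        unitInterval.symm_symm]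
      · rfl
      · rw [hz]
        refine turn_half _ _ t _ _ ?_ m.2
        rw [dbl]
        simp only [Bool.toNat_true, Nat.cast_one, unitInterval.coe_symm_eq]
        rw [min_eq_left (by linarith)]
        ring

/-- The presentation complex as a subset of the order complex. -/
def kMap : P.K → OC P.Cell := Quot.lift kPiece fun _ _ => kPiece_rel

theorem continuous_kMap : Continuous (kMap : P.K → _) := continuous_quot_lift _ continuous_kPiece

theorem K.cases (x : P.K) : x = P.vertex ∨
    (∃ i t, t ≠ 0 ∧ t ≠ 1 ∧ x = Quot.mk _ (Sum.inr (Sum.inl (i, t)))) ∨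
    ∃ j, ∃ z : Disc, ‖(z : ℂ)‖ ≠ 1 ∧ x = Quot.mk _ (Sum.inr (Sum.inr (j, z))) := by
  have key : ∀ i t, (Quot.mk _ (Sum.inr (Sum.inl (i, t))) : P.K) = P.vertex ∨
      (∃ i' t', t' ≠ 0 ∧ t' ≠ 1 ∧ (Quot.mk _ (Sum.inr (Sum.inl (i, t))) : P.K) =
        Quot.mk _ (Sum.inr (Sum.inl (i', t')))) := by
    intro i t
    by_cases h0 : t = 0
    · subst h0; exact .inl (Quot.sound (.source i))
    · by_cases h1 : t = 1
      · subst h1; exact .inl (Quot.sound (.target i))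
      · grind
  obtain ⟨⟨⟩ | ⟨i, t⟩ | ⟨j, z⟩, rfl⟩ := Quot.exists_rep x
  · exact .inl rfl
  · exact (key i t).imp_right .inl
  · by_cases hz : ‖(z : ℂ)‖ = 1
    · obtain ⟨⟨⟨m, k, x⟩, y⟩, rfl⟩ := discPar_surjective (length_pos j) z
      have hy : y = 1 := by rw [norm_discPar] at hz; exact Subtype.ext hz
      subst hy
      have h0 := x.2.1
      have h1 := x.2.2
      have ht : (k.toNat + (x : ℝ)) / 2 ∈ I := by
        cases k <;> simp only [Bool.toNat_false, Bool.toNat_true] <;> constructor <;> push_cast <;>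
          linarith
      have h := Quot.sound (CellRel.letter (P := P) ⟨j, m⟩ ⟨_, ht⟩ (discPar ((m, k, x), 1)) (by
        rw [turn_half _ _ ⟨_, ht⟩ x k rfl m.2]; simp [discPar]))
      rcases key _ _ with h' | ⟨i, t, h1, h2, h'⟩
      · exact .inl (h.trans h')
      · exact .inr (.inl ⟨i, t, h1, h2, h.trans h'⟩)
    · exact .inr (.inr ⟨j, z, hz, rfl⟩)

theorem halfPath_inj {i : Fin P.n} {b : Bool} {x y : I} (h : halfPath i b x = halfPath i b y) : x = y :=
  iota_injective (Subtype.ext (funext fun τ => by rw [← halfPath_apply i b, h, halfPath_apply]))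

theorem exists_of_halfPath {i : Fin P.n} {b : Bool} {x : I} {p : P.Cell} (h : halfPath i b x p ≠ 0) :
    ∃ τ, p = halfCell i b τ := by
  obtain ⟨τ, h, -⟩ := exists_of_push_ne (show push (halfCell i b) (iota x).1 p ≠ 0 from h)
  exact ⟨τ, h.symm⟩

theorem exists_of_cellPath {i : Fin P.n} {x : I} {p : P.Cell} (h : cellPath i x p ≠ 0) :
    p = om ∨ ∃ τ, p = hd i tp τ := by
  have key : ∀ b τ, halfCell i b τ = om ∨ ∃ τ', halfCell i b τ = hd i tp τ' := by
    intro b τ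
    rcases τ with (_ | _) | _
    · exact .inl rfl
    · exact .inr ⟨_, rfl⟩
    · exact .inr ⟨_, rfl⟩
  rw [cellPath] at h
  split_ifs at h
  · obtain ⟨τ, rfl⟩ := exists_of_halfPath h; exact key _ _
  · obtain ⟨τ, rfl⟩ := exists_of_halfPath h; exact key _ _

theorem cellPath_ne {i : Fin P.n} {x : I} (h0 : x ≠ 0) (h1 : x ≠ 1) : ∃ τ, cellPath i x (hd i tp τ) ≠ 0 := by
  have key : ∀ b y, y ≠ 0 → ∃ τ, halfPath i b y (hd i tp τ) ≠ 0 := by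
    intro b y hy
    by_contra! H
    refine hy (iota_injective ((OC.eq_vtx_of_ne fun τ hτ => ?_).trans iota_zero.symm))
    rw [← halfPath_apply i b] at hτ
    rcases τ with (_ | _) | _
    · rfl
    · exact absurd (H _) hτ
    · exact absurd (H _) hτ
  rw [cellPath]
  split_ifs
  · exact key _ _ (mt dbl_zero.1 h0)
  · exact key _ _ (mt dbl_zero.1 (mt unitInterval.symm_eq_zero.1 h1))

theorem eq_one_of_halfPath {i : Fin P.n} {b : Bool} {u v : I} (h : halfPath i b u = halfPath i (!b) v)
    (hu : u ≠ 0) : u = 1 := by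
  have h1 : iota u .md = 0 := by
    rw [← halfPath_apply i b, h]
    by_contra h1
    obtain ⟨τ, h2⟩ := exists_of_halfPath h1
    rcases τ with (_ | _) | _ <;> simp [halfCell] at h2
  exact (iota_md_eq_zero h1).resolve_left hu

theorem cellPath_inj {i : Fin P.n} {x y : I} (h : cellPath i x = cellPath i y) (hx : x ≠ 0) (hy : y ≠ 0)
    (hx' : x ≠ 1) (hy' : y ≠ 1) : x = y := by
  have key : ∀ {x y : I}, dbl x = dbl y → (x : ℝ) ≤ 1 / 2 → (y : ℝ) ≤ 1 / 2 → x = y := by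
    intro x y h hx hy
    have := congrArg Subtype.val h
    simp only [dbl] at this
    rw [min_eq_left (by linarith), min_eq_left (by linarith)] at this
    exact Subtype.ext (by linarith)
  have key2 : ∀ {x y : I}, halfPath i false (dbl x) = halfPath i true (dbl (σ y)) → (x : ℝ) ≤ 1 / 2 →
      ¬ (y : ℝ) ≤ 1 / 2 → x ≠ 0 → y ≠ 1 → False := by
    intro x y h hx hy h0 h1
    have h2 : σ y ≠ 0 := mt unitInterval.symm_eq_zero.1 h1
    have := dbl_eq_one.1 (eq_one_of_halfPath h.symm (mt dbl_zero.1 h2))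
    rw [unitInterval.coe_symm_eq] at this
    linarith
  simp only [cellPath] at h
  split_ifs at h with h1 h2 h2
  · exact key (halfPath_inj h) h1 h2
  · grind
  · grind
  · have := key (halfPath_inj h) (by rw [unitInterval.coe_symm_eq]; linarith)
      (by rw [unitInterval.coe_symm_eq]; linarith)
    rw [← unitInterval.symm_symm x, this, unitInterval.symm_symm]

theorem kDisc_ne {j : Fin P.k} {z : Disc} (hz : ‖(z : ℂ)‖ ≠ 1) :
    discHomeo (length_pos j) z tp ≠ 0 ∧
    ∃ a, kDisc j (discHomeo (length_pos j) z) (kCell j (a, false)) ≠ 0 := by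
  have h0 : discHomeo (length_pos j) z tp ≠ 0 := by rw [discHomeo_tp, sub_ne_zero]; exact hz.symm
  obtain ⟨a, ha⟩ := exists_inW_ne _ (length_pos j) h0
  exact ⟨h0, a, by rwa [kDisc_in]⟩

theorem kMap_injective : Injective (kMap : P.K → _) := by
  have h01 : ∀ i t, t ≠ 0 → t ≠ 1 → OC.vtx om ≠ cellPath (P := P) i t := by
    intro i t h0 h1 h
    obtain ⟨τ, hτ⟩ := cellPath_ne (i := i) h0 h1
    rw [← h] at hτ
    cases OC.vtx_ne hτ
  have h2 : ∀ j (z : Disc), ‖(z : ℂ)‖ ≠ 1 → ∃ a : Poly (P.rel j).length,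
      kDisc j (discHomeo (length_pos j) z) (polyEmb j (a, .md)) ≠ 0 := by
    intro j z hz
    obtain ⟨-, a, ha⟩ := kDisc_ne hz
    exact ⟨_, ha⟩
  have h02 : ∀ j (z : Disc), ‖(z : ℂ)‖ ≠ 1 → OC.vtx om ≠ kDisc (P := P) j (discHomeo (length_pos j) z) := by
    intro j z hz h
    obtain ⟨a, ha⟩ := h2 j z hz
    rw [← h] at ha
    have := isOut_polyEmb (j := j) (x := a)
    rw [OC.vtx_ne ha] at this
    cases this
  have h12 : ∀ i t j (z : Disc), ‖(z : ℂ)‖ ≠ 1 →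
      cellPath i t ≠ kDisc (P := P) j (discHomeo (length_pos j) z) := by
    intro i t j z hz h
    obtain ⟨a, ha⟩ := h2 j z hz
    have := isOut_polyEmb (j := j) (x := a)
    rw [← h] at ha
    rcases exists_of_cellPath ha with h' | ⟨τ, h'⟩ <;> rw [h'] at this <;> cases this
  intro x y h
  rcases K.cases x with rfl | ⟨i, t, ht0, ht1, rfl⟩ | ⟨j, z, hz, rfl⟩ <;>
    rcases K.cases y with rfl | ⟨i', t', ht0', ht1', rfl⟩ | ⟨j', z', hz', rfl⟩
  · rfl
  · exact absurd h (h01 _ _ ht0' ht1')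
  · exact absurd h (h02 _ _ hz')
  · exact absurd h.symm (h01 _ _ ht0 ht1)
  · change cellPath i t = cellPath i' t' at h
    obtain ⟨τ, hτ⟩ := cellPath_ne (i := i) ht0 ht1
    rw [h] at hτ
    rcases exists_of_cellPath hτ with h' | ⟨τ', h'⟩ <;> cases h'
    rw [cellPath_inj h ht0 ht0' ht1 ht1']
  · exact absurd h (h12 _ _ _ _ hz')
  · exact absurd h.symm (h02 _ _ hz)
  · exact absurd h.symm (h12 _ _ _ _ hz)
  · change kDisc j (discHomeo _ z) = kDisc j' (discHomeo _ z') at h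
    obtain ⟨h0, a, ha⟩ := kDisc_ne hz
    have ha' := ha
    rw [h] at ha'
    obtain ⟨q, hq, -⟩ := exists_of_push_ne ha'
    obtain rfl := (kCell_in hq).1
    rw [(discHomeo _).injective (kDisc_injective _ h h0)]

/-! ### The image of the presentation complex -/

/-- The retraction of the cells onto those of the presentation complex. -/
def hull : P.Cell → P.Cell
  | hd i (vt s _) τ => hd i (if s = Fin.last _ then tp else lg s) τ
  | hd i (lg s) τ => hd i (if s = Fin.last _ then tp else lg s) τ
  | hd i (gp _) τ => hd i tp τ
  | hd i tp τ => hd i tp τ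
  | rb o _ => rb o .md
  | dc j _ => dc j .md
  | cp _ => om
  | om => om

theorem hull_legAt (o : P.Occ) (υ τ : IF) : hull (hd (gen o) (legAt o υ) τ) = hd (gen o) (legAt o .md) τ := by
  rcases υ with u | _ <;> simp [legAt, hull, slot_ne_last]

theorem hull_hull (p : P.Cell) : hull (hull p) = hull p := by
  rcases p with ⟨i, a, τ⟩ | _ | _ | _ | _
  · rcases a with ⟨s, b⟩ | s | s | _ <;> simp only [hull]
    · grind
    · grind
  · rfl
  · rfl
  · rfl
  · rfl

theorem le_hull (p : P.Cell) : p ≤ hull p := by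
  rcases p with ⟨i, a, τ⟩ | _ | _ | _ | _
  · rcases a with ⟨s, b⟩ | s | s | _ <;> simp only [hull] <;> refine hd_le_hd.2 ⟨?_, le_rfl⟩
    · split_ifs <;> simp
    · split_ifs <;> simp
    · simp
    · simp
  · exact rb_le_rb.2 ⟨rfl, by simp⟩
  · exact dc_le_dc.2 ⟨rfl, by simp⟩
  · exact le_om_iff.2 (.inr (.inl ⟨_, rfl⟩))
  · exact le_rfl

theorem hull_hd (i : Fin P.n) : ∃ f : Poly (deg i + 1) → Poly (deg i + 1),
    Monotone f ∧ ∀ a τ, hull (hd i a τ) = hd i (f a) τ := by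
  refine ⟨fun | vt s _ => if s = Fin.last _ then tp else lg s
              | lg s => if s = Fin.last _ then tp else lg s
              | gp _ => tp
              | tp => tp, ?_, ?_⟩
  · intro a b h; cases h <;> simp
  · intro a τ; rcases a with ⟨s, b⟩ | s | s | _ <;> rfl

theorem hull_le_om {p : P.Cell} (h : p ≤ om) : hull p ≤ om := by
  rcases p with ⟨i, a, τ⟩ | _ | _ | _ | _
  · obtain ⟨f, -, hf⟩ := hull_hd i; rw [hf]; exact hd_le_om.2 (hd_le_om.1 h)
  · exact rb_le_om
  · exact absurd h not_dc_le_om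
  · exact le_rfl
  · exact le_rfl

theorem monotone_hull : Monotone (hull : P.Cell → P.Cell) := by
  intro p q h
  rcases q with ⟨i, a, τ⟩ | ⟨o, υ⟩ | ⟨j, υ⟩ | c | _
  · obtain ⟨a', ha, τ', hτ, rfl⟩ := le_hd.1 h
    obtain ⟨f, hm, hf⟩ := hull_hd i
    rw [hf, hf]
    exact hd_le_hd.2 ⟨hm ha, hτ⟩
  · rcases le_rb.1 h with ⟨υ', -, rfl⟩ | ⟨υ', -, rfl⟩ | ⟨υ', -, rfl⟩
    · exact le_rfl
    · rw [hull_legAt]; exact hd_le_rb_iff.2 ⟨le_rfl, .inl ⟨rfl, rfl⟩⟩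
    · rw [hull_legAt]; exact hd_le_rb_iff.2 ⟨le_rfl, .inr ⟨rfl, rfl⟩⟩
  · rcases le_dc.1 h with ⟨υ', -, rfl⟩ | ⟨o, rfl, υ', -, rfl⟩ | ⟨o, rfl, υ', -, τ, rfl⟩
    · exact le_rfl
    · exact rb_le_dc.2 ⟨rfl, le_rfl⟩
    · rw [hull_legAt]; exact hd_le_dc.2 ⟨rfl, le_rfl⟩
  · exact hull_le_om (h.trans (le_hull _))
  · exact hull_le_om h

theorem fixed_cases {p : P.Cell} (h : hull p = p) : p = om ∨ (∃ i τ, p = hd i tp τ) ∨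
    (∃ o τ, p = hd (gen o) (legAt o .md) τ) ∨ (∃ o, p = rb o .md) ∨ ∃ j, p = dc j .md := by
  rcases p with ⟨i, a, τ⟩ | _ | _ | _ | _
  · rcases a with ⟨s, b⟩ | s | s | _
    · simp only [hull] at h; split_ifs at h <;> cases h
    · rcases slot_cases s with rfl | ⟨o, ho⟩
      · simp only [hull, if_true] at h; cases h
      · cases ho; exact .inr (.inr (.inl ⟨o, τ, rfl⟩))
    · simp only [hull] at h; cases h
    · simp
  · simp only [hull] at h; cases h; exact .inr (.inr (.inr (.inl ⟨_, rfl⟩)))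
  · simp only [hull] at h; cases h; exact .inr (.inr (.inr (.inr ⟨_, rfl⟩)))
  · cases h
  · simp

theorem hull_outCell (j : Fin P.k) (x) : hull (outCell j x) = outCell j x := by
  rcases x with ⟨s, b⟩ | s | s | _ <;> rfl

theorem hull_polyEmb (j : Fin P.k) (x) : hull (polyEmb j (x, .md)) = polyEmb j (x, .md) := by
  rcases x with ⟨s, b⟩ | s | s | _
  · exact hull_legAt _ _ _
  · exact hull_legAt _ _ _
  · rfl
  · rfl

theorem hull_of_kMap {x : P.K} {p : P.Cell} (h : kMap x p ≠ 0) : hull p = p := by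
  rcases K.cases x with rfl | ⟨i, t, -, -, rfl⟩ | ⟨j, z, -, rfl⟩
  · rw [OC.vtx_ne h]; rfl
  · rcases exists_of_cellPath (i := i) (x := t) h with rfl | ⟨τ, rfl⟩ <;> rfl
  · obtain ⟨⟨a, _ | _⟩, rfl, -⟩ := exists_of_push_ne
      (show push (kCell j) (wt (discHomeo (length_pos j) z).1) p ≠ 0 from h)
    · exact hull_polyEmb _ _
    · exact hull_outCell _ _

theorem not_om_le_hd {i : Fin P.n} {a τ} : ¬ (om : P.Cell) ≤ hd i a τ := fun h => by cases om_le.1 h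

theorem mem_range_kDisc (j : Fin P.k) (s : Fin (P.rel j).length) (k b : Bool) (t : OC P.Cell)
    (ht : ∀ p, t p ≠ 0 → p = kCell j (edge s k .md, false) ∨ p = kCell j (edge s k (.en b), false) ∨
      p = kCell j (edge s k .md, true) ∨ p = kCell j (edge s k (.en b), true) ∨ p = dc j .md) :
    ∃ x, kMap x = t := by
  suffices h : ∃ s, kDisc j s = t by
    obtain ⟨s, hs⟩ := h
    refine ⟨Quot.mk _ (Sum.inr (Sum.inr (j, (discHomeo (length_pos j)).symm s))), ?_⟩
    change kDisc j (discHomeo _ _) = t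
    rw [Homeomorph.apply_symm_apply, hs]
  set ei := kCell j (edge s k .md, false) with hei
  set vi := kCell j (edge s k (.en b), false) with hvi
  set eo := kCell j (edge s k .md, true) with heo
  set vo := kCell j (edge s k (.en b), true) with hvo
  have c1 : ¬ (vi ≤ eo ∨ eo ≤ vi) := by
    cases k <;> cases b <;> simp [hvi, heo, kCell, edge, dual_cyc] <;>
      simp [dual, polyEmb, outCell, hd_le_hd, not_rb_le_hd, legAt, not_hd_le_rb]
  have c2 : ¬ (dc j .md ≤ eo ∨ eo ≤ dc j .md) := by
    cases k <;> simp [heo, kCell, edge, dual, outCell, not_dc_le_hd, not_hd_le_dc]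
  have c3 : ¬ (dc j .md ≤ vo ∨ vo ≤ dc j .md) := by
    cases k <;> cases b <;> simp [hvo, kCell, edge, dual, outCell, not_dc_le_hd, not_hd_le_dc,
      not_dc_le_om, om_le]
  have key : ∀ {p q : P.Cell}, ¬ (p ≤ q ∨ q ≤ p) → t p = 0 ∨ t q = 0 := by
    intro p q h
    by_contra! H
    exact h (t.chain p q H.1 H.2)
  have d0 : edge s k .md ≠ edge s k (.en b) := fun h => by cases edge_injective s k h
  have dt : ∀ τ, edge s k τ ≠ tp := edge_ne_tp s k
  have d1 : ei ≠ vi := fun h => by have := kCell_in_inj h; simp [d0] at this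
  have d2 : eo ≠ ei := fun h => by have := kCell_in_inj h; simp at this
  have d3 : vo ≠ ei := fun h => by have := kCell_in_inj h; simp at this
  have d4 : eo ≠ vi := fun h => by have := kCell_in_inj h; simp at this
  have d5 : vo ≠ vi := fun h => by have := kCell_in_inj h; simp at this
  have d6 : eo ≠ vo := fun h => d0 (kCell_out_inj (dt _) le_rfl (monotone_edge s k (by simp)) h)
  have hdc : dc j .md = kCell j (tp, false) := rfl
  have d7 : ei ≠ dc j .md := fun h => by have := kCell_in_inj (h.trans hdc); simp [dt] at this
  have d8 : vi ≠ dc j .md := fun h => by have := kCell_in_inj (h.trans hdc); simp [dt] at this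
  have d9 : eo ≠ dc j .md := fun h => by have := kCell_in_inj (h.trans hdc); simp at this
  have d10 : vo ≠ dc j .md := fun h => by have := kCell_in_inj (h.trans hdc); simp at this
  have hsum : t ei + t vi + t eo + t vo + t (dc j .md) = 1 := by
    classical
    rw [← t.sum_eq, ← Finset.sum_subset (Finset.subset_univ {ei, vi, eo, vo, dc j .md})]
    · rw [Finset.sum_insert, Finset.sum_insert, Finset.sum_insert, Finset.sum_pair d10]
      · ring
      · simp [d6, d9]
      · grind
      · grind
    · grind
  obtain ⟨w, h6, h1, h2, h3, h4, h5⟩ := exists_wt s k b _ _ _ _ _ (t.nonneg _) (t.nonneg _)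
    (t.nonneg _) (t.nonneg _) (t.nonneg _) hsum (key c1) (key c2) (key c3)
  refine ⟨w, OC.eq_of_forall_ne fun p hp => ?_⟩
  have hout : ∀ a ≤ edge s k .md, kDisc j w (kCell j (a, true)) = wt w (a, true) := fun a ha =>
    push_apply_of fun q hq h => by
      obtain ⟨c, _ | _⟩ := q
      · exact absurd (kCell_in_inj hq.symm) (by simp)
      · rw [kCell_out_inj (dt _) (h6 _ h) ha hq]
  rcases ht p hp with rfl | rfl | rfl | rfl | rfl
  · rw [← h1, ← kDisc_in]
  · rw [← h2, ← kDisc_in]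
  · grind
  · grind
  · rw [← h5, ← kDisc_in]; rfl

/-- A point in the part of the 2-cell at the end `c` of a leg, near the 1-cell. -/
theorem mem_range_leg (o : P.Occ) (c : Bool) (t : OC P.Cell) (ht : ∀ p, t p ≠ 0 →
    p = hd (gen o) (legAt o .md) (.en c) ∨ p = hd (gen o) (legAt o .md) .md ∨
      p = hd (gen o) tp (.en c) ∨ p = hd (gen o) tp .md ∨ p = dc o.1 .md) : ∃ x, kMap x = t := by
  obtain ⟨j, m⟩ := o
  refine mem_range_kDisc j m (c == sgn ⟨j, m⟩) (!(c == sgn ⟨j, m⟩)) t fun p hp => ?_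
  have := ht p hp
  cases h : sgn ⟨j, m⟩ <;> cases c <;> simpa [kCell, edge, dual, polyEmb, outCell, h] using this

/-- A point in the part of the 2-cell at the end of a leg, near the vertex. -/
theorem mem_range_ribbon (o o' : P.Occ) (c : Bool)
    (h : o = o' ∧ c = sgn o ∨ o = next o' ∧ c = !sgn o) (t : OC P.Cell) (ht : ∀ p, t p ≠ 0 →
    p = hd (gen o) (legAt o .md) (.en c) ∨ p = rb o' .md ∨
      p = hd (gen o) tp (.en c) ∨ p = om ∨ p = dc o.1 .md) : ∃ x, kMap x = t := by
  rcases h with ⟨rfl, rfl⟩ | ⟨rfl, rfl⟩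
  · obtain ⟨j, m⟩ := o
    refine mem_range_kDisc j m true true t fun p hp => ?_
    simp only [edge, kCell, dual_cyc]
    simpa [dual, polyEmb, outCell] using ht p hp
  · obtain ⟨j, m⟩ := o'
    refine mem_range_kDisc j (cyc m) false false t fun p hp => ?_
    have := ht p hp
    simp only [next_mk] at this
    simp only [edge, kCell, dual_cyc]
    cases h : sgn ⟨j, cyc m⟩ <;> simpa [dual, polyEmb, outCell, h] using this

theorem halfCell_reflect (i : Fin P.n) (b : Bool) (a a' : IF) (h : halfCell i b a ≤ halfCell i b a') :
    a ≤ a' ∨ a' ≤ a := by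
  rcases a with (_ | _) | _ <;> rcases a' with (_ | _) | _ <;>
    simp [halfCell, om_le, hd_le_om] at h ⊢

theorem mem_range_halfPath (i : Fin P.n) (b : Bool) (t : OC P.Cell)
    (ht : ∀ p, t p ≠ 0 → p = om ∨ p = hd i tp (.en b) ∨ p = hd i tp .md) : ∃ x, kMap x = t := by
  obtain ⟨s, hs⟩ := OC.exists_push_eq (halfCell_injective i b) (halfCell_reflect i b) t fun p hp => by
    rcases ht p hp with rfl | rfl | rfl
    · exact ⟨en false, rfl⟩
    · exact ⟨md, rfl⟩
    · exact ⟨en true, rfl⟩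
  obtain ⟨x, rfl⟩ := iota_surjective s
  have hx : ∃ y : I, (y : ℝ) ≤ 1 / 2 ∧ dbl y = x := by
    have := x.2.1
    have := x.2.2
    refine ⟨⟨x / 2, by linarith, by linarith⟩, by dsimp only; linarith, Subtype.ext ?_⟩
    simp only [dbl]
    rw [min_eq_left (by linarith)]
    ring
  obtain ⟨y, hy, rfl⟩ := hx
  refine ⟨Quot.mk _ (Sum.inr (Sum.inl (i, if !b then y else σ y))), ?_⟩
  change cellPath i _ = t
  rw [cellPath_letter, if_pos hy, Bool.not_not]
  exact Subtype.ext hs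

theorem range_kMap : Set.range (kMap : P.K → _) = {t : OC P.Cell | ∀ p, t p ≠ 0 → hull p = p} := by
  ext t
  constructor
  · rintro ⟨x, rfl⟩ p hp; exact hull_of_kMap hp
  intro ht
  have hc := fun {p q} => t.chain p q
  obtain ⟨p, hp, hmin⟩ := t.exists_min
  rcases fixed_cases (ht p hp) with rfl | ⟨i, τ, rfl⟩ | ⟨o, τ, rfl⟩ | ⟨o, rfl⟩ | ⟨j, rfl⟩
  · exact ⟨P.vertex, (OC.eq_vtx_of_ne fun q hq => om_le.1 (hmin q hq)).symm⟩
  · obtain ⟨b, hb⟩ : ∃ b, .en b ≤ τ := by rcases τ with b | _; exacts [⟨b, le_rfl⟩, ⟨true, by simp⟩]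
    refine mem_range_halfPath i b t fun q hq => ?_
    have h := (hd_le_hd.2 ⟨le_rfl, hb⟩).trans (hmin q hq)
    rcases fixed_cases (ht q hq) with rfl | ⟨i, τ, rfl⟩ | ⟨o, τ, rfl⟩ | ⟨o, rfl⟩ | ⟨j, rfl⟩
    · simp
    · obtain ⟨a, -, υ, hυ, h⟩ := le_hd.1 h
      cases h
      rcases τ with _ | _
      · simp_all
      · simp
    · obtain ⟨a, ha, υ, hυ, h⟩ := le_hd.1 h; cases h; simp [legAt] at ha
    · exact absurd h (not_hd_le_rb (by simp) (by simp))
    · exact absurd h (not_hd_le_dc (by simp) (by simp))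
  · obtain ⟨c, hc'⟩ : ∃ b, .en b ≤ τ := by rcases τ with b | _; exacts [⟨b, le_rfl⟩, ⟨true, by simp⟩]
    have hle : ∀ q, t q ≠ 0 → hd (gen o) (legAt o .md) (.en c) ≤ q := fun q hq =>
      (hd_le_hd.2 ⟨le_rfl, hc'⟩).trans (hmin q hq)
    have hA : ∀ q, t q ≠ 0 → q = om ∨ q = hd (gen o) tp (.en c) ∨ q = hd (gen o) tp .md ∨
        q = hd (gen o) (legAt o .md) (.en c) ∨ q = hd (gen o) (legAt o .md) .md ∨
        (∃ o', q = rb o' .md ∧ (o = o' ∧ c = sgn o ∨ o = next o' ∧ c = !sgn o)) ∨ q = dc o.1 .md := by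
      intro q hq
      have h := hle q hq
      rcases fixed_cases (ht q hq) with rfl | ⟨i, τ, rfl⟩ | ⟨o, τ, rfl⟩ | ⟨o, rfl⟩ | ⟨j, rfl⟩
      · simp
      · obtain ⟨a, -, υ, hυ, h⟩ := le_hd.1 h
        cases h
        rcases τ with _ | _
        · simp_all
        · simp
      · obtain ⟨rfl, -, hυ⟩ := hd_legAt_le h
        rcases τ with _ | _
        · simp_all
        · tauto
      · have := (hd_le_rb_iff.1 h).2
        simp only [en.injEq] at this
        exact .inr (.inr (.inr (.inr (.inr (.inl ⟨_, rfl, this⟩)))))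
      · obtain rfl := (hd_le_dc.1 h).1; tauto
    by_cases hm : ∃ a, t (hd (gen o) a .md) ≠ 0
    · obtain ⟨a, ha⟩ := hm
      refine mem_range_leg o c t fun q hq => ?_
      have h1 := hc hq ha
      rcases hA q hq with rfl | rfl | rfl | rfl | rfl | ⟨o', rfl, -⟩ | rfl <;> try tauto
      · simp [hd_le_om, not_om_le_hd] at h1
      · rcases h1 with h1 | h1
        · exact absurd h1 not_rb_le_hd
        · simpa [hd_le_om] using h1.trans rb_le_om
    · push Not at hm
      have hB : ∀ o', (o = o' ∧ c = sgn o ∨ o = next o' ∧ c = !sgn o) →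
          (∀ q, t (rb q .md) ≠ 0 → q = o') → ∃ x, kMap x = t := by
        intro o' ho h
        refine mem_range_ribbon o o' c ho t fun q hq => ?_
        rcases hA q hq with rfl | rfl | rfl | rfl | rfl | ⟨o'', rfl, -⟩ | rfl <;> tauto
      by_cases hr : ∃ o', t (rb o' .md) ≠ 0
      · obtain ⟨o', ho'⟩ := hr
        rcases hA _ ho' with h | h | h | h | h | ⟨o'', h, h'⟩ | h <;> cases h
        refine hB o' h' fun q hq => ?_
        rcases hc hq ho' with h | h
        · exact (rb_le_rb.1 h).1
        · exact (rb_le_rb.1 h).1.symm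
      · push Not at hr
        rcases bool_cases c (sgn o) with h | h
        · simp_all
        · obtain ⟨o', rfl⟩ := next_surjective o
          exact hB o' (.inr ⟨rfl, h⟩) fun q hq => absurd (hr q) hq
  · refine mem_range_ribbon o o (sgn o) (.inl ⟨rfl, rfl⟩) t fun q hq => ?_
    have h := hmin q hq
    rcases fixed_cases (ht q hq) with rfl | ⟨i, τ, rfl⟩ | ⟨o, τ, rfl⟩ | ⟨o, rfl⟩ | ⟨j, rfl⟩
    · tauto
    · exact absurd h not_rb_le_hd
    · exact absurd h not_rb_le_hd
    · obtain rfl := (rb_le_rb.1 h).1; tauto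
    · obtain rfl := (rb_le_dc.1 h).1; tauto
  · refine mem_range_leg ⟨j, ⟨0, length_pos j⟩⟩ true t fun q hq => ?_
    have h := hmin q hq
    rcases fixed_cases (ht q hq) with rfl | ⟨i, τ, rfl⟩ | ⟨o, τ, rfl⟩ | ⟨o, rfl⟩ | ⟨j, rfl⟩
    · exact absurd h not_dc_le_om
    · exact absurd h not_dc_le_hd
    · exact absurd h not_dc_le_hd
    · exact absurd h not_dc_le_rb
    · obtain rfl := (dc_le_dc.1 h).1; tauto

instance : CompactSpace P.K := inferInstanceAs (CompactSpace (Quot P.CellRel))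

theorem IsStrongDeformationRetract.preimage {X Y : Type*} [TopologicalSpace X] [TopologicalSpace Y]
    (e : X ≃ₜ Y) {A : Set Y} (h : IsStrongDeformationRetract A) :
    IsStrongDeformationRetract (e ⁻¹' A) := by
  obtain ⟨r, hr, ⟨H⟩⟩ := h
  refine ⟨⟨fun x => e.symm (r (e x)), by fun_prop⟩, fun x => by simpa using hr (e x),
    ⟨⟨⟨⟨fun z => e.symm (H (z.1, e z.2)), by fun_prop⟩, fun x => ?_, fun x => ?_⟩, fun s x hx => ?_⟩⟩⟩
  · simp
  · simp
  · have := H.prop' s (e x) hx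
    change e.symm (H (s, e x)) = x
    change H (s, e x) = e x at this
    rw [this, e.symm_apply_apply]

/-- The presentation complex is embedded as a strong deformation retract. -/
theorem exists_embedding_k : ∃ j : P.K → P.X, IsEmbedding j ∧ j P.vertex = P.omega ∧
    IsStrongDeformationRetract (Set.range j) := by
  refine ⟨fun x => P.xHomeo.symm (kMap x), P.xHomeo.symm.isEmbedding.comp
    (continuous_kMap.isClosedEmbedding kMap_injective).isEmbedding, ?_, ?_⟩
  · rw [Homeomorph.symm_apply_eq, xHomeo_omega]; rfl
  · have h := IsStrongDeformationRetract.preimage P.xHomeo (A := Set.range kMap) (by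
      rw [range_kMap]
      exact OC.isStrongDeformationRetract monotone_hull le_hull hull_hull)
    convert h using 1
    ext x
    simp only [Set.mem_range, Set.mem_preimage, Homeomorph.symm_apply_eq]

end FinPresentation

/-! ### The fundamental group of an order complex -/

open CategoryTheory

variable {A : Type} [Fintype A] [PartialOrder A]

/-- Comparability of the elements of a poset. -/
abbrev Cmp (p q : A) : Prop := p ≤ q ∨ q ≤ p

/-- A family of elements of a group that is multiplicative along the edges of the order complex. -/
structure Cocycle (A G : Type) [PartialOrder A] [Group G] where
  val : A → A → G
  mul : ∀ p q r, Cmp p q → Cmp q r → Cmp p r → val p q * val q r = val p r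

namespace Cocycle

variable {G : Type} [Group G] (c : Cocycle A G)

theorem self (p : A) : c.val p p = 1 := by
  have := c.mul p p p (.inl le_rfl) (.inl le_rfl) (.inl le_rfl)
  simpa using this

theorem symm {p q : A} (h : Cmp p q) : c.val p q = (c.val q p)⁻¹ := by
  rw [eq_inv_iff_mul_eq_one, c.mul p q p h h.symm (.inl le_rfl), self]

/-- A cocycle defined on the pairs of elements in order. -/
def ofLe (f : A → A → G) (h : ∀ p q r, p ≤ q → q ≤ r → f p q * f q r = f p r) : Cocycle A G where
  val p q := open Classical in if p ≤ q then f p q else (f q p)⁻¹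
  mul p q r h1 h2 h3 := by
    have h0 : ∀ p, f p p = 1 := fun p => by simpa using h p p p le_rfl le_rfl
    have key : ∀ p q r, p ≤ q → q ≤ r → (f p q)⁻¹ * f p r = f q r ∧ f p r * (f q r)⁻¹ = f p q :=
      fun p q r h1 h2 => by rw [← h p q r h1 h2]; simp
    have hs : ∀ p q, p ≤ q → q ≤ p → (f q p)⁻¹ = f p q := fun p q h1 h2 => by
      rw [inv_eq_iff_mul_eq_one, h q p q h2 h1, h0]
    classical
    have hv : ∀ p q, Cmp p q → (p ≤ q ∧ (if p ≤ q then f p q else (f q p)⁻¹) = f p q) ∨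
        (q ≤ p ∧ (if p ≤ q then f p q else (f q p)⁻¹) = (f q p)⁻¹) := by grind
    obtain ⟨a1, e1⟩ | ⟨a1, e1⟩ := hv p q h1 <;> obtain ⟨a2, e2⟩ | ⟨a2, e2⟩ := hv q r h2 <;>
      obtain ⟨a3, e3⟩ | ⟨a3, e3⟩ := hv p r h3 <;> simp only [e1, e2, e3]
    · grind
    · grind
    · grind
    · rw [← h r p q a3 a1]; simp
    · grind
    · rw [← h q r p a2 a3]; simp
    · grind
    · grind

/-- The fibre bundle given by a cocycle, trivial over the open stars. -/
def core [TopologicalSpace G] [DiscreteTopology G] : FiberBundleCore A (OC A) G where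
  baseSet p := {x | x p ≠ 0}
  isOpen_baseSet p := isOpen_ne_fun (OC.continuous_coord p) continuous_const
  indexAt x := x.exists_ne.choose
  mem_baseSet_at x := x.exists_ne.choose_spec
  coordChange p q _ v := c.val q p * v
  coordChange_self p _ _ v := by rw [self, one_mul]
  continuousOn_coordChange p q := by fun_prop
  coordChange_comp p q r x hx v := by
    rw [← mul_assoc, c.mul r q p (x.chain _ _ hx.2 hx.1.2) (x.chain _ _ hx.1.2 hx.1.1)
      (x.chain _ _ hx.2 hx.1.1)]

end Cocycle

/-- The point is in the closed star of the vertex. -/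
abbrev InStar (x : OC A) (q : A) : Prop := ∀ p, x p ≠ 0 → Cmp p q

theorem inStar_vtx {p q : A} (h : Cmp p q) : InStar (OC.vtx p) q := fun r hr => by
  rwa [OC.vtx_ne hr]

/-- The path in the star of a vertex to this vertex. -/
def conePath (x : OC A) (q : A) (h : InStar x q) : Path x (OC.vtx q) where
  toFun t := OC.mixV x q h t
  continuous_toFun := OC.continuous_of_coord fun p => by
    simp only [OC.mixV_apply]
    split_ifs <;> fun_prop
  source' := OC.mixV_zero ..
  target' := OC.mixV_one ..

theorem conePath_mem (x : OC A) {p q : A} (hp : InStar x p) (hq : InStar x q)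
    (hpq : Cmp p q) (t : I) : InStar (conePath x p hp t) q := by
  intro r hr
  change OC.mixV x p hp t r ≠ 0 at hr
  rw [OC.mixV_apply] at hr
  by_cases h : r = p
  · rwa [h]
  · grind

theorem joined_vtx {p q : A} (h : Cmp p q) : Joined (OC.vtx p) (OC.vtx q) :=
  ⟨conePath _ q (inStar_vtx h)⟩

theorem inStar_of_ne {x : OC A} {p : A} (hp : x p ≠ 0) : InStar x p := fun _ hr => x.chain _ _ hr hp

theorem OC.pathConnectedSpace (o : A) (h : ∀ p : A, Joined (vtx p) (vtx o)) :
    PathConnectedSpace (OC A) :=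
  have h' (x : OC A) : Joined x (vtx o) := by
    obtain ⟨p, hp⟩ := x.exists_ne
    exact Joined.trans ⟨conePath x p (inStar_of_ne hp)⟩ (h p)
  { nonempty := ⟨vtx o⟩
    joined := fun x y => (h' x).trans (h' y).symm }

/-- The class of a path. -/
abbrev cls {x y : OC A} (γ : Path x y) : FundamentalGroupoid.mk x ⟶ FundamentalGroupoid.mk y :=
  Path.Homotopic.Quotient.mk γ

/-- Paths in a star are contracted to the vertex. -/
theorem cls_conePath {x y : OC A} (δ : Path x y) (q : A) (h : ∀ t, InStar (δ t) q)
    (hx : InStar x q) (hy : InStar y q) :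
    cls δ ≫ cls (conePath y q hy) = cls (conePath x q hx) := by
  obtain ⟨f, rfl, rfl⟩ := δ
  let F : f.Homotopy (ContinuousMap.const I (OC.vtx q)) :=
    { toFun := fun z => OC.mixV (f z.2) q (h z.2) z.1
      continuous_toFun := OC.continuous_of_coord fun p => by
        simp only [OC.mixV_apply]
        have := (OC.continuous_coord p).comp f.continuous
        simp only [comp_def] at this
        split_ifs <;> fun_prop
      map_zero_left := fun t => OC.mixV_zero ..
      map_one_left := fun t => OC.mixV_one .. }
  have := Path.Homotopic.map_trans_evalAt F unitInterval.path01
  exact (Path.Homotopic.Quotient.eq.2 this).trans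
    (Path.Homotopic.Quotient.trans_refl (Path.Homotopic.Quotient.mk (F.evalAt 0)))

/-- The class of an edge. -/
def edgeCls (p q : A) (h : Cmp p q) : FundamentalGroupoid.mk (OC.vtx p) ⟶ FundamentalGroupoid.mk (OC.vtx q) :=
  cls (conePath (OC.vtx p) q (inStar_vtx h))

theorem cone_edge {x : OC A} {p q : A} (hp : InStar x p) (hq : InStar x q) (h : Cmp p q) :
    cls (conePath x p hp) ≫ edgeCls p q h = cls (conePath x q hq) :=
  cls_conePath _ _ (conePath_mem x hp hq h) _ _

theorem edge_edge {p q r : A} (h1 : Cmp p q) (h2 : Cmp q r) (h3 : Cmp p r) :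
    edgeCls p q h1 ≫ edgeCls q r h2 = edgeCls p r h3 := cone_edge _ _ _

theorem edge_self (p : A) (h : Cmp p p) : edgeCls p p h = 𝟙 _ := by
  rw [← cancel_epi (edgeCls p p h), edge_edge h h h, Category.comp_id]

/-! ### Edge paths generate -/

section Generation

variable (o : A) (T : ∀ p, FundamentalGroupoid.mk (OC.vtx o) ⟶ FundamentalGroupoid.mk (OC.vtx p))

open Classical in
/-- The cocycle of the edges, with values in the fundamental group, obtained from
a family of paths to the vertices. -/
def edgeCocycle : Cocycle A (FundamentalGroup (OC A) (OC.vtx o)) where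
  val p q := if h : Cmp q p then T q ≫ edgeCls q p h ≫ inv (T p) else 1
  mul p q r h1 h2 h3 := by
    rw [dif_pos h1.symm, dif_pos h2.symm, dif_pos h3.symm, FundamentalGroup.mul_def]
    change (T r ≫ edgeCls r q _ ≫ inv (T q)) ≫ T q ≫ edgeCls q p _ ≫ inv (T p) = _
    simp only [Category.assoc, IsIso.inv_hom_id_assoc]
    rw [← edge_edge h2.symm h1.symm h3.symm, Category.assoc]

theorem edgeCocycle_apply {p q : A} (h : Cmp q p) :
    (edgeCocycle o T).val p q = T q ≫ edgeCls q p h ≫ inv (T p) := dif_pos h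

theorem edgeCocycle_eq_one {p q : A} (h : Cmp q p) (hT : T q ≫ edgeCls q p h = T p) :
    (edgeCocycle o T).val p q = 1 := by
  rw [edgeCocycle_apply o T h, ← Category.assoc, hT, IsIso.hom_inv_id]
  rfl

theorem mem_of_edges_mem (hT : T o = 𝟙 _) (S : Subgroup (FundamentalGroup (OC A) (OC.vtx o)))
    (hS : ∀ p q, Cmp p q → (edgeCocycle o T).val p q ∈ S)
    (g : FundamentalGroup (OC A) (OC.vtx o)) : g ∈ S := by
  let Good : ∀ {x : OC A}, (FundamentalGroupoid.mk (OC.vtx o) ⟶ FundamentalGroupoid.mk x) → Prop :=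
    fun {x} α => ∀ p (hp : x p ≠ 0), α ≫ cls (conePath x p (inStar_of_ne hp)) ≫ inv (T p) ∈ S
  have piece : ∀ {x y : OC A} (δ : Path x y) (p : A) (α), (∀ s, δ s p ≠ 0) → Good (x := x) α →
      Good (α ≫ cls δ) := by
    intro x y δ p α hδ hα q hq
    have hx : x p ≠ 0 := by simpa using hδ 0
    have hy : y p ≠ 0 := by simpa using hδ 1
    have hpq := y.chain p q hy hq
    have h1 := S.mul_mem (hS q p hpq.symm) (hα p hx)
    rw [edgeCocycle_apply o T hpq, FundamentalGroup.mul_def] at h1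
    change (α ≫ cls (conePath x p _) ≫ inv (T p)) ≫ T p ≫ edgeCls p q _ ≫ inv (T q) ∈ S at h1
    rw [← cls_conePath δ p (fun t => inStar_of_ne (hδ t)) _ (inStar_of_ne hy)] at h1
    simp only [Category.assoc, IsIso.inv_hom_id_assoc] at h1 ⊢
    rwa [← Category.assoc (cls (conePath y p _)), cone_edge] at h1
  have path : ∀ {x y : OC A} (γ : Path x y) (α), Good (x := x) α → Good (α ≫ cls γ) := by
    rintro x y γ α hα
    obtain ⟨t, t0, tm, ⟨N, hN⟩, ht⟩ := exists_monotone_Icc_subset_open_cover_unitInterval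
      (c := fun p : A => {s | γ s p ≠ 0})
      (fun p => isOpen_ne_fun ((OC.continuous_coord p).comp γ.continuous) continuous_const)
      (fun s _ => Set.mem_iUnion.2 (γ s).exists_ne)
    obtain ⟨f, rfl, rfl⟩ := γ
    set γ : Path (f 0) (f 1) := ⟨f, rfl, rfl⟩
    have key : ∀ n, Good (α ≫ cls (γ.subpath 0 (t n))) := by
      intro n
      induction n with
      | zero =>
        rw [t0, Path.subpath_self]
        exact (Category.comp_id α).symm ▸ hα
      | succ n ih =>
        obtain ⟨p, hp⟩ := ht n
        have := piece (γ.subpath (t n) (t (n + 1))) p _ (fun s => by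
          have h1 : γ.subpath (t n) (t (n + 1)) s ∈ γ '' Set.Icc (t n) (t (n + 1)) := by
            rw [← Path.range_subpath_of_le _ _ _ (tm n.le_succ)]
            exact ⟨s, rfl⟩
          obtain ⟨s', hs', h2⟩ := h1
          rw [← h2]
          exact hp hs') ih
        rw [Category.assoc] at this
        have h3 : cls (γ.subpath 0 (t n)) ≫ cls (γ.subpath (t n) (t (n + 1))) =
          cls (γ.subpath 0 (t (n + 1))) :=
          Path.Homotopic.Quotient.eq.2 ⟨Path.Homotopy.subpathTransSubpath γ _ _ _⟩
        rwa [h3] at this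
    have := key N
    rw [hN N le_rfl, Path.subpath_zero_one] at this
    exact this
  obtain ⟨γ, rfl⟩ := Path.Homotopic.Quotient.mk_surjective g
  have hvo : OC.vtx o o ≠ 0 := by simp [OC.vtx_apply]
  have h0 : Good (𝟙 (FundamentalGroupoid.mk (OC.vtx o))) := by
    intro p hp
    obtain rfl := OC.vtx_ne hp
    have := edge_self p (.inl le_rfl)
    rw [edgeCls] at this
    rw [this, hT, IsIso.inv_id, Category.comp_id, Category.comp_id]
    exact S.one_mem
  have := path γ _ h0 o hvo
  have h1 := edge_self o (.inl le_rfl)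
  rw [edgeCls] at h1
  rw [h1, hT, IsIso.inv_id] at this
  simpa only [Category.id_comp, Category.comp_id] using this

end Generation

/-! ### Monodromy -/

section Monodromy

variable {G : Type} [Group G] [TopologicalSpace G] [DiscreteTopology G] (c : Cocycle A G)

/-- The covering of the order complex given by a cocycle. -/
abbrev Cocycle.Cover : Type := c.core.TotalSpace

theorem Cocycle.isCoveringMap : IsCoveringMap (Bundle.TotalSpace.proj : c.Cover → OC A) :=
  FiberBundle.isCoveringMap

/-- A point of the covering over a vertex. -/
def Cocycle.pt (p : A) (v : G) : (Bundle.TotalSpace.proj : c.Cover → OC A) ⁻¹' {OC.vtx p} :=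
  ⟨⟨OC.vtx p, v⟩, rfl⟩

theorem Cocycle.index_vtx (p : A) : c.core.indexAt (OC.vtx p) = p :=
  OC.vtx_ne (c.core.mem_baseSet_at _)

theorem Cocycle.monodromy_edge {p q : A} (h : Cmp p q) (v : G) :
    c.isCoveringMap.monodromy (edgeCls p q h) (c.pt p v) = c.pt q (c.val q p * v) := by
  let δ := conePath (OC.vtx p) q (inStar_vtx h)
  have hst : ∀ t, InStar (δ t) q := conePath_mem _ _ (inStar_vtx h) (.inl le_rfl)
  let S : OC A → c.Cover := fun x => ⟨x, c.val (c.core.indexAt x) q * (c.val q p * v)⟩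
  let L : I → c.Cover := fun t => S (δ t)
  have hL : Continuous L := by
    refine continuous_iff_continuousAt.2 fun t => ?_
    rw [FiberBundle.continuousAt_totalSpace]
    refine ⟨δ.continuous.continuousAt, ?_⟩
    have hi := fun t => c.core.mem_baseSet_at (δ t)
    have hopen : ∀ᶠ s in 𝓝 t, δ s (c.core.indexAt (δ t)) ≠ 0 :=
      (isOpen_ne_fun ((OC.continuous_coord _).comp δ.continuous) continuous_const).mem_nhds (hi t)
    refine continuousAt_const.congr (f := fun _ => c.val (c.core.indexAt (δ t)) q * (c.val q p * v))
      (hopen.mono fun s hs => ?_)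
    change _ = c.val (c.core.indexAt (δ t)) (c.core.indexAt (δ s)) *
      (c.val (c.core.indexAt (δ s)) q * (c.val q p * v))
    rw [← mul_assoc (c.val _ _) (c.val _ q), c.mul _ _ _ ((δ s).chain _ _ hs (hi s)) (hst s _ (hi s)) (hst s _ hs)]
  have hS : ∀ r, S (OC.vtx r) = (c.pt r (c.val r q * (c.val q p * v))).1 := fun r =>
    congrArg (fun r' => (⟨OC.vtx r, c.val r' q * (c.val q p * v)⟩ : c.Cover)) (c.index_vtx r)
  have h0 : L 0 = (c.pt p v).1 := by
    rw [show L 0 = S (OC.vtx p) from congrArg S δ.source, hS, ← mul_assoc,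
      c.mul _ _ _ h h.symm (.inl le_rfl), self, one_mul]
  have h1 : L 1 = (c.pt q (c.val q p * v)).1 := by
    rw [show L 1 = S (OC.vtx q) from congrArg S δ.target, hS, self, one_mul]
  let Γ : Path (c.pt p v).1 (c.pt q (c.val q p * v)).1 := ⟨⟨L, hL⟩, h0, h1⟩
  exact c.isCoveringMap.monodromy_eq_of_map_eq (Path.Homotopic.Quotient.mk Γ) rfl

end Monodromy

open IF CategoryTheory

/-- The product of the first letters of a word. -/
def wordProd {ι G : Type} [Group G] (g : ι → G) (L : List (ι × Bool)) (m : ℕ) : G :=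
  ((L.take m).map fun x => cond x.2 (g x.1) (g x.1)⁻¹).prod

theorem wordProd_zero {ι G : Type} [Group G] (g : ι → G) (L : List (ι × Bool)) :
    wordProd g L 0 = 1 := rfl

theorem wordProd_succ {ι G : Type} [Group G] (g : ι → G) (L : List (ι × Bool)) (m : Fin L.length) :
    wordProd g L (m + 1) = wordProd g L m * cond (L.get m).2 (g (L.get m).1) (g (L.get m).1)⁻¹ := by
  rw [wordProd, ← List.take_concat_get' _ _ m.2, List.map_append, List.prod_append]
  simp [wordProd]

theorem lift_mk_eq_wordProd {ι G : Type} [Group G] (g : ι → G) (L : List (ι × Bool)) :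
    FreeGroup.lift g (FreeGroup.mk L) = wordProd g L L.length := by
  rw [FreeGroup.lift_mk, wordProd, List.take_length]

theorem map_wordProd {ι G H : Type} [Group G] [Group H] (φ : G →* H) (g : ι → G)
    (L : List (ι × Bool)) (m : ℕ) : φ (wordProd g L m) = wordProd (fun i => φ (g i)) L m := by
  rw [wordProd, wordProd, map_list_prod, List.map_map]
  congr 2
  ext ⟨i, _ | _⟩ <;> simp

namespace FinPresentation

open SingularManifold.Poly Cell

variable {P : FinPresentation}

/-- The generators of the group. -/
def gr (i : Fin P.n) : P.Grp := PresentedGroup.of i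

theorem wordProd_gr (j : Fin P.k) : wordProd gr (P.rel j) (P.rel j).length = (1 : P.Grp) := by
  rw [← lift_mk_eq_wordProd]
  have : FreeGroup.lift gr = PresentedGroup.mk (Set.range fun j => FreeGroup.mk (P.rel j)) :=
    FreeGroup.ext_hom _ _ fun i => by rw [FreeGroup.lift_apply_of]; rfl
  rw [this]
  exact PresentedGroup.one_of_mem ⟨j, rfl⟩

theorem pred_length_add_one (j : Fin P.k) : (P.rel j).length - 1 + 1 = (P.rel j).length :=
  Nat.sub_add_cancel (length_pos j)

/-- The last letter of a relator. -/
def lastOcc (j : Fin P.k) : P.Occ := ⟨j, ⟨(P.rel j).length - 1, Nat.sub_lt (length_pos j) one_pos⟩⟩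

theorem next_lastOcc (j : Fin P.k) : next (lastOcc j) = ⟨j, ⟨0, length_pos j⟩⟩ := by
  refine Sigma.ext rfl (heq_of_eq (Fin.ext ?_))
  simp only [lastOcc, next]
  rw [pred_length_add_one, Nat.mod_self]

theorem next_of_lt {j : Fin P.k} {m : ℕ} (h : m + 1 < (P.rel j).length) :
    next (⟨j, ⟨m, by omega⟩⟩ : P.Occ) = ⟨j, ⟨m + 1, h⟩⟩ :=
  Sigma.ext rfl (heq_of_eq (Fin.ext (Nat.mod_eq_of_lt h)))

theorem wordProd_next (o : P.Occ) :
    wordProd gr (P.rel (next o).1) (next o).2 = (wordProd gr (P.rel o.1) (o.2 + 1) : P.Grp) := by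
  obtain ⟨j, m, hm⟩ := o
  rcases Nat.lt_or_ge (m + 1) (P.rel j).length with h | h
  · rw [next_of_lt h]
  · obtain rfl : m = (P.rel j).length - 1 := by omega
    rw [show (⟨j, ⟨_, hm⟩⟩ : P.Occ) = lastOcc j from rfl, next_lastOcc]
    simp only [lastOcc]
    rw [pred_length_add_one, wordProd_gr, wordProd_zero]

open Classical in
/-- The values on the edges to the cells of the 2-handles. -/
def toDisc : P.Cell → P.Grp
  | rb o _ => (wordProd gr (P.rel o.1) (o.2 + 1))⁻¹
  | hd i a τ => if h : ∃ o : P.Occ, ∃ υ, (hd i a τ : P.Cell) = hd (gen o) (legAt o υ) τ then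
      (wordProd gr (P.rel h.choose.1)
        (if (τ = en true) = (sgn h.choose = true) then h.choose.2 + 1 else h.choose.2))⁻¹ else 1
  | _ => 1

theorem toDisc_hd (o : P.Occ) (υ τ : IF) : toDisc (hd (gen o) (legAt o υ) τ) =
    (wordProd gr (P.rel o.1) (if (τ = en true) = (sgn o = true) then o.2 + 1 else o.2))⁻¹ := by
  have h : ∃ o' : P.Occ, ∃ υ', (hd (gen o) (legAt o υ) τ : P.Cell) = hd (gen o') (legAt o' υ') τ :=
    ⟨o, υ, rfl⟩
  have ho : h.choose = o := (hd_legAt_inj.1 h.choose_spec.choose_spec).1.symm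
  rw [toDisc, dif_pos h, ho]

theorem toDisc_of_le_rb {p : P.Cell} {o : P.Occ} {υ : IF} (h : p ≤ rb o υ) :
    toDisc p = toDisc (rb o υ) := by
  rcases le_rb.1 h with ⟨υ', -, rfl⟩ | ⟨υ', -, rfl⟩ | ⟨υ', -, rfl⟩
  · rfl
  · rw [toDisc_hd, toDisc]; simp
  · rw [toDisc_hd, toDisc, ← wordProd_next]; simp

/-- The values on the edges to the cells of the 1-handles. -/
def toHandle : P.Cell → P.Grp
  | hd i _ (en true) => (gr i)⁻¹
  | _ => 1

theorem toHandle_mul_toDisc (o : P.Occ) (υ υ' τ : IF) :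
    toHandle (hd (gen o) (legAt o υ) τ) * toDisc (hd (gen o) (legAt o υ') md) =
      toDisc (hd (gen o) (legAt o υ) τ) := by
  have h := wordProd_succ (gr (P := P)) (P.rel o.1) o.2
  change _ = _ * cond (sgn o) (gr (gen o)) (gr (gen o))⁻¹ at h
  rw [toDisc_hd, toDisc_hd]
  rcases τ with (_ | _) | _ <;> cases hs : sgn o <;> simp_all [toHandle]

/-- The values of the tautological cocycle. -/
def tautVal (p : P.Cell) : P.Cell → P.Grp
  | dc _ _ => toDisc p
  | hd _ _ md => toHandle p
  | _ => 1

/-- The tautological cocycle with values in the group of the presentation. -/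
def taut : Cocycle P.Cell P.Grp := Cocycle.ofLe tautVal <| by
  intro p q r hpq hqr
  rcases r with ⟨i, a, τ⟩ | ⟨o, υ⟩ | ⟨j, υ⟩ | c | _
  · obtain ⟨a', ha, τ', hτ, rfl⟩ := le_hd.1 hqr
    obtain ⟨a'', -, τ'', hτ', rfl⟩ := le_hd.1 hpq
    rcases τ with b | _
    · obtain rfl := le_en.1 hτ; simp [tautVal]
    · rcases τ' with b | _
      · obtain rfl := le_en.1 hτ'; cases b <;> simp [tautVal, toHandle]
      · simp [tautVal, toHandle]
  · rcases le_rb.1 hqr with ⟨_, -, rfl⟩ | ⟨_, -, rfl⟩ | ⟨_, -, rfl⟩ <;> simp [tautVal]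
  · rcases le_dc.1 hqr with ⟨_, -, rfl⟩ | ⟨o, rfl, υ', -, rfl⟩ | ⟨o, rfl, υ', -, τ, rfl⟩
    · simp [tautVal, toDisc]
    · simp [tautVal, toDisc_of_le_rb hpq]
    · obtain ⟨a', ha, τ', hτ, rfl⟩ := le_hd.1 hpq
      obtain ⟨υ'', -, rfl⟩ := le_legAt.1 ha
      rcases τ with b | _
      · obtain rfl := le_en.1 hτ; simp [tautVal, toDisc_hd]
      · exact toHandle_mul_toDisc ..
  · rcases le_cp.1 hqr with rfl | h
    · simp [tautVal]
    · rcases h with ⟨_, _, _, _, rfl, -⟩ | ⟨_, _, _, rfl, -⟩ | ⟨_, _, rfl, -⟩ | ⟨_, _, rfl, -⟩ <;>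
        simp [tautVal]
  · rcases le_om.1 hqr with rfl | ⟨_, rfl⟩ | ⟨_, _, rfl⟩ | ⟨_, _, _, rfl⟩ <;> simp [tautVal]

theorem taut_of_le {p q : P.Cell} (h : p ≤ q) : taut.val p q = tautVal p q := if_pos h

/-! ### The relations between the edges -/

section Relations

variable {H : Type} [Group H] (C : Cocycle P.Cell H)

/-- A cocycle that is trivial on the edges of a tree. -/
structure Normalized : Prop where
  om {p : P.Cell} (h : p ≤ om) : C.val p om = 1
  hd (i : Fin P.n) (a) : C.val (hd i a (en false)) (hd i a md) = 1
  dc (j : Fin P.k) (υ) : C.val (rb (lastOcc j) υ) (dc j υ) = 1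

variable {C} (hC : Normalized C)

theorem mul_of_le {p q r : P.Cell} (h : p ≤ q) (h' : q ≤ r) :
    C.val p q * C.val q r = C.val p r := C.mul _ _ _ (.inl h) (.inl h') (.inl (h.trans h'))

variable (C) in
/-- The values on the 1-handles. -/
def handleVal (i : Fin P.n) : H := (C.val (hd i tp (en true)) (hd i tp md))⁻¹

include hC

theorem Normalized.le_om {p q : P.Cell} (h : p ≤ q) (hq : q ≤ Cell.om) : C.val p q = 1 := by
  have := mul_of_le (C := C) h hq
  rwa [hC.om hq, hC.om (h.trans hq), mul_one] at this

theorem Normalized.hd_le (i : Fin P.n) (a) (b : Bool) :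
    C.val (Cell.hd i a (en b)) (Cell.hd i tp md) = if b then (handleVal C i)⁻¹ else 1 := by
  rw [← mul_of_le (q := Cell.hd i tp (en b)) (hd_le_hd.2 ⟨by simp, le_rfl⟩) (hd_le_hd.2 ⟨le_rfl, by simp⟩),
    hC.le_om (hd_le_hd.2 ⟨by simp, le_rfl⟩) (hd_le_om.2 ⟨_, rfl⟩), one_mul]
  cases b
  · exact hC.hd i tp
  · simp [handleVal]

theorem Normalized.hd_md (i : Fin P.n) (a) : C.val (Cell.hd i a md) (Cell.hd i tp md) = 1 := by
  have := mul_of_le (C := C) (p := Cell.hd i a (en false)) (q := Cell.hd i a md)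
    (r := Cell.hd i tp md) (hd_le_hd.2 ⟨le_rfl, by simp⟩) (hd_le_hd.2 ⟨by simp, le_rfl⟩)
  rwa [hC.hd, hC.hd_le, one_mul] at this

theorem Normalized.rb_le {p : P.Cell} {o : P.Occ} {υ} (h : p ≤ rb o υ) :
    C.val p (Cell.dc o.1 md) = C.val (rb o md) (Cell.dc o.1 md) := by
  have h' : p ≤ rb o md := h.trans (rb_le_rb.2 ⟨rfl, by simp⟩)
  rw [← mul_of_le h' (rb_le_dc.2 ⟨rfl, le_rfl⟩), hC.le_om h' rb_le_om, one_mul]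

theorem Normalized.legAt_md (o : P.Occ) (υ : IF) (b : Bool) :
    C.val (Cell.hd (gen o) (legAt o υ) (en b)) (Cell.dc o.1 md) = (if b then (handleVal C (gen o))⁻¹ else 1) *
      C.val (Cell.hd (gen o) (legAt o υ) md) (Cell.dc o.1 md) := by
  rw [← mul_of_le (q := Cell.hd (gen o) (legAt o υ) md) (hd_le_hd.2 ⟨le_rfl, by simp⟩)
    (hd_le_dc.2 ⟨rfl, by simp⟩), ← hC.hd_le (gen o) (legAt o υ) b,
    ← mul_of_le (q := Cell.hd (gen o) (legAt o υ) md) (r := Cell.hd (gen o) tp md)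
    (hd_le_hd.2 ⟨le_rfl, by simp⟩) (hd_le_hd.2 ⟨by simp, le_rfl⟩), hC.hd_md, mul_one]

theorem Normalized.legAt_sgn (o : P.Occ) (υ : IF) :
    C.val (Cell.hd (gen o) (legAt o υ) (en (sgn o))) (Cell.dc o.1 md) =
      C.val (rb o md) (Cell.dc o.1 md) :=
  hC.rb_le (υ := υ) (hd_le_rb_iff.2 ⟨le_rfl, .inl ⟨rfl, rfl⟩⟩)

theorem Normalized.legAt_next (o : P.Occ) (υ : IF) :
    C.val (Cell.hd (gen (next o)) (legAt (next o) υ) (en !sgn (next o))) (Cell.dc o.1 md) =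
      C.val (rb o md) (Cell.dc o.1 md) :=
  hC.rb_le (υ := υ) (hd_le_rb_iff.2 ⟨le_rfl, .inr ⟨rfl, rfl⟩⟩)

theorem Normalized.rb_next (o : P.Occ) :
    cond (sgn (next o)) (handleVal C (gen (next o))) (handleVal C (gen (next o)))⁻¹ *
      C.val (rb (next o) md) (Cell.dc o.1 md) = C.val (rb o md) (Cell.dc o.1 md) := by
  have h1 := hC.legAt_sgn (next o) md
  have h2 := hC.legAt_next o md
  have h3 := hC.legAt_md (next o) md
  change C.val _ (Cell.dc o.1 md) = C.val _ (Cell.dc o.1 md) at h1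
  change ∀ b, C.val _ (Cell.dc o.1 md) = _ * C.val _ (Cell.dc o.1 md) at h3
  rw [← h1, ← h2, h3, h3]
  cases sgn (next o) <;> simp

theorem Normalized.rb_last (j : Fin P.k) : C.val (rb (lastOcc j) md) (Cell.dc j md) = 1 := hC.dc j md

theorem Normalized.wordProd_mul (j : Fin P.k) (m : ℕ) (hm : m < (P.rel j).length) :
    wordProd (handleVal C) (P.rel j) (m + 1) * C.val (rb ⟨j, ⟨m, hm⟩⟩ md) (Cell.dc j md) = 1 := by
  have h := wordProd_succ (handleVal C) (P.rel j) ⟨m, hm⟩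
  rw [h, mul_assoc]
  induction m with
  | zero =>
    have := hC.rb_next (lastOcc j)
    rw [next_lastOcc] at this
    rw [wordProd_zero, one_mul]
    exact this.trans (hC.rb_last j)
  | succ m ih =>
    have := hC.rb_next ⟨j, ⟨m, by omega⟩⟩
    rw [next_of_lt hm] at this
    have ih := ih (by omega) (wordProd_succ _ _ ⟨m, _⟩)
    rw [← mul_assoc] at ih
    have h' := wordProd_succ (handleVal C) (P.rel j) ⟨m, by omega⟩
    exact (congrArg₂ (· * ·) h' this).trans ih

theorem Normalized.rb_eq (o : P.Occ) :
    C.val (rb o md) (Cell.dc o.1 md) = (wordProd (handleVal C) (P.rel o.1) (o.2 + 1))⁻¹ :=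
  eq_inv_of_mul_eq_one_right (hC.wordProd_mul o.1 o.2 o.2.2)

/-- The homomorphism from the group of the presentation given by a cocycle. -/
def Normalized.hom (hC : Normalized C) : P.Grp →* H := PresentedGroup.toGroup (f := handleVal C) <| by
  rintro _ ⟨j, rfl⟩
  have h := hC.wordProd_mul j ((P.rel j).length - 1) (Nat.sub_lt (length_pos j) one_pos)
  have h := h.symm.trans ((congrArg _ (hC.rb_last j)).trans (mul_one _))
  rw [pred_length_add_one] at h
  rw [lift_mk_eq_wordProd]
  exact h.symm

theorem Normalized.hom_gr (i : Fin P.n) : hC.hom (gr i) = handleVal C i := PresentedGroup.toGroup.of _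

theorem Normalized.mem_range_dc {p : P.Cell} {j : Fin P.k} (h : p ≤ Cell.dc j md) :
    C.val p (Cell.dc j md) ∈ hC.hom.range := by
  have hrb : ∀ o : P.Occ, C.val (rb o md) (Cell.dc o.1 md) ∈ hC.hom.range := fun o =>
    ⟨(wordProd gr (P.rel o.1) (o.2 + 1))⁻¹, by
      rw [hC.rb_eq, map_inv, map_wordProd]; simp only [hC.hom_gr]⟩
  have hhd : ∀ (o : P.Occ) υ b, C.val (Cell.hd (gen o) (legAt o υ) (en b)) (Cell.dc o.1 md) ∈
      hC.hom.range := by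
    intro o υ b
    rcases bool_cases b (sgn o) with rfl | rfl
    · exact hC.legAt_sgn o υ ▸ hrb o
    · obtain ⟨o, rfl⟩ := next_surjective o; exact hC.legAt_next o υ ▸ hrb o
  rcases le_dc.1 h with ⟨υ, -, rfl⟩ | ⟨o, rfl, υ, -, rfl⟩ | ⟨o, rfl, υ, -, τ, rfl⟩
  · have h1 := mul_of_le (C := C) (show rb (lastOcc j) υ ≤ Cell.dc j υ from
      rb_le_dc.2 ⟨rfl, le_rfl⟩) h
    have h2 : C.val (rb (lastOcc j) υ) (Cell.dc j md) = 1 :=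
      (hC.rb_le (o := lastOcc j) le_rfl).trans (hC.rb_last j)
    rw [hC.dc, one_mul, h2] at h1
    exact h1 ▸ one_mem _
  · rw [hC.rb_le le_rfl]; exact hrb o
  · rcases τ with b | _
    · grind
    · have := hC.legAt_md o υ false
      rw [if_neg (by simp), one_mul] at this
      exact this ▸ hhd o υ _

theorem Normalized.mem_range {p q : P.Cell} (h : p ≤ q) : C.val p q ∈ hC.hom.range := by
  have key : ∀ {r : P.Cell}, (∀ p, p ≤ r → C.val p r ∈ hC.hom.range) → q ≤ r →
      C.val p q ∈ hC.hom.range := by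
    intro r hr hq
    rw [eq_mul_inv_of_mul_eq (mul_of_le (C := C) h hq)]
    exact mul_mem (hr p (h.trans hq)) (inv_mem (hr q hq))
  have hom : q ≤ Cell.om → C.val p q ∈ hC.hom.range := fun hq => hC.le_om h hq ▸ one_mem _
  rcases q with ⟨i, a, τ⟩ | ⟨o, υ⟩ | ⟨j, υ⟩ | c | _
  · refine key (r := Cell.hd i tp md) (fun p hp => ?_) (hd_le_hd.2 ⟨by simp, by simp⟩)
    obtain ⟨a', -, (b | _), -, rfl⟩ := le_hd.1 hp
    · rw [hC.hd_le]
      split_ifs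
      · exact inv_mem ⟨gr i, hC.hom_gr i⟩
      · simp
    · exact hC.hd_md i a' ▸ one_mem _
  · exact hom rb_le_om
  · exact key (r := Cell.dc j md) (fun p hp => hC.mem_range_dc hp) (dc_le_dc.2 ⟨rfl, by simp⟩)
  · exact hom (le_om_iff.2 (.inr (.inl ⟨_, rfl⟩)))
  · grind

end Relations

theorem normalized_taut : Normalized (taut (P := P)) where
  om h := by rw [taut_of_le h]; rfl
  hd i a := by rw [taut_of_le (hd_le_hd.2 ⟨le_rfl, by simp⟩)]; rfl
  dc j υ := by
    rw [taut_of_le (show rb (lastOcc j) υ ≤ dc j υ from rb_le_dc.2 ⟨rfl, le_rfl⟩)]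
    simp only [tautVal, toDisc, lastOcc]
    rw [pred_length_add_one, wordProd_gr, inv_one]

theorem handleVal_taut (i : Fin P.n) : handleVal taut i = gr i := by
  rw [handleVal, taut_of_le (hd_le_hd.2 ⟨le_rfl, by simp⟩)]
  simp [tautVal, toHandle]

end FinPresentation

namespace FinPresentation

open SingularManifold.Poly Cell

variable {P : FinPresentation}

/-! ### The fundamental group -/

/-- The cell that precedes a cell in a spanning tree. -/
def parent : P.Cell → P.Cell
  | hd i a md => hd i a (en false)
  | dc j υ => rb (lastOcc j) υ
  | p => p

theorem parent_le_om (p : P.Cell) : parent p ≤ om := by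
  rcases p with ⟨i, a, _ | _⟩ | _ | _ | _ | _
  · exact hd_le_om.2 ⟨_, rfl⟩
  · exact hd_le_om.2 ⟨_, rfl⟩
  · exact rb_le_om
  · exact rb_le_om
  · exact le_om_iff.2 (.inr (.inl ⟨_, rfl⟩))
  · exact le_rfl

theorem parent_le (p : P.Cell) : parent p ≤ p := by
  rcases p with ⟨i, a, _ | _⟩ | _ | _ | _ | _
  · exact le_rfl
  · exact hd_le_hd.2 ⟨le_rfl, by simp⟩
  · exact le_rfl
  · exact rb_le_dc.2 ⟨rfl, le_rfl⟩
  · exact le_rfl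
  · exact le_rfl

theorem parent_of_le_om {p : P.Cell} (h : p ≤ om) : parent p = p := by
  rcases p with ⟨i, a, _ | _⟩ | _ | _ | _ | _
  · rfl
  · obtain ⟨_, h⟩ := hd_le_om.1 h; cases h
  · rfl
  · exact absurd h not_dc_le_om
  · rfl
  · rfl

/-- The path to a vertex in a spanning tree. -/
def tree (p : P.Cell) : FundamentalGroupoid.mk (OC.vtx (om : P.Cell)) ⟶ FundamentalGroupoid.mk (OC.vtx p) :=
  edgeCls om (parent p) (.inr (parent_le_om p)) ≫ edgeCls (parent p) p (.inl (parent_le p))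

theorem tree_of_le_om {p : P.Cell} (h : p ≤ om) : tree p = edgeCls om p (.inr h) := by
  have : ∀ q (hq : q = p) h1 h2, edgeCls om q h1 ≫ edgeCls q p h2 = edgeCls om p (.inr h) := by
    rintro q rfl h1 h2
    rw [edge_self, Category.comp_id]
  exact this _ (parent_of_le_om h) _ _

theorem tree_parent (p : P.Cell) : tree (parent p) ≫ edgeCls (parent p) p (.inl (parent_le p)) = tree p := by
  rw [tree_of_le_om (parent_le_om p), tree]

theorem tree_om : tree (om : P.Cell) = 𝟙 _ := by rw [tree_of_le_om le_rfl, edge_self]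

/-- The edges of the complex in its fundamental group. -/
abbrev edges : Cocycle P.Cell (FundamentalGroup (OC P.Cell) (OC.vtx om)) := edgeCocycle om tree

theorem edges_parent (p : P.Cell) : edges.val (parent p) p = 1 := by
  rw [edges.symm (.inl (parent_le p)), edgeCocycle_eq_one _ _ (.inl (parent_le p)) (tree_parent p), inv_one]

theorem normalized_edges : Normalized (edges (P := P)) where
  om {p} h := by
    rw [edgeCocycle_eq_one _ _ (.inr h)]
    rw [tree_om, Category.id_comp, tree_of_le_om h]
  hd i a := edges_parent (.hd i a md)
  dc j υ := edges_parent (.dc j υ)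

theorem surjective_hom : Surjective (normalized_edges (P := P)).hom := fun g =>
  mem_of_edges_mem om tree tree_om normalized_edges.hom.range (fun p q h => by
    rcases h with h | h
    · exact normalized_edges.mem_range h
    · rw [edges.symm (.inr h)]; exact inv_mem (normalized_edges.mem_range h)) g

section Monodromy

variable [TopologicalSpace P.Grp] [DiscreteTopology P.Grp]

theorem monodromy_tree (p : P.Cell) (v : P.Grp) :
    taut.isCoveringMap.monodromy (tree p) (taut.pt om v) = taut.pt p v := by
  have h1 : taut.val (parent p) om = 1 := normalized_taut.om (parent_le_om p)
  have h2 : taut.val p (parent p) = 1 := by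
    rw [taut.symm (.inr (parent_le p)), inv_eq_one]
    rcases p with ⟨i, a, _ | _⟩ | _ | _ | _ | _
    · exact taut.self _
    · exact normalized_taut.hd i a
    · exact taut.self _
    · exact normalized_taut.dc _ _
    · exact taut.self _
    · grind
  rw [tree]
  refine (taut.isCoveringMap.monodromy_trans_apply ..).trans ?_
  rw [taut.monodromy_edge, taut.monodromy_edge, h1, h2, one_mul, one_mul]

theorem monodromy_edges {p q : P.Cell} (h : p ≤ q) (v : P.Grp) :
    taut.isCoveringMap.monodromy (edges.val p q) (taut.pt om v) = taut.pt om (taut.val p q * v) := by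
  rw [edgeCocycle_apply _ _ (.inr h)]
  refine (taut.isCoveringMap.monodromy_trans_apply ..).trans ?_
  rw [monodromy_tree]
  refine (taut.isCoveringMap.monodromy_trans_apply ..).trans ?_
  rw [taut.monodromy_edge, ← monodromy_tree p]
  refine (taut.isCoveringMap.monodromy_trans_apply ..).symm.trans ?_
  rw [show Path.Homotopic.Quotient.trans (tree p) (inv (tree p)) = Path.Homotopic.Quotient.refl _ from
    IsIso.hom_inv_id (tree p), IsCoveringMap.monodromy_refl]
  rfl

theorem monodromy_hom (g v : P.Grp) :
    taut.isCoveringMap.monodromyPerm _ (normalized_edges.hom g) (taut.pt om v) = taut.pt om (g * v) := by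
  let S : Subgroup P.Grp :=
    { carrier := {g | ∀ v, taut.isCoveringMap.monodromyPerm _ (normalized_edges.hom g) (taut.pt om v) =
        taut.pt om (g * v)}
      mul_mem' := fun {a b} ha hb v => by
        rw [map_mul, map_mul, Equiv.Perm.mul_apply, hb, ha, mul_assoc]
      one_mem' := fun v => by rw [map_one, map_one, one_mul]; rfl
      inv_mem' := fun {a} ha v => by
        rw [map_inv, map_inv, Equiv.Perm.inv_eq_iff_eq, ha, mul_inv_cancel_left] }
  have hS : ∀ i : Fin P.n, PresentedGroup.of i ∈ S := by
    intro i
    refine inv_mem_iff.1 fun v => ?_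
    change taut.isCoveringMap.monodromyPerm _ (normalized_edges.hom (gr i)⁻¹) _ = taut.pt om ((gr i)⁻¹ * v)
    have h : (Cell.hd i tp (en true) : P.Cell) ≤ Cell.hd i tp md := hd_le_hd.2 ⟨le_rfl, by simp⟩
    have h1 := handleVal_taut i
    rw [map_inv, normalized_edges.hom_gr, ← h1, handleVal, handleVal, inv_inv, inv_inv]
    exact monodromy_edges h v
  exact PresentedGroup.generated_by _ S hS g v

end Monodromy

theorem injective_hom : Injective (normalized_edges (P := P)).hom := by
  letI : TopologicalSpace P.Grp := ⊥
  haveI : DiscreteTopology P.Grp := ⟨rfl⟩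
  rw [injective_iff_map_eq_one]
  intro g hg
  have h := monodromy_hom g 1
  rw [hg, map_one, mul_one] at h
  exact eq_of_heq (Bundle.TotalSpace.mk.inj (congrArg Subtype.val h)).2.symm

instance : PathConnectedSpace (OC P.Cell) := OC.pathConnectedSpace om fun p =>
  (joined_vtx (.inr (parent_le p))).trans (joined_vtx (.inl (parent_le_om p)))

theorem pathConnectedSpace_x : PathConnectedSpace P.X :=
  P.xHomeo.symm.surjective.pathConnectedSpace P.xHomeo.symm.continuous

theorem fundamentalGroup_x : Nonempty (FundamentalGroup P.X P.omega ≃* P.Grp) := by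
  have e := MulEquiv.ofBijective _ ⟨injective_hom (P := P), surjective_hom⟩
  have h := (FundamentalGroupoidFunctor.equivOfHomotopyEquiv
    P.xHomeo.toHomotopyEquiv).fullyFaithfulFunctor.mulEquivEnd (FundamentalGroupoid.mk P.omega)
  have h' : FundamentalGroup P.X P.omega ≃* FundamentalGroup (OC P.Cell) (P.xHomeo P.omega) := h
  rw [xHomeo_omega] at h'
  exact ⟨h'.trans e.symm⟩

/-! ### Presentations with connected surface -/

theorem hd_lt_om (i : Fin P.n) (a) (b : Bool) : (hd i a (en b) : P.Cell) < om :=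
  lt_of_le_of_ne (hd_le_om.2 ⟨b, rfl⟩) (by simp)

/-- The disc of a generator, as a cell of the surface. -/
def discCell (i : Fin P.n) (b : Bool) : P.OmegaCell := ⟨hd i tp (en b), hd_lt_om _ _ _⟩

theorem joined_of_hd_le {p : P.OmegaCell} {i a b} (h : hd i a (en b) ≤ p.1) :
    Joined (OC.vtx p) (OC.vtx (discCell i b)) :=
  (joined_vtx (q := (⟨hd i a (en b), hd_lt_om _ _ _⟩ : P.OmegaCell)) (.inr h)).trans
    (joined_vtx (.inl (hd_le_hd.2 ⟨by simp, le_rfl⟩)))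

theorem hd_sgn_le_rb (o : P.Occ) (υ) : hd (gen o) (legAt o υ) (en (sgn o)) ≤ rb o υ :=
  hd_le_rb_iff.2 ⟨le_rfl, .inl ⟨rfl, rfl⟩⟩

theorem hd_next_le_rb (o : P.Occ) (υ) :
    hd (gen (next o)) (legAt (next o) υ) (en !sgn (next o)) ≤ rb o υ :=
  hd_le_rb_iff.2 ⟨le_rfl, .inr ⟨rfl, rfl⟩⟩

theorem joined_next (o : P.Occ) : Joined (OC.vtx (discCell (gen o) (sgn o)))
    (OC.vtx (discCell (gen (next o)) (!sgn (next o)))) :=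
  let p : P.OmegaCell := ⟨rb o md, lt_of_le_of_ne rb_le_om (by simp)⟩
  (joined_of_hd_le (p := p) (hd_sgn_le_rb o md)).symm.trans
    (joined_of_hd_le (p := p) (hd_next_le_rb o md))

theorem connectedSpace_omega (i₀ : Fin P.n) (h : ∀ i j, ∃ l,
    P.rel l = [(i, true), (j, true), (j, false), (i, false)]) : ConnectedSpace P.Omega := by
  have h1 (i j : Fin P.n) : Joined (OC.vtx (discCell i true)) (OC.vtx (discCell j false)) := by
    obtain ⟨l, hl⟩ := h i j
    have := joined_next (⟨l, ⟨0, length_pos l⟩⟩ : P.Occ)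
    simpa [gen, sgn, next, hl] using this
  have h2 (i : Fin P.n) (b : Bool) : Joined (OC.vtx (discCell i b)) (OC.vtx (discCell i₀ true)) := by
    cases b
    · exact (h1 i₀ i).symm
    · exact (h1 i i₀).trans (h1 i₀ i₀).symm
  have h3 (p : P.OmegaCell) : Joined (OC.vtx p) (OC.vtx (discCell i₀ true)) := by
    obtain ⟨p, hp⟩ := p
    rcases le_om.1 hp.le with rfl | ⟨c, rfl⟩ | ⟨o, υ, rfl⟩ | ⟨i, a, b, rfl⟩
    · grind
    · obtain ⟨⟨i, s, x, b⟩, rfl⟩ : ∃ w, capV w = c := Quot.exists_rep c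
      exact (joined_of_hd_le (le_cp.2 (.inr (.inl ⟨i, s, x, b, rfl, rfl⟩)))).trans (h2 i b)
    · exact (joined_of_hd_le (hd_sgn_le_rb o υ)).trans (h2 _ _)
    · exact (joined_of_hd_le (a := a) le_rfl).trans (h2 i b)
  have := OC.pathConnectedSpace _ h3
  exact omegaHomeo.surjective.connectedSpace omegaHomeo.continuous

/-- The relators of the presentation obtained by adding trivial relators. -/
def addedRel {n : ℕ} {s : Set (FreeGroup (Fin n))} :
    {r : s // r.1 ≠ 1} ⊕ (Fin n × Fin n) → List (Fin n × Bool)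
  | .inl r => r.1.1.toWord
  | .inr (i, j) => [(i, true), (j, true), (j, false), (i, false)]

theorem mk_added {α : Type} (i j : α) :
    FreeGroup.mk [(i, true), (j, true), (j, false), (i, false)] = 1 := by
  change FreeGroup.of i * FreeGroup.of j * (FreeGroup.of j)⁻¹ * (FreeGroup.of i)⁻¹ = 1
  group

theorem exists_connected {n : ℕ} (hn : 0 < n) {s : Set (FreeGroup (Fin n))} (hs : s.Finite) :
    ∃ P : FinPresentation, Nonempty (P.Grp ≃* PresentedGroup s) ∧ ConnectedSpace P.Omega := by
  classical
  have := hs.to_subtype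
  let e := Finite.equivFin ({r : s // r.1 ≠ 1} ⊕ (Fin n × Fin n))
  let P : FinPresentation :=
    { n := n
      k := _
      rel := fun j => addedRel (e.symm j)
      rel_ne_nil := fun j h => by
        rcases hj : e.symm j with r | ⟨i, i'⟩ <;> rw [hj] at h
        · exact r.2 (FreeGroup.toWord_eq_nil_iff.1 h)
        · cases h }
  refine ⟨P, ⟨QuotientGroup.quotientMulEquivOfEq ?_⟩, connectedSpace_omega (P := P) ⟨0, hn⟩
    fun i j => ⟨e (.inr (i, j)), by simp [P, addedRel]⟩⟩
  apply le_antisymm <;> refine Subgroup.normalClosure_le_normal ?_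
  · rintro _ ⟨j, rfl⟩
    change FreeGroup.mk (addedRel (e.symm j)) ∈ Subgroup.normalClosure s
    rcases e.symm j with r | ⟨i, i'⟩
    · rw [addedRel, FreeGroup.mk_toWord]; exact Subgroup.subset_normalClosure r.1.2
    · rw [addedRel, mk_added]; exact one_mem _
  · intro r hr
    by_cases h : r = 1
    · simp_all
    · refine Subgroup.subset_normalClosure ⟨e (.inl ⟨⟨r, hr⟩, h⟩), ?_⟩
      change FreeGroup.mk (addedRel (e.symm _)) = r
      rw [Equiv.symm_apply_apply, addedRel, FreeGroup.mk_toWord]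

theorem subsingleton_presentedGroup {α : Type} {s : Set (FreeGroup α)}
    (h : ∀ i, PresentedGroup.of (rels := s) i = 1) : Subsingleton (PresentedGroup s) :=
  subsingleton_of_forall_eq 1 (PresentedGroup.generated_by s ⊥ h)

theorem exists_presentation {G : Type*} [Group G] (hG : Group.IsFinitelyPresented G) :
    ∃ P : FinPresentation, Nonempty (P.Grp ≃* G) ∧ ConnectedSpace P.Omega := by
  obtain ⟨n, s, hs, ⟨e⟩⟩ := Group.IsFinitelyPresented.exists_mulEquiv_presentedGroup (G := G)
  rcases n.eq_zero_or_pos with rfl | hn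
  · obtain ⟨P, ⟨f⟩, hP⟩ := exists_connected one_pos (Set.finite_singleton (FreeGroup.of (0 : Fin 1)))
    have h1 := subsingleton_presentedGroup (s := {FreeGroup.of (0 : Fin 1)}) fun i =>
      PresentedGroup.one_of_mem (by simp [Subsingleton.elim i 0])
    have h2 := subsingleton_presentedGroup (s := s) fun i => i.elim0
    have := e.toEquiv.subsingleton
    have := f.toEquiv.subsingleton
    exact ⟨P, ⟨{ toFun := 1, invFun := 1, left_inv := fun _ => Subsingleton.elim _ _, right_inv := fun _ => Subsingleton.elim _ _, map_mul' := fun _ _ => Subsingleton.elim _ _ }⟩, hP⟩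
  · obtain ⟨P, ⟨f⟩, hP⟩ := exists_connected hn hs; exact ⟨P, ⟨f.trans e.symm⟩, hP⟩

end FinPresentation

end SingularManifold

end

open SingularManifold in
theorem theorem2p1 :
    (∀ P : FinPresentation,
      IsClosedOrientableSurface P.Omega ∧
      HasLink P.X P.omega P.Omega ∧
      (∃ j : P.K → P.X, Topology.IsEmbedding j ∧ j P.vertex = P.omega ∧
        IsStrongDeformationRetract (Set.range j)) ∧
      PathConnectedSpace P.X ∧
      Nonempty (FundamentalGroup P.X P.omega ≃* P.Grp) ∧
      (ConnectedSpace P.Omega → IsCompactOrientableSingularThreeManifold P.X {P.omega})) ∧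
    (∀ (G : Type*) [Group G], Group.IsFinitelyPresented G →
      ∃ P : FinPresentation,
        Nonempty (P.Grp ≃* G) ∧
        ConnectedSpace P.Omega ∧
        IsCompactOrientableSingularThreeManifold P.X {P.omega} ∧
        PathConnectedSpace P.X ∧
        Nonempty (FundamentalGroup P.X P.omega ≃* G)) := by
  have key : ∀ P : FinPresentation, PathConnectedSpace P.X ∧
      Nonempty (FundamentalGroup P.X P.omega ≃* P.Grp) := fun P =>
    ⟨FinPresentation.pathConnectedSpace_x, FinPresentation.fundamentalGroup_x⟩
  refine ⟨fun P => ⟨FinPresentation.isClosedOrientableSurface_omega, FinPresentation.hasLink_omega,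
    FinPresentation.exists_embedding_k, (key P).1, (key P).2,
    FinPresentation.isCompactOrientableSingularThreeManifold_x⟩, fun G _ hG => ?_⟩
  obtain ⟨P, ⟨e⟩, hP⟩ := FinPresentation.exists_presentation hG
  obtain ⟨h, ⟨f⟩⟩ := key P
  exact ⟨P, ⟨e⟩, hP, FinPresentation.isCompactOrientableSingularThreeManifold_x hP, h, ⟨f.trans e⟩⟩
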